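/- **Setting.** For $j\in\{1,2\}$ let $k_j\ge1$, $D_j\ge2$ be integers and let $\delta_{j,l},d_{j,l}$ ($1\le l\le D_j$) be non-negative integers with $\delta_{j,1}=1$, $\delta_{j,l}<\delta_{j,l+1}$, $d_{j,l}>(\delta_{j,l}-1)(k_j+1)$ for $1\le l\le D_j-1$, and $d_{j,D_j}=(\delta_{j,D_j}-1)(k_j+1)$. Write $\delta_{D_j}=\delta_{j,D_j}$. Let $Q_j,R_{D_j},R_0,R_{l_1,l_2}\in\mathbb C[X]$ and $\Delta_{l_1,l_2}\in\mathbb Z_{\ge0}$ ($1\le l_j\le D_j-1$), let $r>0$, and let $P_1,P_2$ be polynomials in $X$ whose coefficients are holomorphic in $\epsilon$ near $\overline D(0,r)$. Assume $\deg R_{D_j}\le\deg Q_j$; that $R_{l_1,l_2}$, $R_0$, $P_1,P_2$ have degree at most $\deg(R_{D_1}R_{D_2})$; $Q_j(im)\ne0\ne R_{D_j}(im)$ for $m\in\mathbb R$; and that the quotients $Q_j(im)/R_{D_j}(im)$, $m\in\mathbb R$, lie in a sector $\{|z|\ge r_j,\ |\arg z-\delta'_j|\le\eta_j\}$ with $r_j,\eta_j>0$.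 Assume $\delta_{D_1}\ge\delta_{1,l_1}+\frac2{k_1}$, $\delta_{D_2}\ge\delta_{2,l_2}+\frac2{k_2}$ and $\Delta_{l_1,l_2}+k_1(1-\delta_{D_1})+k_2(1-\delta_{D_2})+2\ge0$ for $1\le l_j\le D_j-1$. Let $\beta,\nu_1,\nu_2,\rho>0$ and $\mu>\max(\deg P_1,\deg P_2)+1$. $E_{(\beta,\mu)}$ is the space of continuous $h:\mathbb R\to\mathbb C$ with $\|h\|_{(\beta,\mu)}=\sup_m(1+|m|)^\mu e^{\beta|m|}|h(m)|<\infty$. Let $S_{d_j}$ be the open unbounded sector with vertex $0$, direction $d_j\in\mathbb R$ and opening $2\delta_{S,j}>0$, and put $\Omega_j=D(0,\rho)\cup S_{d_j}$, $\overline\Omega_j=\overline D(0,\rho)\cup S_{d_j}$. Assume that the roots of $P_{m,j}(\tau)=Q_j(im)k_j-R_{D_j}(im)k_j^{\delta_{D_j}}\tau^{(\delta_{D_j}-1)k_j}$ stay uniformly apart from $\overline\Omega_j$: there is $M_j>0$ with $|\tau-q|\ge M_j(1+|\tau|)$ for all $\tau\in\overline\Omega_j$, all $m\in\mathbb R$ and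 all roots $q$ of $P_{m,j}$. For $\epsilon\neq0$ let $F_\epsilon$ be the space of functions $h(\tau_1,\tau_2,m)$ continuous on $\overline\Omega_1\times\overline\Omega_2\times\mathbb R$, holomorphic in $(\tau_1,\tau_2)$ on $\Omega_1\times\Omega_2$, with finite norm $$\|h\|_\epsilon=\sup\,(1+|m|)^\mu e^{\beta|m|}\prod_{j=1}^2\frac{1+|\tau_j/\epsilon|^{2k_j}}{|\tau_j/\epsilon|}e^{-\nu_j|\tau_j/\epsilon|^{k_j}}\;|h(\tau_1,\tau_2,m)|,$$ and let $F_{j,\epsilon}$ be the analogous space of functions $h(\tau_j,m)$ on $\overline\Omega_j\times\mathbb R$ (only the factor with index $j$ in the norm). Given $K_0,T_0,\epsilon_0>0$, consider families $C_{n_1,n_2}(\cdot,\epsilon)$ ($n_1,n_2\ge0$) and $F_{n_1,n_2}(\cdot,\epsilon)$ ($n_1,n_2\ge1$) in $E_{(\beta,\mu)}$, holomorphic in $\epsilon\in D(0,\epsilon_0)$, with norms at most $K_0T_0^{-n_1-n_2}$. Put $C_0(T,m,\epsilon)=\sum_{n_1,n_2\ge0}C_{n_1,n_2}T_1^{n_1}T_2^{n_2}$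 and $F(T,m,\epsilon)=\sum_{n_1,n_2\ge1}F_{n_1,n_2}T_1^{n_1}T_2^{n_2}$, and consider, with null initial data $U(T_1,0,m,\epsilon)\equiv U(0,T_2,m,\epsilon)\equiv0$, the equation $$\begin{aligned}&\bigl(Q_1(im)\partial_{T_1}-T_1^{(\delta_{D_1}-1)(k_1+1)}\partial_{T_1}^{\delta_{D_1}}R_{D_1}(im)\bigr)\bigl(Q_2(im)\partial_{T_2}-T_2^{(\delta_{D_2}-1)(k_2+1)}\partial_{T_2}^{\delta_{D_2}}R_{D_2}(im)\bigr)U\\ &=\tfrac{\epsilon^{-2}}{\sqrt{2\pi}}\int_{\mathbb R}P_1(i(m-m_1),\epsilon)U(T,m-m_1,\epsilon)P_2(im_1,\epsilon)U(T,m_1,\epsilon)\,dm_1\\ &\quad+\sum_{1\le l_j\le D_j-1}\epsilon^{\Delta_{l_1,l_2}-d_{1,l_1}-d_{2,l_2}+\delta_{1,l_1}+\delta_{2,l_2}-2}\,T_1^{d_{1,l_1}}T_2^{d_{2,l_2}}\partial_{T_1}^{\delta_{1,l_1}}\partial_{T_2}^{\delta_{2,l_2}}R_{l_1,l_2}(im)U\\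 &\quad+\tfrac{\epsilon^{-2}}{\sqrt{2\pi}}\int_{\mathbb R}C_0(T,m-m_1,\epsilon)R_0(im_1)U(T,m_1,\epsilon)\,dm_1+\epsilon^{-2}F(T,m,\epsilon).\qquad(\mathrm{SCP})\end{aligned}$$ Let $\varphi=\sum_{n_1,n_2\ge1}C_{n_1,n_2}\frac{\tau_1^{n_1}\tau_2^{n_2}}{\Gamma(n_1/k_1)\Gamma(n_2/k_2)}$, $\psi=\sum_{n_1,n_2\ge1}F_{n_1,n_2}\frac{\tau_1^{n_1}\tau_2^{n_2}}{\Gamma(n_1/k_1)\Gamma(n_2/k_2)}$, $\varphi^1=\sum_{n\ge1}C_{n,0}\frac{\tau_1^n}{\Gamma(n/k_1)}$, $\varphi^2=\sum_{n\ge1}C_{0,n}\frac{\tau_2^n}{\Gamma(n/k_2)}$. The *convolution equation* for $\omega(\tau_1,\tau_2,m)$ is obtained from (SCP) multiplied by $T_1^{k_1+1}T_2^{k_2+1}$ by replacing $U,C_0,F$ by $\omega$, $\varphi+\varphi^1+\varphi^2+C_{0,0}$, $\psi$ and, in each variable (with $k=k_j$), multiplication by $T^n$ ($n\ge 1$) by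 $f\mapsto\frac{\tau^k}{\Gamma(n/k)}\int_0^{\tau^k}(\tau^k-s)^{\frac nk-1}f(s^{1/k})\frac{ds}s$, the operator $T^{k+1}\partial_T$ by multiplication by $k\tau^k$, the operator $T^{\delta(k+1)}\partial_T^\delta=(T^{k+1}\partial_T)^\delta+\sum_{1\le p\le\delta-1}A_{\delta,p}T^{k(\delta-p)}(T^{k+1}\partial_T)^p$ accordingly, and products of two $T$-dependent factors by $\tau^k\int_0^{\tau^k}f((\tau^k-s)^{1/k})\,g(s^{1/k})\frac{ds}{(\tau^k-s)s}$ (products with a factor that does not depend on the variable remain products). **Proposition.** There are positive constants $\epsilon_*\le r$, $\varpi,\zeta_1,\zeta_2,\zeta_1^1,\zeta_1^2,\zeta_1^0$, depending only on the data preceding $K_0,T_0,\epsilon_0$ and the families, such that the following holds. (a) For all $K_0,T_0>0$ there is $\epsilon_1>0$ such that for every $0<\epsilon_0\le\epsilon_1$, all families as above satisfy, for all $\epsilon\in D(0,\epsilon_0)\setminus\{0\}$, the bounds $$\|\varphi\|_{\epsilon}\le\zeta_1,\quad\|\psi\|_{\epsilon}\le\zeta_2,\quad\|\varphi^1\|_{F_{1,\epsilon}}\le\zeta_1^1,\quad\|\varphi^2\|_{F_{2,\epsilon}}\le\zeta_1^2\qquad(*)$$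 (in particular these functions belong to the respective spaces). (b) Let $0<\epsilon_0\le\epsilon_*$, $K_0,T_0>0$, and let families as above satisfy $(*)$ and $\|C_{0,0}(\cdot,\epsilon)\|_{(\beta,\mu)}\le\zeta_1^0$ for all $\epsilon\in D(0,\epsilon_0)\setminus\{0\}$. Then there is a function $\omega(\tau_1,\tau_2,m,\epsilon)$, continuous on $\overline\Omega_1\times\overline\Omega_2\times\mathbb R\times(D(0,\epsilon_0)\setminus\{0\})$ and, for each $m$, holomorphic in $(\tau_1,\tau_2,\epsilon)$ on $\Omega_1\times\Omega_2\times(D(0,\epsilon_0)\setminus\{0\})$, such that for each $\epsilon$ it is the unique solution of the convolution equation in the closed ball of radius $\varpi$ of $F_\epsilon$; in particular, for all $(\tau_1,\tau_2,m,\epsilon)\in\overline\Omega_1\times\overline\Omega_2\times\mathbb R\times(D(0,\epsilon_0)\setminus\{0\})$, $$|\omega(\tau_1,\tau_2,m,\epsilon)|\le\varpi(1+|m|)^{-\mu}e^{-\beta|m|}\frac{|\tau_1/\epsilon|}{1+|\tau_1/\epsilon|^{2k_1}}\frac{|\tau_2/\epsilon|}{1+|\tau_2/\epsilon|^{2k_2}}\exp\bigl(\nu_1|\tau_1/\epsilon|^{k_1}+\nu_2|\tau_2/\epsilon|^{k_2}\bigr).$$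 Moreover, for all $\theta_j$ with $\frac\pi{k_j}<\theta_j<\frac\pi{k_j}+2\delta_{S,j}$ there are $h'>0$ with $h'\epsilon_0\le T_0/2$ and $\delta_1>0$, both independent of $\epsilon$, and a function $U(T_1,T_2,m,\epsilon)$ such that, for every $\epsilon\in D(0,\epsilon_0)\setminus\{0\}$, with $S_j$ the open sector with vertex $0$, direction $d_j$, opening $\theta_j$ and radius $h'|\epsilon|$: $U$ solves (SCP) on $S_1\times S_2\times\mathbb R$; for each $m$, $(T_1,T_2)\mapsto U$ is holomorphic and bounded on $S_1\times S_2$, is continuous on $(S_1\cup\{0\})\times(S_2\cup\{0\})$, and vanishes for $T_1=0$ and for $T_2=0$; for all $(T_1,T_2)\in S_1\times S_2$ and $0<\beta'<\beta$ the function $m\mapsto U(T_1,T_2,m,\epsilon)$ belongs to $E_{(\beta',\mu)}$; and for all $(T_1,T_2)\in S_1\times S_2$ there are half-lines $L_{\gamma_j}=\mathbb R_+e^{i\gamma_j}\subset S_{d_j}\cup\{0\}$ with $\cos(k_j(\gamma_j-\arg T_j))\ge\delta_1$ such that for all $m\in\mathbb R$, with absolute convergence, $$U(T_1,T_2,m,\epsilon)=k_1k_2\int_{L_{\gamma_1}}\int_{L_{\gamma_2}}\omega(u_1,u_2,m,\epsilon)\,e^{-(u_1/T_1)^{k_1}-(u_2/T_2)^{k_2}}\,\frac{du_2}{u_2}\frac{du_1}{u_1}.$$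 -/

import Mathlib

open Set Filter Topology MeasureTheory
open scoped Polynomial

noncomputable section

namespace TwoTime

/-! ## Sectors -/

/-- The open unbounded sector with vertex `0`, bisecting direction `d` and opening `2 * a`. -/
def sector (d a : ℝ) : Set ℂ :=
  {τ | ∃ r φ : ℝ, 0 < r ∧ |φ - d| < a ∧ τ = r * Complex.exp (φ * Complex.I)}

/-- The bounded sector with vertex `0`, bisecting direction `d`, opening `θ` and radius `R`. -/
def bddSector (d θ R : ℝ) : Set ℂ := sector d (θ / 2) ∩ Metric.ball 0 R

/-- The closed set of all `z` with `|z| ≥ r` and `|arg z - d| ≤ η`. -/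
def outerSector (r d η : ℝ) : Set ℂ :=
  {z | r ≤ ‖z‖ ∧ ∃ φ : ℝ, |φ - d| ≤ η ∧ z = ‖z‖ * Complex.exp (φ * Complex.I)}

/-- The punctured disc `D(0, r) \ {0}`. -/
def puncturedDisc (r : ℝ) : Set ℂ := Metric.ball 0 r \ {0}

/-! ## The data attached to one time variable -/

/-- The data of one of the two time variables: the integers `k`, `D`, `δ_l`, `d_l`
(`1 ≤ l ≤ D`), the polynomials `Q` and `R_D`, the growth type `ν`, and the unbounded sector
with direction `dir` and opening `2 * a` in the Borel plane. -/
structure TimeData where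
  k : ℕ
  D : ℕ
  δ : ℕ → ℕ
  d : ℕ → ℕ
  Q : ℂ[X]
  RD : ℂ[X]
  ν : ℝ
  dir : ℝ
  a : ℝ

namespace TimeData

/-- The unbounded sector `S_d`. -/
def S (t : TimeData) : Set ℂ := sector t.dir t.a

/-- `D(0, ρ) ∪ S_d`. -/
def openDom (t : TimeData) (ρ : ℝ) : Set ℂ := Metric.ball 0 ρ ∪ t.S

/-- `closure D(0, ρ) ∪ S_d`. -/
def closedDom (t : TimeData) (ρ : ℝ) : Set ℂ := Metric.closedBall 0 ρ ∪ t.S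

/-- `P_m(τ) = Q(im) k - R_D(im) k ^ δ_D τ ^ ((δ_D - 1) k)`. -/
def Pm (t : TimeData) (m : ℝ) (τ : ℂ) : ℂ :=
  t.Q.eval (Complex.I * m) * t.k
    - t.RD.eval (Complex.I * m) * (t.k : ℂ) ^ t.δ t.D * τ ^ ((t.δ t.D - 1) * t.k)

/-- The roots of all the polynomials `P_m`, `m ∈ ℝ`, stay uniformly apart from
`closure D(0, ρ) ∪ S_d`. -/
def RootsApart (t : TimeData) (ρ : ℝ) : Prop :=
  ∃ M : ℝ, 0 < M ∧ ∀ (m : ℝ) (q : ℂ), t.Pm m q = 0 →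
    ∀ τ ∈ t.closedDom ρ, M * (1 + ‖τ‖) ≤ ‖τ - q‖

/-- The standing assumptions on the data of one time variable. -/
structure Admissible (t : TimeData) : Prop where
  one_le_k : 1 ≤ t.k
  two_le_D : 2 ≤ t.D
  δ_one : t.δ 1 = 1
  δ_lt : ∀ l, 1 ≤ l → l ≤ t.D - 1 → t.δ l < t.δ (l + 1)
  d_last : t.d t.D = (t.δ t.D - 1) * (t.k + 1)
  d_gt : ∀ l, 1 ≤ l → l ≤ t.D - 1 → (t.δ l - 1) * (t.k + 1) < t.d l
  deg_le : t.RD.natDegree ≤ t.Q.natDegree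
  Q_ne : ∀ m : ℝ, t.Q.eval (Complex.I * m) ≠ 0
  RD_ne : ∀ m : ℝ, t.RD.eval (Complex.I * m) ≠ 0
  quotient_mem : ∃ r d η : ℝ, 0 < r ∧ 0 < η ∧
    ∀ m : ℝ, t.Q.eval (Complex.I * m) / t.RD.eval (Complex.I * m) ∈ outerSector r d η
  δ_gap : ∀ l, 1 ≤ l → l ≤ t.D - 1 → (t.δ l : ℝ) + 2 / t.k ≤ t.δ t.D
  ν_pos : 0 < t.ν
  a_pos : 0 < t.a

/-- The weight `(1 + |τ/ε| ^ (2k)) / |τ/ε| * exp (-ν |τ/ε| ^ k)`. At `τ = 0` it has the value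
`0`; this does not change the spaces and norms below, since a continuous function with finite
norm vanishes at `τ = 0`. -/
def weight (t : TimeData) (ε τ : ℂ) : ℝ :=
  (1 + ‖τ / ε‖ ^ (2 * t.k)) / ‖τ / ε‖ * Real.exp (-(t.ν * ‖τ / ε‖ ^ t.k))

/-- The singular operator `Q(im) ∂_T - T ^ ((δ_D - 1)(k + 1)) ∂_T ^ δ_D R_D(im)`. -/
def opT (t : TimeData) (m : ℝ) (f : ℂ → ℂ) (T : ℂ) : ℂ :=
  t.Q.eval (Complex.I * m) * deriv f T
    - T ^ ((t.δ t.D - 1) * (t.k + 1)) * iteratedDeriv (t.δ t.D) f T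
      * t.RD.eval (Complex.I * m)

end TimeData

/-! ## The Banach spaces -/

/-- The norm of the space `E_(β, μ)`. -/
def normE (β μ : ℝ) (h : ℝ → ℂ) : ℝ :=
  ⨆ m : ℝ, (1 + |m|) ^ μ * Real.exp (β * |m|) * ‖h m‖

/-- `h` belongs to `E_(β, μ)`. -/
def MemE (β μ : ℝ) (h : ℝ → ℂ) : Prop :=
  Continuous h ∧
    BddAbove (range fun m : ℝ => (1 + |m|) ^ μ * Real.exp (β * |m|) * ‖h m‖)

/-- The weighted values of `h` whose supremum is the norm of `F^d_(ν, β, μ, k, ε)`, one time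
variable. -/
def valuesF₁ (t : TimeData) (ρ β μ : ℝ) (ε : ℂ) (h : ℂ → ℝ → ℂ) : Set ℝ :=
  (fun p : ℂ × ℝ => (1 + |p.2|) ^ μ * t.weight ε p.1 * Real.exp (β * |p.2|) * ‖h p.1 p.2‖) ''
    (t.closedDom ρ ×ˢ univ)

/-- The norm of `F^d_(ν, β, μ, k, ε)`, one time variable. -/
def normF₁ (t : TimeData) (ρ β μ : ℝ) (ε : ℂ) (h : ℂ → ℝ → ℂ) : ℝ :=
  sSup (valuesF₁ t ρ β μ ε h)

/-- `h` belongs to `F^d_(ν, β, μ, k, ε)`, one time variable. -/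
def MemF₁ (t : TimeData) (ρ β μ : ℝ) (ε : ℂ) (h : ℂ → ℝ → ℂ) : Prop :=
  ContinuousOn (fun p : ℂ × ℝ => h p.1 p.2) (t.closedDom ρ ×ˢ univ) ∧
  (∀ m : ℝ, DifferentiableOn ℂ (fun τ => h τ m) (t.openDom ρ)) ∧
  BddAbove (valuesF₁ t ρ β μ ε h)

/-- The weighted values of `h` whose supremum is the norm of `F^d_(ν, β, μ, k, ε)`, two time
variables. -/
def valuesF (t₁ t₂ : TimeData) (ρ β μ : ℝ) (ε : ℂ) (h : ℂ → ℂ → ℝ → ℂ) : Set ℝ :=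
  (fun p : ℂ × ℂ × ℝ =>
    (1 + |p.2.2|) ^ μ * t₁.weight ε p.1 * t₂.weight ε p.2.1 * Real.exp (β * |p.2.2|)
      * ‖h p.1 p.2.1 p.2.2‖) ''
    (t₁.closedDom ρ ×ˢ t₂.closedDom ρ ×ˢ univ)

/-- The norm of `F^d_(ν, β, μ, k, ε)`, two time variables. -/
def normF (t₁ t₂ : TimeData) (ρ β μ : ℝ) (ε : ℂ) (h : ℂ → ℂ → ℝ → ℂ) : ℝ :=
  sSup (valuesF t₁ t₂ ρ β μ ε h)

/-- `h` belongs to `F^d_(ν, β, μ, k, ε)`, two time variables. -/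
def MemF (t₁ t₂ : TimeData) (ρ β μ : ℝ) (ε : ℂ) (h : ℂ → ℂ → ℝ → ℂ) : Prop :=
  ContinuousOn (fun p : ℂ × ℂ × ℝ => h p.1 p.2.1 p.2.2)
    (t₁.closedDom ρ ×ˢ t₂.closedDom ρ ×ˢ univ) ∧
  (∀ m : ℝ, DifferentiableOn ℂ (fun p : ℂ × ℂ => h p.1 p.2 m)
    (t₁.openDom ρ ×ˢ t₂.openDom ρ)) ∧
  BddAbove (valuesF t₁ t₂ ρ β μ ε h)

/-! ## The data of the singular initial value problem -/

/-- The data of the problem apart from the coefficient series: two time variables, the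
exponents `Δ_{l₁,l₂}`, the polynomials `R_{l₁,l₂}`, `R₀`, and the polynomials
`P₁(X, ε)`, `P₂(X, ε)` with coefficients depending on `ε`. -/
structure CauchyData where
  t₁ : TimeData
  t₂ : TimeData
  Δ : ℕ → ℕ → ℕ
  R : ℕ → ℕ → ℂ[X]
  R₀ : ℂ[X]
  P₁ : ℂ → ℂ[X]
  P₂ : ℂ → ℂ[X]

/-- `P(X, ε)` is a polynomial in `X` of degree at most `N` and less than `μ - 1`, with
coefficients holomorphic on (a neighbourhood of) the closed disc of radius `r`. -/
structure PolyAdmissible (P : ℂ → ℂ[X]) (r μ : ℝ) (N : ℕ) : Prop where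
  analytic : ∀ i, AnalyticOnNhd ℂ (fun ε => (P ε).coeff i) (Metric.closedBall 0 r)
  deg_le : ∀ ε ∈ Metric.closedBall (0 : ℂ) r, (P ε).natDegree ≤ N
  deg_lt : ∀ ε ∈ Metric.closedBall (0 : ℂ) r, ((P ε).natDegree : ℝ) + 1 < μ

/-- The standing assumptions on the data. -/
structure CauchyData.Admissible (S : CauchyData) (r μ : ℝ) : Prop where
  time₁ : S.t₁.Admissible
  time₂ : S.t₂.Admissible
  deg_R : ∀ l₁ l₂, 1 ≤ l₁ → l₁ ≤ S.t₁.D - 1 → 1 ≤ l₂ → l₂ ≤ S.t₂.D - 1 →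
    (S.R l₁ l₂).natDegree ≤ (S.t₁.RD * S.t₂.RD).natDegree
  deg_R₀ : S.R₀.natDegree ≤ (S.t₁.RD * S.t₂.RD).natDegree
  poly₁ : PolyAdmissible S.P₁ r μ (S.t₁.RD * S.t₂.RD).natDegree
  poly₂ : PolyAdmissible S.P₂ r μ (S.t₁.RD * S.t₂.RD).natDegree
  Δ_ge : ∀ l₁ l₂, 1 ≤ l₁ → l₁ ≤ S.t₁.D - 1 → 1 ≤ l₂ → l₂ ≤ S.t₂.D - 1 →
    0 ≤ (S.Δ l₁ l₂ : ℤ) + S.t₁.k * (1 - (S.t₁.δ S.t₁.D : ℤ))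
      + S.t₂.k * (1 - (S.t₂.δ S.t₂.D : ℤ)) + 2

/-- A double family of coefficients, `C n₁ n₂ m ε`. -/
abbrev Family : Type := ℕ → ℕ → ℝ → ℂ → ℂ

/-- The coefficients with indices `n₁, n₂ ≥ n₀` lie in `E_(β, μ)`, depend holomorphically on
`ε ∈ D(0, ε₀)` and have norms at most `K₀ / T₀ ^ (n₁ + n₂)`. (With these uniform norm bounds,
holomorphy for each fixed `m` is the same as holomorphy with values in `E_(β, μ)`.) -/
structure FamilyBound (β μ K₀ T₀ ε₀ : ℝ) (n₀ : ℕ) (C : Family) : Prop where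
  mem : ∀ n₁ n₂, n₀ ≤ n₁ → n₀ ≤ n₂ → ∀ ε ∈ Metric.ball (0 : ℂ) ε₀,
    MemE β μ fun m => C n₁ n₂ m ε
  holo : ∀ n₁ n₂, n₀ ≤ n₁ → n₀ ≤ n₂ → ∀ m : ℝ,
    DifferentiableOn ℂ (fun ε => C n₁ n₂ m ε) (Metric.ball 0 ε₀)
  norm_le : ∀ n₁ n₂, n₀ ≤ n₁ → n₀ ≤ n₂ → ∀ ε ∈ Metric.ball (0 : ℂ) ε₀,
    normE β μ (fun m => C n₁ n₂ m ε) ≤ K₀ * (1 / T₀) ^ (n₁ + n₂)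

/-- `∑_{n₁, n₂ ≥ 0} C_{n₁,n₂}(m, ε) T₁ ^ n₁ T₂ ^ n₂`. -/
def sumC (C : Family) (T₁ T₂ : ℂ) (m : ℝ) (ε : ℂ) : ℂ :=
  ∑' n : ℕ × ℕ, C n.1 n.2 m ε * T₁ ^ n.1 * T₂ ^ n.2

/-- `∑_{n₁, n₂ ≥ 1} F_{n₁,n₂}(m, ε) T₁ ^ n₁ T₂ ^ n₂`. -/
def sumF (F : Family) (T₁ T₂ : ℂ) (m : ℝ) (ε : ℂ) : ℂ :=
  ∑' n : ℕ × ℕ, F (n.1 + 1) (n.2 + 1) m ε * T₁ ^ (n.1 + 1) * T₂ ^ (n.2 + 1)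

/-- `(2π) ^ (-1/2) ∫ A(i(m - m₁)) f(m - m₁) B(i m₁) g(m₁) dm₁`. -/
def fourierConv (A B : ℂ[X]) (f g : ℝ → ℂ) (m : ℝ) : ℂ :=
  ((Real.sqrt (2 * Real.pi))⁻¹ : ℝ) *
    ∫ m₁ : ℝ, A.eval (Complex.I * ((m - m₁ : ℝ) : ℂ)) * f (m - m₁)
      * (B.eval (Complex.I * (m₁ : ℂ)) * g m₁)

/-- The exponent `Δ_{l₁,l₂} - d_{l₁} - d̃_{l₂} + δ_{l₁} + δ̃_{l₂} - 2` of `ε`. -/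
def CauchyData.epsExp (S : CauchyData) (l₁ l₂ : ℕ) : ℤ :=
  (S.Δ l₁ l₂ : ℤ) - S.t₁.d l₁ - S.t₂.d l₂ + S.t₁.δ l₁ + S.t₂.δ l₂ - 2

/-- The function `U(T₁, T₂, m)` satisfies the singular equation, for the value `ε` of the
parameter, at the point `(T₁, T₂, m)`. -/
def CauchyData.SolvesAt (S : CauchyData) (C F : Family) (ε : ℂ) (U : ℂ → ℂ → ℝ → ℂ)
    (T₁ T₂ : ℂ) (m : ℝ) : Prop :=
  S.t₁.opT m (fun z₁ => S.t₂.opT m (fun z₂ => U z₁ z₂ m) T₂) T₁ =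
    ε ^ (-2 : ℤ) * fourierConv (S.P₁ ε) (S.P₂ ε) (U T₁ T₂) (U T₁ T₂) m
    + ∑ l₁ ∈ Finset.Icc 1 (S.t₁.D - 1), ∑ l₂ ∈ Finset.Icc 1 (S.t₂.D - 1),
        ε ^ S.epsExp l₁ l₂ * T₁ ^ S.t₁.d l₁ * T₂ ^ S.t₂.d l₂
          * iteratedDeriv (S.t₁.δ l₁)
              (fun z₁ => iteratedDeriv (S.t₂.δ l₂) (fun z₂ => U z₁ z₂ m) T₂) T₁
          * (S.R l₁ l₂).eval (Complex.I * m)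
    + ε ^ (-2 : ℤ) * fourierConv 1 S.R₀ (fun m' => sumC C T₁ T₂ m' ε) (U T₁ T₂) m
    + ε ^ (-2 : ℤ) * sumF F T₁ T₂ m ε

/-! ## The equation in the Borel plane

Throughout, an integral `∫_0^{τ^k} G(s, s^{1/k}) ds` is taken along the segment
`s = τ^k x`, `0 ≤ x ≤ 1`, with `s^{1/k} = τ x^{1/k}`. -/

/-- The Borel transforms `∑_{n₁, n₂ ≥ 1} C_{n₁,n₂} τ₁^n₁ τ₂^n₂ / (Γ(n₁/k₁) Γ(n₂/k₂))`. -/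
def borel₁₂ (k₁ k₂ : ℕ) (C : Family) (ε : ℂ) (τ₁ τ₂ : ℂ) (m : ℝ) : ℂ :=
  ∑' n : ℕ × ℕ, C (n.1 + 1) (n.2 + 1) m ε
    * (τ₁ ^ (n.1 + 1) / (Real.Gamma (((n.1 + 1 : ℕ) : ℝ) / k₁) : ℝ))
    * (τ₂ ^ (n.2 + 1) / (Real.Gamma (((n.2 + 1 : ℕ) : ℝ) / k₂) : ℝ))

/-- `∑_{n ≥ 1} C_{n,0} τ^n / Γ(n/k)`. -/
def borel₁ (k : ℕ) (C : Family) (ε : ℂ) (τ : ℂ) (m : ℝ) : ℂ :=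
  ∑' n : ℕ, C (n + 1) 0 m ε * (τ ^ (n + 1) / (Real.Gamma (((n + 1 : ℕ) : ℝ) / k) : ℝ))

/-- `∑_{n ≥ 1} C_{0,n} τ^n / Γ(n/k)`. -/
def borel₂ (k : ℕ) (C : Family) (ε : ℂ) (τ : ℂ) (m : ℝ) : ℂ :=
  ∑' n : ℕ, C 0 (n + 1) m ε * (τ ^ (n + 1) / (Real.Gamma (((n + 1 : ℕ) : ℝ) / k) : ℝ))

/-- The operator `f ↦ τ^k / Γ(n/k) ∫_0^{τ^k} (τ^k - s)^{n/k - 1} f(s^{1/k}) ds/s`, the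
counterpart of multiplication by `T^n` under the Borel transform of order `k`. -/
def mulB (k n : ℕ) (f : ℂ → ℂ) (τ : ℂ) : ℂ :=
  τ ^ n / (Real.Gamma ((n : ℝ) / k) : ℝ) *
    ∫ x in (0 : ℝ)..1, (((1 - x) ^ ((n : ℝ) / k - 1) / x : ℝ) : ℂ)
      * f (τ * ((x ^ ((1 : ℝ) / k) : ℝ) : ℂ))

/-- The operator `B ↦ τ^k ∫_0^{τ^k} B((τ^k - s)^{1/k}, s^{1/k}) ds / ((τ^k - s) s)`, the
counterpart of a product under the Borel transform of order `k`. -/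
def convB (k : ℕ) (B : ℂ → ℂ → ℂ) (τ : ℂ) : ℂ :=
  ∫ x in (0 : ℝ)..1, B (τ * (((1 - x) ^ ((1 : ℝ) / k) : ℝ) : ℂ))
      (τ * ((x ^ ((1 : ℝ) / k) : ℝ) : ℂ)) / (((1 - x) * x : ℝ) : ℂ)

/-- The integers `A_{δ,p}` with
`T^{δ(k+1)} ∂_T^δ = ∑_{0 ≤ p ≤ δ} A_{δ,p} T^{k(δ-p)} (T^{k+1} ∂_T)^p`. -/
def coefA (k : ℕ) : ℕ → ℕ → ℤ
  | 0, 0 => 1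
  | 0, _ + 1 => 0
  | δ + 1, 0 => -(δ : ℤ) * coefA k δ 0
  | δ + 1, p + 1 => coefA k δ p - ((k * (p + 1) + δ : ℕ) : ℤ) * coefA k δ (p + 1)

/-- The counterpart of `T^{δ(k+1)} ∂_T^δ` (for `δ ≥ 1`) under the Borel transform of order `k`:
`(k τ^k)^δ f + ∑_{1 ≤ p ≤ δ - 1} A_{δ,p} τ^k / Γ(δ - p)
  ∫_0^{τ^k} (τ^k - s)^{δ - p - 1} (k s)^p f(s^{1/k}) ds/s`. -/
def derivB (k δ : ℕ) (f : ℂ → ℂ) (τ : ℂ) : ℂ :=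
  (k * τ ^ k) ^ δ * f τ
    + ∑ p ∈ Finset.Icc 1 (δ - 1),
        (coefA k δ p : ℂ) * mulB k (k * (δ - p)) (fun σ => (k * σ ^ k) ^ p * f σ) τ

/-- The counterpart of `T^{k+1} (Q(im) ∂_T - T^{(δ_D - 1)(k+1)} ∂_T^{δ_D} R_D(im))`. -/
def TimeData.opB (t : TimeData) (m : ℝ) (f : ℂ → ℂ) (τ : ℂ) : ℂ :=
  t.Q.eval (Complex.I * m) * (t.k * τ ^ t.k * f τ)
    - derivB t.k (t.δ t.D) f τ * t.RD.eval (Complex.I * m)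

/-- The integer `d_{l,k}` with `d_l + k + 1 = δ_l (k + 1) + d_{l,k}`. -/
def TimeData.dk (t : TimeData) (l : ℕ) : ℕ := t.d l + t.k + 1 - t.δ l * (t.k + 1)

/-- The counterpart of multiplication by `T₁^{k₁+1} T₂^{k₂+1}`. -/
def CauchyData.shiftB (S : CauchyData) (G : ℂ → ℂ → ℂ) (τ₁ τ₂ : ℂ) : ℂ :=
  mulB S.t₁.k (S.t₁.k + 1) (fun σ₁ => mulB S.t₂.k (S.t₂.k + 1) (fun σ₂ => G σ₁ σ₂) τ₂) τ₁

/-- The function `w(τ₁, τ₂, m)` satisfies the convolution equation in the Borel plane (the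
equation which the Borel transform of orders `k₁`, `k₂` produces from the singular equation
multiplied by `T₁^{k₁+1} T₂^{k₂+1}`), for the value `ε` of the parameter, at `(τ₁, τ₂, m)`. -/
def CauchyData.BorelEqAt (S : CauchyData) (C F : Family) (ε : ℂ) (w : ℂ → ℂ → ℝ → ℂ)
    (τ₁ τ₂ : ℂ) (m : ℝ) : Prop :=
  S.t₁.opB m (fun σ₁ => S.t₂.opB m (fun σ₂ => w σ₁ σ₂ m) τ₂) τ₁ =
    ε ^ (-2 : ℤ) * S.shiftB (fun σ₁ σ₂ =>
        convB S.t₁.k (fun x₁ y₁ => convB S.t₂.k (fun x₂ y₂ =>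
          fourierConv (S.P₁ ε) (S.P₂ ε) (w x₁ x₂) (w y₁ y₂) m) σ₂) σ₁) τ₁ τ₂
    + ∑ l₁ ∈ Finset.Icc 1 (S.t₁.D - 1), ∑ l₂ ∈ Finset.Icc 1 (S.t₂.D - 1),
        (S.R l₁ l₂).eval (Complex.I * m) * ε ^ S.epsExp l₁ l₂
          * mulB S.t₁.k (S.t₁.dk l₁) (derivB S.t₁.k (S.t₁.δ l₁) fun σ₁ =>
              mulB S.t₂.k (S.t₂.dk l₂) (derivB S.t₂.k (S.t₂.δ l₂) fun σ₂ => w σ₁ σ₂ m) τ₂) τ₁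
    + ε ^ (-2 : ℤ) * S.shiftB (fun σ₁ σ₂ =>
        convB S.t₁.k (fun x₁ y₁ => convB S.t₂.k (fun x₂ y₂ =>
          fourierConv 1 S.R₀ (borel₁₂ S.t₁.k S.t₂.k C ε x₁ x₂) (w y₁ y₂) m) σ₂) σ₁) τ₁ τ₂
    + ε ^ (-2 : ℤ) * S.shiftB (fun σ₁ σ₂ =>
        convB S.t₁.k (fun x₁ y₁ =>
          fourierConv 1 S.R₀ (borel₁ S.t₁.k C ε x₁) (w y₁ σ₂) m) σ₁) τ₁ τ₂
    + ε ^ (-2 : ℤ) * S.shiftB (fun σ₁ σ₂ =>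
        convB S.t₂.k (fun x₂ y₂ =>
          fourierConv 1 S.R₀ (borel₂ S.t₂.k C ε x₂) (w σ₁ y₂) m) σ₂) τ₁ τ₂
    + ε ^ (-2 : ℤ) * S.shiftB (fun σ₁ σ₂ =>
        fourierConv 1 S.R₀ (fun m' => C 0 0 m' ε) (w σ₁ σ₂) m) τ₁ τ₂
    + ε ^ (-2 : ℤ) * S.shiftB (fun σ₁ σ₂ => borel₁₂ S.t₁.k S.t₂.k F ε σ₁ σ₂ m) τ₁ τ₂

/-- `w` is, for the value `ε` of the parameter, an element of the closed ball of radius `ϖ` of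
`F^d_(ν, β, μ, k, ε)` which solves the convolution equation. -/
def CauchyData.BorelSol (S : CauchyData) (ρ β μ ϖ : ℝ) (C F : Family) (ε : ℂ)
    (w : ℂ → ℂ → ℝ → ℂ) : Prop :=
  MemF S.t₁ S.t₂ ρ β μ ε w ∧ normF S.t₁ S.t₂ ρ β μ ε w ≤ ϖ ∧
  ∀ τ₁ ∈ S.t₁.closedDom ρ, ∀ τ₂ ∈ S.t₂.closedDom ρ, ∀ m : ℝ, S.BorelEqAt C F ε w τ₁ τ₂ m

/-- The smallness conditions on the Borel transforms of the coefficient series (apart from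
`C_{0,0}`), for all `ε ∈ D(0, ε₀) \ {0}`. -/
def CauchyData.SmallBorel (S : CauchyData) (ρ β μ ε₀ ζ₁ ζ₂ ζ₁₁ ζ₁₂ : ℝ) (C F : Family) : Prop :=
  ∀ ε ∈ puncturedDisc ε₀,
    (MemF S.t₁ S.t₂ ρ β μ ε (borel₁₂ S.t₁.k S.t₂.k C ε) ∧
      normF S.t₁ S.t₂ ρ β μ ε (borel₁₂ S.t₁.k S.t₂.k C ε) ≤ ζ₁) ∧
    (MemF S.t₁ S.t₂ ρ β μ ε (borel₁₂ S.t₁.k S.t₂.k F ε) ∧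
      normF S.t₁ S.t₂ ρ β μ ε (borel₁₂ S.t₁.k S.t₂.k F ε) ≤ ζ₂) ∧
    (MemF₁ S.t₁ ρ β μ ε (borel₁ S.t₁.k C ε) ∧
      normF₁ S.t₁ ρ β μ ε (borel₁ S.t₁.k C ε) ≤ ζ₁₁) ∧
    (MemF₁ S.t₂ ρ β μ ε (borel₂ S.t₂.k C ε) ∧
      normF₁ S.t₂ ρ β μ ε (borel₂ S.t₂.k C ε) ≤ ζ₁₂)

/-! ## The Laplace transform -/

/-- The point `r e^{iγ}` of the half-line `L_γ`. -/
def ray (γ r : ℝ) : ℂ := r * Complex.exp (γ * Complex.I)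

/-- The integrand of the iterated Laplace transform on `L_{γ₁} × L_{γ₂}`, with `u_j = r_j e^{iγ_j}`
and `du_j / u_j = dr_j / r_j`. -/
def laplaceIntegrand (k₁ k₂ : ℕ) (γ₁ γ₂ : ℝ) (w : ℂ → ℂ → ℂ) (T₁ T₂ : ℂ) (r₁ r₂ : ℝ) : ℂ :=
  w (ray γ₁ r₁) (ray γ₂ r₂)
    * Complex.exp (-(ray γ₁ r₁ / T₁) ^ k₁ - (ray γ₂ r₂ / T₂) ^ k₂) / (r₂ : ℂ) / (r₁ : ℂ)

/-- `z = k₁ k₂ ∫_{L_{γ₁}} ∫_{L_{γ₂}} w(u₁, u₂) e^{-(u₁/T₁)^k₁ - (u₂/T₂)^k₂} du₂/u₂ du₁/u₁`, the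
integral being absolutely convergent. -/
def IsLaplace (k₁ k₂ : ℕ) (γ₁ γ₂ : ℝ) (w : ℂ → ℂ → ℂ) (T₁ T₂ z : ℂ) : Prop :=
  IntegrableOn (fun r : ℝ × ℝ => laplaceIntegrand k₁ k₂ γ₁ γ₂ w T₁ T₂ r.1 r.2)
    (Ioi 0 ×ˢ Ioi 0) ∧
  z = k₁ * k₂ * ∫ r₁ in Ioi (0 : ℝ), ∫ r₂ in Ioi (0 : ℝ),
    laplaceIntegrand k₁ k₂ γ₁ γ₂ w T₁ T₂ r₁ r₂

end TwoTime

end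

open Set Filter Topology MeasureTheory
open scoped Polynomial ENNReal Interval Real

namespace TwoTime

open Real (exp Gamma rpow_natCast norm_of_nonneg exp_pos rpow_add exp_add exp_le_exp mul_rpow cos
  rpow_sub_one rpow_mul rpow_one Gamma_nonneg_of_nonneg rpow_neg rpow_add_of_nonneg Gamma_pos_of_pos
  rpow_le_one rpow_le_rpow_of_exponent_le rpow_le_rpow pi_pos one_le_exp)
open Complex (I norm_real ofReal_re ofReal_ne_zero ofReal_pow ofReal_one exp_ne_zero real_smul)
open Metric (ball closedBall isOpen_ball mem_ball_self ball_subset_closedBall)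
open Finset (sum_mul sum_congr sum_nonneg mul_sum)
open Function (comp_apply iterate_succ_apply')
open MeasureTheory.Measure (quasiMeasurePreserving_fst quasiMeasurePreserving_snd)

noncomputable section

/-- The `k`-th root of the real number `x`, as a complex number. -/
local notation "rt(" k "," x ")" => (((x : ℝ) ^ ((1 : ℝ) / (k : ℝ)) : ℝ) : ℂ)

/-- Side conditions left to `positivity`. -/
local notation:max "pos!" => by positivity

/-- Side conditions left to `fun_prop`. -/
local notation:max "fp!" => by fun_prop

/-- Functions of `(τ1, τ2, m)`. -/
local notation "𝔽" => ℂ → ℂ → ℝ → ℂ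

/-- Points `(τ1, τ2, m, ε)`. -/
local notation "ℙ" => ℂ × ℂ × ℝ × ℂ

open TimeData CauchyData

variable {S : CauchyData} {t : TimeData} {k k1 k2 n n0 n1 n2 δ l : ℕ} {ρ β μ r K K' c c' e e' s x γ
  γ1 γ2 κ κ' κ1 κ2 T0 M c1 c2 d ε0 Kf Kg ζ R K0 ϖ u θ θ1 θ2 : ℝ} {ε τ τ1 τ2 T T1 T2 z : ℂ} {C F :
  Family} {b1 b2 : Bool} {a b : ℝ → ℝ} {A B : ℂ[X]} {V : Set ℂ} {w f g : 𝔽}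

/-! ### Monotonicity with automatic side conditions -/

lemma mul_le_l {a b c : ℝ} (h : b ≤ c) (ha : 0 ≤ a := by positivity) : a * b ≤ a * c :=
  mul_le_mul_of_nonneg_left h ha

lemma mul_le_r {a b c : ℝ} (h : b ≤ c) (ha : 0 ≤ a := by positivity) : b * a ≤ c * a :=
  mul_le_mul_of_nonneg_right h ha

lemma div_le_r {a b c : ℝ} (h : b ≤ c) (ha : 0 ≤ a := by positivity) : b / a ≤ c / a :=
  div_le_div_of_nonneg_right h ha

lemma mul_le_m {a b c d : ℝ} (h : a ≤ b) (h' : c ≤ d) (hc : 0 ≤ c := by positivity)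
    (hb : 0 ≤ b := by positivity) : a * c ≤ b * d :=
  mul_le_mul h h' hc hb

/-! ### Holomorphic dependence of integrals on parameters -/

lemma differentiableOn_setIntegral {E α : Type*} [NormedAddCommGroup E] [NormedSpace ℂ E]
    [FiniteDimensional ℂ E] [MeasurableSpace α] {ν : Measure α} {s : Set α} (hs : MeasurableSet s)
    {F : E → α → ℂ} {U : Set E} (hU : IsOpen U) (hF : ∀ a ∈ s, DifferentiableOn ℂ (F · a) U)
    (hm : ∀ q ∈ U, AEStronglyMeasurable (F q) (ν.restrict s))
    (hb : ∀ q0 ∈ U, ∃ bound : α → ℝ, IntegrableOn bound s ν ∧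
      ∀ᶠ q in 𝓝[U] q0, ∀ a ∈ s, ‖F q a‖ ≤ bound a) :
    DifferentiableOn ℂ (fun q => ∫ a in s, F q a ∂ν) U := by
  intro q0 hq0
  obtain ⟨bound, hbi, hbe⟩ := hb q0 hq0
  rw [hU.nhdsWithin_eq hq0] at hbe
  obtain ⟨r, hr, hball⟩ := Metric.eventually_nhds_iff_ball.1 (hbe.and (hU.mem_nhds hq0))
  have hmem : ∀ q ∈ ball q0 (r / 2), ball q (r / 2) ⊆ ball q0 r := by
    intro q hq
    refine Metric.ball_subset_ball' ?_
    have := Metric.mem_ball.1 hq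
    linarith
  have hfd : ∀ a ∈ s, ∀ q ∈ ball q0 (r / 2), ‖fderiv ℂ (F · a) q‖ ≤ 4 * bound a / r := by
    intro a ha q hq
    have hsub := hmem q hq
    have h1 : MapsTo (F · a) (ball q (r / 2)) (closedBall (F q a) (2 * bound a)) := by
      intro q' hq'
      rw [Metric.mem_closedBall, dist_eq_norm]
      have h1 := (hball q' (hsub hq')).1 a ha
      have h2 := (hball q (hsub (mem_ball_self pos!))).1 a ha
      calc ‖F q' a - F q a‖ ≤ ‖F q' a‖ + ‖F q a‖ := norm_sub_le _ _
        _ ≤ 2 * bound a := by linarith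
    have := Complex.norm_fderiv_le_div_of_mapsTo_ball
      ((hF a ha).mono fun q' hq' => (hball q' (hsub hq')).2) h1 pos!
    calc _ ≤ _ := this
      _ = 4 * bound a / r := by field_simp; ring
  have hdiff : ∀ a ∈ s, ∀ q ∈ ball q0 (r / 2), HasFDerivAt (F · a) (fderiv ℂ (F · a) q) q := by
    intro a ha q hq
    have hqU : q ∈ U := (hball q (Metric.ball_subset_ball (by linarith) hq)).2
    exact ((hF a ha).differentiableAt (hU.mem_nhds hqU)).hasFDerivAt
  have hq0b : q0 ∈ ball q0 (r / 2) := mem_ball_self pos!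
  -- the derivative is measurable in the parameter, since its values on a basis are limits of
  -- difference quotients
  have hmeas : AEStronglyMeasurable (fun a => fderiv ℂ (F · a) q0) (ν.restrict s) := by
    let b := Module.finBasis ℂ E
    have h1 : ∀ v : E, AEStronglyMeasurable (fun a => fderiv ℂ (F · a) q0 v) (ν.restrict s) := by
      intro v
      have hlim : Tendsto (fun n : ℕ => q0 + ((1 / ((n : ℂ) + 1))) • v) atTop (𝓝 q0) := by
        have : Tendsto (fun n : ℕ => (1 / ((n : ℂ) + 1))) atTop (𝓝 0) :=
          tendsto_one_div_add_atTop_nhds_zero_nat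
        simpa using (tendsto_const_nhds (x := q0)).add (this.smul_const v)
      obtain ⟨N, hN⟩ := eventually_atTop.1 (hlim.eventually (hU.mem_nhds hq0))
      refine aestronglyMeasurable_of_tendsto_ae (u := atTop)
        (f := fun (n : ℕ) a => (((n + N : ℕ) : ℂ) + 1) *
          (F (q0 + (1 / (((n + N : ℕ) : ℂ) + 1)) • v) a - F q0 a)) ?_ ?_
      · intro n
        exact ((hm _ (hN (n + N) (by omega))).sub (hm _ hq0)).const_mul _
      · refine (ae_restrict_iff' hs).2 (.of_forall fun a ha => ?_)
        have h : Tendsto (fun n : ℕ => ((n : ℂ) + 1) • (F (q0 + ((n : ℂ) + 1)⁻¹ • v) a - F q0 a)) atTop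
            (𝓝 (fderiv ℂ (F · a) q0 v)) := by
          refine HasFDerivAt.lim (hdiff a ha q0 hq0b) v ?_
          refine tendsto_atTop_mono (f := fun n : ℕ => (n : ℝ)) (fun n => ?_)
            tendsto_natCast_atTop_atTop
          have : ‖(n : ℂ) + 1‖ = n + 1 := by
            rw [← Nat.cast_add_one, Complex.norm_natCast, Nat.cast_add_one]
          rw [this]
          linarith
        refine (h.comp (tendsto_add_atTop_nat N)).congr fun n => ?_
        simp
    have h2 : (fun a => fderiv ℂ (F · a) q0) = fun a => ∑ i, (fderiv ℂ (F · a) q0 (b i)) •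
        (LinearMap.toContinuousLinearMap (b.coord i)) := by
      funext a
      ext v
      have h := congrArg (fderiv ℂ (F · a) q0) (b.sum_repr v)
      rw [map_sum] at h
      simp only [map_smul] at h
      rw [← h]
      simp [mul_comm]
    rw [h2]
    exact Finset.aestronglyMeasurable_fun_sum _ fun i _ => (h1 (b i)).smul_const _
  refine (hasFDerivAt_integral_of_dominated_of_fderiv_le (F' := fun q a => fderiv ℂ (F · a) q)
    (bound := fun a => 4 * bound a / r) (Metric.ball_mem_nhds q0 (half_pos hr)) ?_ ?_ hmeas ?_ ?_
    ?_).differentiableAt.differentiableWithinAt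
  · filter_upwards [hU.mem_nhds hq0] with q hq using hm q hq
  · refine Integrable.mono' hbi (hm _ hq0) ((ae_restrict_iff' hs).2 (.of_forall ?_))
    exact (hball q0 (mem_ball_self hr)).1
  · exact (ae_restrict_iff' hs).2 (.of_forall hfd)
  · exact (hbi.const_mul 4).div_const r
  · exact (ae_restrict_iff' hs).2 (.of_forall hdiff)

lemma continuousOn_setIntegral {X α : Type*} [TopologicalSpace X] [FirstCountableTopology X]
    [MeasurableSpace α] {ν : Measure α} {s : Set α} (hs : MeasurableSet s)
    {F : X → α → ℂ} {U : Set X} (hF : ∀ a ∈ s, ContinuousOn (F · a) U)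
    (hm : ∀ q ∈ U, AEStronglyMeasurable (F q) (ν.restrict s))
    (hb : ∀ q0 ∈ U, ∃ bound : α → ℝ, IntegrableOn bound s ν ∧
      ∀ᶠ q in 𝓝[U] q0, ∀ a ∈ s, ‖F q a‖ ≤ bound a) :
    ContinuousOn (fun q => ∫ a in s, F q a ∂ν) U := by
  intro q0 hq0
  obtain ⟨bound, hbi, hbe⟩ := hb q0 hq0
  refine continuousWithinAt_of_dominated ?_ ?_ hbi ?_
  · filter_upwards [self_mem_nhdsWithin] with q hq using hm q hq
  · filter_upwards [hbe] with q hq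
    exact (ae_restrict_iff' hs).2 (.of_forall hq)
  · exact (ae_restrict_iff' hs).2 (.of_forall fun a ha => hF a ha q0 hq0)

/-- A function of `(z, y)` which is continuous, and holomorphic off `z = 0`, is holomorphic:
near `z = 0` it is the mean of its values over a circle in the variable `z`, which avoids `0`. -/
lemma differentiableOn_of_continuousOn_of_off_zero {E : Type*} [NormedAddCommGroup E]
    [NormedSpace ℂ E] [FiniteDimensional ℂ E] {f : ℂ × E → ℂ} {U : Set ℂ} {Y : Set E}
    (hU : IsOpen U) (hY : IsOpen Y) (hc : ContinuousOn f (U ×ˢ Y))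
    (hd : DifferentiableOn ℂ f ((U \ {0}) ×ˢ Y)) : DifferentiableOn ℂ f (U ×ˢ Y) := by
  rintro ⟨z, y⟩ ⟨hz, hy⟩
  have hU' : IsOpen (U \ {0}) := hU.sdiff isClosed_singleton
  rcases eq_or_ne z 0 with rfl | hz0
  swap
  · exact (hd.differentiableAt ((hU'.prod hY).mem_nhds ⟨⟨hz, hz0⟩, hy⟩)).differentiableWithinAt
  have : ProperSpace E := FiniteDimensional.proper ℂ E
  obtain ⟨R, hR, hRU⟩ := Metric.nhds_basis_closedBall.mem_iff.1 (hU.mem_nhds hz)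
  obtain ⟨δ, hδ, hδY⟩ := Metric.nhds_basis_closedBall.mem_iff.1 (hY.mem_nhds hy)
  obtain ⟨K, hK⟩ := ((isCompact_closedBall (0 : ℂ) R).prod
    (isCompact_closedBall y δ)).exists_bound_of_continuousOn (hc.mono (prod_mono hRU hδY))
  set D := ball (0 : ℂ) (R / 2) ×ˢ ball y δ with hD
  have hopen : IsOpen D := isOpen_ball.prod isOpen_ball
  have hr : |R / 2| = R / 2 := abs_of_pos pos!
  have hball : ∀ q ∈ D, closedBall q.1 |R / 2| ⊆ closedBall 0 R := fun q hq =>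
    Metric.closedBall_subset_closedBall' (by
      have := Metric.mem_ball.1 hq.1
      linarith)
  have hcirc (q) (hq : q ∈ D) (θ : ℝ) : circleMap q.1 (R / 2) θ ∈ closedBall 0 R :=
    hball q hq (Metric.sphere_subset_closedBall (circleMap_mem_sphere' _ _ θ))
  have hne (q) (hq : q ∈ D) (θ : ℝ) : circleMap q.1 (R / 2) θ ≠ 0 := fun h0 => by
    have h1 : ‖(0 : ℂ) - q.1‖ = |R / 2| := by rw [← h0]; simp
    have h2 := mem_ball_zero_iff.1 hq.1
    rw [zero_sub, norm_neg] at h1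
    linarith
  have key : DifferentiableOn ℂ (fun q : ℂ × E => ∫ θ in Ioc 0 (2 * π),
      f (circleMap q.1 (R / 2) θ, q.2)) D := by
    refine differentiableOn_setIntegral measurableSet_Ioc hopen (fun θ _ => hd.comp ?_
      fun q hq => ⟨⟨hRU (hcirc q hq θ), hne q hq θ⟩, hδY (ball_subset_closedBall hq.2)⟩)
      (fun q hq => (hc.comp_continuous (f := fun θ => (circleMap q.1 (R / 2) θ, q.2)) fp! fun θ => ⟨hRU (hcirc q hq θ),
        hδY (ball_subset_closedBall hq.2)⟩).aestronglyMeasurable) fun q0 _ =>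
      ⟨fun _ => K, integrableOn_const measure_Ioc_lt_top.ne, ?_⟩
    · unfold circleMap; fun_prop
    · filter_upwards [self_mem_nhdsWithin] with q hq θ _
      exact hK _ ⟨hcirc q hq θ, ball_subset_closedBall hq.2⟩
  have hmem : ((0 : ℂ), y) ∈ D := ⟨mem_ball_self pos!, mem_ball_self hδ⟩
  refine (((key.differentiableAt (hopen.mem_nhds hmem)).const_smul
    (2 * π)⁻¹).congr_of_eventuallyEq ?_).differentiableWithinAt
  filter_upwards [hopen.mem_nhds hmem] with q hq
  have hY' := hδY (ball_subset_closedBall hq.2)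
  have := circleAverage_of_differentiable_on_off_countable (f := fun w => f (w, q.2))
    (countable_singleton 0) (hc.comp fp! fun w hw => ⟨hRU (hball q hq hw), hY'⟩) fun w hw =>
      DifferentiableAt.comp w (f := fun w => (w, q.2)) (hd.differentiableAt ((hU'.prod hY).mem_nhds
        ⟨⟨hRU (hball q hq (ball_subset_closedBall hw.1)), hw.2⟩, hY'⟩)) fp!
  rw [Real.circleAverage, intervalIntegral.integral_of_le pos!] at this
  exact this.symm

/-! ### Weights in the Borel plane and the convolution of order `k` -/

lemma integrableOn_one_sub_rpow_mul_rpow {p q : ℝ} (hp : 0 < p) (hq : 0 < q) :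
    IntegrableOn (fun x : ℝ => (1 - x) ^ (p - 1) * x ^ (q - 1)) (Ioo 0 1) := by
  have h := Complex.betaIntegral_convergent (u := (q : ℂ)) (v := (p : ℂ)) (by simpa) (by simpa)
  rw [intervalIntegrable_iff_integrableOn_Ioo_of_le zero_le_one] at h
  refine IntegrableOn.congr_fun (show IntegrableOn _ _ _ from Integrable.norm h) (fun x hx => ?_)
    measurableSet_Ioo
  have h1 : 0 < 1 - x := by linarith [hx.2]
  have e1 : ((q : ℂ) - 1) = ((q - 1 : ℝ) : ℂ) := by push_cast; ring
  have e2 : ((p : ℂ) - 1) = ((p - 1 : ℝ) : ℂ) := by push_cast; ring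
  have e3 : (1 - (x : ℂ)) = ((1 - x : ℝ) : ℂ) := by push_cast; ring
  simp only [norm_mul]
  rw [e1, e2, e3, ← Complex.ofReal_cpow hx.1.le, ← Complex.ofReal_cpow h1.le, norm_real,
    norm_real, norm_of_nonneg (by have := hx.1.le; positivity),
    norm_of_nonneg pos!, mul_comm]

/-- Power functions are dominated by `exp (ν s ^ k)`. -/
lemma exists_rpow_le_exp (hk : 1 ≤ k) {p ν : ℝ} (hp : 0 ≤ p) (hν : 0 < ν) :
    ∃ C : ℝ, 0 < C ∧ ∀ s : ℝ, 0 ≤ s → s ^ p ≤ C * exp (ν * s ^ k) := by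
  obtain ⟨N, hN⟩ := exists_nat_ge p
  refine ⟨1 + N.factorial / ν ^ N, by positivity, fun s hs => ?_⟩
  have hexp : 1 ≤ exp (ν * s ^ k) := one_le_exp pos!
  rcases le_total s 1 with h1 | h1
  · calc s ^ p ≤ 1 := rpow_le_one hs h1 hp
      _ ≤ 1 * exp (ν * s ^ k) := by linarith
      _ ≤ _ := by gcongr; simp; positivity
  · have h2 := Real.pow_div_factorial_le_exp (ν * s ^ k) pos! N
    calc s ^ p ≤ s ^ (N : ℝ) := rpow_le_rpow_of_exponent_le h1 hN
      _ = s ^ N := rpow_natCast _ _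
      _ ≤ (s ^ k) ^ N := by gcongr; exact le_self_pow₀ h1 (by omega)
      _ = N.factorial / ν ^ N * ((ν * s ^ k) ^ N / N.factorial) := by
        rw [mul_pow]; field_simp
      _ ≤ N.factorial / ν ^ N * exp (ν * s ^ k) := by gcongr
      _ ≤ _ := by gcongr; simp

/-- The convolution of two weights `1 / (1 + y ^ 2)` is again of this size, and gains any power of
`y` of exponent at most `2` at the price of a singularity at the end points. -/
lemma rpow_mul_div_le {y b : ℝ} (hy : 0 ≤ y) (hx : x ∈ Ioo (0 : ℝ) 1) (hb : 0 ≤ b)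
    (hb2 : b ≤ 2) :
    y ^ b / ((1 + (y * (1 - x)) ^ 2) * (1 + (y * x) ^ 2)) ≤
      4 * (x ^ (-b) + (1 - x) ^ (-b)) / (1 + y ^ 2) := by
  have key : ∀ z : ℝ, 0 < z → y ^ b ≤ z ^ (-b) * (1 + (y * z) ^ 2) := by
    intro z hz
    have h1 : (y * z) ^ b ≤ 1 + (y * z) ^ 2 := by
      rcases le_total (y * z) 1 with h | h
      · have := rpow_le_one pos! h hb
        nlinarith [sq_nonneg (y * z)]
      · have := rpow_le_rpow_of_exponent_le h hb2
        rw [Real.rpow_two] at this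
        linarith
    calc y ^ b = z ^ (-b) * (y * z) ^ b := by
          rw [mul_rpow hy hz.le, rpow_neg hz.le]
          field_simp
      _ ≤ _ := by gcongr
  have hx1 : 0 < 1 - x := by linarith [hx.2]
  have hx0 := hx.1
  have p1 : 0 ≤ x ^ (-b) := by positivity
  have p2 : 0 ≤ (1 - x) ^ (-b) := by positivity
  rw [div_le_div_iff₀ pos! pos!]
  have k1 := key x hx0
  have k2 := key (1 - x) hx1
  rcases le_total (1 / 2) x with h | h
  · have h4 : 1 + y ^ 2 ≤ 4 * (1 + (y * x) ^ 2) := by nlinarith [mul_le_l (show 1 / 4 ≤ x ^ 2 by nlinarith) (sq_nonneg y)]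
    calc y ^ b * (1 + y ^ 2) ≤ ((1 - x) ^ (-b) * (1 + (y * (1 - x)) ^ 2)) *
          (4 * (1 + (y * x) ^ 2)) := by gcongr
      _ = 4 * (1 - x) ^ (-b) * ((1 + (y * (1 - x)) ^ 2) * (1 + (y * x) ^ 2)) := by ring
      _ ≤ _ := by gcongr; linarith
  · have h4 : 1 + y ^ 2 ≤ 4 * (1 + (y * (1 - x)) ^ 2) := by nlinarith [mul_le_l (show 1 / 4 ≤ (1 - x) ^ 2 by nlinarith) (sq_nonneg y)]
    calc y ^ b * (1 + y ^ 2) ≤ (x ^ (-b) * (1 + (y * x) ^ 2)) *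
          (4 * (1 + (y * (1 - x)) ^ 2)) := by gcongr
      _ = 4 * x ^ (-b) * ((1 + (y * (1 - x)) ^ 2) * (1 + (y * x) ^ 2)) := by ring
      _ ≤ _ := by gcongr; linarith

/-- The weight `|z| ^ e / (1 + |z| ^ (2k)) exp (ν |z| ^ k)`. For `e = 1` it is the inverse of
`TimeData.weight`. -/
def TimeData.wt (t : TimeData) (e : ℝ) (z : ℂ) : ℝ :=
  ‖z‖ ^ e / (1 + ‖z‖ ^ (2 * t.k)) * exp (t.ν * ‖z‖ ^ t.k)

lemma TimeData.wt_nonneg (t : TimeData) (e : ℝ) (z : ℂ) : 0 ≤ t.wt e z := by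
  unfold wt; positivity

lemma TimeData.wt_mul (t : TimeData) (hk : 1 ≤ t.k) (e : ℝ) (z : ℂ) (hx : 0 ≤ x) :
    t.wt e (z * rt(t.k, x)) = ‖z‖ ^ e * x ^ (e / t.k) /
      (1 + (‖z‖ ^ t.k * x) ^ 2) * exp (t.ν * (‖z‖ ^ t.k * x)) := by
  have hk0 : (t.k : ℝ) ≠ 0 := by positivity
  have h1 : ‖z * rt(t.k, x)‖ = ‖z‖ * x ^ ((1 : ℝ) / t.k) := by
    rw [norm_mul, norm_real, norm_of_nonneg pos!]
  have h2 : (‖z‖ * x ^ ((1 : ℝ) / t.k)) ^ t.k = ‖z‖ ^ t.k * x := by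
    rw [mul_pow, ← rpow_natCast (x ^ _), ← rpow_mul hx, one_div_mul_cancel hk0,
      rpow_one]
  rw [TimeData.wt, h1, mul_comm 2, pow_mul, h2, mul_rpow (norm_nonneg _) pos!,
    ← rpow_mul hx]
  congr 4
  ring

/-- The kernel of the convolution, applied to two weights. -/
lemma TimeData.wt_mul_wt_div_le (t : TimeData) (hk : 1 ≤ t.k) {b : ℝ} (hb : 0 ≤ b)
    (hbe : b < e) (hbe' : b < e') (hb2 : b ≤ 2 * t.k) (z : ℂ) (hx : x ∈ Ioo (0 : ℝ) 1) :
    t.wt e (z * rt(t.k, 1 - x)) * t.wt e' (z * rt(t.k, x))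
      / ((1 - x) * x) ≤ 4 * t.wt (e + e' - b) z *
        ((1 - x) ^ (e / t.k - 1) * x ^ ((e' - b) / t.k - 1)
          + (1 - x) ^ ((e - b) / t.k - 1) * x ^ (e' / t.k - 1)) := by
  have hx0 := hx.1
  have hx1 : 0 < 1 - x := by linarith [hx.2]
  have hk0 : (0 : ℝ) < t.k := by positivity
  rw [t.wt_mul hk e z hx1.le, t.wt_mul hk e' z hx0.le]
  set y := ‖z‖ ^ t.k with hy
  have hy0 : 0 ≤ y := by positivity
  have hzb : ‖z‖ ^ e * ‖z‖ ^ e' = ‖z‖ ^ (e + e' - b) * y ^ (b / t.k) := by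
    rw [hy, ← rpow_natCast ‖z‖, ← rpow_mul (norm_nonneg _),
      ← rpow_add_of_nonneg (norm_nonneg _) (by linarith) (by linarith),
      ← rpow_add_of_nonneg (norm_nonneg _) (by linarith)
        (by rw [mul_div_cancel₀ _ hk0.ne']; exact hb), mul_div_cancel₀ _ hk0.ne']
    congr 1; ring
  have hexp : exp (t.ν * (y * (1 - x))) * exp (t.ν * (y * x)) = exp (t.ν * y) := by
    rw [← exp_add]; congr 1; ring
  have hker := rpow_mul_div_le hy0 hx (b := b / t.k) pos!
    (by rw [div_le_iff₀ hk0]; exact hb2)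
  have hwt : t.wt (e + e' - b) z = ‖z‖ ^ (e + e' - b) * exp (t.ν * y) / (1 + y ^ 2) := by
    rw [TimeData.wt, mul_comm 2, pow_mul, ← hy]; ring
  have r1 : (1 - x) ^ (e / t.k - 1) = (1 - x) ^ (e / t.k) / (1 - x) := rpow_sub_one hx1.ne' _
  have r2 : x ^ (e' / t.k - 1) = x ^ (e' / t.k) / x := rpow_sub_one hx0.ne' _
  have r3 : x ^ ((e' - b) / t.k - 1) = x ^ (e' / t.k) * x ^ (-(b / t.k)) / x := by
    rw [rpow_sub_one hx0.ne', ← rpow_add hx0]; congr 2; ring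
  have r4 : (1 - x) ^ ((e - b) / t.k - 1) = (1 - x) ^ (e / t.k) * (1 - x) ^ (-(b / t.k)) / (1 - x) := by
    rw [rpow_sub_one hx1.ne', ← rpow_add hx1]; congr 2; ring
  calc _ = (‖z‖ ^ e * ‖z‖ ^ e') * (exp (t.ν * (y * (1 - x))) * exp (t.ν * (y * x))) *
        ((1 - x) ^ (e / t.k) / (1 - x)) * (x ^ (e' / t.k) / x) /
        ((1 + (y * (1 - x)) ^ 2) * (1 + (y * x) ^ 2)) := by field_simp
    _ = ‖z‖ ^ (e + e' - b) * exp (t.ν * y) * ((1 - x) ^ (e / t.k) / (1 - x)) *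
        (x ^ (e' / t.k) / x) *
        (y ^ (b / t.k) / ((1 + (y * (1 - x)) ^ 2) * (1 + (y * x) ^ 2))) := by
      rw [hzb, hexp]; ring
    _ ≤ ‖z‖ ^ (e + e' - b) * exp (t.ν * y) * ((1 - x) ^ (e / t.k) / (1 - x)) *
        (x ^ (e' / t.k) / x) *
        (4 * (x ^ (-(b / t.k)) + (1 - x) ^ (-(b / t.k))) / (1 + y ^ 2)) := by gcongr
    _ = _ := by rw [hwt, r1, r2, r3, r4]; ring

lemma convB_eq_setIntegral (k : ℕ) (B : ℂ → ℂ → ℂ) (τ : ℂ) :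
    convB k B τ = ∫ x in Ioo (0 : ℝ) 1, B (τ * rt(k, 1 - x))
      (τ * rt(k, x)) / (((1 - x) * x : ℝ) : ℂ) := by
  rw [convB, intervalIntegral.integral_of_le zero_le_one, integral_Ioc_eq_integral_Ioo]

/-- The bound for the integrand of `convB`, in terms of weights. -/
lemma TimeData.norm_convB_integrand_le (t : TimeData) (hk : 1 ≤ t.k) {b : ℝ} (hb : 0 ≤ b)
    (hbe : b < e) (hbe' : b < e') (hb2 : b ≤ 2 * t.k) {B : ℂ → ℂ → ℂ}
    (hK : 0 ≤ K) (hx : x ∈ Ioo (0 : ℝ) 1)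
    (hB : ‖B (τ * rt(t.k, 1 - x)) (τ * rt(t.k, x))‖ ≤
      K * (t.wt e (τ * rt(t.k, 1 - x) / ε) *
        t.wt e' (τ * rt(t.k, x) / ε))) :
    ‖B (τ * rt(t.k, 1 - x)) (τ * rt(t.k, x)) /
      (((1 - x) * x : ℝ) : ℂ)‖ ≤ K * (4 * t.wt (e + e' - b) (τ / ε) *
        ((1 - x) ^ (e / t.k - 1) * x ^ ((e' - b) / t.k - 1)
          + (1 - x) ^ ((e - b) / t.k - 1) * x ^ (e' / t.k - 1))) := by
  have hx0 := hx.1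
  have hx1 : 0 < 1 - x := by linarith [hx.2]
  rw [norm_div, norm_real, norm_of_nonneg pos!]
  have hs : ∀ c : ℂ, τ * c / ε = τ / ε * c := fun c => by ring
  rw [hs, hs] at hB
  calc _ ≤ K * (t.wt e (τ / ε * rt(t.k, 1 - x)) *
        t.wt e' (τ / ε * rt(t.k, x))) / ((1 - x) * x) := by gcongr
    _ = K * (t.wt e (τ / ε * rt(t.k, 1 - x)) *
        t.wt e' (τ / ε * rt(t.k, x)) / ((1 - x) * x)) := by ring
    _ ≤ _ := by gcongr; exact t.wt_mul_wt_div_le hk hb hbe hbe' hb2 _ hx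

/-- The dominating function for the integrand of `convB`. -/
def convKernel (k : ℕ) (e e' b x : ℝ) : ℝ :=
  (1 - x) ^ (e / k - 1) * x ^ ((e' - b) / k - 1) + (1 - x) ^ ((e - b) / k - 1) * x ^ (e' / k - 1)

lemma integrableOn_convKernel (hk : 1 ≤ k) {b : ℝ} (hb : 0 ≤ b) (hbe : b < e)
    (hbe' : b < e') : IntegrableOn (convKernel k e e' b) (Ioo 0 1) := by
  have hk0 : (0 : ℝ) < k := by positivity
  exact (integrableOn_one_sub_rpow_mul_rpow (div_pos (by linarith) hk0)
    (div_pos (by linarith) hk0)).add (integrableOn_one_sub_rpow_mul_rpow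
    (div_pos (by linarith) hk0) (div_pos (by linarith) hk0))

lemma convKernel_nonneg (k : ℕ) (e e' b : ℝ) (hx : x ∈ Ioo (0 : ℝ) 1) :
    0 ≤ convKernel k e e' b x := by
  have hx0 := hx.1
  have hx1 : 0 < 1 - x := by linarith [hx.2]
  unfold convKernel
  positivity

/-- The constant in the estimate for `convB`. -/
def convConst (k : ℕ) (e e' b : ℝ) : ℝ :=
  4 * ∫ x in Ioo (0 : ℝ) 1, convKernel k e e' b x

lemma convConst_nonneg (k : ℕ) (e e' b : ℝ) : 0 ≤ convConst k e e' b :=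
  mul_nonneg (by norm_num)
    (setIntegral_nonneg measurableSet_Ioo fun _ hx => convKernel_nonneg k e e' b hx)

/-- The convolution of order `k` is continuous between weighted spaces. -/
lemma TimeData.norm_convB_le (t : TimeData) (hk : 1 ≤ t.k) {b : ℝ} (hb : 0 ≤ b)
    (hbe : b < e) (hbe' : b < e') (hb2 : b ≤ 2 * t.k) {B : ℂ → ℂ → ℂ}
    (hK : 0 ≤ K)
    (hB : ∀ x ∈ Ioo (0 : ℝ) 1,
      ‖B (τ * rt(t.k, 1 - x)) (τ * rt(t.k, x))‖ ≤
      K * (t.wt e (τ * rt(t.k, 1 - x) / ε) *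
        t.wt e' (τ * rt(t.k, x) / ε))) :
    ‖convB t.k B τ‖ ≤ convConst t.k e e' b * K * t.wt (e + e' - b) (τ / ε) := by
  rw [convB_eq_setIntegral]
  refine (norm_integral_le_of_norm_le (((integrableOn_convKernel hk hb hbe hbe').const_mul
    (4 * t.wt (e + e' - b) (τ / ε))).const_mul K) ((ae_restrict_iff' measurableSet_Ioo).2
    (.of_forall fun x hx =>
      t.norm_convB_integrand_le hk hb hbe hbe' hb2 hK hx (hB x hx)))).trans_eq ?_
  rw [integral_const_mul, integral_const_mul, convConst]
  ring

/-- Multiplication by `T ^ n` is, in the Borel plane, convolution with a monomial. -/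
lemma mulB_eq_convB (hk : 1 ≤ k) (n : ℕ) (f : ℂ → ℂ) (τ : ℂ) :
    mulB k n f τ = convB k (fun x y => x ^ n / (Gamma ((n : ℝ) / k) : ℝ) * f y) τ := by
  have hk0 : (k : ℝ) ≠ 0 := by positivity
  rw [convB_eq_setIntegral, mulB, intervalIntegral.integral_of_le zero_le_one,
    integral_Ioc_eq_integral_Ioo, ← integral_const_mul]
  refine setIntegral_congr_fun measurableSet_Ioo fun x hx => ?_
  have hx0 := hx.1
  have hx1 : 0 < 1 - x := by linarith [hx.2]
  have h1 : rt(k, 1 - x) ^ n = (((1 - x) ^ ((n : ℝ) / k) : ℝ) : ℂ) := by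
    rw [← ofReal_pow, ← rpow_natCast, ← rpow_mul hx1.le]
    congr 2; ring
  have hc0 : (x : ℂ) ≠ 0 := mod_cast hx0.ne'
  have hc1 : (1 - x : ℂ) ≠ 0 := mod_cast hx1.ne'
  rw [mul_pow, h1, rpow_sub_one hx1.ne']
  push_cast
  field_simp

/-- A monomial, measured with the weight of any lower order. -/
lemma TimeData.exists_monomial_le (t : TimeData) (hk : 1 ≤ t.k) (hν : 0 < t.ν) (n : ℕ)
    (he : 0 ≤ e) (hen : e ≤ n) : ∃ C : ℝ, 0 ≤ C ∧ ∀ ε x : ℂ, ε ≠ 0 →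
      ‖x ^ n / ((Gamma ((n : ℝ) / t.k) : ℝ) : ℂ)‖ ≤ C * ‖ε‖ ^ n * t.wt e (x / ε) := by
  obtain ⟨C1, hC1, h1⟩ := exists_rpow_le_exp hk (p := n - e) (by linarith) hν
  obtain ⟨C2, hC2, h2⟩ := exists_rpow_le_exp hk (p := n - e + (2 * t.k : ℕ))
    (by have : (0 : ℝ) ≤ (2 * t.k : ℕ) := by positivity
        linarith) hν
  set G := ‖((Gamma ((n : ℝ) / t.k) : ℝ) : ℂ)‖ with hG
  refine ⟨(C1 + C2) / G, by positivity, fun ε x hε => ?_⟩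
  have hε0 : 0 < ‖ε‖ := norm_pos_iff.2 hε
  set s := ‖x / ε‖ with hs
  have hs0 : 0 ≤ s := norm_nonneg _
  have hx : ‖x‖ = ‖ε‖ * s := by rw [hs, norm_div]; field_simp
  have key : s ^ n ≤ (C1 + C2) * (s ^ e / (1 + s ^ (2 * t.k)) * exp (t.ν * s ^ t.k)) := by
    have e1 : s ^ n = s ^ e * s ^ ((n : ℝ) - e) := by
      rw [← rpow_add_of_nonneg hs0 he (by linarith), ← rpow_natCast]; congr 1; ring
    have e2 : s ^ ((n : ℝ) - e) * (1 + s ^ (2 * t.k)) ≤ (C1 + C2) * exp (t.ν * s ^ t.k) := by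
      have := h1 s hs0
      have h3 := h2 s hs0
      rw [rpow_add_of_nonneg hs0 (by linarith) pos!, rpow_natCast] at h3
      calc _ = s ^ ((n : ℝ) - e) + s ^ ((n : ℝ) - e) * s ^ (2 * t.k) := by ring
        _ ≤ _ := by rw [add_mul]; exact add_le_add this h3
    calc s ^ n = s ^ e / (1 + s ^ (2 * t.k)) * (s ^ ((n : ℝ) - e) * (1 + s ^ (2 * t.k))) := by
          rw [e1]; field_simp
      _ ≤ s ^ e / (1 + s ^ (2 * t.k)) * ((C1 + C2) * exp (t.ν * s ^ t.k)) := by gcongr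
      _ = _ := by ring
  rw [norm_div, norm_pow, ← hG, hx, mul_pow, TimeData.wt, ← hs]
  calc ‖ε‖ ^ n * s ^ n / G ≤ ‖ε‖ ^ n * ((C1 + C2) * (s ^ e / (1 + s ^ (2 * t.k)) *
        exp (t.ν * s ^ t.k))) / G := by gcongr
    _ = _ := by ring

lemma TimeData.exists_norm_mulB_le (t : TimeData) (hk : 1 ≤ t.k) (hν : 0 < t.ν) (n : ℕ) (he : 0 < e) (hen : e ≤ n) (he' : 0 < e') :
    ∃ C : ℝ, 0 ≤ C ∧ ∀ (ε τ : ℂ) (f : ℂ → ℂ) (K : ℝ), ε ≠ 0 → 0 ≤ K →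
      (∀ x ∈ Ioo (0 : ℝ) 1, ‖f (τ * rt(t.k, x))‖ ≤
        K * t.wt e' (τ * rt(t.k, x) / ε)) →
      ‖mulB t.k n f τ‖ ≤ C * ‖ε‖ ^ n * K * t.wt (e' + e) (τ / ε) := by
  obtain ⟨C, hC, h⟩ := t.exists_monomial_le hk hν n he.le hen
  refine ⟨convConst t.k e e' 0 * C, mul_nonneg (convConst_nonneg _ _ _ _) hC,
    fun ε τ f K hε hK hf => ?_⟩
  rw [mulB_eq_convB hk]
  refine (t.norm_convB_le hk le_rfl he he' pos! (ε := ε) (K := C * ‖ε‖ ^ n * K)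
    pos! fun x hx => ?_).trans_eq ?_
  · rw [norm_mul]
    calc _ ≤ (C * ‖ε‖ ^ n * t.wt e _) * (K * t.wt e' _) :=
          mul_le_mul (h ε _ hε) (hf x hx) (norm_nonneg _)
            (mul_nonneg pos! (t.wt_nonneg _ _))
      _ = _ := by ring
  · rw [sub_zero, add_comm e e']; ring

/-! ### Polynomials on the imaginary axis -/

lemma norm_I_mul_ofReal (m : ℝ) : ‖I * (m : ℂ)‖ = |m| := by simp

lemma norm_eval_le_of_coeff_le {p : ℂ[X]} (hn : p.natDegree ≤ n) {c : ℕ → ℝ}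
    (hc : ∀ i, ‖p.coeff i‖ ≤ c i) (m : ℝ) :
    ‖p.eval (I * m)‖ ≤ (∑ i ∈ Finset.range (n + 1), c i) * (1 + |m|) ^ n := by
  rw [Polynomial.eval_eq_sum_range' (Nat.lt_succ_of_le hn), sum_mul]
  refine norm_sum_le_of_le _ fun i hi => ?_
  rw [norm_mul, norm_pow, norm_I_mul_ofReal]
  have h1 : (1 : ℝ) ≤ 1 + |m| := by linarith [abs_nonneg m]
  have h2 : |m| ^ i ≤ (1 + |m|) ^ n :=
    (pow_le_pow_left₀ (abs_nonneg m) (by linarith) i).trans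
      (pow_le_pow_right₀ h1 (by simpa [Nat.lt_succ_iff] using hi))
  have h3 := (norm_nonneg _).trans (hc i)
  have := hc i
  gcongr

lemma exists_norm_eval_le {p : ℂ[X]} (hn : p.natDegree ≤ n) :
    ∃ C : ℝ, 0 ≤ C ∧ ∀ m : ℝ, ‖p.eval (I * m)‖ ≤ C * (1 + |m|) ^ n :=
  ⟨_, sum_nonneg fun i _ => norm_nonneg (p.coeff i),
    norm_eval_le_of_coeff_le hn fun _ => le_rfl⟩

lemma PolyAdmissible.exists_bound {P : ℂ → ℂ[X]} {N : ℕ} (hr : 0 < r)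
    (hP : PolyAdmissible P r μ N) : ∃ n : ℕ, n ≤ N ∧ (n : ℝ) + 1 < μ ∧ ∃ C : ℝ, 0 ≤ C ∧
      ∀ ε ∈ closedBall (0 : ℂ) r, ∀ m : ℝ,
        ‖(P ε).eval (I * m)‖ ≤ C * (1 + |m|) ^ n := by
  set A : Set ℕ := (fun ε => (P ε).natDegree) '' closedBall (0 : ℂ) r with hA
  have hne : A.Nonempty := ⟨_, 0, Metric.mem_closedBall_self hr.le, rfl⟩
  have hbd : BddAbove A := ⟨N, by rintro _ ⟨ε, hε, rfl⟩; exact hP.deg_le ε hε⟩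
  obtain ⟨ε', hε', hn⟩ := Nat.sSup_mem hne hbd
  have hb : ∀ i, ∃ c, ∀ ε ∈ closedBall (0 : ℂ) r, ‖(P ε).coeff i‖ ≤ c := fun i =>
    (isCompact_closedBall (0 : ℂ) r).exists_bound_of_continuousOn (hP.analytic i).continuousOn
  choose c hc using hb
  have h0 : ∀ i, 0 ≤ c i := fun i =>
    (norm_nonneg _).trans (hc i 0 (Metric.mem_closedBall_self hr.le))
  refine ⟨sSup A, ?_, ?_, _, sum_nonneg fun i _ => h0 i, fun ε hε m =>
    norm_eval_le_of_coeff_le (le_csSup hbd ⟨ε, hε, rfl⟩) (fun i => hc i ε hε) m⟩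
  · rw [← hn]; exact hP.deg_le ε' hε'
  · rw [← hn]; exact hP.deg_lt ε' hε'

lemma norm_eval_ge_of_roots {p : ℂ[X]} {x : ℂ} (hc : 0 ≤ c)
    (h : ∀ q ∈ p.roots, c ≤ ‖x - q‖) :
    ‖p.leadingCoeff‖ * c ^ p.natDegree ≤ ‖p.eval x‖ := by
  have hs := IsAlgClosed.splits p
  have key : ∀ s : Multiset ℂ, (∀ q ∈ s, c ≤ ‖x - q‖) →
      c ^ Multiset.card s ≤ ‖(s.map fun q => x - q).prod‖ := by
    intro s
    induction s using Multiset.induction with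
    | empty => simp
    | cons a s ih =>
      intro h
      simp only [Multiset.mem_cons, forall_eq_or_imp] at h
      rw [Multiset.card_cons, Multiset.map_cons, Multiset.prod_cons, norm_mul, pow_succ']
      exact mul_le_mul h.1 (ih h.2) pos! (norm_nonneg _)
  rw [hs.eval_eq_prod_roots, norm_mul, hs.natDegree_eq_card_roots]
  exact mul_le_l (key _ h) (norm_nonneg _)

/-- A polynomial without zeros on the imaginary axis is bounded below there by its degree. -/
lemma exists_norm_eval_ge {p : ℂ[X]} (hp : ∀ m : ℝ, p.eval (I * m) ≠ 0) :
    ∃ c : ℝ, 0 < c ∧ ∀ m : ℝ, c * (1 + |m|) ^ p.natDegree ≤ ‖p.eval (I * m)‖ := by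
  have hp0 : p ≠ 0 := by rintro rfl; exact hp 0 (by simp)
  have hre : ∀ q ∈ p.roots, q.re ≠ 0 := by
    intro q hq h0
    refine hp q.im ?_
    have : I * (q.im : ℂ) = q := by apply Complex.ext <;> simp [h0]
    rw [this]
    exact (Polynomial.mem_roots hp0).1 hq
  set g : ℂ → ℝ := fun q => 1 + (1 + ‖q‖) / |q.re| with hg
  have hg0 : ∀ q, 0 ≤ g q := fun q => by positivity
  set G := 1 + ∑ q ∈ p.roots.toFinset, g q with hG
  have hGpos : 0 < G := by have := sum_nonneg fun q (_ : q ∈ p.roots.toFinset) => hg0 q; linarith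
  have hlc : 0 < ‖p.leadingCoeff‖ := by simpa using hp0
  refine ⟨‖p.leadingCoeff‖ * (G⁻¹) ^ p.natDegree, by positivity, fun m => ?_⟩
  rw [mul_assoc, ← mul_pow]
  refine norm_eval_ge_of_roots pos! fun q hq => ?_
  have h1 : |q.re| ≤ ‖I * (m : ℂ) - q‖ := by
    have := Complex.abs_re_le_norm (I * (m : ℂ) - q)
    simpa using this
  have h2 : |m| ≤ ‖I * (m : ℂ) - q‖ + ‖q‖ := by
    have := norm_sub_norm_le (I * (m : ℂ)) q
    rw [norm_I_mul_ofReal] at this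
    linarith
  have hq0 : 0 < |q.re| := abs_pos.2 (hre q hq)
  have h3 : 1 + |m| ≤ g q * ‖I * (m : ℂ) - q‖ := by
    have : (1 + ‖q‖) ≤ (1 + ‖q‖) / |q.re| * ‖I * (m : ℂ) - q‖ := by
      rw [div_mul_eq_mul_div, le_div_iff₀ hq0]
      gcongr
    rw [hg]; linarith
  have h4 : g q ≤ G := by
    have := Finset.single_le_sum (fun q _ => hg0 q) (Multiset.mem_toFinset.2 hq)
    linarith
  rw [inv_mul_le_iff₀ hGpos]
  exact h3.trans (by gcongr)

lemma TimeData.Admissible.one_lt_δ (ht : t.Admissible) : 1 < t.δ t.D := by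
  have : ∀ l, 1 ≤ l → l ≤ t.D - 1 → 1 < t.δ (l + 1) := by
    intro l hl
    induction l, hl using Nat.le_induction with
    | base => intro h; have := ht.δ_lt 1 le_rfl h; rwa [ht.δ_one] at this
    | succ l hl ih => intro h; exact (ih (by omega)).trans (ht.δ_lt (l + 1) (by omega) h)
  have h2 := this (t.D - 1) (by have := ht.two_le_D; omega) le_rfl
  rwa [Nat.sub_add_cancel (by have := ht.two_le_D; omega)] at h2

/-- The lower bound for `P_m` which the separation of its roots from the domain gives. -/
lemma TimeData.exists_norm_Pm_ge (t : TimeData) (ht : t.Admissible)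
    (hroots : t.RootsApart ρ) : ∃ c : ℝ, 0 < c ∧ ∀ (m : ℝ), ∀ τ ∈ t.closedDom ρ,
      c * ‖t.RD.eval (I * m)‖ * (1 + ‖τ‖) ^ ((t.δ t.D - 1) * t.k) ≤ ‖t.Pm m τ‖ := by
  obtain ⟨M, hM, h⟩ := hroots
  have hk := ht.one_le_k
  have hδ := ht.one_lt_δ
  set N := (t.δ t.D - 1) * t.k with hN
  have hN0 : N ≠ 0 := by
    rw [hN]; exact Nat.mul_ne_zero (by omega) (by omega)
  have hkδ : (0 : ℝ) < (t.k : ℝ) ^ t.δ t.D := by positivity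
  refine ⟨(t.k : ℝ) ^ t.δ t.D * M ^ N, by positivity, fun m τ hτ => ?_⟩
  set a : ℂ := t.RD.eval (I * m) * (t.k : ℂ) ^ t.δ t.D with ha
  set b : ℂ := t.Q.eval (I * m) * t.k with hb
  have ha0 : a ≠ 0 := mul_ne_zero (ht.RD_ne m) (by
    have : (t.k : ℂ) ≠ 0 := mod_cast (by omega : t.k ≠ 0)
    positivity)
  set p : ℂ[X] := Polynomial.C a * Polynomial.X ^ N - Polynomial.C b with hp
  have hpe : ∀ z, t.Pm m z = - p.eval z := by
    intro z; simp [hp, TimeData.Pm, ha, hb, hN]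
  have hdeg : p.natDegree = N := by
    rw [hp, Polynomial.natDegree_sub_C, Polynomial.natDegree_C_mul_X_pow _ _ ha0]
  have hlc : p.leadingCoeff = a := by
    rw [Polynomial.leadingCoeff, hdeg, hp]
    simp [Polynomial.coeff_C, hN0]
  have hp0 : p ≠ 0 := by rw [← Polynomial.leadingCoeff_ne_zero, hlc]; exact ha0
  have := norm_eval_ge_of_roots (p := p) (x := τ) (c := M * (1 + ‖τ‖)) pos!
    fun q hq => h m q (by rw [hpe, (Polynomial.mem_roots hp0).1 hq, neg_zero]) τ hτ
  rw [hlc, hdeg] at this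
  rw [hpe, norm_neg]
  refine le_trans (le_of_eq ?_) this
  rw [ha, norm_mul, norm_pow, Complex.norm_natCast, mul_pow]
  ring

/-! ### The convolution in the Fourier variable -/

/-- The weight `(1 + |m|) ^ s exp (-β |m|)` in the Fourier variable. -/
def fw (β s m : ℝ) : ℝ := (1 + |m|) ^ s * exp (-(β * |m|))

lemma fw_pos (β s m : ℝ) : 0 < fw β s m := by
  unfold fw; positivity

lemma continuous_fw (β s : ℝ) : Continuous (fw β s) := by
  unfold fw
  refine Continuous.mul (Continuous.rpow_const fp! fun m => Or.inl ?_) fp!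
  positivity

/-- Majorants `a`, `b` of the symbols of the Fourier convolution on `E_(β, μ)`: the convolution then
maps into the space with the weight `fw β (M - μ)`. -/
structure ConvMaj (β μ M C s : ℝ) (a b : ℝ → ℝ) : Prop where
  one_lt : 1 < s
  a_nonneg : ∀ m, 0 ≤ a m
  b_nonneg : ∀ m, 0 ≤ b m
  bdd_a : ∀ m, a m * fw β (-μ) m ≤ C
  int_b : Integrable fun m => b m * fw β (-μ) m
  kernel : ∀ m m1, (a (m - m1) * fw β (-μ) (m - m1)) * (b m1 * fw β (-μ) m1) ≤
    C * fw β (M - μ) m * ((1 + |m1|) ^ (-s) + (1 + |m - m1|) ^ (-s))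

lemma integrable_one_add_abs_rpow (hs : 1 < s) :
    Integrable fun x : ℝ => (1 + |x|) ^ (-s) := by
  simpa using integrable_one_add_norm (E := ℝ) (μ := volume) (r := s) (by simpa using hs)

/-- The constant in the estimate of the Fourier convolution. -/
def convMajConst (C s : ℝ) : ℝ := C * (2 * ∫ x : ℝ, (1 + |x|) ^ (-s))

lemma ConvMaj.C_nonneg {C : ℝ} (h : ConvMaj β μ M C s a b) : 0 ≤ C :=
  (mul_nonneg (h.a_nonneg 0) (fw_pos _ _ _).le).trans (h.bdd_a 0)

lemma ConvMaj.const_nonneg {C : ℝ} (h : ConvMaj β μ M C s a b) :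
    0 ≤ convMajConst C s := by
  refine mul_nonneg h.C_nonneg (mul_nonneg (by norm_num) (integral_nonneg fun x => ?_))
  have := abs_nonneg x
  positivity

section
variable {C : ℝ} {f g : ℝ → ℂ}

/-- The bound `|A(im)| ≤ a(m)` on the imaginary axis. -/
abbrev EvalLe (A : ℂ[X]) (a : ℝ → ℝ) : Prop := ∀ m : ℝ, ‖A.eval (I * m)‖ ≤ a m

lemma norm_fourierConv_integrand_le (hA : EvalLe A a)
    (hB : EvalLe B b)
    (hf : ∀ m, ‖f m‖ ≤ Kf * fw β (-μ) m) (hg : ∀ m, ‖g m‖ ≤ Kg * fw β (-μ) m) (m m1 : ℝ) :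
    ‖A.eval (I * ((m - m1 : ℝ) : ℂ)) * f (m - m1) * (B.eval (I * (m1 : ℂ)) * g m1)‖ ≤
      Kf * Kg * ((a (m - m1) * fw β (-μ) (m - m1)) * (b m1 * fw β (-μ) m1)) := by
  rw [norm_mul, norm_mul, norm_mul]
  calc _ ≤ a (m - m1) * (Kf * fw β (-μ) (m - m1)) * (b m1 * (Kg * fw β (-μ) m1)) := by
        have a0 := (norm_nonneg _).trans (hA (m - m1))
        have b0 := (norm_nonneg _).trans (hB m1)
        have f0 := (norm_nonneg _).trans (hf (m - m1))
        have g0 := (norm_nonneg _).trans (hg m1)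
        gcongr
        · exact hA _
        · exact hf _
        · exact hB _
        · exact hg _
    _ = _ := by ring

lemma ConvMaj.nonneg_of_le (hf : ∀ m, ‖f m‖ ≤ Kf * fw β (-μ) m) : 0 ≤ Kf := by
  have := (norm_nonneg _).trans (hf 0)
  exact nonneg_of_mul_nonneg_left this (fw_pos _ _ _)

lemma ConvMaj.norm_integrand_le (h : ConvMaj β μ M C s a b)
    (hA : EvalLe A a) (hB : EvalLe B b)
    (hf : ∀ m, ‖f m‖ ≤ Kf * fw β (-μ) m) (hg : ∀ m, ‖g m‖ ≤ Kg * fw β (-μ) m) (m m1 : ℝ) :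
    ‖A.eval (I * ((m - m1 : ℝ) : ℂ)) * f (m - m1) * (B.eval (I * (m1 : ℂ)) * g m1)‖ ≤
      Kf * Kg * (C * (b m1 * fw β (-μ) m1)) := by
  refine (norm_fourierConv_integrand_le hA hB hf hg m m1).trans ?_
  have f0 := ConvMaj.nonneg_of_le hf
  have g0 := ConvMaj.nonneg_of_le hg
  have := h.bdd_a (m - m1)
  have b0 := mul_nonneg (h.b_nonneg m1) (fw_pos β (-μ) m1).le
  gcongr

lemma ConvMaj.integrable (h : ConvMaj β μ M C s a b)
    (hA : EvalLe A a) (hB : EvalLe B b)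
    (hfm : Measurable f) (hgm : Measurable g)
    (hf : ∀ m, ‖f m‖ ≤ Kf * fw β (-μ) m) (hg : ∀ m, ‖g m‖ ≤ Kg * fw β (-μ) m) (m : ℝ) :
    Integrable fun m1 : ℝ => A.eval (I * ((m - m1 : ℝ) : ℂ)) * f (m - m1) *
      (B.eval (I * (m1 : ℂ)) * g m1) := by
  refine Integrable.mono' ((h.int_b.const_mul C).const_mul (Kf * Kg)) ?_
    (.of_forall (h.norm_integrand_le hA hB hf hg m))
  have hA' : Measurable fun x : ℂ => A.eval x := A.continuous.measurable
  have hB' : Measurable fun x : ℂ => B.eval x := B.continuous.measurable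
  exact (by fun_prop : Measurable _).aestronglyMeasurable

lemma ConvMaj.norm_fourierConv_le (h : ConvMaj β μ M C s a b)
    (hA : EvalLe A a) (hB : EvalLe B b)
    (hf : ∀ m, ‖f m‖ ≤ Kf * fw β (-μ) m) (hg : ∀ m, ‖g m‖ ≤ Kg * fw β (-μ) m) (m : ℝ) :
    ‖fourierConv A B f g m‖ ≤ convMajConst C s * (Kf * Kg) * fw β (M - μ) m := by
  have f0 := ConvMaj.nonneg_of_le hf
  have g0 := ConvMaj.nonneg_of_le hg
  have hi := integrable_one_add_abs_rpow h.one_lt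
  have h1 : ‖(((Real.sqrt (2 * π))⁻¹ : ℝ) : ℂ)‖ ≤ 1 := by
    rw [norm_real, norm_of_nonneg pos!]
    refine inv_le_one_of_one_le₀ (Real.one_le_sqrt.2 ?_)
    linarith [Real.pi_gt_three]
  rw [fourierConv, norm_mul]
  refine (mul_le_of_le_one_left (norm_nonneg _) h1).trans ?_
  refine (norm_integral_le_of_norm_le (((hi.add (hi.comp_sub_left m)).const_mul
    (C * fw β (M - μ) m)).const_mul (Kf * Kg)) (.of_forall fun m1 => ?_)).trans_eq ?_
  · refine (norm_fourierConv_integrand_le hA hB hf hg m m1).trans ?_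
    have := h.kernel m m1
    simp only [Pi.add_apply]
    gcongr
  · rw [integral_const_mul, integral_const_mul]
    simp only [Pi.add_apply]
    rw [integral_add hi (hi.comp_sub_left m), integral_sub_left_eq_self
      (fun x => (1 + |x|) ^ (-s)), convMajConst]
    ring

lemma ConvMaj.norm_fourierConv_sub_le {f' g' : ℝ → ℂ} {L L' : ℝ} (h : ConvMaj β μ M C s a b)
    (hA : EvalLe A a) (hB : EvalLe B b)
    (mf : Measurable f) (mf' : Measurable f') (mg : Measurable g) (mg' : Measurable g')
    (hf : ∀ m, ‖f m‖ ≤ Kf * fw β (-μ) m) (hf' : ∀ m, ‖f' m‖ ≤ Kf * fw β (-μ) m)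
    (hg : ∀ m, ‖g m‖ ≤ Kg * fw β (-μ) m) (hg' : ∀ m, ‖g' m‖ ≤ Kg * fw β (-μ) m)
    (hd : ∀ m, ‖f m - f' m‖ ≤ L * fw β (-μ) m) (hd' : ∀ m, ‖g m - g' m‖ ≤ L' * fw β (-μ) m)
    (m : ℝ) : ‖fourierConv A B f g m - fourierConv A B f' g' m‖ ≤
      convMajConst C s * (Kf * L' + L * Kg) * fw β (M - μ) m := by
  have e : fourierConv A B f g m - fourierConv A B f' g' m =
      fourierConv A B f (g - g') m + fourierConv A B (f - f') g' m := by
    simp only [fourierConv]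
    rw [← mul_sub, ← mul_add, ← integral_sub (h.integrable hA hB mf mg hf hg m)
      (h.integrable hA hB mf' mg' hf' hg' m), ← integral_add
      (h.integrable hA hB mf (mg.sub mg') hf hd' m)
      (h.integrable hA hB (mf.sub mf') mg' hd hg' m)]
    congr 2
    funext x
    simp only [Pi.sub_apply]
    ring
  rw [e]
  exact (norm_add_le_of_le (h.norm_fourierConv_le hA hB hf hd' m)
    (h.norm_fourierConv_le hA hB hd hg' m)).trans_eq (by ring)

end

lemma fw_mul_pow (β s m : ℝ) (n : ℕ) : (1 + |m|) ^ n * fw β s m = fw β (n + s) m := by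
  have : 0 < 1 + |m| := by positivity
  rw [fw, fw, rpow_add this, rpow_natCast]; ring

lemma fw_le_fw (β : ℝ) {s' : ℝ} (h : s ≤ s') (m : ℝ) : fw β s m ≤ fw β s' m := by
  unfold fw
  have := abs_nonneg m
  gcongr
  linarith

lemma fw_le_rpow (hβ : 0 ≤ β) (s m : ℝ) : fw β s m ≤ (1 + |m|) ^ s :=
  mul_le_of_le_one_right pos! (Real.exp_le_one_iff.2 (neg_nonpos.2 pos!))

lemma fw_le_one (hβ : 0 ≤ β) (hs : s ≤ 0) (m : ℝ) : fw β s m ≤ 1 :=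
  (fw_le_rpow hβ _ _).trans
    (Real.rpow_le_one_of_one_le_of_nonpos (by linarith [abs_nonneg m]) hs)

lemma integrable_pow_mul_fw (hβ : 0 < β) (hμ : 0 ≤ μ) (n : ℕ) : Integrable (fw β (n - μ)) := by
  obtain ⟨C, hC, h⟩ := exists_rpow_le_exp (k := 1) le_rfl (p := n + 2) pos! hβ
  refine Integrable.mono' ((integrable_one_add_abs_rpow (s := 2) (by norm_num)).const_mul
    (C * exp β)) (continuous_fw _ _).aestronglyMeasurable (.of_forall fun m => ?_)
  rw [norm_of_nonneg (fw_pos _ _ _).le]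
  have hw : 0 < 1 + |m| := by positivity
  calc fw β (n - μ) m ≤ fw β ((n + 2) + (-2)) m := fw_le_fw β (by linarith) m
    _ = (1 + |m|) ^ ((n : ℝ) + 2) * (1 + |m|) ^ (-2 : ℝ) * exp (-(β * |m|)) := by
      rw [fw, rpow_add hw]
    _ ≤ C * exp (β * (1 + |m|) ^ 1) * (1 + |m|) ^ (-2 : ℝ) * exp (-(β * |m|)) := by
      gcongr; exact h _ hw.le
    _ = _ := by
      rw [show β * (1 + |m|) ^ 1 = β + β * |m| by ring, exp_add, Real.exp_neg]
      field_simp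

lemma rpow_kernel_le (hs : 0 ≤ s) (m m1 : ℝ) :
    (1 + |m - m1|) ^ (-s) * (1 + |m1|) ^ (-s) ≤
      2 ^ s * (1 + |m|) ^ (-s) * ((1 + |m1|) ^ (-s) + (1 + |m - m1|) ^ (-s)) := by
  have h := abs_sub_abs_le_abs_sub m m1
  have key : ∀ x : ℝ, 0 ≤ x → 1 + |m| ≤ 2 * (1 + x) →
      (1 + x) ^ (-s) ≤ 2 ^ s * (1 + |m|) ^ (-s) := fun x hx h => by
    have := Real.rpow_le_rpow_of_nonpos pos! h (neg_nonpos.2 hs)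
    rwa [mul_rpow (by norm_num) pos!, rpow_neg (by norm_num),
      inv_mul_le_iff₀ pos!] at this
  rw [mul_add]
  rcases le_total |m1| |m - m1| with h' | h'
  · exact (mul_le_r (key _ pos! (by linarith))).trans (le_add_of_nonneg_right pos!)
  · rw [mul_comm]
    exact (mul_le_r (key _ pos! (by linarith))).trans (le_add_of_nonneg_left pos!)

lemma convMaj_of_kernel (hβ : 0 < β) {i j : ℕ} {C Ca Cb : ℝ} (hs : 1 < s) (hi : i ≤ μ)
    (ha : 0 ≤ Ca) (hb : 0 ≤ Cb) (hC : 0 ≤ C)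
    (h : ∀ m m1, fw β (i - μ) (m - m1) * fw β (j - μ) m1 ≤
      C * fw β (M - μ) m * ((1 + |m1|) ^ (-s) + (1 + |m - m1|) ^ (-s))) :
    ConvMaj β μ M (Ca + Ca * Cb * C) s (fun m => Ca * (1 + |m|) ^ i)
      (fun m => Cb * (1 + |m|) ^ j) := by
  have hfw (c : ℝ) (n : ℕ) (m : ℝ) : c * (1 + |m|) ^ n * fw β (-μ) m = c * fw β (n - μ) m := by
    rw [mul_assoc, fw_mul_pow]; rfl
  refine ⟨hs, fun m => by positivity, fun m => by positivity, fun m => ?_, ?_, fun m m1 => ?_⟩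
  · rw [hfw]
    exact (mul_le_of_le_one_right ha (fw_le_one hβ.le (by linarith) m)).trans
      (le_add_of_nonneg_right pos!)
  · simp only [hfw]
    exact (integrable_pow_mul_fw hβ (i.cast_nonneg.trans hi) j).const_mul _
  · have := (fw_pos β (M - μ) m).le
    rw [hfw, hfw]
    calc _ = Ca * Cb * (fw β (i - μ) (m - m1) * fw β (j - μ) m1) := by ring
      _ ≤ Ca * Cb * (C * fw β (M - μ) m * ((1 + |m1|) ^ (-s) + (1 + |m - m1|) ^ (-s))) := by
        exact mul_le_l (h m m1)
      _ = Ca * Cb * C * fw β (M - μ) m * ((1 + |m1|) ^ (-s) + (1 + |m - m1|) ^ (-s)) := by ring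
      _ ≤ _ := by gcongr; linarith

/-- Symbols of the same degree `n < μ - 1` on both factors. -/
lemma convMaj_of_deg_lt (hβ : 0 < β) (hn : (n : ℝ) + 1 < μ) (hnM : n ≤ M)
    {Ca Cb : ℝ} (ha : 0 ≤ Ca) (hb : 0 ≤ Cb) :
    ∃ C, ConvMaj β μ M C (μ - n) (fun m => Ca * (1 + |m|) ^ n) (fun m => Cb * (1 + |m|) ^ n) := by
  refine ⟨_, convMaj_of_kernel hβ (C := 2 ^ (μ - n)) (by linarith) (by linarith) ha hb
    pos! fun m m1 => ?_⟩
  have h := abs_sub_abs_le_abs_sub m m1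
  have h3 : fw β (-(μ - n)) m ≤ fw β (M - μ) m := fw_le_fw β (by linarith) m
  rw [← neg_sub μ n]
  calc _ = ((1 + |m - m1|) ^ (-(μ - n)) * (1 + |m1|) ^ (-(μ - n))) *
        exp (-(β * (|m - m1| + |m1|))) := by unfold fw; rw [mul_add, neg_add, exp_add]; ring
    _ ≤ (2 ^ (μ - n) * (1 + |m|) ^ (-(μ - n)) *
        ((1 + |m1|) ^ (-(μ - n)) + (1 + |m - m1|) ^ (-(μ - n)))) * exp (-(β * |m|)) := by
      refine mul_le_m (rpow_kernel_le (by linarith) m m1) (exp_le_exp.2 ?_)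
      nlinarith
    _ = 2 ^ (μ - n) * fw β (-(μ - n)) m *
        ((1 + |m1|) ^ (-(μ - n)) + (1 + |m - m1|) ^ (-(μ - n))) := by unfold fw; ring
    _ ≤ _ := by gcongr

/-- A symbol of any degree `n` on one of the factors only; here the exponential decay is needed. -/
lemma convMaj_of_one (hβ : 0 < β) (hμ : 1 < μ) (n : ℕ) {Cb : ℝ} (hb : 0 ≤ Cb) :
    ∃ C, ConvMaj β μ n C μ (fun _ => 1) (fun m => Cb * (1 + |m|) ^ n) := by
  obtain ⟨C, hC, hexp⟩ := exists_rpow_le_exp (k := 1) le_rfl (p := n) pos! hβ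
  have h0 : ((0 : ℕ) : ℝ) ≤ μ := by push_cast; linarith
  suffices h : ∀ m m1 : ℝ, fw β (-μ) (m - m1) * fw β (n - μ) m1 ≤ (2 ^ μ * (C * exp β)) *
      fw β (n - μ) m * ((1 + |m1|) ^ (-μ) + (1 + |m - m1|) ^ (-μ)) by
    have := convMaj_of_kernel (M := n) (i := 0) (j := n) (C := 2 ^ μ * (C * exp β)) hβ hμ h0
      zero_le_one hb pos! (by simpa using h)
    exact ⟨_, by simpa using this⟩
  intro m m1
  -- `x` is a lower bound for the excess `|m - m1| + |m1| - |m|`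
  obtain ⟨x, hx0, hx, hx'⟩ : ∃ x, 0 ≤ x ∧ |m1| - |m| ≤ x ∧ x ≤ |m - m1| + |m1| - |m| :=
    ⟨max 0 (|m1| - |m|), le_max_left _ _, le_max_right _ _, max_le
      (by linarith [abs_sub_abs_le_abs_sub m m1]) (by linarith [abs_nonneg (m - m1)])⟩
  have h2 : 1 + |m1| ≤ (1 + |m|) * (1 + x) := by nlinarith [abs_nonneg m]
  have h4 := hexp (1 + x) (by linarith)
  rw [rpow_natCast, pow_one] at h4
  have e (y : ℝ) : fw β (n - μ) y = (1 + |y|) ^ (-μ) * ((1 + |y|) ^ n * exp (-(β * |y|))) := by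
    rw [sub_eq_add_neg, ← fw_mul_pow, fw]; ring
  rw [e, e, fw]
  calc _ = ((1 + |m - m1|) ^ (-μ) * (1 + |m1|) ^ (-μ)) *
        ((1 + |m1|) ^ n * exp (-(β * (|m - m1| + |m1|)))) := by
          rw [mul_add β, neg_add, exp_add]; ring
    _ ≤ (2 ^ μ * (1 + |m|) ^ (-μ) * ((1 + |m1|) ^ (-μ) + (1 + |m - m1|) ^ (-μ))) *
        (((1 + |m|) * (1 + x)) ^ n * exp (-(β * (|m| + x)))) := by
      refine mul_le_m (rpow_kernel_le (by linarith) m m1) (mul_le_m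
        (pow_le_pow_left₀ pos! h2 n) (exp_le_exp.2 ?_))
      nlinarith
    _ ≤ (2 ^ μ * (1 + |m|) ^ (-μ) * ((1 + |m1|) ^ (-μ) + (1 + |m - m1|) ^ (-μ))) *
        ((1 + |m|) ^ n * (C * exp (β * (1 + x))) * exp (-(β * (|m| + x)))) := by
      rw [mul_pow]; gcongr
    _ = (2 ^ μ * (1 + |m|) ^ (-μ) * ((1 + |m1|) ^ (-μ) + (1 + |m - m1|) ^ (-μ))) *
        ((1 + |m|) ^ n * C * exp (β * (1 + x) + -(β * (|m| + x)))) := by rw [exp_add]; ring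
    _ = _ := by
      rw [show β * (1 + x) + -(β * (|m| + x)) = β + -(β * |m|) by ring, exp_add]; ring

/-! ### Linear operators in one Borel variable -/

lemma sector_smul_mem {a : ℝ} (h : τ ∈ sector d a) (hc : 0 < c) :
    τ * (c : ℂ) ∈ sector d a := by
  obtain ⟨r, φ, hr, hφ, rfl⟩ := h
  exact ⟨r * c, φ, by positivity, hφ, by push_cast; ring⟩

lemma TimeData.smul_mem_closedDom (t : TimeData) (h : τ ∈ t.closedDom ρ)
    (hc : 0 < c) (hc1 : c ≤ 1) : τ * (c : ℂ) ∈ t.closedDom ρ := by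
  rcases h with h | h
  · left
    rw [mem_closedBall_zero_iff] at h ⊢
    rw [norm_mul, norm_real, norm_of_nonneg hc.le]
    exact (mul_le_of_le_one_right (norm_nonneg _) hc1).trans h
  · right; exact sector_smul_mem h hc

lemma rpow_one_div_mem (hx : x ∈ Ioo (0 : ℝ) 1) :
    0 < x ^ ((1 : ℝ) / k) ∧ x ^ ((1 : ℝ) / k) ≤ 1 :=
  ⟨Real.rpow_pos_of_pos hx.1 _, rpow_le_one hx.1.le hx.2.le pos!⟩

lemma one_sub_mem_Ioo (hx : x ∈ Ioo (0 : ℝ) 1) : 1 - x ∈ Ioo (0 : ℝ) 1 :=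
  ⟨by linarith [hx.2], by linarith [hx.1]⟩

lemma TimeData.root_mem_closedDom (t : TimeData) (h : τ ∈ t.closedDom ρ)
    (hx : x ∈ Ioo (0 : ℝ) 1) : τ * rt(t.k, x) ∈ t.closedDom ρ :=
  t.smul_mem_closedDom h (rpow_one_div_mem hx).1 (rpow_one_div_mem hx).2

lemma TimeData.wt_mul_pow (t : TimeData) (he : 0 ≤ e) (n : ℕ) (z : ℂ) :
    ‖z‖ ^ n * t.wt e z = t.wt (e + n) z := by
  rw [TimeData.wt, TimeData.wt, rpow_add_of_nonneg (norm_nonneg _) he (Nat.cast_nonneg n),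
    rpow_natCast]
  ring

lemma TimeData.wt_mul_rpow (t : TimeData) {g : ℝ} (he : 0 ≤ e) (hg : 0 ≤ g) (z : ℂ) :
    ‖z‖ ^ g * t.wt e z = t.wt (e + g) z := by
  rw [TimeData.wt, TimeData.wt, rpow_add_of_nonneg (norm_nonneg _) he hg]
  ring

lemma measurable_convB {α : Type*} [MeasurableSpace α] (k : ℕ) {B : α → ℂ → ℂ → ℂ} {τ : α → ℂ}
    (hB : Measurable fun p : α × ℂ × ℂ => B p.1 p.2.1 p.2.2) (hτ : Measurable τ) :
    Measurable fun a => convB k (B a) (τ a) := by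
  simp only [convB_eq_setIntegral]
  have h : Measurable fun p : α × ℝ => B p.1 (τ p.1 * (((1 - p.2) ^ ((1 : ℝ) / k) : ℝ) : ℂ))
      (τ p.1 * rt(k, p.2)) / (((1 - p.2) * p.2 : ℝ) : ℂ) := by
    refine Measurable.div ?_ fp!
    exact hB.comp (g := fun p : α × ℂ × ℂ => B p.1 p.2.1 p.2.2)
      (f := fun p : α × ℝ => (p.1, τ p.1 * (((1 - p.2) ^ ((1 : ℝ) / k) : ℝ) : ℂ),
        τ p.1 * rt(k, p.2))) fp!
  exact h.stronglyMeasurable.integral_prod_right'.measurable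

lemma measurable_mulB {α : Type*} [MeasurableSpace α] (hk : 1 ≤ k) (n : ℕ) {f : α → ℂ → ℂ}
    {τ : α → ℂ} (hf : Measurable fun p : α × ℂ => f p.1 p.2) (hτ : Measurable τ) :
    Measurable fun a => mulB k n (f a) (τ a) := by
  simp only [mulB_eq_convB hk]
  refine measurable_convB k ?_ hτ
  refine Measurable.mul fp! ?_
  exact hf.comp (g := fun p : α × ℂ => f p.1 p.2) (f := fun p : α × ℂ × ℂ => (p.1, p.2.2))
    fp!

lemma measurable_fourierConv {α : Type*} [MeasurableSpace α] (A B : ℂ[X]) {f g : α → ℝ → ℂ}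
    {m : α → ℝ} (hf : Measurable fun p : α × ℝ => f p.1 p.2)
    (hg : Measurable fun p : α × ℝ => g p.1 p.2) (hm : Measurable m) :
    Measurable fun a => fourierConv A B (f a) (g a) (m a) := by
  have hA : Measurable fun x : ℂ => A.eval x := A.continuous.measurable
  have hB : Measurable fun x : ℂ => B.eval x := B.continuous.measurable
  have h : Measurable fun p : α × ℝ => A.eval (I * ((m p.1 - p.2 : ℝ) : ℂ)) *
      f p.1 (m p.1 - p.2) * (B.eval (I * (p.2 : ℂ)) * g p.1 p.2) := by
    refine Measurable.mul (Measurable.mul fp! ?_) (Measurable.mul fp! hg)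
    exact hf.comp (g := fun p : α × ℝ => f p.1 p.2) (f := fun p : α × ℝ => (p.1, m p.1 - p.2))
      fp!
  exact (h.stronglyMeasurable.integral_prod_right'.measurable).const_mul _

lemma convB_congr {B B' : ℂ → ℂ → ℂ}
    (h : ∀ x ∈ Ioo (0 : ℝ) 1,
      B (τ * rt(k, 1 - x)) (τ * rt(k, x)) =
      B' (τ * rt(k, 1 - x)) (τ * rt(k, x))) :
    convB k B τ = convB k B' τ := by
  rw [convB_eq_setIntegral, convB_eq_setIntegral]
  exact setIntegral_congr_fun measurableSet_Ioo fun x hx => by simp only [h x hx]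

lemma convB_const_mul (k : ℕ) (c : ℂ) (B : ℂ → ℂ → ℂ) (τ : ℂ) :
    convB k (fun x y => c * B x y) τ = c * convB k B τ := by
  rw [convB_eq_setIntegral, convB_eq_setIntegral, ← integral_const_mul]
  simp only [mul_div_assoc]

lemma TimeData.integrableOn_convB (t : TimeData) (hk : 1 ≤ t.k) (he : 0 < e)
    (he' : 0 < e') {B : ℂ → ℂ → ℂ} (hK : 0 ≤ K)
    (hm : Measurable fun p : ℂ × ℂ => B p.1 p.2)
    (hB : ∀ x ∈ Ioo (0 : ℝ) 1,
      ‖B (τ * rt(t.k, 1 - x)) (τ * rt(t.k, x))‖ ≤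
      K * (t.wt e (τ * rt(t.k, 1 - x) / ε) *
        t.wt e' (τ * rt(t.k, x) / ε))) :
    IntegrableOn (fun x : ℝ => B (τ * rt(t.k, 1 - x))
      (τ * rt(t.k, x)) / (((1 - x) * x : ℝ) : ℂ)) (Ioo 0 1) := by
  refine Integrable.mono' (((integrableOn_convKernel hk le_rfl he he').const_mul
    (4 * t.wt (e + e' - 0) (τ / ε))).const_mul K) ?_ ((ae_restrict_iff' measurableSet_Ioo).2
    (.of_forall fun x hx =>
      t.norm_convB_integrand_le hk le_rfl he he' pos! hK hx (hB x hx)))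
  have h : Measurable fun x : ℝ => B (τ * rt(t.k, 1 - x))
      (τ * rt(t.k, x)) := hm.comp (g := fun p : ℂ × ℂ => B p.1 p.2)
      (f := fun x : ℝ => (τ * rt(t.k, 1 - x),
        τ * rt(t.k, x))) fp!
  exact (h.div fp!).aestronglyMeasurable

/-- Measurable functions bounded on the closed domain by `K` times the weight with exponent `e`. -/
structure TimeData.Bd (t : TimeData) (ρ : ℝ) (ε : ℂ) (e K : ℝ) (f : ℂ → ℂ) : Prop where
  nonneg : 0 ≤ K
  meas : Measurable f
  le : ∀ σ ∈ t.closedDom ρ, ‖f σ‖ ≤ K * t.wt e (σ / ε)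

/-- An operator in one Borel variable (depending on `m`) which vanishes at `0` and is Lipschitz,
with constant `c`, from the functions of weight `e` to those of weight `e'`, uniformly in `m`. Only
the values on the closed domain matter. -/
structure OneOp (t : TimeData) (ρ : ℝ) (ε : ℂ) (e e' c : ℝ) (A : ℝ → (ℂ → ℂ) → ℂ → ℂ) : Prop where
  nonneg : 0 ≤ c
  zero : ∀ m τ, A m (fun _ => 0) τ = 0
  lip : ∀ {m f g K L}, t.Bd ρ ε e K f → t.Bd ρ ε e K g → 0 ≤ L →
    (∀ σ ∈ t.closedDom ρ, ‖f σ - g σ‖ ≤ L * t.wt e (σ / ε)) →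
    ∀ τ ∈ t.closedDom ρ, ‖A m f τ - A m g τ‖ ≤ c * L * t.wt e' (τ / ε)
  meas : ∀ {α : Type} [MeasurableSpace α] (F : α → ℂ → ℂ) (m : α → ℝ) (τ : α → ℂ),
    Measurable (fun p : α × ℂ => F p.1 p.2) → Measurable m → Measurable τ →
    Measurable fun a => A (m a) (F a) (τ a)

namespace OneOp

variable {e'' : ℝ} {A A' : ℝ → (ℂ → ℂ) → ℂ → ℂ}

lemma bd (h : OneOp t ρ ε e e' c A) {m : ℝ} {f : ℂ → ℂ} (hf : t.Bd ρ ε e K f) :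
    t.Bd ρ ε e' (c * K) (A m f) where
  nonneg := mul_nonneg h.nonneg hf.nonneg
  meas := h.meas (fun _ => f) (fun _ => m) _ (hf.meas.comp measurable_snd) measurable_const
    measurable_id
  le τ hτ := by
    have h0 : t.Bd ρ ε e K fun _ => 0 := ⟨hf.nonneg, measurable_const, fun σ _ => by
      simpa using mul_nonneg hf.nonneg (t.wt_nonneg e (σ / ε))⟩
    simpa [h.zero] using h.lip (m := m) hf h0 hf.nonneg (by simpa using hf.le) τ hτ

lemma id (t : TimeData) (ρ : ℝ) (ε : ℂ) (e : ℝ) : OneOp t ρ ε e e 1 fun _ f => f where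
  nonneg := zero_le_one
  zero _ _ := rfl
  lip _ _ _ h := by simpa using h
  meas _ m τ hF _ hτ := hF.comp (measurable_id.prodMk hτ)

lemma add (h : OneOp t ρ ε e e' c A) (h' : OneOp t ρ ε e e' c' A') :
    OneOp t ρ ε e e' (c + c') fun m f τ => A m f τ + A' m f τ where
  nonneg := add_nonneg h.nonneg h'.nonneg
  zero m τ := by rw [h.zero, h'.zero, add_zero]
  lip hf hg hL hd τ hτ := by
    rw [add_sub_add_comm, add_mul, add_mul]
    exact norm_add_le_of_le (h.lip hf hg hL hd τ hτ) (h'.lip hf hg hL hd τ hτ)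
  meas F m τ hF hm hτ := (h.meas F m τ hF hm hτ).add (h'.meas F m τ hF hm hτ)

lemma sum {ι : Type*} (s : Finset ι) {c : ι → ℝ} {A : ι → ℝ → (ℂ → ℂ) → ℂ → ℂ}
    (h : ∀ i ∈ s, OneOp t ρ ε e e' (c i) (A i)) :
    OneOp t ρ ε e e' (∑ i ∈ s, c i) fun m f τ => ∑ i ∈ s, A i m f τ := by
  classical
  induction s using Finset.induction_on with
  | empty => simpa using ⟨le_rfl, by simp, by simp, by simp⟩
  | insert a s ha ih =>
    simp only [Finset.sum_insert ha]
    exact (h a (Finset.mem_insert_self a s)).add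
      (ih fun i hi => h i (Finset.mem_insert_of_mem hi))

/-- Composition with multiplication by a function `g` of `(m, τ)`, acting last. -/
lemma mul_left (h : OneOp t ρ ε e e' c A) {g : ℝ → ℂ → ℂ} (hg : Measurable fun p : ℝ × ℂ => g p.1 p.2)
    (hc' : 0 ≤ c') (hb : ∀ m, ∀ τ ∈ t.closedDom ρ, ‖g m τ‖ * (c * t.wt e' (τ / ε)) ≤ c' * t.wt e'' (τ / ε)) :
    OneOp t ρ ε e e'' c' fun m f τ => g m τ * A m f τ where
  nonneg := hc'
  zero m τ := by rw [h.zero, mul_zero]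
  lip {m _ _ _ L} hf hf' hL hd τ hτ := by
    rw [← mul_sub, norm_mul]
    calc _ ≤ ‖g m τ‖ * (c * L * t.wt e' (τ / ε)) := by gcongr; exact h.lip hf hf' hL hd τ hτ
      _ = L * (‖g m τ‖ * (c * t.wt e' (τ / ε))) := by ring
      _ ≤ L * (c' * t.wt e'' (τ / ε)) := mul_le_l (hb m τ hτ) hL
      _ = _ := by ring
  meas F m τ hF hm hτ := (hg.comp (hm.prodMk hτ)).mul (h.meas F m τ hF hm hτ)

lemma comp (h : OneOp t ρ ε e e' c A) (h' : OneOp t ρ ε e' e'' c' A') :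
    OneOp t ρ ε e e'' (c' * c) fun m f => A' m (A m f) where
  nonneg := mul_nonneg h'.nonneg h.nonneg
  zero m τ := by rw [show A m (fun _ => 0) = fun _ => 0 from funext (h.zero m), h'.zero]
  lip hf hg hL hd τ hτ := (h'.lip (h.bd hf) (h.bd hg) (mul_nonneg h.nonneg hL)
    (h.lip hf hg hL hd) τ hτ).trans_eq (by ring)
  meas F m τ hF hm hτ := h'.meas (fun a => A (m a) (F a)) m τ (h.meas (fun p : _ × ℂ => F p.1)
    (fun p => m p.1) (fun p => p.2) (hF.comp (f := fun p : (_ × ℂ) × ℂ => (p.1.1, p.2))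
      fp!) fp! fp!) hm hτ

end OneOp

lemma TimeData.mulB_sub (t : TimeData) (hk : 1 ≤ t.k) (hν : 0 < t.ν) (hε : ε ≠ 0) (hn : 1 ≤ n)
    (he : 0 < e) {f g : ℂ → ℂ} (hf : t.Bd ρ ε e K f) (hg : t.Bd ρ ε e K' g)
    (hτ : τ ∈ t.closedDom ρ) :
    mulB t.k n (fun σ => f σ - g σ) τ = mulB t.k n f τ - mulB t.k n g τ := by
  have hn' : (0 : ℝ) < n := mod_cast hn
  obtain ⟨C, hC, hmono⟩ := t.exists_monomial_le hk hν n hn'.le le_rfl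
  have hint : ∀ {K} {f : ℂ → ℂ}, t.Bd ρ ε e K f →
      IntegrableOn (fun x : ℝ => (fun x y => x ^ n / ((Gamma ((n : ℝ) / t.k) : ℝ) : ℂ) * f y)
        (τ * rt(t.k, 1 - x))
        (τ * rt(t.k, x)) / (((1 - x) * x : ℝ) : ℂ)) (Ioo 0 1) := by
    intro K f hf
    have := hf.meas
    have := hf.nonneg
    refine t.integrableOn_convB hk hn' he (ε := ε) (K := C * ‖ε‖ ^ n * K)
      (B := fun x y => x ^ n / ((Gamma ((n : ℝ) / t.k) : ℝ) : ℂ) * f y)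
      pos! fp! fun x hx => ?_
    rw [norm_mul]
    have h4 := t.wt_nonneg n (τ * rt(t.k, 1 - x) / ε)
    exact (mul_le_mul (hmono ε _ hε) (hf.le _ (t.root_mem_closedDom hτ hx)) (norm_nonneg _)
      pos!).trans_eq (by ring)
  rw [mulB_eq_convB hk, mulB_eq_convB hk, mulB_eq_convB hk, convB_eq_setIntegral,
    convB_eq_setIntegral, convB_eq_setIntegral, ← integral_sub (hint hf) (hint hg)]
  congr 1
  funext x
  ring

/-- The operator `mulB k n` raises the weight by any `e ∈ (0, n]`, with a factor `|ε| ^ n`. -/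
lemma TimeData.exists_oneOp_mulB (t : TimeData) (hk : 1 ≤ t.k) (hν : 0 < t.ν) (ρ : ℝ) (n : ℕ) (he : 0 < e) (hen : e ≤ n) (he' : 0 < e') :
    ∃ C : ℝ, 0 ≤ C ∧ ∀ ε : ℂ, ε ≠ 0 →
      OneOp t ρ ε e' (e' + e) (C * ‖ε‖ ^ n) fun _ => mulB t.k n := by
  obtain ⟨C, hC, h⟩ := t.exists_norm_mulB_le hk hν n he hen he'
  refine ⟨C, hC, fun ε hε => ⟨by positivity, fun m τ => by simp [mulB], fun {_ f g K L} hf hg hL hd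
    τ hτ => ?_, fun F m τ hF _ hτ => measurable_mulB hk n hF hτ⟩⟩
  rw [← t.mulB_sub hk hν hε (mod_cast he.trans_le hen) he' hf hg hτ]
  exact h ε τ _ L hε hL fun x hx => hd _ (t.root_mem_closedDom hτ hx)

lemma mulB_const_mul (hk : 1 ≤ k) (n : ℕ) (c : ℂ) (f : ℂ → ℂ) (τ : ℂ) :
    mulB k n (fun σ => c * f σ) τ = c * mulB k n f τ := by
  rw [mulB_eq_convB hk, mulB_eq_convB hk, ← convB_const_mul]
  congr 1
  funext x y
  ring

/-- Multiplication by `(k τ ^ k) ^ p`, the counterpart of `(T ^ {k+1} ∂_T) ^ p`. -/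
lemma TimeData.oneOp_pow (t : TimeData) (ρ : ℝ) (hε : ε ≠ 0) (he : 0 ≤ e) (p : ℕ) :
    OneOp t ρ ε e (e + (t.k * p : ℕ)) ((t.k : ℝ) ^ p * ‖ε‖ ^ (t.k * p))
      fun _ f τ => ((t.k : ℂ) * τ ^ t.k) ^ p * f τ := by
  refine (OneOp.id t ρ ε e).mul_left (g := fun _ τ => ((t.k : ℂ) * τ ^ t.k) ^ p) fp!
    pos! fun m τ hτ => le_of_eq ?_
  have : ‖τ‖ = ‖ε‖ * ‖τ / ε‖ := by
    have := norm_pos_iff.2 hε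
    rw [norm_div]; field_simp
  rw [← t.wt_mul_pow he, norm_pow, norm_mul, norm_pow, Complex.norm_natCast, this, mul_pow, mul_pow,
    mul_pow, ← pow_mul, ← pow_mul]
  ring

/-- The terms of lower order of `derivB`. -/
def lowB (k δ : ℕ) (f : ℂ → ℂ) (τ : ℂ) : ℂ :=
  ∑ p ∈ Finset.Icc 1 (δ - 1),
    (coefA k δ p : ℂ) * mulB k (k * (δ - p)) (fun σ => (k * σ ^ k) ^ p * f σ) τ

lemma derivB_eq (k δ : ℕ) (f : ℂ → ℂ) (τ : ℂ) :
    derivB k δ f τ = (k * τ ^ k) ^ δ * f τ + lowB k δ f τ := rfl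

/-- The terms of lower order of `derivB`, with a gain `1 - g ∈ [0, 1)` in the weight. -/
lemma TimeData.exists_oneOp_lowB (t : TimeData) (hk : 1 ≤ t.k) (hν : 0 < t.ν) (ρ : ℝ) (δ : ℕ)
    {g : ℝ} (hg : 0 ≤ g) (hg1 : g < 1) :
    ∃ C : ℝ, 0 ≤ C ∧ ∀ ε : ℂ, ε ≠ 0 →
      OneOp t ρ ε 1 (1 + (t.k * δ : ℕ) - g) (C * ‖ε‖ ^ (t.k * δ)) fun _ => lowB t.k δ := by
  have hb : ∀ p ∈ Finset.Icc 1 (δ - 1), ∃ C : ℝ, 0 ≤ C ∧ ∀ ε : ℂ, ε ≠ 0 →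
      OneOp t ρ ε 1 (1 + (t.k * δ : ℕ) - g) (C * ‖ε‖ ^ (t.k * δ)) fun _ f τ =>
        (coefA t.k δ p : ℂ) * mulB t.k (t.k * (δ - p)) (fun σ => (t.k * σ ^ t.k) ^ p * f σ) τ := by
    intro p hp
    rw [Finset.mem_Icc] at hp
    have hn : 1 ≤ t.k * (δ - p) := Nat.mul_pos hk (by omega)
    have hn' : (1 : ℝ) ≤ (t.k * (δ - p) : ℕ) := mod_cast hn
    have hadd : t.k * (δ - p) + t.k * p = t.k * δ := by
      rw [← Nat.mul_add, Nat.sub_add_cancel (by omega)]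
    obtain ⟨C, hC, h⟩ := t.exists_oneOp_mulB hk hν ρ (t.k * (δ - p))
      (e := (t.k * (δ - p) : ℕ) - g) (e' := 1 + (t.k * p : ℕ)) (by linarith) (by linarith) pos!
    refine ⟨‖(coefA t.k δ p : ℂ)‖ * (C * (t.k : ℝ) ^ p), by positivity, fun ε hε => ?_⟩
    have h1 := ((t.oneOp_pow ρ hε zero_le_one p).comp (h ε hε)).mul_left
      (g := fun _ _ => (coefA t.k δ p : ℂ)) (e'' := 1 + (t.k * δ : ℕ) - g)
      (c' := ‖(coefA t.k δ p : ℂ)‖ * (C * (t.k : ℝ) ^ p) * ‖ε‖ ^ (t.k * δ))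
      measurable_const pos! fun m τ _ => le_of_eq ?_
    · exact h1
    · have he : (1 + ((t.k * p : ℕ) : ℝ) + (((t.k * (δ - p) : ℕ) : ℝ) - g)) = 1 + (t.k * δ : ℕ) - g := by
        rw [← hadd]; push_cast; ring
      rw [he, ← hadd, pow_add]; ring
  choose! C hC h using hb
  refine ⟨∑ p ∈ Finset.Icc 1 (δ - 1), C p, sum_nonneg hC, fun ε hε => ?_⟩
  rw [sum_mul]
  exact OneOp.sum _ fun p hp => h p hp ε hε

lemma TimeData.exists_oneOp_derivB (t : TimeData) (hk : 1 ≤ t.k) (hν : 0 < t.ν) (ρ : ℝ) (δ : ℕ) :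
    ∃ C : ℝ, 0 ≤ C ∧ ∀ ε : ℂ, ε ≠ 0 →
      OneOp t ρ ε 1 (1 + (t.k * δ : ℕ)) (C * ‖ε‖ ^ (t.k * δ)) fun _ => derivB t.k δ := by
  obtain ⟨C, hC, h⟩ := t.exists_oneOp_lowB hk hν ρ δ le_rfl zero_lt_one
  refine ⟨(t.k : ℝ) ^ δ + C, by positivity, fun ε hε => ?_⟩
  have h1 := h ε hε
  rw [sub_zero] at h1
  rw [add_mul]
  exact (t.oneOp_pow ρ hε zero_le_one δ).add h1

lemma lowB_const_mul (hk : 1 ≤ k) (δ : ℕ) (c : ℂ) (f : ℂ → ℂ) (τ : ℂ) :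
    lowB k δ (fun σ => c * f σ) τ = c * lowB k δ f τ := by
  unfold lowB
  rw [mul_sum]
  refine sum_congr rfl fun p _ => ?_
  have h : (fun σ : ℂ => ((k : ℂ) * σ ^ k) ^ p * (c * f σ)) =
      fun σ => c * (((k : ℂ) * σ ^ k) ^ p * f σ) := by funext σ; ring
  rw [h, mulB_const_mul hk]
  ring

/-- The operator `1 - (τ ^ k P_m)⁻¹ opB`. -/
def TimeData.kop (t : TimeData) (m : ℝ) (f : ℂ → ℂ) (τ : ℂ) : ℂ :=
  t.RD.eval (I * m) / (τ ^ t.k * t.Pm m τ) * lowB t.k (t.δ t.D) f τ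

lemma TimeData.kop_const_mul (t : TimeData) (hk : 1 ≤ t.k) (m : ℝ) (c : ℂ) (f : ℂ → ℂ) (τ : ℂ) :
    t.kop m (fun σ => c * f σ) τ = c * t.kop m f τ := by
  rw [TimeData.kop, lowB_const_mul hk, TimeData.kop]; ring

lemma TimeData.kop_sub (t : TimeData) (hk : 1 ≤ t.k) (hν : 0 < t.ν) (hε : ε ≠ 0) (m : ℝ)
    {f g : ℂ → ℂ} (hf : t.Bd ρ ε 1 K f) (hg : t.Bd ρ ε 1 K' g) (hτ : τ ∈ t.closedDom ρ) :
    t.kop m (fun σ => f σ - g σ) τ = t.kop m f τ - t.kop m g τ := by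
  rw [kop, kop, kop, ← mul_sub, lowB, lowB, lowB, ← Finset.sum_sub_distrib]
  refine congrArg _ (sum_congr rfl fun p hp => ?_)
  have h := t.oneOp_pow ρ hε zero_le_one p
  rw [Finset.mem_Icc] at hp
  rw [← mul_sub, ← t.mulB_sub hk hν hε (Nat.mul_pos hk (by omega)) pos!
    (h.bd (m := m) hf) (h.bd (m := m) hg) hτ]
  simp only [mul_sub]

lemma TimeData.opB_eq (t : TimeData) (ht : t.Admissible) {m : ℝ} (f : ℂ → ℂ) (hτ : τ ≠ 0)
    (hP : t.Pm m τ ≠ 0) : t.opB m f τ = τ ^ t.k * t.Pm m τ * (f τ - t.kop m f τ) := by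
  obtain ⟨d, hd⟩ : ∃ d, t.δ t.D = d + 1 := ⟨t.δ t.D - 1, by have := ht.one_lt_δ; omega⟩
  have h1 : τ ^ t.k ≠ 0 := pow_ne_zero _ hτ
  have h2 : t.kop m f τ * (τ ^ t.k * t.Pm m τ) = t.RD.eval (I * m) * lowB t.k (t.δ t.D) f τ := by
    rw [TimeData.kop]; field_simp
  have h3 : ((t.k : ℂ) * τ ^ t.k) ^ t.δ t.D =
      (t.k : ℂ) ^ t.δ t.D * (τ ^ t.k * τ ^ ((t.δ t.D - 1) * t.k)) := by
    rw [mul_pow, ← pow_mul, ← pow_add, hd]; congr 2; simp; ring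
  rw [mul_sub, mul_comm _ (t.kop m f τ), h2, TimeData.opB, derivB_eq, h3, TimeData.Pm]
  ring

/-- Division by `τ ^ k P_m(τ)` lowers the weight by `k + g`, where `0 ≤ g ≤ deg P_m`, at the price
of a factor `|ε| ^ (-(k + g))`. -/
lemma TimeData.exists_wt_le_mul_Pm (t : TimeData) (ht : t.Admissible)
    (hroots : t.RootsApart ρ) : ∃ C : ℝ, 0 < C ∧ ∀ (g : ℝ), 0 ≤ g → g ≤ ((t.δ t.D - 1) * t.k : ℕ) →
      ∀ (m : ℝ) (ε : ℂ), ε ≠ 0 → ∀ τ ∈ t.closedDom ρ,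
      ‖t.RD.eval (I * m)‖ * t.wt (1 + t.k + g) (τ / ε) ≤
        C * ‖ε‖ ^ (-(t.k + g)) * ‖τ ^ t.k * t.Pm m τ‖ * t.wt 1 (τ / ε) := by
  obtain ⟨c, hc, h⟩ := t.exists_norm_Pm_ge ht hroots
  refine ⟨c⁻¹, by positivity, fun g hg hgN m ε hε τ hτ => ?_⟩
  have hε0 := norm_pos_iff.2 hε
  have h0 := norm_nonneg τ
  have h1 := h m τ hτ
  have hz : ‖τ / ε‖ = ‖τ‖ * ‖ε‖⁻¹ := by rw [norm_div]; rfl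
  have e1 : t.wt (1 + t.k + g) (τ / ε) =
      ‖τ‖ ^ t.k * ‖τ‖ ^ g * ‖ε‖ ^ (-(t.k + g)) * t.wt 1 (τ / ε) := by
    rw [← t.wt_mul_rpow pos! hg, ← t.wt_mul_pow zero_le_one, hz,
      mul_rpow h0 pos!, mul_pow, Real.inv_rpow hε0.le, neg_add,
      rpow_add hε0, rpow_neg hε0.le, rpow_neg hε0.le, rpow_natCast, inv_pow]
    ring
  have e2 : ‖τ‖ ^ g ≤ (1 + ‖τ‖) ^ ((t.δ t.D - 1) * t.k) := by
    calc ‖τ‖ ^ g ≤ (1 + ‖τ‖) ^ g := rpow_le_rpow h0 (by linarith) hg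
      _ ≤ (1 + ‖τ‖) ^ (((t.δ t.D - 1) * t.k : ℕ) : ℝ) :=
        rpow_le_rpow_of_exponent_le (by linarith) hgN
      _ = _ := rpow_natCast _ _
  have hw := t.wt_nonneg 1 (τ / ε)
  rw [e1, norm_mul, norm_pow]
  calc _ = ‖τ‖ ^ t.k * ‖ε‖ ^ (-(t.k + g)) * t.wt 1 (τ / ε) * c⁻¹ *
        (c * ‖t.RD.eval (I * m)‖ * ‖τ‖ ^ g) := by field_simp
    _ ≤ ‖τ‖ ^ t.k * ‖ε‖ ^ (-(t.k + g)) * t.wt 1 (τ / ε) * c⁻¹ * ‖t.Pm m τ‖ := by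
      gcongr
      refine le_trans ?_ h1
      gcongr
    _ = _ := by ring

lemma TimeData.Pm_ne_zero (t : TimeData) (hroots : t.RootsApart ρ)
    (m : ℝ) (hτ : τ ∈ t.closedDom ρ) : t.Pm m τ ≠ 0 := by
  obtain ⟨M, hM, h⟩ := hroots
  intro h0
  have := h m τ h0 τ hτ
  rw [sub_self, norm_zero] at this
  have h2 : 0 < M * (1 + ‖τ‖) := by positivity
  linarith

lemma TimeData.measurable_Pm (t : TimeData) : Measurable fun p : ℝ × ℂ => t.Pm p.1 p.2 := by
  unfold Pm
  have hA : Measurable fun x : ℂ => t.Q.eval x := t.Q.continuous.measurable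
  have hB : Measurable fun x : ℂ => t.RD.eval x := t.RD.continuous.measurable
  fun_prop

lemma TimeData.exists_oneOp_kop (t : TimeData) (ht : t.Admissible)
    (hroots : t.RootsApart ρ) : ∃ C : ℝ, 0 ≤ C ∧ ∀ ε : ℂ, ε ≠ 0 →
      OneOp t ρ ε 1 1 (C * ‖ε‖ ^ (1 / 2 : ℝ)) t.kop := by
  have hk := ht.one_le_k
  obtain ⟨C, hC, h⟩ := t.exists_oneOp_lowB hk ht.ν_pos ρ (t.δ t.D) (g := 1 / 2) (by norm_num)
    (by norm_num)
  obtain ⟨C', hC', h'⟩ := t.exists_wt_le_mul_Pm ht hroots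
  refine ⟨C * C', by positivity, fun ε hε => ?_⟩
  have hδ := ht.one_lt_δ
  have hA : Measurable fun x : ℂ => t.RD.eval x := t.RD.continuous.measurable
  have hP := t.measurable_Pm
  have hε0 := norm_pos_iff.2 hε
  refine (h ε hε).mul_left (g := fun m τ => t.RD.eval (I * m) / (τ ^ t.k * t.Pm m τ))
    fp! pos! fun m τ hτ => ?_
  have hNat : ((t.δ t.D - 1) * t.k : ℕ) + t.k = t.k * t.δ t.D := by
    rw [← Nat.succ_mul, Nat.succ_eq_add_one, Nat.sub_add_cancel (by omega), mul_comm]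
  have hR : (((t.δ t.D - 1) * t.k : ℕ) : ℝ) + t.k = (t.k * t.δ t.D : ℕ) := mod_cast hNat
  have hN1 : (1 : ℝ) ≤ ((t.δ t.D - 1) * t.k : ℕ) := by
    exact_mod_cast Nat.mul_pos (by omega : 0 < t.δ t.D - 1) hk
  have h1 := h' (((t.δ t.D - 1) * t.k : ℕ) - 1 / 2) (by linarith) (by linarith) m ε hε τ hτ
  have e1 : (1 + (t.k : ℝ) + ((((t.δ t.D - 1) * t.k : ℕ) : ℝ) - 1 / 2)) =
      1 + (t.k * t.δ t.D : ℕ) - 1 / 2 := by rw [← hR]; ring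
  rw [e1] at h1
  have e2 : ‖ε‖ ^ (t.k * t.δ t.D) * ‖ε‖ ^ (-((t.k : ℝ) + ((((t.δ t.D - 1) * t.k : ℕ) : ℝ) - 1 / 2))) =
      ‖ε‖ ^ (1 / 2 : ℝ) := by
    rw [← rpow_natCast, ← rpow_add hε0, ← hR]; congr 1; ring
  rcases eq_or_ne τ 0 with rfl | hτ0
  · have : (0 : ℂ) ^ t.k = 0 := zero_pow (by omega)
    rw [this]
    simp only [zero_mul, div_zero, norm_zero]
    have := t.wt_nonneg 1 (0 / ε)
    positivity
  have hM : 0 < ‖τ ^ t.k * t.Pm m τ‖ :=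
    norm_pos_iff.2 (mul_ne_zero (pow_ne_zero _ hτ0) (t.Pm_ne_zero hroots m hτ))
  rw [norm_div, div_mul_eq_mul_div, div_le_iff₀ hM]
  calc _ = C * ‖ε‖ ^ (t.k * t.δ t.D) * (‖t.RD.eval (I * m)‖ *
        t.wt (1 + (t.k * t.δ t.D : ℕ) - 1 / 2) (τ / ε)) := by ring
    _ ≤ C * ‖ε‖ ^ (t.k * t.δ t.D) * _ := mul_le_l h1
    _ = C * C' * (‖ε‖ ^ (t.k * t.δ t.D) * ‖ε‖ ^ (-((t.k : ℝ) + ((((t.δ t.D - 1) * t.k : ℕ) : ℝ) - 1 / 2))))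
        * t.wt 1 (τ / ε) * ‖τ ^ t.k * t.Pm m τ‖ := by ring
    _ = _ := by rw [e2]

/-! ### Operators in two Borel variables -/

/-- Joint measurability of a function of `(τ1, τ2, m)`. -/
def Meas3 (f : 𝔽) : Prop := Measurable fun p : ℂ × ℂ × ℝ => f p.1 p.2.1 p.2.2

lemma Meas3.comp (hf : Meas3 f) {α : Type*} [MeasurableSpace α] {a b : α → ℂ}
    {c : α → ℝ} (ha : Measurable a := by fun_prop) (hb : Measurable b := by fun_prop)
    (hc : Measurable c := by fun_prop) : Measurable fun x => f (a x) (b x) (c x) :=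
  Measurable.comp (g := fun p : ℂ × ℂ × ℝ => f p.1 p.2.1 p.2.2) hf (ha.prodMk (hb.prodMk hc))

/-- `|f| ≤ K W` on the closed domains. -/
def CauchyData.Bd (S : CauchyData) (ρ : ℝ) (W : ℂ → ℂ → ℝ → ℝ) (K : ℝ) (f : 𝔽) : Prop :=
  ∀ τ1 ∈ S.t₁.closedDom ρ, ∀ τ2 ∈ S.t₂.closedDom ρ, ∀ m : ℝ, ‖f τ1 τ2 m‖ ≤ K * W τ1 τ2 m

/-- The weight with exponents `e1`, `e2`, `s`. -/
def CauchyData.W (S : CauchyData) (β : ℝ) (ε : ℂ) (e1 e2 s : ℝ) : ℂ → ℂ → ℝ → ℝ :=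
  fun τ1 τ2 m => S.t₁.wt e1 (τ1 / ε) * S.t₂.wt e2 (τ2 / ε) * fw β s m

lemma CauchyData.W_nonneg (S : CauchyData) (β : ℝ) (ε : ℂ) (e1 e2 s : ℝ) (τ1 τ2 : ℂ) (m : ℝ) :
    0 ≤ S.W β ε e1 e2 s τ1 τ2 m :=
  mul_nonneg (mul_nonneg (TimeData.wt_nonneg _ _ _) (TimeData.wt_nonneg _ _ _)) (fw_pos _ _ _).le

/-- Measurable functions bounded by `K W` on the closed domains. -/
structure CauchyData.Ball (S : CauchyData) (ρ : ℝ) (W : ℂ → ℂ → ℝ → ℝ) (K : ℝ) (f : 𝔽) : Prop where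
  nonneg : 0 ≤ K
  meas : Meas3 f
  bd : S.Bd ρ W K f

/-- An operator on functions of `(τ1, τ2, m)` which vanishes at `0` and is Lipschitz, with constant
`c`, between the spaces with weights `W` and `W'`. -/
structure TwoOp (S : CauchyData) (ρ : ℝ) (W W' : ℂ → ℂ → ℝ → ℝ) (c : ℝ)
    (A : 𝔽 → 𝔽) : Prop where
  nonneg : 0 ≤ c
  zero : ∀ τ1 τ2 m, A (fun _ _ _ => 0) τ1 τ2 m = 0
  lip : ∀ {f g K L}, S.Ball ρ W K f → S.Ball ρ W K g → 0 ≤ L →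
    S.Bd ρ W L (fun τ1 τ2 m => f τ1 τ2 m - g τ1 τ2 m) →
    S.Bd ρ W' (c * L) fun τ1 τ2 m => A f τ1 τ2 m - A g τ1 τ2 m
  meas : ∀ f, Meas3 f → Meas3 (A f)

section
variable {W W' W'' : ℂ → ℂ → ℝ → ℝ} {A A' : 𝔽 → 𝔽}

lemma CauchyData.Ball.zero (h : S.Ball ρ W K f) : S.Ball ρ W K fun _ _ _ => 0 where
  nonneg := h.nonneg
  meas := measurable_const
  bd τ1 h1 τ2 h2 m := by simpa using (norm_nonneg _).trans (h.bd τ1 h1 τ2 h2 m)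

namespace TwoOp

lemma map (h : TwoOp S ρ W W' c A) (hf : S.Ball ρ W K f) : S.Ball ρ W' (c * K) (A f) where
  nonneg := mul_nonneg h.nonneg hf.nonneg
  meas := h.meas f hf.meas
  bd := by simpa [h.zero] using h.lip hf hf.zero hf.nonneg (by simpa using hf.bd)

lemma mono (h : TwoOp S ρ W W' c A) (hc : c ≤ c') (hW : ∀ τ1 τ2 m, 0 ≤ W' τ1 τ2 m) :
    TwoOp S ρ W W' c' A where
  nonneg := h.nonneg.trans hc
  zero := h.zero
  lip hf hg hL hd τ1 h1 τ2 h2 m := (h.lip hf hg hL hd τ1 h1 τ2 h2 m).trans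
    (mul_le_r (mul_le_r hc hL) (hW τ1 τ2 m))
  meas := h.meas

lemma add (h : TwoOp S ρ W W' c A) (h' : TwoOp S ρ W W' c' A') :
    TwoOp S ρ W W' (c + c') fun f τ1 τ2 m => A f τ1 τ2 m + A' f τ1 τ2 m where
  nonneg := add_nonneg h.nonneg h'.nonneg
  zero τ1 τ2 m := by rw [h.zero, h'.zero, add_zero]
  lip hf hg hL hd τ1 h1 τ2 h2 m := by
    beta_reduce
    rw [add_sub_add_comm, add_mul, add_mul]
    exact norm_add_le_of_le (h.lip hf hg hL hd τ1 h1 τ2 h2 m) (h'.lip hf hg hL hd τ1 h1 τ2 h2 m)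
  meas f hf := (h.meas f hf).add (h'.meas f hf)

lemma sum {ι : Type*} (s : Finset ι) {c : ι → ℝ} {A : ι → 𝔽 → 𝔽}
    (h : ∀ i ∈ s, TwoOp S ρ W W' (c i) (A i)) :
    TwoOp S ρ W W' (∑ i ∈ s, c i) fun f τ1 τ2 m => ∑ i ∈ s, A i f τ1 τ2 m := by
  classical
  induction s using Finset.induction_on with
  | empty => exact ⟨le_rfl, by simp, fun _ _ _ _ τ1 _ τ2 _ m => by simp, fun _ _ => measurable_const⟩
  | insert a s ha ih =>
    simp only [Finset.sum_insert ha]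
    exact (h a (Finset.mem_insert_self a s)).add
      (ih fun i hi => h i (Finset.mem_insert_of_mem hi))

lemma mul_left (h : TwoOp S ρ W W' c A) (hg : Meas3 g) (hc' : 0 ≤ c')
    (hb : ∀ τ1 ∈ S.t₁.closedDom ρ, ∀ τ2 ∈ S.t₂.closedDom ρ, ∀ m : ℝ,
      ‖g τ1 τ2 m‖ * (c * W' τ1 τ2 m) ≤ c' * W'' τ1 τ2 m) :
    TwoOp S ρ W W'' c' fun f τ1 τ2 m => g τ1 τ2 m * A f τ1 τ2 m where
  nonneg := hc'
  zero τ1 τ2 m := by rw [h.zero, mul_zero]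
  lip {_ _ _ L} hf hf' hL hd τ1 h1 τ2 h2 m := by
    beta_reduce
    rw [← mul_sub, norm_mul]
    calc _ ≤ ‖g τ1 τ2 m‖ * (c * L * W' τ1 τ2 m) :=
          mul_le_l (h.lip hf hf' hL hd τ1 h1 τ2 h2 m) (norm_nonneg _)
      _ = L * (‖g τ1 τ2 m‖ * (c * W' τ1 τ2 m)) := by ring
      _ ≤ L * (c' * W'' τ1 τ2 m) := mul_le_l (hb τ1 h1 τ2 h2 m) hL
      _ = _ := by ring
  meas f hf := hg.mul (h.meas f hf)

lemma comp (h : TwoOp S ρ W W' c A) (h' : TwoOp S ρ W' W'' c' A') :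
    TwoOp S ρ W W'' (c' * c) fun f => A' (A f) where
  nonneg := mul_nonneg h'.nonneg h.nonneg
  zero τ1 τ2 m := by
    rw [show A (fun _ _ _ => 0) = fun _ _ _ => 0 by funext x y m; exact h.zero x y m, h'.zero]
  lip hf hg hL hd := by
    rw [mul_assoc]
    exact h'.lip (h.map hf) (h.map hg) (mul_nonneg h.nonneg hL) (h.lip hf hg hL hd)
  meas f hf := h'.meas _ (h.meas f hf)

end TwoOp

end

/-- The composition of an operator in `τ1` with one in `τ2`. -/
def prodOp (A1 A2 : ℝ → (ℂ → ℂ) → ℂ → ℂ) (f : 𝔽) (τ1 τ2 : ℂ) (m : ℝ) : ℂ :=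
  A1 m (fun σ1 => A2 m (fun σ2 => f σ1 σ2 m) τ2) τ1

section
variable {e1 e2 e1' e2' : ℝ} {A1 A2 : ℝ → (ℂ → ℂ) → ℂ → ℂ}

lemma CauchyData.Ball.slice (hf : S.Ball ρ (S.W β ε e1 e2 s) K f) (h1 : τ1 ∈ S.t₁.closedDom ρ)
    (m : ℝ) : S.t₂.Bd ρ ε e2 (K * (S.t₁.wt e1 (τ1 / ε) * fw β s m)) fun τ2 => f τ1 τ2 m where
  nonneg := mul_nonneg hf.nonneg (mul_nonneg (S.t₁.wt_nonneg _ _) (fw_pos β s m).le)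
  meas := hf.meas.comp
  le τ2 h2 := (hf.bd τ1 h1 τ2 h2 m).trans_eq (by unfold W; ring)

lemma OneOp.bd_slice (h : OneOp S.t₂ ρ ε e2 e2' c A2) (hf : S.Ball ρ (S.W β ε e1 e2 s) K f)
    (h2 : τ2 ∈ S.t₂.closedDom ρ) (m : ℝ) :
    S.t₁.Bd ρ ε e1 (c * K * (S.t₂.wt e2' (τ2 / ε) * fw β s m)) fun τ1 => A2 m (f τ1 · m) τ2 where
  nonneg := mul_nonneg (mul_nonneg h.nonneg hf.nonneg)
    (mul_nonneg (S.t₂.wt_nonneg _ _) (fw_pos β s m).le)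
  meas := h.meas (fun σ1 σ2 => f σ1 σ2 m) (fun _ => m) (fun _ => τ2) hf.meas.comp fp!
    fp!
  le τ1 h1 := ((h.bd (hf.slice h1 m)).le τ2 h2).trans_eq (by ring)

lemma TwoOp.prodOp (h1 : OneOp S.t₁ ρ ε e1 e1' c1 A1) (h2 : OneOp S.t₂ ρ ε e2 e2' c2 A2) (s : ℝ) :
    TwoOp S ρ (S.W β ε e1 e2 s) (S.W β ε e1' e2' s) (c1 * c2) (prodOp A1 A2) where
  nonneg := mul_nonneg h1.nonneg h2.nonneg
  zero τ1 τ2 m := by simp only [TwoTime.prodOp, h2.zero, h1.zero]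
  lip {f g K L} hf hg hL hd τ1 hτ1 τ2 hτ2 m := by
    have hw := (fw_pos β s m).le
    have w1 := S.t₁.wt_nonneg e1
    have w2 := S.t₂.wt_nonneg e2' (τ2 / ε)
    have hc := h2.nonneg
    refine (h1.lip (h2.bd_slice hf hτ2 m) (h2.bd_slice hg hτ2 m)
      (L := c2 * L * (S.t₂.wt e2' (τ2 / ε) * fw β s m)) pos! (fun σ1 hσ1 =>
      (h2.lip (hf.slice hσ1 m) (hg.slice hσ1 m) (L := L * (S.t₁.wt e1 (σ1 / ε) * fw β s m))
        (mul_nonneg hL (mul_nonneg (w1 _) hw)) (fun σ2 hσ2 =>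
        (hd σ1 hσ1 σ2 hσ2 m).trans_eq (by unfold W; ring)) τ2 hτ2).trans_eq (by ring))
      τ1 hτ1).trans_eq (by unfold W; ring)
  meas f hf := h1.meas (fun p : ℂ × ℂ × ℝ => fun σ1 => A2 p.2.2 (fun σ2 => f σ1 σ2 p.2.2) p.2.1)
    (fun p => p.2.2) (fun p => p.1)
    (h2.meas (fun p : (ℂ × ℂ × ℝ) × ℂ => fun σ2 => f p.2 σ2 p.1.2.2) (fun p => p.1.2.2)
      (fun p => p.1.2.1) hf.comp fp! fp!) fp! fp!

end

/-! ### Products in the Borel plane -/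

/-- The product in one variable: the convolution `convB` if both factors depend on the variable,
the ordinary product if the first one does not. -/
def cvB (b : Bool) (k : ℕ) (B : ℂ → ℂ → ℂ) (τ : ℂ) : ℂ :=
  match b with
  | true => convB k B τ
  | false => B τ τ

/-- The weight of the first factor of `cvB`. -/
def TimeData.wtb (t : TimeData) (b : Bool) (z : ℂ) : ℝ :=
  match b with
  | true => t.wt 1 z
  | false => 1

lemma TimeData.wtb_nonneg (t : TimeData) (b : Bool) (z : ℂ) : 0 ≤ t.wtb b z := by
  cases b
  · exact zero_le_one
  · exact t.wt_nonneg 1 z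

/-- The exponent of the weight of a product `cvB`; half a power is given away in the convolution. -/
def cvExp (b : Bool) : ℝ :=
  match b with
  | true => 3 / 2
  | false => 1

/-- The norm of the product `cvB`. -/
def cvConst (k : ℕ) (b : Bool) : ℝ :=
  match b with
  | true => convConst k 1 1 (1 / 2)
  | false => 1

lemma cvConst_nonneg (k : ℕ) (b : Bool) : 0 ≤ cvConst k b := by
  cases b
  · exact zero_le_one
  · exact convConst_nonneg _ _ _ _

lemma measurable_cvB {α : Type*} [MeasurableSpace α] (b : Bool) (k : ℕ) {B : α → ℂ → ℂ → ℂ}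
    {τ : α → ℂ} (hB : Measurable fun p : α × ℂ × ℂ => B p.1 p.2.1 p.2.2) (hτ : Measurable τ) :
    Measurable fun a => cvB b k (B a) (τ a) := by
  cases b
  · exact hB.comp (g := fun p : α × ℂ × ℂ => B p.1 p.2.1 p.2.2) (f := fun a => (a, τ a, τ a))
      fp!
  · exact measurable_convB k hB hτ

section
variable {B B' : ℂ → ℂ → ℂ}

lemma cvB_zero (b : Bool) (k : ℕ) (τ : ℂ) : cvB b k (fun _ _ => 0) τ = 0 := by
  cases b <;> simp [cvB, convB]

lemma norm_cvB_sub_le (hk : 1 ≤ t.k) (b : Bool) {L : ℝ} (hK : 0 ≤ K) (hL : 0 ≤ L)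
    (hm : Measurable fun p : ℂ × ℂ => B p.1 p.2) (hm' : Measurable fun p : ℂ × ℂ => B' p.1 p.2)
    (h : ∀ x ∈ t.closedDom ρ, ∀ y ∈ t.closedDom ρ,
      ‖B x y‖ ≤ K * (t.wtb b (x / ε) * t.wt 1 (y / ε)))
    (h' : ∀ x ∈ t.closedDom ρ, ∀ y ∈ t.closedDom ρ,
      ‖B' x y‖ ≤ K * (t.wtb b (x / ε) * t.wt 1 (y / ε)))
    (hd : ∀ x ∈ t.closedDom ρ, ∀ y ∈ t.closedDom ρ,
      ‖B x y - B' x y‖ ≤ L * (t.wtb b (x / ε) * t.wt 1 (y / ε))) (hτ : τ ∈ t.closedDom ρ) :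
    ‖cvB b t.k B τ - cvB b t.k B' τ‖ ≤ cvConst t.k b * L * t.wt (cvExp b) (τ / ε) := by
  cases b
  · exact (hd τ hτ τ hτ).trans_eq (by simp [cvConst, cvExp, TimeData.wtb])
  · have hk' : (1 : ℝ) ≤ t.k := mod_cast hk
    have r1 {x : ℝ} (hx : x ∈ Ioo (0 : ℝ) 1) := t.root_mem_closedDom hτ (one_sub_mem_Ioo hx)
    have r2 {x : ℝ} (hx : x ∈ Ioo (0 : ℝ) 1) := t.root_mem_closedDom hτ hx
    have := t.norm_convB_le hk (e := 1) (e' := 1) (b := 1 / 2) (ε := ε) (τ := τ)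
      (B := fun x y => B x y - B' x y) (by norm_num) (by norm_num) (by norm_num) (by linarith) hL fun x hx => hd _ (r1 hx) _ (r2 hx)
    rw [show (1 : ℝ) + 1 - 1 / 2 = 3 / 2 by norm_num, convB_eq_setIntegral] at this
    simp only [sub_div] at this
    rwa [integral_sub
      (t.integrableOn_convB hk one_pos one_pos hK hm fun x hx => h _ (r1 hx) _ (r2 hx))
      (t.integrableOn_convB hk one_pos one_pos hK hm' fun x hx => h' _ (r1 hx) _ (r2 hx)),
      ← convB_eq_setIntegral, ← convB_eq_setIntegral] at this

end

/-- The product in both variables, for a function `Ψ x1 y1 x2 y2`. -/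
def cv2 (S : CauchyData) (b1 b2 : Bool) (Ψ : ℂ → ℂ → ℂ → ℂ → ℂ) (τ1 τ2 : ℂ) : ℂ :=
  cvB b1 S.t₁.k (fun x1 y1 => cvB b2 S.t₂.k (fun x2 y2 => Ψ x1 y1 x2 y2) τ2) τ1

/-- The bounds under which `cv2` makes sense. -/
def CauchyData.Bd4 (S : CauchyData) (ρ : ℝ) (ε : ℂ) (b1 b2 : Bool) (K : ℝ)
    (Ψ : ℂ → ℂ → ℂ → ℂ → ℂ) : Prop :=
  ∀ x1 ∈ S.t₁.closedDom ρ, ∀ y1 ∈ S.t₁.closedDom ρ, ∀ x2 ∈ S.t₂.closedDom ρ,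
    ∀ y2 ∈ S.t₂.closedDom ρ, ‖Ψ x1 y1 x2 y2‖ ≤
      K * ((S.t₁.wtb b1 (x1 / ε) * S.t₁.wt 1 (y1 / ε)) * (S.t₂.wtb b2 (x2 / ε) * S.t₂.wt 1 (y2 / ε)))

section
variable {Ψ Ψ' : ℂ → ℂ → ℂ → ℂ → ℂ}

lemma CauchyData.Bd4.inner {L : ℝ} (hk2 : 1 ≤ S.t₂.k) (hK : 0 ≤ K) (hL : 0 ≤ L)
    (hm : Measurable fun p : (ℂ × ℂ) × (ℂ × ℂ) => Ψ p.1.1 p.1.2 p.2.1 p.2.2)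
    (hm' : Measurable fun p : (ℂ × ℂ) × (ℂ × ℂ) => Ψ' p.1.1 p.1.2 p.2.1 p.2.2)
    (h : S.Bd4 ρ ε b1 b2 K Ψ) (h' : S.Bd4 ρ ε b1 b2 K Ψ')
    (hd : S.Bd4 ρ ε b1 b2 L fun x1 y1 x2 y2 => Ψ x1 y1 x2 y2 - Ψ' x1 y1 x2 y2)
    (h2 : τ2 ∈ S.t₂.closedDom ρ) : ∀ x1 ∈ S.t₁.closedDom ρ, ∀ y1 ∈ S.t₁.closedDom ρ,
      ‖cvB b2 S.t₂.k (fun x2 y2 => Ψ x1 y1 x2 y2) τ2 - cvB b2 S.t₂.k (fun x2 y2 => Ψ' x1 y1 x2 y2) τ2‖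
        ≤ (cvConst S.t₂.k b2 * L * S.t₂.wt (cvExp b2) (τ2 / ε)) *
          (S.t₁.wtb b1 (x1 / ε) * S.t₁.wt 1 (y1 / ε)) := by
  intro x1 hx1 y1 hy1
  have w1 := S.t₁.wtb_nonneg b1 (x1 / ε)
  have w2 := S.t₁.wt_nonneg 1 (y1 / ε)
  have e {K : ℝ} (x y : ℂ) : K * (S.t₁.wtb b1 (x1 / ε) * S.t₁.wt 1 (y1 / ε) *
    (S.t₂.wtb b2 (x / ε) * S.t₂.wt 1 (y / ε))) = K * (S.t₁.wtb b1 (x1 / ε) * S.t₁.wt 1 (y1 / ε)) *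
    (S.t₂.wtb b2 (x / ε) * S.t₂.wt 1 (y / ε)) := by ring
  exact (norm_cvB_sub_le hk2 b2 pos! pos!
    (hm.comp (f := fun p => ((x1, y1), p)) fp!)
    (hm'.comp (f := fun p => ((x1, y1), p)) fp!)
    (fun x2 hx2 y2 hy2 => (h x1 hx1 y1 hy1 x2 hx2 y2 hy2).trans_eq (e _ _))
    (fun x2 hx2 y2 hy2 => (h' x1 hx1 y1 hy1 x2 hx2 y2 hy2).trans_eq (e _ _))
    (fun x2 hx2 y2 hy2 => (hd x1 hx1 y1 hy1 x2 hx2 y2 hy2).trans_eq (e _ _)) h2).trans_eq (by ring)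

lemma norm_cv2_sub_le {L : ℝ} (hk1 : 1 ≤ S.t₁.k) (hk2 : 1 ≤ S.t₂.k) (hK : 0 ≤ K) (hL : 0 ≤ L)
    (hm : Measurable fun p : (ℂ × ℂ) × (ℂ × ℂ) => Ψ p.1.1 p.1.2 p.2.1 p.2.2)
    (hm' : Measurable fun p : (ℂ × ℂ) × (ℂ × ℂ) => Ψ' p.1.1 p.1.2 p.2.1 p.2.2)
    (h : S.Bd4 ρ ε b1 b2 K Ψ) (h' : S.Bd4 ρ ε b1 b2 K Ψ')
    (hd : S.Bd4 ρ ε b1 b2 L fun x1 y1 x2 y2 => Ψ x1 y1 x2 y2 - Ψ' x1 y1 x2 y2)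
    (h1 : τ1 ∈ S.t₁.closedDom ρ) (h2 : τ2 ∈ S.t₂.closedDom ρ) :
    ‖cv2 S b1 b2 Ψ τ1 τ2 - cv2 S b1 b2 Ψ' τ1 τ2‖ ≤ cvConst S.t₁.k b1 * cvConst S.t₂.k b2 * L *
      (S.t₁.wt (cvExp b1) (τ1 / ε) * S.t₂.wt (cvExp b2) (τ2 / ε)) := by
  have w1 := S.t₂.wt_nonneg (cvExp b2) (τ2 / ε)
  have w2 := cvConst_nonneg S.t₂.k b2
  have h0 : S.Bd4 ρ ε b1 b2 K fun _ _ _ _ => 0 := fun x1 a1 y1 a2 x2 a3 y2 a4 => by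
    simpa using (norm_nonneg _).trans (h x1 a1 y1 a2 x2 a3 y2 a4)
  exact (norm_cvB_sub_le hk1 b1 (K := cvConst S.t₂.k b2 * K * S.t₂.wt (cvExp b2) (τ2 / ε))
    pos! pos!
    (measurable_cvB b2 S.t₂.k (B := fun p : ℂ × ℂ => fun x2 y2 => Ψ p.1 p.2 x2 y2) hm measurable_const)
    (measurable_cvB b2 S.t₂.k (B := fun p : ℂ × ℂ => fun x2 y2 => Ψ' p.1 p.2 x2 y2) hm'
      measurable_const)
    (by simpa [cvB_zero] using h.inner hk2 hK hK hm measurable_const h0 (by simpa using h) h2)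
    (by simpa [cvB_zero] using h'.inner hk2 hK hK hm' measurable_const h0 (by simpa using h') h2)
    (h.inner hk2 hK hL hm hm' h' hd h2) h1).trans_eq (by ring)

end

/-- The product of `f` and `g` in the Borel plane: `cv2` in `(τ1, τ2)` and the Fourier
convolution in `m`. -/
def bil (S : CauchyData) (b1 b2 : Bool) (A B : ℂ[X]) (f g : 𝔽) (τ1 τ2 : ℂ)
    (m : ℝ) : ℂ :=
  cv2 S b1 b2 (fun x1 y1 x2 y2 => fourierConv A B (f x1 x2) (g y1 y2) m) τ1 τ2

/-- The weight for the first factor of `bil`. -/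
def CauchyData.Wb (S : CauchyData) (β : ℝ) (ε : ℂ) (b1 b2 : Bool) (s : ℝ) :
    ℂ → ℂ → ℝ → ℝ :=
  fun τ1 τ2 m => S.t₁.wtb b1 (τ1 / ε) * S.t₂.wtb b2 (τ2 / ε) * fw β s m

section
variable {C L L' : ℝ} {f' g' : 𝔽}

lemma meas_fourierConv_four (A B : ℂ[X]) (hf : Meas3 f) (hg : Meas3 g) {α : Type*}
    [MeasurableSpace α] {x1 y1 x2 y2 : α → ℂ} {m : α → ℝ} (h1 : Measurable x1 := by fun_prop)
    (h2 : Measurable y1 := by fun_prop) (h3 : Measurable x2 := by fun_prop)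
    (h4 : Measurable y2 := by fun_prop) (h5 : Measurable m := by fun_prop) :
    Measurable fun p => fourierConv A B (f (x1 p) (x2 p)) (g (y1 p) (y2 p)) (m p) :=
  measurable_fourierConv A B (f := fun p => f (x1 p) (x2 p)) (g := fun p => g (y1 p) (y2 p))
    hf.comp hg.comp h5

lemma meas3_bil (S : CauchyData) (b1 b2 : Bool) (A B : ℂ[X]) (hf : Meas3 f) (hg : Meas3 g) :
    Meas3 (bil S b1 b2 A B f g) := by
  refine measurable_cvB b1 S.t₁.k (α := ℂ × ℂ × ℝ) (B := fun p => fun x1 y1 => cvB b2 S.t₂.k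
    (fun x2 y2 => fourierConv A B (f x1 x2) (g y1 y2) p.2.2) p.2.1) (τ := fun p => p.1) ?_
    fp!
  refine measurable_cvB b2 S.t₂.k (α := (ℂ × ℂ × ℝ) × ℂ × ℂ) (B := fun q => fun x2 y2 =>
    fourierConv A B (f q.2.1 x2) (g q.2.2 y2) q.1.2.2) (τ := fun q => q.1.2.1) ?_ fp!
  exact meas_fourierConv_four A B hf hg

lemma ConvMaj.bd4_sub (h : ConvMaj β μ M C s a b)
    (hA : EvalLe A a) (hB : EvalLe B b)
    (hf : S.Ball ρ (S.Wb β ε b1 b2 (-μ)) Kf f) (hf' : S.Ball ρ (S.Wb β ε b1 b2 (-μ)) Kf f')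
    (hg : S.Ball ρ (S.W β ε 1 1 (-μ)) Kg g) (hg' : S.Ball ρ (S.W β ε 1 1 (-μ)) Kg g')
    (hd : S.Bd ρ (S.Wb β ε b1 b2 (-μ)) L fun τ1 τ2 m => f τ1 τ2 m - f' τ1 τ2 m)
    (hd' : S.Bd ρ (S.W β ε 1 1 (-μ)) L' fun τ1 τ2 m => g τ1 τ2 m - g' τ1 τ2 m) (m : ℝ) :
    S.Bd4 ρ ε b1 b2 (convMajConst C s * (Kf * L' + L * Kg) * fw β (M - μ) m) fun x1 y1 x2 y2 =>
      fourierConv A B (f x1 x2) (g y1 y2) m - fourierConv A B (f' x1 x2) (g' y1 y2) m := by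
  intro x1 a1 y1 c1 x2 a2 y2 c2
  have e {K : ℝ} (m : ℝ) : K * S.Wb β ε b1 b2 (-μ) x1 x2 m =
    K * (S.t₁.wtb b1 (x1 / ε) * S.t₂.wtb b2 (x2 / ε)) * fw β (-μ) m := by unfold Wb; ring
  have e' {K : ℝ} (m : ℝ) : K * S.W β ε 1 1 (-μ) y1 y2 m =
    K * (S.t₁.wt 1 (y1 / ε) * S.t₂.wt 1 (y2 / ε)) * fw β (-μ) m := by unfold W; ring
  exact (h.norm_fourierConv_sub_le hA hB hf.meas.comp hf'.meas.comp hg.meas.comp hg'.meas.comp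
    (fun m => (hf.bd x1 a1 x2 a2 m).trans_eq (e m)) (fun m => (hf'.bd x1 a1 x2 a2 m).trans_eq (e m))
    (fun m => (hg.bd y1 c1 y2 c2 m).trans_eq (e' m)) (fun m => (hg'.bd y1 c1 y2 c2 m).trans_eq (e' m))
    (fun m => (hd x1 a1 x2 a2 m).trans_eq (e m)) (fun m => (hd' y1 c1 y2 c2 m).trans_eq (e' m))
    m).trans_eq (by ring)

lemma bil_zero_left (τ1 τ2 : ℂ) (m : ℝ) : bil S b1 b2 A B (fun _ _ _ => 0) g τ1 τ2 m = 0 := by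
  simp [bil, cv2, fourierConv, cvB_zero]

lemma bil_zero_right (τ1 τ2 : ℂ) (m : ℝ) : bil S b1 b2 A B f (fun _ _ _ => 0) τ1 τ2 m = 0 := by
  simp [bil, cv2, fourierConv, cvB_zero]

/-- The product depends on both factors in a Lipschitz way. -/
lemma ConvMaj.bil_lip (h : ConvMaj β μ M C s a b)
    (hA : EvalLe A a) (hB : EvalLe B b)
    (hk1 : 1 ≤ S.t₁.k) (hk2 : 1 ≤ S.t₂.k)
    (hf : S.Ball ρ (S.Wb β ε b1 b2 (-μ)) Kf f) (hf' : S.Ball ρ (S.Wb β ε b1 b2 (-μ)) Kf f')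
    (hg : S.Ball ρ (S.W β ε 1 1 (-μ)) Kg g) (hg' : S.Ball ρ (S.W β ε 1 1 (-μ)) Kg g')
    (hL : 0 ≤ L) (hL' : 0 ≤ L')
    (hd : S.Bd ρ (S.Wb β ε b1 b2 (-μ)) L fun τ1 τ2 m => f τ1 τ2 m - f' τ1 τ2 m)
    (hd' : S.Bd ρ (S.W β ε 1 1 (-μ)) L' fun τ1 τ2 m => g τ1 τ2 m - g' τ1 τ2 m) :
    S.Bd ρ (S.W β ε (cvExp b1) (cvExp b2) (M - μ))
      (cvConst S.t₁.k b1 * cvConst S.t₂.k b2 * convMajConst C s * (Kf * L' + L * Kg))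
      fun τ1 τ2 m => bil S b1 b2 A B f g τ1 τ2 m - bil S b1 b2 A B f' g' τ1 τ2 m := by
  intro τ1 h1 τ2 h2 m
  have := (fw_pos β (M - μ) m).le
  have := h.const_nonneg
  have := hf.nonneg
  have := hg.nonneg
  have b0 {f g} (hf : S.Ball ρ (S.Wb β ε b1 b2 (-μ)) Kf f) (hg : S.Ball ρ (S.W β ε 1 1 (-μ)) Kg g) :=
    h.bd4_sub hA hB hf hf.zero hg hg (L := Kf) (L' := 0) (by simpa using hf.bd)
      (fun _ _ _ _ _ => by simp) m
  simp only [show ∀ g : ℝ → ℂ, fourierConv A B (fun _ => 0) g m = 0 by simp [fourierConv],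
    sub_zero] at b0
  exact (norm_cv2_sub_le hk1 hk2 pos! pos!
    (meas_fourierConv_four A B hf.meas hg.meas) (meas_fourierConv_four A B hf'.meas hg'.meas)
    (b0 hf hg) (b0 hf' hg') (h.bd4_sub hA hB hf hf' hg hg' hd hd' m) h1 h2).trans_eq
    (by unfold W; ring)

lemma ConvMaj.bil_bound (h : ConvMaj β μ M C s a b)
    (hA : EvalLe A a) (hB : EvalLe B b)
    (hk1 : 1 ≤ S.t₁.k) (hk2 : 1 ≤ S.t₂.k) (hf : S.Ball ρ (S.Wb β ε b1 b2 (-μ)) Kf f)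
    (hg : S.Ball ρ (S.W β ε 1 1 (-μ)) Kg g) :
    S.Ball ρ (S.W β ε (cvExp b1) (cvExp b2) (M - μ))
      (cvConst S.t₁.k b1 * cvConst S.t₂.k b2 * convMajConst C s * (Kf * Kg))
      (bil S b1 b2 A B f g) where
  nonneg := mul_nonneg (mul_nonneg (mul_nonneg (cvConst_nonneg _ _) (cvConst_nonneg _ _))
    h.const_nonneg) (mul_nonneg hf.nonneg hg.nonneg)
  meas := meas3_bil S b1 b2 A B hf.meas hg.meas
  bd := by
    simpa [bil_zero_left] using h.bil_lip hA hB hk1 hk2 hf hf.zero hg hg hf.nonneg le_rfl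
      (by simpa using hf.bd) (fun _ _ _ _ _ => by simp)

/-- The product with a fixed first factor is a bounded operator. -/
lemma ConvMaj.twoOp_bil (h : ConvMaj β μ M C s a b)
    (hA : EvalLe A a) (hB : EvalLe B b)
    (hk1 : 1 ≤ S.t₁.k) (hk2 : 1 ≤ S.t₂.k) (hf : S.Ball ρ (S.Wb β ε b1 b2 (-μ)) Kf f) :
    TwoOp S ρ (S.W β ε 1 1 (-μ)) (S.W β ε (cvExp b1) (cvExp b2) (M - μ))
      (cvConst S.t₁.k b1 * cvConst S.t₂.k b2 * convMajConst C s * Kf) (bil S b1 b2 A B f) where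
  nonneg := mul_nonneg (mul_nonneg (mul_nonneg (cvConst_nonneg _ _) (cvConst_nonneg _ _))
    h.const_nonneg) hf.nonneg
  zero := bil_zero_right
  lip hg hg' hL hd := by
    have := h.bil_lip hA hB hk1 hk2 hf hf hg hg' le_rfl hL (fun _ _ _ _ _ => by simp) hd
    rwa [zero_mul, add_zero, ← mul_assoc] at this
  meas g hg := meas3_bil S b1 b2 A B hf.meas hg

end

/-! ### The fixed point operator -/

/-- The standing assumptions on the data of the problem. -/
structure CauchyData.Setup (S : CauchyData) (ρ β μ r : ℝ) : Prop extends S.Admissible r μ where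
  hρ : 0 < ρ
  hβ : 0 < β
  hr : 0 < r
  roots1 : S.t₁.RootsApart ρ
  roots2 : S.t₂.RootsApart ρ

lemma TwoOp.id (S : CauchyData) (ρ : ℝ) (W : ℂ → ℂ → ℝ → ℝ) : TwoOp S ρ W W 1 fun f => f where
  nonneg := zero_le_one
  zero _ _ _ := rfl
  lip _ _ _ h := by rwa [one_mul]
  meas _ h := h

/-- The factor `τ ^ k P_m(τ)` of the counterpart of the singular operator. -/
def TimeData.den (t : TimeData) (m : ℝ) (τ : ℂ) : ℂ := τ ^ t.k * t.Pm m τ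

/-- Division by the product of the two factors `τ ^ k P_m(τ)`. -/
def CauchyData.divOp (S : CauchyData) (f : 𝔽) (τ1 τ2 : ℂ) (m : ℝ) : ℂ :=
  (S.t₁.den m τ1 * S.t₂.den m τ2)⁻¹ * f τ1 τ2 m

/-- `deg (R_{D1} R_{D2})`, the loss in the exponent of `1 + |m|` which the division makes up for. -/
def CauchyData.N (S : CauchyData) : ℕ := (S.t₁.RD * S.t₂.RD).natDegree

lemma CauchyData.exists_twoOp_div (S : CauchyData) (hS : S.Setup ρ β μ r) :
    ∃ C : ℝ, 0 ≤ C ∧ ∀ g1 g2 : ℝ, 0 ≤ g1 → g1 ≤ ((S.t₁.δ S.t₁.D - 1) * S.t₁.k : ℕ) →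
      0 ≤ g2 → g2 ≤ ((S.t₂.δ S.t₂.D - 1) * S.t₂.k : ℕ) → ∀ ε : ℂ, ε ≠ 0 →
      TwoOp S ρ (S.W β ε (1 + S.t₁.k + g1) (1 + S.t₂.k + g2) (S.N - μ)) (S.W β ε 1 1 (-μ))
        (C * ‖ε‖ ^ (-(S.t₁.k + g1)) * ‖ε‖ ^ (-(S.t₂.k + g2))) S.divOp := by
  obtain ⟨C1, hC1, h1⟩ := S.t₁.exists_wt_le_mul_Pm hS.time₁ hS.roots1
  obtain ⟨C2, hC2, h2⟩ := S.t₂.exists_wt_le_mul_Pm hS.time₂ hS.roots2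
  obtain ⟨c, hc, h⟩ := exists_norm_eval_ge (p := S.t₁.RD * S.t₂.RD) fun m => by
    rw [Polynomial.eval_mul]; exact mul_ne_zero (hS.time₁.RD_ne m) (hS.time₂.RD_ne m)
  refine ⟨C1 * C2 * c⁻¹, by positivity, fun g1 g2 hg1 hg1' hg2 hg2' ε hε => ?_⟩
  have hP1 := S.t₁.measurable_Pm
  have hP2 := S.t₂.measurable_Pm
  have hm1 : Measurable fun p : ℂ × ℂ × ℝ => S.t₁.Pm p.2.2 p.1 :=
    hP1.comp (g := fun p : ℝ × ℂ => S.t₁.Pm p.1 p.2) (f := fun p : ℂ × ℂ × ℝ => (p.2.2, p.1))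
      fp!
  have hm2 : Measurable fun p : ℂ × ℂ × ℝ => S.t₂.Pm p.2.2 p.2.1 :=
    hP2.comp (g := fun p : ℝ × ℂ => S.t₂.Pm p.1 p.2) (f := fun p : ℂ × ℂ × ℝ => (p.2.2, p.2.1))
      fp!
  have hε0 := norm_pos_iff.2 hε
  refine (TwoOp.id S ρ _).mul_left (g := fun τ1 τ2 m => (S.t₁.den m τ1 * S.t₂.den m τ2)⁻¹)
    ?_ pos! fun τ1 hτ1 τ2 hτ2 m => ?_
  · unfold Meas3 den
    fun_prop
  rcases eq_or_ne (S.t₁.den m τ1 * S.t₂.den m τ2) 0 with h0 | h0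
  · rw [h0, inv_zero, norm_zero, zero_mul]
    have := S.W_nonneg β ε 1 1 (-μ) τ1 τ2 m
    positivity
  have e1 := h1 g1 hg1 hg1' m ε hε τ1 hτ1
  have e2 := h2 g2 hg2 hg2' m ε hε τ2 hτ2
  have e3 := h m
  have hfw : fw β (S.N - μ) m = (1 + |m|) ^ S.N * fw β (-μ) m := by
    rw [fw_mul_pow, sub_eq_add_neg]
  have hw1 := S.t₁.wt_nonneg (1 + S.t₁.k + g1) (τ1 / ε)
  have hw2 := S.t₂.wt_nonneg (1 + S.t₂.k + g2) (τ2 / ε)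
  have hfw0 := (fw_pos β (-μ) m).le
  rw [norm_inv, inv_mul_le_iff₀ (norm_pos_iff.2 h0), one_mul, CauchyData.W, CauchyData.W, hfw]
  rw [Polynomial.eval_mul, norm_mul] at e3
  rw [norm_mul]
  have e4 := mul_le_mul e1 e2 (mul_nonneg (norm_nonneg _) hw2)
    ((mul_nonneg (norm_nonneg _) hw1).trans e1)
  calc _ = c⁻¹ * (c * (1 + |m|) ^ S.N) * (S.t₁.wt (1 + S.t₁.k + g1) (τ1 / ε) *
        S.t₂.wt (1 + S.t₂.k + g2) (τ2 / ε)) * fw β (-μ) m := by field_simp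
    _ ≤ c⁻¹ * (‖S.t₁.RD.eval (I * m)‖ * ‖S.t₂.RD.eval (I * m)‖) *
        (S.t₁.wt (1 + S.t₁.k + g1) (τ1 / ε) *
        S.t₂.wt (1 + S.t₂.k + g2) (τ2 / ε)) * fw β (-μ) m := by
      refine mul_le_r (mul_le_r
        (mul_le_l e3)) hfw0
    _ = c⁻¹ * (‖S.t₁.RD.eval (I * m)‖ * S.t₁.wt (1 + S.t₁.k + g1) (τ1 / ε) *
        (‖S.t₂.RD.eval (I * m)‖ *
        S.t₂.wt (1 + S.t₂.k + g2) (τ2 / ε))) * fw β (-μ) m := by ring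
    _ ≤ c⁻¹ * _ * fw β (-μ) m := mul_le_r
        (mul_le_l e4) hfw0
    _ = _ := by simp only [TimeData.den]; ring

/-- The operator `ε ^ (-2) (τ1 ^ k1 P_{m,1} τ2 ^ k2 P_{m,2})⁻¹ shiftB`, which acts on the terms of
the convolution equation without derivatives. -/
def CauchyData.nrm (S : CauchyData) (ε : ℂ) (f : 𝔽) : 𝔽 :=
  S.divOp fun τ1 τ2 m => ε ^ (-2 : ℤ) *
    prodOp (fun _ => mulB S.t₁.k (S.t₁.k + 1)) (fun _ => mulB S.t₂.k (S.t₂.k + 1)) f τ1 τ2 m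

lemma cvExp_mem (b : Bool) : 1 ≤ cvExp b ∧ cvExp b ≤ 3 / 2 := by
  cases b <;> norm_num [cvExp]

/-- The factors `ε ^ (-2)` and `|ε|^{k_j + 1}`, `|ε|^{-k_j}` of the three operators cancel. -/
lemma CauchyData.exists_twoOp_nrm (S : CauchyData) (hS : S.Setup ρ β μ r) :
    ∃ C : ℝ, 0 ≤ C ∧ ∀ (b1 b2 : Bool) (ε : ℂ), ε ≠ 0 →
      TwoOp S ρ (S.W β ε (cvExp b1) (cvExp b2) (S.N - μ)) (S.W β ε 1 1 (-μ)) C (S.nrm ε) := by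
  obtain ⟨C, hC, h⟩ := S.exists_twoOp_div (β := β) hS
  have one : ∀ t : TimeData, t.Admissible → ∀ b : Bool, ∃ C : ℝ, 0 ≤ C ∧ ∀ ε : ℂ, ε ≠ 0 →
      OneOp t ρ ε (cvExp b) (1 + t.k + 0) (C * ‖ε‖ ^ (t.k + 1)) fun _ => mulB t.k (t.k + 1) := by
    intro t ht b
    have hk : (1 : ℝ) ≤ t.k := mod_cast ht.one_le_k
    have hb := cvExp_mem b
    obtain ⟨C, hC, h⟩ := t.exists_oneOp_mulB ht.one_le_k ht.ν_pos ρ (t.k + 1) (e := 1 + t.k - cvExp b)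
      (e' := cvExp b) (by linarith) (by push_cast; linarith) (by linarith)
    refine ⟨C, hC, fun ε hε => ?_⟩
    have := h ε hε
    rwa [show cvExp b + (1 + t.k - cvExp b) = 1 + t.k + 0 by ring] at this
  choose C1 hC1 h1 using one S.t₁ hS.time₁
  choose C2 hC2 h2 using one S.t₂ hS.time₂
  refine ⟨C * ((C1 true + C1 false) * (C2 true + C2 false)),
    mul_nonneg hC (mul_nonneg (add_nonneg (hC1 _) (hC1 _)) (add_nonneg (hC2 _) (hC2 _))),
    fun b1 b2 ε hε => ?_⟩
  have hε0 := norm_pos_iff.2 hε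
  have hb1 : C1 b1 ≤ C1 true + C1 false := by
    have := hC1 true; have := hC1 false; cases b1 <;> linarith
  have hb2 : C2 b2 ≤ C2 true + C2 false := by
    have := hC2 true; have := hC2 false; cases b2 <;> linarith
  have p := TwoOp.prodOp (S := S) (β := β) (h1 b1 ε hε) (h2 b2 ε hε) (S.N - μ)
  have q := p.mul_left (g := fun _ _ _ => ε ^ (-2 : ℤ)) (W'' := S.W β ε (1 + S.t₁.k + 0) (1 + S.t₂.k + 0)
    (S.N - μ)) (c' := ‖ε‖ ^ (-2 : ℤ) * (C1 b1 * ‖ε‖ ^ (S.t₁.k + 1) * (C2 b2 * ‖ε‖ ^ (S.t₂.k + 1))))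
    measurable_const
    (mul_nonneg pos! p.nonneg) fun τ1 _ τ2 _ m => le_of_eq (by rw [norm_zpow]; ring)
  refine (q.comp (h 0 0 le_rfl pos! le_rfl pos! ε hε)).mono ?_
    (S.W_nonneg β ε _ _ _)
  have e1 : ∀ k : ℕ, ‖ε‖ ^ (-((k : ℝ) + 0)) * ‖ε‖ ^ (k + 1) = ‖ε‖ := by
    intro k
    rw [add_zero, rpow_neg hε0.le, rpow_natCast, pow_succ, ← mul_assoc,
      inv_mul_cancel₀ pos!, one_mul]
  calc _ = C * (C1 b1 * C2 b2) * (‖ε‖ ^ (-2 : ℤ) *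
        ((‖ε‖ ^ (-((S.t₁.k : ℝ) + 0)) * ‖ε‖ ^ (S.t₁.k + 1)) *
        (‖ε‖ ^ (-((S.t₂.k : ℝ) + 0)) * ‖ε‖ ^ (S.t₂.k + 1)))) := by ring
    _ = C * (C1 b1 * C2 b2) := by
      rw [e1, e1, zpow_neg, show ‖ε‖ ^ (2 : ℤ) = ‖ε‖ * ‖ε‖ by rw [zpow_ofNat, sq],
        inv_mul_cancel₀ pos!, mul_one]
    _ ≤ _ := by
      have := hC1 b1
      have := hC2 b2
      have := add_nonneg (hC1 true) (hC1 false)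
      gcongr

/-- The part of the fixed point operator that comes from the lower order terms on the left. -/
def CauchyData.leftOp (S : CauchyData) (f : 𝔽) (τ1 τ2 : ℂ) (m : ℝ) : ℂ :=
  prodOp S.t₁.kop (fun _ f => f) f τ1 τ2 m + (prodOp (fun _ f => f) S.t₂.kop f τ1 τ2 m
    + (-1) * prodOp S.t₁.kop S.t₂.kop f τ1 τ2 m)

lemma sqrt_norm_le_one (h0 : 0 ≤ x) (h1 : x ≤ 1) : x ^ (1 / 2 : ℝ) ≤ 1 :=
  rpow_le_one h0 h1 (by norm_num)

lemma CauchyData.exists_twoOp_leftOp (S : CauchyData) (hS : S.Setup ρ β μ r) :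
    ∃ C : ℝ, 0 ≤ C ∧ ∀ ε : ℂ, ε ≠ 0 → ‖ε‖ ≤ 1 →
      TwoOp S ρ (S.W β ε 1 1 (-μ)) (S.W β ε 1 1 (-μ)) (C * ‖ε‖ ^ (1 / 2 : ℝ)) S.leftOp := by
  obtain ⟨C1, hC1, h1⟩ := S.t₁.exists_oneOp_kop hS.time₁ hS.roots1
  obtain ⟨C2, hC2, h2⟩ := S.t₂.exists_oneOp_kop hS.time₂ hS.roots2
  refine ⟨C1 + (C2 + C1 * C2), by positivity, fun ε hε hε1 => ?_⟩
  have p := TwoOp.prodOp (S := S) (β := β) (h1 ε hε) (OneOp.id S.t₂ ρ ε 1) (-μ)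
  have q := TwoOp.prodOp (S := S) (β := β) (OneOp.id S.t₁ ρ ε 1) (h2 ε hε) (-μ)
  have s := (TwoOp.prodOp (S := S) (β := β) (h1 ε hε) (h2 ε hε) (-μ)).mul_left
    (g := fun _ _ _ => -1) (W'' := S.W β ε 1 1 (-μ)) (c' := C1 * C2 * ‖ε‖ ^ (1 / 2 : ℝ))
    (measurable_const (a := (-1 : ℂ)) : Measurable fun _ : ℂ × ℂ × ℝ => (-1 : ℂ)) pos! fun τ1 _ τ2 _ m => by
      rw [norm_neg, norm_one, one_mul]
      refine mul_le_r ?_ (S.W_nonneg β ε _ _ _ _ _ _)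
      calc _ = C1 * C2 * ‖ε‖ ^ (1 / 2 : ℝ) * ‖ε‖ ^ (1 / 2 : ℝ) := by ring
        _ ≤ _ := mul_le_of_le_one_right pos! (sqrt_norm_le_one (norm_nonneg _) hε1)
  exact (p.add (q.add s)).mono (le_of_eq (by ring)) (S.W_nonneg β ε _ _ _)

/-- The terms of the fixed point operator that come from the terms with derivatives on the right. -/
def CauchyData.rightOp (S : CauchyData) (ε : ℂ) (f : 𝔽) (τ1 τ2 : ℂ)
    (m : ℝ) : ℂ :=
  ∑ l1 ∈ Finset.Icc 1 (S.t₁.D - 1), ∑ l2 ∈ Finset.Icc 1 (S.t₂.D - 1),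
    S.divOp (fun τ1 τ2 m => (S.R l1 l2).eval (I * m) * ε ^ S.epsExp l1 l2 *
      prodOp (fun _ f => mulB S.t₁.k (S.t₁.dk l1) (derivB S.t₁.k (S.t₁.δ l1) f))
        (fun _ f => mulB S.t₂.k (S.t₂.dk l2) (derivB S.t₂.k (S.t₂.δ l2) f)) f τ1 τ2 m) τ1 τ2 m

lemma TimeData.Admissible.one_le_δ (ht : t.Admissible) (h1 : 1 ≤ l)
    (h2 : l ≤ t.D - 1) : 1 ≤ t.δ l := by
  induction l, h1 using Nat.le_induction with
  | base => exact ht.δ_one.ge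
  | succ l hl ih => have := ih (by omega); have := ht.δ_lt l hl (by omega); omega

/-- `dk` involves no truncated subtraction. -/
lemma TimeData.Admissible.dk_add (ht : t.Admissible) (h1 : 1 ≤ l)
    (h2 : l ≤ t.D - 1) : t.dk l + t.δ l * (t.k + 1) = t.d l + t.k + 1 ∧ 1 ≤ t.dk l := by
  have := ht.d_gt l h1 h2
  obtain ⟨d, hd⟩ : ∃ d, t.δ l = d + 1 := ⟨t.δ l - 1, by have := ht.one_le_δ h1 h2; omega⟩
  rw [hd, Nat.add_sub_cancel] at this
  have e : (d + 1) * (t.k + 1) = d * (t.k + 1) + (t.k + 1) := by ring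
  rw [TimeData.dk, hd, e]
  omega

lemma TimeData.Admissible.gap (ht : t.Admissible) (h1 : 1 ≤ l)
    (h2 : l ≤ t.D - 1) : (t.k : ℝ) * t.δ l + 2 ≤ t.k * t.δ t.D := by
  have hk : (0 : ℝ) < t.k := mod_cast ht.one_le_k
  have := mul_le_l (ht.δ_gap l h1 h2) hk.le
  rw [mul_add, mul_div_cancel₀ _ hk.ne'] at this
  exact this

lemma CauchyData.exists_twoOp_rightOp (S : CauchyData) (hS : S.Setup ρ β μ r) :
    ∃ C : ℝ, 0 ≤ C ∧ ∀ ε : ℂ, ε ≠ 0 → ‖ε‖ ≤ 1 →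
      TwoOp S ρ (S.W β ε 1 1 (-μ)) (S.W β ε 1 1 (-μ)) (C * ‖ε‖ ^ (1 / 2 : ℝ)) (S.rightOp ε) := by
  obtain ⟨C, hC, h⟩ := S.exists_twoOp_div (β := β) hS
  have one : ∀ t : TimeData, t.Admissible → ∀ l, 1 ≤ l → l ≤ t.D - 1 → ∃ C : ℝ, 0 ≤ C ∧
      ∀ ε : ℂ, ε ≠ 0 → OneOp t ρ ε 1 (1 + t.k + (t.k * t.δ l - t.k + 1 / 2))
        (C * ‖ε‖ ^ ((t.dk l : ℝ) + t.k * t.δ l))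
        fun _ f => mulB t.k (t.dk l) (derivB t.k (t.δ l) f) := by
    intro t ht l u1 u2
    have hdk := (ht.dk_add u1 u2).2
    obtain ⟨C, hC, h⟩ := t.exists_oneOp_mulB ht.one_le_k ht.ν_pos ρ (t.dk l) (e := 1 / 2)
      (e' := 1 + (t.k * t.δ l : ℕ)) (by norm_num) (by
        have : (1 : ℝ) ≤ t.dk l := mod_cast hdk
        linarith) pos!
    obtain ⟨C', hC', h'⟩ := t.exists_oneOp_derivB ht.one_le_k ht.ν_pos ρ (t.δ l)
    refine ⟨C * C', by positivity, fun ε hε => ?_⟩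
    have hε0 := norm_pos_iff.2 hε
    have := (h' ε hε).comp (h ε hε)
    rw [show (1 + ((t.k * t.δ l : ℕ) : ℝ) + 1 / 2) = 1 + t.k + (t.k * t.δ l - t.k + 1 / 2) by
      push_cast; ring] at this
    convert! this using 1
    rw [rpow_add hε0, rpow_natCast, ← Nat.cast_mul, rpow_natCast]
    ring
  have key : ∀ l1 ∈ Finset.Icc 1 (S.t₁.D - 1), ∀ l2 ∈ Finset.Icc 1 (S.t₂.D - 1), ∃ C : ℝ, 0 ≤ C ∧
      ∀ ε : ℂ, ε ≠ 0 → ‖ε‖ ≤ 1 →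
      TwoOp S ρ (S.W β ε 1 1 (-μ)) (S.W β ε 1 1 (-μ)) (C * ‖ε‖ ^ (1 / 2 : ℝ)) fun f =>
        S.divOp (fun τ1 τ2 m => (S.R l1 l2).eval (I * m) * ε ^ S.epsExp l1 l2 *
      prodOp (fun _ f => mulB S.t₁.k (S.t₁.dk l1) (derivB S.t₁.k (S.t₁.δ l1) f))
        (fun _ f => mulB S.t₂.k (S.t₂.dk l2) (derivB S.t₂.k (S.t₂.δ l2) f)) f τ1 τ2 m) := by
    intro l1 hl1 l2 hl2
    rw [Finset.mem_Icc] at hl1 hl2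
    obtain ⟨C1, hC1, h1⟩ := one S.t₁ hS.time₁ l1 hl1.1 hl1.2
    obtain ⟨C2, hC2, h2⟩ := one S.t₂ hS.time₂ l2 hl2.1 hl2.2
    obtain ⟨CR, hCR, hR⟩ := exists_norm_eval_le (hS.deg_R l1 l2 hl1.1 hl1.2 hl2.1 hl2.2)
    refine ⟨C * (CR * (C1 * C2)), by positivity, fun ε hε hε1 => ?_⟩
    have hε0 := norm_pos_iff.2 hε
    have hRm : Measurable fun x : ℂ => (S.R l1 l2).eval x := (S.R l1 l2).continuous.measurable
    have p := TwoOp.prodOp (S := S) (β := β) (h1 ε hε) (h2 ε hε) (-μ)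
    have q := p.mul_left (g := fun _ _ m => (S.R l1 l2).eval (I * m) * ε ^ S.epsExp l1 l2)
      (W'' := S.W β ε (1 + S.t₁.k + (S.t₁.k * S.t₁.δ l1 - S.t₁.k + 1 / 2))
        (1 + S.t₂.k + (S.t₂.k * S.t₂.δ l2 - S.t₂.k + 1 / 2)) (S.N - μ))
      (c' := CR * ‖ε‖ ^ S.epsExp l1 l2 * ((C1 * ‖ε‖ ^ ((S.t₁.dk l1 : ℝ) + S.t₁.k * S.t₁.δ l1)) *
        (C2 * ‖ε‖ ^ ((S.t₂.dk l2 : ℝ) + S.t₂.k * S.t₂.δ l2)))) (by unfold Meas3; fun_prop)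
      pos! fun τ1 _ τ2 _ m => by
        have hfw : fw β (S.N - μ) m = (1 + |m|) ^ S.N * fw β (-μ) m := by
          rw [fw_mul_pow, sub_eq_add_neg]
        rw [norm_mul, norm_zpow]
        unfold W
        rw [hfw]
        have w1 := S.t₁.wt_nonneg (1 + S.t₁.k + (S.t₁.k * S.t₁.δ l1 - S.t₁.k + 1 / 2)) (τ1 / ε)
        have w2 := S.t₂.wt_nonneg (1 + S.t₂.k + (S.t₂.k * S.t₂.δ l2 - S.t₂.k + 1 / 2)) (τ2 / ε)
        have w3 := (fw_pos β (-μ) m).le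
        have hR' : ‖(S.R l1 l2).eval (I * m)‖ ≤ CR * (1 + |m|) ^ S.N := hR m
        refine (mul_le_r (mul_le_r hR'
          (zpow_nonneg hε0.le _)) (mul_nonneg pos! pos!)).trans_eq (by ring)
    have hg : ∀ t : TimeData, t.Admissible → ∀ l, 1 ≤ l → l ≤ t.D - 1 →
        (0 : ℝ) ≤ t.k * t.δ l - t.k + 1 / 2 ∧
        (t.k * t.δ l - t.k + 1 / 2 : ℝ) ≤ ((t.δ t.D - 1) * t.k : ℕ) := by
      intro t ht l u1 u2
      have hδ : (1 : ℝ) ≤ t.δ l := mod_cast ht.one_le_δ u1 u2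
      have hk : (1 : ℝ) ≤ t.k := mod_cast ht.one_le_k
      have := ht.gap u1 u2
      have hD := ht.one_lt_δ
      rw [Nat.cast_mul, Nat.cast_sub hD.le]
      push_cast
      constructor <;> nlinarith
    obtain ⟨g1, g1'⟩ := hg S.t₁ hS.time₁ l1 hl1.1 hl1.2
    obtain ⟨g2, g2'⟩ := hg S.t₂ hS.time₂ l2 hl2.1 hl2.2
    refine (q.comp (h _ _ g1 g1' g2 g2' ε hε)).mono ?_ (S.W_nonneg β ε _ _ _)
    have hexp : (1 / 2 : ℝ) ≤ (S.t₁.dk l1 : ℝ) + S.t₂.dk l2 - 1 + S.epsExp l1 l2 := by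
      have a1 := (hS.time₁.dk_add hl1.1 hl1.2).1
      have a2 := (hS.time₂.dk_add hl2.1 hl2.2).1
      have b1 := hS.time₁.gap hl1.1 hl1.2
      have b2 := hS.time₂.gap hl2.1 hl2.2
      have hΔ := hS.Δ_ge l1 l2 hl1.1 hl1.2 hl2.1 hl2.2
      have a1' : (S.t₁.dk l1 : ℝ) + S.t₁.δ l1 * (S.t₁.k + 1) = S.t₁.d l1 + S.t₁.k + 1 := by
        exact_mod_cast a1
      have a2' : (S.t₂.dk l2 : ℝ) + S.t₂.δ l2 * (S.t₂.k + 1) = S.t₂.d l2 + S.t₂.k + 1 := by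
        exact_mod_cast a2
      have hΔ' : (0 : ℝ) ≤ S.Δ l1 l2 + S.t₁.k * (1 - S.t₁.δ S.t₁.D) + S.t₂.k * (1 - S.t₂.δ S.t₂.D) + 2 := by
        exact_mod_cast hΔ
      rw [CauchyData.epsExp]
      push_cast
      linarith
    calc _ = C * (CR * (C1 * C2)) * (‖ε‖ ^ (-((S.t₁.k : ℝ) + (S.t₁.k * S.t₁.δ l1 - S.t₁.k + 1 / 2))) *
          ‖ε‖ ^ (-((S.t₂.k : ℝ) + (S.t₂.k * S.t₂.δ l2 - S.t₂.k + 1 / 2))) *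
          (‖ε‖ ^ (S.epsExp l1 l2 : ℝ) * ‖ε‖ ^ ((S.t₁.dk l1 : ℝ) + S.t₁.k * S.t₁.δ l1) *
          ‖ε‖ ^ ((S.t₂.dk l2 : ℝ) + S.t₂.k * S.t₂.δ l2))) := by
            rw [← Real.rpow_intCast]; ring
      _ = C * (CR * (C1 * C2)) * ‖ε‖ ^ ((S.t₁.dk l1 : ℝ) + S.t₂.dk l2 - 1 + S.epsExp l1 l2) := by
        rw [← rpow_add hε0, ← rpow_add hε0, ← rpow_add hε0, ← rpow_add hε0]
        congr 2; ring
      _ ≤ _ := mul_le_l (Real.rpow_le_rpow_of_exponent_ge hε0 hε1 hexp)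
  choose! K hK hop using key
  refine ⟨∑ l1 ∈ Finset.Icc 1 (S.t₁.D - 1), ∑ l2 ∈ Finset.Icc 1 (S.t₂.D - 1), K l1 l2,
    sum_nonneg fun l1 h1 => sum_nonneg fun l2 h2 => hK l1 h1 l2 h2, fun ε hε hε1 => ?_⟩
  simp only [sum_mul]
  exact TwoOp.sum _ fun l1 h1 => TwoOp.sum _ fun l2 h2 => hop l1 h1 l2 h2 ε hε hε1

/-- The coefficient functions of the convolution equation for a fixed value of `ε`: the Borel
transforms `φ`, `φ¹`, `φ²`, the coefficient `C_{0,0}`, and the inhomogeneity `ψ`. -/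
structure Coefs where
  φ : 𝔽
  φ1 : ℂ → ℝ → ℂ
  φ2 : ℂ → ℝ → ℂ
  c : ℝ → ℂ
  ψ : 𝔽

/-- Measurability and smallness of the coefficient functions. -/
structure Coefs.Small (c : Coefs) (S : CauchyData) (ρ β μ : ℝ) (ε : ℂ) (ζ : ℝ) : Prop where
  φ : S.Ball ρ (S.Wb β ε true true (-μ)) ζ c.φ
  φ1 : S.Ball ρ (S.Wb β ε true false (-μ)) ζ fun x _ m => c.φ1 x m
  φ2 : S.Ball ρ (S.Wb β ε false true (-μ)) ζ fun _ y m => c.φ2 y m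
  ψ : S.Ball ρ (S.W β ε 1 1 (-μ)) ζ c.ψ
  c : S.Ball ρ (S.Wb β ε false false (-μ)) ζ fun _ _ m => c.c m

/-- The terms of the fixed point operator with the coefficients `φ`, `φ¹`, `φ²`, `C_{0,0}`. -/
def CauchyData.coefOp (S : CauchyData) (ε : ℂ) (c : Coefs) (f : 𝔽)
    (τ1 τ2 : ℂ) (m : ℝ) : ℂ :=
  S.nrm ε (bil S true true 1 S.R₀ c.φ f) τ1 τ2 m
  + (S.nrm ε (bil S true false 1 S.R₀ (fun x _ m => c.φ1 x m) f) τ1 τ2 m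
  + (S.nrm ε (bil S false true 1 S.R₀ (fun _ y m => c.φ2 y m) f) τ1 τ2 m
  + S.nrm ε (bil S false false 1 S.R₀ (fun _ _ m => c.c m) f) τ1 τ2 m))

/-- The linear part of the fixed point operator. -/
def CauchyData.linOp (S : CauchyData) (ε : ℂ) (c : Coefs) (f : 𝔽)
    (τ1 τ2 : ℂ) (m : ℝ) : ℂ :=
  S.leftOp f τ1 τ2 m + (S.rightOp ε f τ1 τ2 m + S.coefOp ε c f τ1 τ2 m)

/-- The map whose fixed points are the solutions of the convolution equation. -/
def CauchyData.fixOp (S : CauchyData) (ε : ℂ) (c : Coefs) (f : 𝔽)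
    (τ1 τ2 : ℂ) (m : ℝ) : ℂ :=
  S.linOp ε c f τ1 τ2 m + (S.nrm ε (bil S true true (S.P₁ ε) (S.P₂ ε) f f) τ1 τ2 m
    + S.nrm ε c.ψ τ1 τ2 m)

lemma norm_eval_one_le (m : ℝ) : ‖(1 : ℂ[X]).eval (I * m)‖ ≤ 1 := by simp

lemma CauchyData.Admissible.one_lt_μ (hS : S.Admissible r μ)
    (hr : 0 < r) : 1 < μ := by
  have := hS.poly₁.deg_lt 0 (Metric.mem_closedBall_self hr.le)
  have h0 : (0 : ℝ) ≤ (S.P₁ 0).natDegree := Nat.cast_nonneg _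
  linarith

lemma CauchyData.exists_twoOp_coefOp (S : CauchyData) (hS : S.Setup ρ β μ r) :
    ∃ C : ℝ, 0 ≤ C ∧ ∀ ε : ℂ, ε ≠ 0 → ∀ (c : Coefs) (ζ : ℝ), c.Small S ρ β μ ε ζ →
      TwoOp S ρ (S.W β ε 1 1 (-μ)) (S.W β ε 1 1 (-μ)) (C * ζ) (S.coefOp ε c) := by
  obtain ⟨C, hC, h⟩ := S.exists_twoOp_nrm (β := β) hS
  obtain ⟨CR, hCR, hR⟩ := exists_norm_eval_le hS.deg_R₀
  obtain ⟨Cm, hm⟩ := convMaj_of_one hS.hβ (hS.one_lt_μ hS.hr) S.N hCR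
  have hk1 := hS.time₁.one_le_k
  have hk2 := hS.time₂.one_le_k
  have hC' (b1 b2 : Bool) : 0 ≤ C * (cvConst S.t₁.k b1 * cvConst S.t₂.k b2 * convMajConst Cm μ) :=
    mul_nonneg hC (mul_nonneg (mul_nonneg (cvConst_nonneg _ _) (cvConst_nonneg _ _)) hm.const_nonneg)
  refine ⟨_, add_nonneg (hC' true true) (add_nonneg (hC' true false)
    (add_nonneg (hC' false true) (hC' false false))), fun ε hε c ζ hc => ?_⟩
  have one {b1 b2 : Bool} {f : 𝔽} (hf : S.Ball ρ (S.Wb β ε b1 b2 (-μ)) ζ f) :=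
    (hm.twoOp_bil norm_eval_one_le hR hk1 hk2 hf).comp (h b1 b2 ε hε)
  exact ((one hc.φ).add ((one hc.φ1).add ((one hc.φ2).add (one hc.c)))).mono (le_of_eq (by ring))
    (S.W_nonneg β ε _ _ _)

/-- The two polynomials of the nonlinear term are bounded by powers of `1 + |m|` whose Fourier
convolution is under control. -/
lemma CauchyData.Setup.exists_convMaj (hS : S.Setup ρ β μ r) :
    ∃ (n : ℕ) (Cm C1 C2 : ℝ), ConvMaj β μ S.N Cm (μ - n) (fun m => C1 * (1 + |m|) ^ n)
      (fun m => C2 * (1 + |m|) ^ n) ∧ ∀ ε ∈ closedBall (0 : ℂ) r, ∀ m : ℝ,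
        ‖(S.P₁ ε).eval (I * m)‖ ≤ C1 * (1 + |m|) ^ n ∧ ‖(S.P₂ ε).eval (I * m)‖ ≤ C2 * (1 + |m|) ^ n := by
  obtain ⟨n1, hn1, hμ1, C1, hC1, hP1⟩ := hS.poly₁.exists_bound hS.hr
  obtain ⟨n2, hn2, hμ2, C2, hC2, hP2⟩ := hS.poly₂.exists_bound hS.hr
  have hn : (max n1 n2 : ℕ) ≤ S.N := max_le hn1 hn2
  obtain ⟨Cm, hm⟩ := convMaj_of_deg_lt (β := β) (μ := μ) (M := S.N) hS.hβ (n := max n1 n2) (by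
    rcases max_choice n1 n2 with h | h <;> rw [h] <;> assumption) (mod_cast hn) hC1 hC2
  have up (m : ℝ) : 1 ≤ 1 + |m| := le_add_of_nonneg_right (abs_nonneg m)
  exact ⟨_, Cm, C1, C2, hm, fun ε hε m => ⟨(hP1 ε hε m).trans (mul_le_l
    (pow_le_pow_right₀ (up m) (le_max_left _ _)) hC1), (hP2 ε hε m).trans
    (mul_le_l (pow_le_pow_right₀ (up m) (le_max_right _ _)) hC2)⟩⟩

lemma CauchyData.exists_quad_bound (S : CauchyData) (hS : S.Setup ρ β μ r) :
    ∃ C : ℝ, 0 ≤ C ∧ ∀ ε : ℂ, ε ≠ 0 → ‖ε‖ ≤ r → ∀ (f g : 𝔽) (K L : ℝ),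
      S.Ball ρ (S.W β ε 1 1 (-μ)) K f → S.Ball ρ (S.W β ε 1 1 (-μ)) K g → 0 ≤ L →
      S.Bd ρ (S.W β ε 1 1 (-μ)) L (fun τ1 τ2 m => f τ1 τ2 m - g τ1 τ2 m) →
      S.Bd ρ (S.W β ε 1 1 (-μ)) (C * (2 * K * L)) fun τ1 τ2 m =>
        S.nrm ε (bil S true true (S.P₁ ε) (S.P₂ ε) f f) τ1 τ2 m -
        S.nrm ε (bil S true true (S.P₁ ε) (S.P₂ ε) g g) τ1 τ2 m := by
  obtain ⟨C, hC, h⟩ := S.exists_twoOp_nrm (β := β) hS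
  obtain ⟨n, Cm, C1, C2, hm, hP⟩ := hS.exists_convMaj
  have hk1 := hS.time₁.one_le_k
  have hk2 := hS.time₂.one_le_k
  have h0 : 0 ≤ cvConst S.t₁.k true * cvConst S.t₂.k true * convMajConst Cm (μ - n) :=
    mul_nonneg (mul_nonneg (cvConst_nonneg _ _) (cvConst_nonneg _ _)) hm.const_nonneg
  refine ⟨_, mul_nonneg hC h0, fun ε hε hεr f g K L hf hg hL hd => ?_⟩
  have hA := fun m => (hP ε (mem_closedBall_zero_iff.2 hεr) m).1
  have hB := fun m => (hP ε (mem_closedBall_zero_iff.2 hεr) m).2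
  have := hf.nonneg
  have := (h true true ε hε).lip (hm.bil_bound (b1 := true) (b2 := true) hA hB hk1 hk2 hf hf)
    (hm.bil_bound hA hB hk1 hk2 hg hg) (mul_nonneg h0 pos!)
    (hm.bil_lip hA hB hk1 hk2 hf hg hf hg hL hL hd hd)
  rwa [show K * L + L * K = 2 * K * L by ring, ← mul_assoc] at this

/-- The operator `Φ` maps the ball of radius `ϖ` into itself and contracts distances there by
`1 / 2`. -/
structure CauchyData.Contracts (S : CauchyData) (ρ β μ ϖ : ℝ) (ε : ℂ) (Φ : 𝔽 → 𝔽) : Prop where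
  maps : ∀ {f}, S.Ball ρ (S.W β ε 1 1 (-μ)) ϖ f → S.Ball ρ (S.W β ε 1 1 (-μ)) ϖ (Φ f)
  half : ∀ {f g L}, S.Ball ρ (S.W β ε 1 1 (-μ)) ϖ f → S.Ball ρ (S.W β ε 1 1 (-μ)) ϖ g → 0 ≤ L →
    S.Bd ρ (S.W β ε 1 1 (-μ)) L (fun τ1 τ2 m => f τ1 τ2 m - g τ1 τ2 m) →
    S.Bd ρ (S.W β ε 1 1 (-μ)) (L / 2) fun τ1 τ2 m => Φ f τ1 τ2 m - Φ g τ1 τ2 m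

/-- The fixed point operator maps a ball into itself and is a contraction there, if the data are
small. -/
lemma CauchyData.exists_contraction (S : CauchyData) (hS : S.Setup ρ β μ r) :
    ∃ εs ϖ ζ : ℝ, 0 < εs ∧ εs ≤ r ∧ 0 < ϖ ∧ 0 < ζ ∧ ∀ ε : ℂ, ε ≠ 0 → ‖ε‖ ≤ εs → ∀ c : Coefs,
      c.Small S ρ β μ ε ζ → S.Contracts ρ β μ ϖ ε (S.fixOp ε c) := by
  obtain ⟨Cl, hCl, hl⟩ := S.exists_twoOp_leftOp (β := β) hS
  obtain ⟨Cr, hCr, hrt⟩ := S.exists_twoOp_rightOp (β := β) hS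
  obtain ⟨Cc, hCc, hc⟩ := S.exists_twoOp_coefOp (ρ := ρ) hS
  obtain ⟨Cq, hCq, hq⟩ := S.exists_quad_bound (ρ := ρ) hS
  obtain ⟨Cn, hCn, hn⟩ := S.exists_twoOp_nrm (β := β) hS
  -- one constant for all terms
  set K := 1 + Cl + Cr + Cc + Cq + Cn with hK
  have hK1 : 1 ≤ K := by linarith
  have hK0 : 0 < K := by linarith
  set ϖ := 1 / (16 * K) with hϖ
  have hϖ0 : 0 < ϖ := by positivity
  have hKϖ : K * ϖ = 1 / 16 := by rw [hϖ]; field_simp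
  set ζ := ϖ / (16 * K) with hζ
  have hζ0 : 0 < ζ := by positivity
  have hKζ : K * ζ = ϖ / 16 := by rw [hζ]; field_simp
  have hr := hS.hr
  have hϖ1 : ϖ ≤ 1 := by
    rw [hϖ, div_le_one pos!]; linarith
  set εs := min r (min 1 ((1 / (16 * K)) ^ 2)) with hεs
  have hεs0 : 0 < εs := by positivity
  refine ⟨εs, ϖ, ζ, hεs0, min_le_left _ _, hϖ0, hζ0, fun ε hε hεle c hsm => ?_⟩
  have hεr : ‖ε‖ ≤ r := hεle.trans (min_le_left _ _)
  have hε1 : ‖ε‖ ≤ 1 := hεle.trans ((min_le_right _ _).trans (min_le_left _ _))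
  have hεK : K * ‖ε‖ ^ (1 / 2 : ℝ) ≤ 1 / 16 := by
    have : ‖ε‖ ≤ (1 / (16 * K)) ^ 2 := hεle.trans ((min_le_right _ _).trans (min_le_right _ _))
    rw [← Real.sqrt_eq_rpow]
    have u2 : Real.sqrt ‖ε‖ ≤ 1 / (16 * K) := by
      rw [Real.sqrt_le_left pos!]; exact this
    calc K * _ ≤ K * (1 / (16 * K)) := mul_le_l u2 hK0.le
      _ = 1 / 16 := by field_simp
  have hlin : TwoOp S ρ (S.W β ε 1 1 (-μ)) (S.W β ε 1 1 (-μ)) (1 / 4) (S.linOp ε c) := ((hl ε hε hε1).add ((hrt ε hε hε1).add (hc ε hε c ζ hsm))).mono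
    (c' := 1 / 4) (by
      have u1 : Cl * ‖ε‖ ^ (1 / 2 : ℝ) ≤ K * ‖ε‖ ^ (1 / 2 : ℝ) := by gcongr; linarith
      have u2 : Cr * ‖ε‖ ^ (1 / 2 : ℝ) ≤ K * ‖ε‖ ^ (1 / 2 : ℝ) := by gcongr; linarith
      have h3 : Cc * ζ ≤ K * ζ := by gcongr; linarith
      linarith) (S.W_nonneg β ε _ _ _)
  have hψ : S.Ball ρ (S.W β ε 1 1 (-μ)) (Cn * ζ) (S.nrm ε c.ψ) :=
    (hn false false ε hε).map ⟨hζ0.le, hsm.ψ.meas, fun τ1 h1 τ2 h2 m =>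
      (hsm.ψ.bd τ1 h1 τ2 h2 m).trans (mul_le_l (mul_le_l
        (fw_le_fw β (by simp) m)
        (mul_nonneg (TimeData.wt_nonneg _ _ _) (TimeData.wt_nonneg _ _ _))) hζ0.le)⟩
  have half {f g L} (hf : S.Ball ρ (S.W β ε 1 1 (-μ)) ϖ f) (hg : S.Ball ρ (S.W β ε 1 1 (-μ)) ϖ g)
      (hL : 0 ≤ L) (hd : S.Bd ρ (S.W β ε 1 1 (-μ)) L fun τ1 τ2 m => f τ1 τ2 m - g τ1 τ2 m) :
      S.Bd ρ (S.W β ε 1 1 (-μ)) (L / 2)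
        fun τ1 τ2 m => S.fixOp ε c f τ1 τ2 m - S.fixOp ε c g τ1 τ2 m := by
    intro τ1 h1 τ2 h2 m
    have hW := S.W_nonneg β ε 1 1 (-μ) τ1 τ2 m
    have c2 : Cq * (2 * ϖ * L) ≤ L / 8 := by
      calc Cq * (2 * ϖ * L) ≤ K * (2 * ϖ * L) := by gcongr; linarith
        _ = (K * ϖ) * (2 * L) := by ring
        _ = L / 8 := by rw [hKϖ]; ring
    beta_reduce
    unfold fixOp
    rw [add_sub_add_comm, add_sub_add_right_eq_sub]
    refine (norm_add_le_of_le (hlin.lip hf hg hL hd τ1 h1 τ2 h2 m)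
      (hq ε hε hεr f g ϖ L hf hg hL hd τ1 h1 τ2 h2 m)).trans ?_
    rw [← add_mul]
    exact mul_le_r (by linarith) hW
  refine ⟨fun {f} hf => ⟨hϖ0.le, (hlin.meas f hf.meas).add (((hn true true ε hε).meas _
    (meas3_bil S _ _ _ _ hf.meas hf.meas)).add hψ.meas), fun τ1 h1 τ2 h2 m => ?_⟩, half⟩
  have hW := S.W_nonneg β ε 1 1 (-μ) τ1 τ2 m
  have hK' : Cn * ζ ≤ K * ζ := by gcongr; linarith
  have h0 : S.fixOp ε c (fun _ _ _ => 0) τ1 τ2 m = S.nrm ε c.ψ τ1 τ2 m := by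
    have : bil S true true (S.P₁ ε) (S.P₂ ε) (fun _ _ _ => 0) (fun _ _ _ => 0) = fun _ _ _ => 0 := by
      funext τ1 τ2 m; exact bil_zero_left τ1 τ2 m
    rw [fixOp, hlin.zero, this, (hn true true ε hε).zero, zero_add, zero_add]
  have := norm_add_le_of_le (half hf hf.zero hϖ0.le (by simpa using hf.bd) τ1 h1 τ2 h2 m)
    (hψ.bd τ1 h1 τ2 h2 m)
  beta_reduce at this
  rw [h0, sub_add_cancel, ← add_mul] at this
  exact this.trans (mul_le_r (by linarith) hW)

/-! ### The convolution equation as a fixed point equation -/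

/-- The coefficient functions which belong to two families of coefficients. -/
def CauchyData.coefs (S : CauchyData) (C F : Family) (ε : ℂ) : Coefs where
  φ := borel₁₂ S.t₁.k S.t₂.k C ε
  φ1 := borel₁ S.t₁.k C ε
  φ2 := borel₂ S.t₂.k C ε
  c := fun m => C 0 0 m ε
  ψ := borel₁₂ S.t₁.k S.t₂.k F ε

lemma TimeData.den_ne_zero (t : TimeData) (hroots : t.RootsApart ρ) (m : ℝ)
    (hτ : τ ∈ t.closedDom ρ) (h0 : τ ≠ 0) : t.den m τ ≠ 0 :=
  mul_ne_zero (pow_ne_zero _ h0) (t.Pm_ne_zero hroots m hτ)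

/-- The left hand side of the convolution equation. -/
lemma CauchyData.opB_opB_eq (S : CauchyData) (hS : S.Setup ρ β μ r) (hε : ε ≠ 0) (hw : S.Ball ρ (S.W β ε 1 1 (-μ)) K w) (h1 : τ1 ∈ S.t₁.closedDom ρ) (h2 : τ2 ∈ S.t₂.closedDom ρ) (h10 : τ1 ≠ 0)
    (h20 : τ2 ≠ 0) (m : ℝ) :
    S.t₁.opB m (fun σ1 => S.t₂.opB m (fun σ2 => w σ1 σ2 m) τ2) τ1 =
      S.t₁.den m τ1 * S.t₂.den m τ2 * (w τ1 τ2 m - S.leftOp w τ1 τ2 m) := by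
  obtain ⟨C2, -, o2⟩ := S.t₂.exists_oneOp_kop hS.time₂ hS.roots2
  have e1 : (fun σ1 => S.t₂.opB m (fun σ2 => w σ1 σ2 m) τ2) = fun σ1 => S.t₂.den m τ2 *
      (w σ1 τ2 m - S.t₂.kop m (fun σ2 => w σ1 σ2 m) τ2) := by
    funext σ1
    rw [S.t₂.opB_eq hS.time₂ _ h20 (S.t₂.Pm_ne_zero hS.roots2 m h2)]
    rfl
  rw [e1, S.t₁.opB_eq hS.time₁ _ h10 (S.t₁.Pm_ne_zero hS.roots1 m h1),
    S.t₁.kop_const_mul hS.time₁.one_le_k,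
    S.t₁.kop_sub hS.time₁.one_le_k hS.time₁.ν_pos hε m
      ((OneOp.id S.t₂ ρ ε 1).bd_slice hw h2 m) ((o2 ε hε).bd_slice hw h2 m) h1]
  simp only [CauchyData.leftOp, prodOp, TimeData.den]
  ring

lemma CauchyData.borelEqAt_iff (S : CauchyData) (hS : S.Setup ρ β μ r) (hε : ε ≠ 0) (C F : Family) (hw : S.Ball ρ (S.W β ε 1 1 (-μ)) K w) (h1 : τ1 ∈ S.t₁.closedDom ρ) (h2 : τ2 ∈ S.t₂.closedDom ρ) (h10 : τ1 ≠ 0)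
    (h20 : τ2 ≠ 0) (m : ℝ) :
    S.BorelEqAt C F ε w τ1 τ2 m ↔ S.fixOp ε (S.coefs C F ε) w τ1 τ2 m = w τ1 τ2 m := by
  have hd : S.t₁.den m τ1 * S.t₂.den m τ2 ≠ 0 :=
    mul_ne_zero (S.t₁.den_ne_zero hS.roots1 m h1 h10) (S.t₂.den_ne_zero hS.roots2 m h2 h20)
  have hdiv : ∀ f : 𝔽,
      S.t₁.den m τ1 * S.t₂.den m τ2 * S.divOp f τ1 τ2 m = f τ1 τ2 m := fun f => by
    rw [CauchyData.divOp, mul_inv_cancel_left₀ hd]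
  have hsum : S.t₁.den m τ1 * S.t₂.den m τ2 * S.rightOp ε w τ1 τ2 m =
      ∑ l1 ∈ Finset.Icc 1 (S.t₁.D - 1), ∑ l2 ∈ Finset.Icc 1 (S.t₂.D - 1),
        (S.R l1 l2).eval (I * m) * ε ^ S.epsExp l1 l2
          * mulB S.t₁.k (S.t₁.dk l1) (derivB S.t₁.k (S.t₁.δ l1) fun σ1 =>
              mulB S.t₂.k (S.t₂.dk l2) (derivB S.t₂.k (S.t₂.δ l2) fun σ2 => w σ1 σ2 m) τ2) τ1 := by
    simp only [CauchyData.rightOp, mul_sum, hdiv]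
    rfl
  have hrhs : S.t₁.den m τ1 * S.t₂.den m τ2 *
      (S.fixOp ε (S.coefs C F ε) w τ1 τ2 m - S.leftOp w τ1 τ2 m) =
      ε ^ (-2 : ℤ) * S.shiftB (fun σ1 σ2 => bil S true true (S.P₁ ε) (S.P₂ ε) w w σ1 σ2 m) τ1 τ2
      + S.t₁.den m τ1 * S.t₂.den m τ2 * S.rightOp ε w τ1 τ2 m
      + ε ^ (-2 : ℤ) * S.shiftB (fun σ1 σ2 => bil S true true 1 S.R₀ (S.coefs C F ε).φ w σ1 σ2 m) τ1 τ2
      + ε ^ (-2 : ℤ) * S.shiftB (fun σ1 σ2 => bil S true false 1 S.R₀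
        (fun x _ m => (S.coefs C F ε).φ1 x m) w σ1 σ2 m) τ1 τ2
      + ε ^ (-2 : ℤ) * S.shiftB (fun σ1 σ2 => bil S false true 1 S.R₀
        (fun _ y m => (S.coefs C F ε).φ2 y m) w σ1 σ2 m) τ1 τ2
      + ε ^ (-2 : ℤ) * S.shiftB (fun σ1 σ2 => bil S false false 1 S.R₀
        (fun _ _ m => (S.coefs C F ε).c m) w σ1 σ2 m) τ1 τ2
      + ε ^ (-2 : ℤ) * S.shiftB (fun σ1 σ2 => (S.coefs C F ε).ψ σ1 σ2 m) τ1 τ2 := by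
    have hn : ∀ f : 𝔽, S.t₁.den m τ1 * S.t₂.den m τ2 * S.nrm ε f τ1 τ2 m =
        ε ^ (-2 : ℤ) * S.shiftB (fun σ1 σ2 => f σ1 σ2 m) τ1 τ2 := fun f => by
      rw [CauchyData.nrm, hdiv]; rfl
    simp only [← hn]
    simp only [CauchyData.fixOp, CauchyData.linOp, CauchyData.coefOp]
    ring
  rw [hsum] at hrhs
  have hiff : S.BorelEqAt C F ε w τ1 τ2 m ↔ S.t₁.den m τ1 * S.t₂.den m τ2 *
      (w τ1 τ2 m - S.leftOp w τ1 τ2 m) = S.t₁.den m τ1 * S.t₂.den m τ2 *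
      (S.fixOp ε (S.coefs C F ε) w τ1 τ2 m - S.leftOp w τ1 τ2 m) := by
    rw [hrhs, ← S.opB_opB_eq hS hε hw h1 h2 h10 h20 m]
    rfl
  rw [hiff, mul_right_inj' hd, sub_left_inj, eq_comm]

lemma mulB_zero_right (k : ℕ) (hn : 1 ≤ n) (f : ℂ → ℂ) : mulB k n f 0 = 0 := by
  rw [mulB, zero_pow (by omega), zero_div, zero_mul]

lemma mulB_zero_fun (k n : ℕ) (τ : ℂ) : mulB k n (fun _ => 0) τ = 0 := by
  simp [mulB]

lemma derivB_zero_right (hk : 1 ≤ k) (hδ : 1 ≤ δ) (f : ℂ → ℂ) : derivB k δ f 0 = 0 := by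
  rw [derivB, zero_pow (by omega), mul_zero, zero_pow (by omega), zero_mul, zero_add]
  refine Finset.sum_eq_zero fun p hp => ?_
  rw [Finset.mem_Icc] at hp
  rw [mulB_zero_right k (Nat.mul_pos hk (by omega)), mul_zero]

lemma derivB_zero_fun (k δ : ℕ) : derivB k δ (fun _ => 0) = fun _ => 0 := by
  funext τ
  simp [derivB, mulB_zero_fun]

lemma TimeData.opB_zero_right (t : TimeData) (ht : t.Admissible) (m : ℝ) (f : ℂ → ℂ) :
    t.opB m f 0 = 0 := by
  have hk := ht.one_le_k
  rw [TimeData.opB, derivB_zero_right hk ht.one_lt_δ.le, zero_pow (by omega)]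
  ring

lemma TimeData.opB_zero_fun (t : TimeData) (m : ℝ) (τ : ℂ) : t.opB m (fun _ => 0) τ = 0 := by
  rw [TimeData.opB, derivB_zero_fun]; ring

/-- For `τ1 = 0` or `τ2 = 0` the convolution equation is void. -/
lemma CauchyData.borelEqAt_of_zero (S : CauchyData) (hS : S.Setup ρ β μ r) (ε : ℂ)
    (C F : Family) (w : 𝔽) (h : τ1 = 0 ∨ τ2 = 0) (m : ℝ) :
    S.BorelEqAt C F ε w τ1 τ2 m := by
  have hs : ∀ G, S.shiftB G τ1 τ2 = 0 := by
    intro G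
    rcases h with rfl | rfl
    · exact mulB_zero_right _ (by omega) _
    · simp only [CauchyData.shiftB, mulB_zero_right _ (Nat.succ_pos _ : 1 ≤ S.t₂.k + 1), mulB_zero_fun]
  have hl : S.t₁.opB m (fun σ1 => S.t₂.opB m (fun σ2 => w σ1 σ2 m) τ2) τ1 = 0 := by
    rcases h with rfl | rfl
    · exact S.t₁.opB_zero_right hS.time₁ _ _
    · simp only [S.t₂.opB_zero_right hS.time₂, S.t₁.opB_zero_fun]
  have hr : ∑ l1 ∈ Finset.Icc 1 (S.t₁.D - 1), ∑ l2 ∈ Finset.Icc 1 (S.t₂.D - 1),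
        (S.R l1 l2).eval (I * m) * ε ^ S.epsExp l1 l2
          * mulB S.t₁.k (S.t₁.dk l1) (derivB S.t₁.k (S.t₁.δ l1) fun σ1 =>
              mulB S.t₂.k (S.t₂.dk l2) (derivB S.t₂.k (S.t₂.δ l2) fun σ2 => w σ1 σ2 m) τ2) τ1 = 0 := by
    refine Finset.sum_eq_zero fun l1 hl1 => Finset.sum_eq_zero fun l2 hl2 => ?_
    rw [Finset.mem_Icc] at hl1 hl2
    rcases h with rfl | rfl
    · rw [mulB_zero_right _ (hS.time₁.dk_add hl1.1 hl1.2).2, mul_zero]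
    · simp only [mulB_zero_right _ (hS.time₂.dk_add hl2.1 hl2.2).2, derivB_zero_fun, mulB_zero_fun,
        mul_zero]
  rw [CauchyData.BorelEqAt, hl, hr]
  simp only [hs, mul_zero, add_zero]

/-! ### The norms and the pointwise bounds -/

lemma isOpen_sector (d a : ℝ) : IsOpen (sector d a) := by
  have h : sector d a = Complex.exp '' {z | |z.im - d| < a} := by
    ext τ
    constructor
    · rintro ⟨r, φ, hr, hφ, rfl⟩
      refine ⟨Real.log r + φ * I, by simpa using hφ, ?_⟩
      rw [Complex.exp_add, ← Complex.ofReal_exp, Real.exp_log hr]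
    · rintro ⟨z, hz, rfl⟩
      refine ⟨exp z.re, z.im, exp_pos _, hz, ?_⟩
      rw [Complex.ofReal_exp, ← Complex.exp_add, Complex.re_add_im]
  rw [h]
  refine Complex.isOpenMap_exp _ (isOpen_lt ?_ continuous_const)
  fun_prop

lemma TimeData.isOpen_openDom (t : TimeData) (ρ : ℝ) : IsOpen (t.openDom ρ) :=
  isOpen_ball.union (isOpen_sector _ _)

lemma TimeData.measurableSet_closedDom (t : TimeData) (ρ : ℝ) : MeasurableSet (t.closedDom ρ) :=
  Metric.isClosed_closedBall.measurableSet.union (isOpen_sector _ _).measurableSet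

lemma TimeData.openDom_subset (t : TimeData) (ρ : ℝ) : t.openDom ρ ⊆ t.closedDom ρ :=
  union_subset_union_left _ ball_subset_closedBall

lemma TimeData.zero_mem_openDom (t : TimeData) (hρ : 0 < ρ) : (0 : ℂ) ∈ t.openDom ρ :=
  Or.inl (mem_ball_self hρ)

lemma TimeData.smul_mem_openDom (t : TimeData) (h : τ ∈ t.openDom ρ)
    (hc : 0 < c) (hc1 : c ≤ 1) : τ * (c : ℂ) ∈ t.openDom ρ := by
  rcases h with h | h
  · left
    rw [mem_ball_zero_iff] at h ⊢
    rw [norm_mul, norm_real, norm_of_nonneg hc.le]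
    exact (mul_le_of_le_one_right (norm_nonneg _) hc1).trans_lt h
  · right; exact sector_smul_mem h hc

lemma TimeData.continuous_wt (t : TimeData) (he : 0 ≤ e) : Continuous (t.wt e) := by
  unfold wt
  refine Continuous.mul (Continuous.div (continuous_norm.rpow_const fun _ => Or.inr he) fp!
    fun z => ?_) fp!
  positivity

lemma TimeData.weight_mul_wt (t : TimeData) (hε : ε ≠ 0) (hτ : τ ≠ 0) :
    t.weight ε τ * t.wt 1 (τ / ε) = 1 := by
  have h : 0 < ‖τ / ε‖ := norm_pos_iff.2 (div_ne_zero hτ hε)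
  rw [TimeData.weight, TimeData.wt, rpow_one, Real.exp_neg]
  field_simp

/-- A weighted bound on a continuous function is a bound by `wt`, also at `τ = 0` where the value
of the weight carries no information. -/
lemma TimeData.le_of_weight_mul_le (t : TimeData) (hρ : 0 < ρ) (hε : ε ≠ 0) {f : ℂ → ℝ}
    (hf : ContinuousOn f (t.closedDom ρ)) (h : ∀ τ ∈ t.closedDom ρ, t.weight ε τ * f τ ≤ c)
    (hτ : τ ∈ t.closedDom ρ) : f τ ≤ c * t.wt 1 (τ / ε) := by
  have h' : ∀ τ ∈ t.closedDom ρ, τ ≠ 0 → f τ ≤ c * t.wt 1 (τ / ε) := fun τ hτ h0 => by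
    refine le_of_eq_of_le ?_ (mul_le_r (h τ hτ) (t.wt_nonneg 1 (τ / ε)))
    rw [mul_right_comm, t.weight_mul_wt hε h0, one_mul]
  rcases eq_or_ne τ 0 with rfl | h0
  · have hU : t.closedDom ρ ∈ 𝓝 (0 : ℂ) :=
      mem_of_superset ((t.isOpen_openDom ρ).mem_nhds (t.zero_mem_openDom hρ)) (t.openDom_subset ρ)
    have hg : Continuous fun τ => c * t.wt 1 (τ / ε) := by
      have := t.continuous_wt zero_le_one
      fun_prop
    refine le_of_tendsto_of_tendsto ((hf.continuousAt hU).tendsto.mono_left nhdsWithin_le_nhds)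
      (hg.continuousAt.tendsto.mono_left nhdsWithin_le_nhds) (b := 𝓝[≠] 0) ?_
    filter_upwards [self_mem_nhdsWithin, nhdsWithin_le_nhds hU] with σ hσ hσ' using h' σ hσ' hσ
  · exact h' τ hτ h0

lemma TimeData.weight_mul_le (t : TimeData) (hε : ε ≠ 0) (hc : 0 ≤ c)
    (h : x ≤ c * t.wt 1 (τ / ε)) : t.weight ε τ * x ≤ c := by
  rcases eq_or_ne τ 0 with rfl | h0
  · simpa [TimeData.weight]
  · refine (mul_le_l h (by unfold weight; positivity)).trans_eq ?_
    rw [mul_left_comm, t.weight_mul_wt hε h0, mul_one]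

lemma weight_mul_fw (β μ m : ℝ) : (1 + |m|) ^ μ * exp (β * |m|) * fw β (-μ) m = 1 := by
  have : 0 < 1 + |m| := by positivity
  rw [fw, rpow_neg this.le, Real.exp_neg]
  field_simp

lemma le_mul_fw {m : ℝ} (h : (1 + |m|) ^ μ * exp (β * |m|) * x ≤ K) : x ≤ K * fw β (-μ) m := by
  refine le_of_eq_of_le ?_ (mul_le_r h (fw_pos β (-μ) m).le)
  rw [mul_right_comm, weight_mul_fw, one_mul]

lemma mul_le_of_le_fw {m : ℝ} (h : x ≤ K * fw β (-μ) m) :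
    (1 + |m|) ^ μ * exp (β * |m|) * x ≤ K := by
  refine (mul_le_l h).trans_eq ?_
  rw [mul_left_comm, weight_mul_fw, mul_one]

lemma TimeData.bd_of_memF1 (t : TimeData) (hρ : 0 < ρ) (hε : ε ≠ 0)
    {h : ℂ → ℝ → ℂ} (hm : MemF₁ t ρ β μ ε h) (hK : normF₁ t ρ β μ ε h ≤ K)
    (hτ : τ ∈ t.closedDom ρ) (m : ℝ) : ‖h τ m‖ ≤ K * (t.wt 1 (τ / ε) * fw β (-μ) m) := by
  rw [← mul_assoc]
  refine le_mul_fw (t.le_of_weight_mul_le hρ hε (continuousOn_const.mul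
    (hm.1.comp (f := fun τ : ℂ => (τ, m)) fp! fun σ hσ => ⟨hσ, mem_univ _⟩).norm)
    (fun σ hσ => ?_) hτ)
  refine le_of_eq_of_le ?_ ((le_csSup hm.2.2 ⟨(σ, m), ⟨hσ, mem_univ _⟩, rfl⟩).trans hK)
  simp only [Pi.mul_apply, comp_apply]
  ring

lemma CauchyData.bd_of_memF (S : CauchyData) (hρ : 0 < ρ) (hε : ε ≠ 0)
    {h : 𝔽} (hm : MemF S.t₁ S.t₂ ρ β μ ε h) (hK : normF S.t₁ S.t₂ ρ β μ ε h ≤ K) :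
    S.Bd ρ (S.W β ε 1 1 (-μ)) K h := by
  intro τ1 h1 τ2 h2 m
  rw [W, ← mul_assoc, ← mul_assoc]
  refine le_mul_fw (S.t₂.le_of_weight_mul_le hρ hε (continuousOn_const.mul
    (hm.1.comp (f := fun τ : ℂ => (τ1, τ, m)) fp! fun σ hσ => ⟨h1, hσ, mem_univ _⟩).norm)
    (fun τ2 h2 => S.t₁.le_of_weight_mul_le hρ hε (continuousOn_const.mul (continuousOn_const.mul
      (hm.1.comp (f := fun τ : ℂ => (τ, τ2, m)) fp! fun σ hσ => ⟨hσ, h2, mem_univ _⟩).norm))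
      (fun τ1 h1 => ?_) h1) h2)
  refine le_of_eq_of_le ?_
    ((le_csSup hm.2.2 ⟨(τ1, τ2, m), ⟨h1, h2, mem_univ _⟩, rfl⟩).trans hK)
  simp only [Pi.mul_apply, comp_apply]
  ring

lemma CauchyData.memF_of_bd (S : CauchyData) (hρ : 0 < ρ) (hε : ε ≠ 0)
    {h : 𝔽} (hK : 0 ≤ K) (hb : S.Bd ρ (S.W β ε 1 1 (-μ)) K h)
    (hc : ContinuousOn (fun p : ℂ × ℂ × ℝ => h p.1 p.2.1 p.2.2)
      (S.t₁.closedDom ρ ×ˢ S.t₂.closedDom ρ ×ˢ univ))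
    (hd : ∀ m : ℝ, DifferentiableOn ℂ (fun p : ℂ × ℂ => h p.1 p.2 m)
      (S.t₁.openDom ρ ×ˢ S.t₂.openDom ρ)) :
    MemF S.t₁ S.t₂ ρ β μ ε h ∧ normF S.t₁ S.t₂ ρ β μ ε h ≤ K := by
  have key : ∀ x ∈ valuesF S.t₁ S.t₂ ρ β μ ε h, x ≤ K := by
    rintro _ ⟨⟨τ1, τ2, m⟩, ⟨h1, h2, -⟩, rfl⟩
    refine le_of_eq_of_le ?_ (S.t₁.weight_mul_le hε hK (τ := τ1) (S.t₂.weight_mul_le hε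
      (mul_nonneg hK (S.t₁.wt_nonneg _ _)) (τ := τ2) (mul_le_of_le_fw (β := β) (μ := μ) (m := m) (x := ‖h τ1 τ2 m‖)
        ((hb τ1 h1 τ2 h2 m).trans_eq ?_))))
    · ring
    · unfold W; ring
  have h0 := S.t₁.openDom_subset ρ (S.t₁.zero_mem_openDom hρ)
  have h0' := S.t₂.openDom_subset ρ (S.t₂.zero_mem_openDom hρ)
  exact ⟨⟨hc, hd, ⟨K, key⟩⟩, csSup_le ⟨_, (0, 0, 0), ⟨h0, h0', mem_univ _⟩, rfl⟩ key⟩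

lemma TimeData.memF1_of_bd (t : TimeData) (hρ : 0 < ρ) (hε : ε ≠ 0)
    {h : ℂ → ℝ → ℂ} (hK : 0 ≤ K)
    (hb : ∀ τ ∈ t.closedDom ρ, ∀ m : ℝ, ‖h τ m‖ ≤ K * (t.wt 1 (τ / ε) * fw β (-μ) m))
    (hc : ContinuousOn (fun p : ℂ × ℝ => h p.1 p.2) (t.closedDom ρ ×ˢ univ))
    (hd : ∀ m : ℝ, DifferentiableOn ℂ (fun τ : ℂ => h τ m) (t.openDom ρ)) :
    MemF₁ t ρ β μ ε h ∧ normF₁ t ρ β μ ε h ≤ K := by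
  have key : ∀ x ∈ valuesF₁ t ρ β μ ε h, x ≤ K := by
    rintro _ ⟨⟨τ, m⟩, ⟨hτ, -⟩, rfl⟩
    refine le_of_eq_of_le ?_ (t.weight_mul_le hε hK (τ := τ) (mul_le_of_le_fw (β := β) (μ := μ) (m := m) (x := ‖h τ m‖)
      ((hb τ hτ m).trans_eq (mul_assoc _ _ _).symm)))
    ring
  have h0 := t.openDom_subset ρ (t.zero_mem_openDom hρ)
  exact ⟨⟨hc, hd, ⟨K, key⟩⟩, csSup_le ⟨_, (0, 0), ⟨h0, mem_univ _⟩, rfl⟩ key⟩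

lemma norm_le_of_memE {h : ℝ → ℂ} (hm : MemE β μ h) (hK : normE β μ h ≤ K) (m : ℝ) :
    ‖h m‖ ≤ K * fw β (-μ) m :=
  le_mul_fw ((le_ciSup hm.2 m).trans hK)

/-! ### Functions that are continuous in all variables and holomorphic in `(τ1, τ2, ε)` -/

/-- The points `(τ1, τ2, m, ε)` of the closed domains with `τ1, τ2 ≠ 0` and `ε ∈ V`. -/
def CauchyData.dom (S : CauchyData) (ρ : ℝ) (V : Set ℂ) : Set (ℙ) :=
  (S.t₁.closedDom ρ \ {0}) ×ˢ (S.t₂.closedDom ρ \ {0}) ×ˢ univ ×ˢ V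

/-- The points `(τ1, τ2, ε)` of the open domains with `τ1, τ2 ≠ 0` and `ε ∈ V`. -/
def CauchyData.domH (S : CauchyData) (ρ : ℝ) (V : Set ℂ) : Set (ℂ × ℂ × ℂ) :=
  (S.t₁.openDom ρ \ {0}) ×ˢ (S.t₂.openDom ρ \ {0}) ×ˢ V

/-- Continuity in `(τ1, τ2, m, ε)` and holomorphy in `(τ1, τ2, ε)`, away from `τ1 τ2 = 0`. -/
structure Reg (S : CauchyData) (ρ : ℝ) (V : Set ℂ) (G : ℙ → ℂ) : Prop where
  cont : ContinuousOn G (S.dom ρ V)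
  holo : ∀ m : ℝ, DifferentiableOn ℂ (fun p : ℂ × ℂ × ℂ => G (p.1, p.2.1, m, p.2.2)) (S.domH ρ V)

/-- The set `V` of values of `ε` is open and does not contain `0`, and the data satisfy what is
needed to invert the leading operators and to convolve. -/
class Dom (S : CauchyData) (ρ : ℝ) (V : Set ℂ) : Prop where
  isOpen : IsOpen V
  ne_zero : ∀ ε ∈ V, ε ≠ 0
  k1 : 1 ≤ S.t₁.k
  k2 : 1 ≤ S.t₂.k
  ν1 : 0 < S.t₁.ν
  ν2 : 0 < S.t₂.ν
  roots1 : S.t₁.RootsApart ρ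
  roots2 : S.t₂.RootsApart ρ

/-- The two variables exchanged. Only the part of the data that enters `Dom` and `Reg` matters. -/
def CauchyData.swap (S : CauchyData) : CauchyData := { S with t₁ := S.t₂, t₂ := S.t₁ }

section
variable [H : Dom S ρ V] {G G' : ℙ → ℂ}

instance : Dom S.swap ρ V := ⟨H.isOpen, H.ne_zero, H.k2, H.k1, H.ν2, H.ν1, H.roots2, H.roots1⟩

lemma CauchyData.mem_dom_of_mem_domH {p : ℂ × ℂ × ℂ} (hp : p ∈ S.domH ρ V) (m : ℝ) :
    (p.1, p.2.1, m, p.2.2) ∈ S.dom ρ V :=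
  ⟨⟨S.t₁.openDom_subset ρ hp.1.1, hp.1.2⟩, ⟨S.t₂.openDom_subset ρ hp.2.1.1, hp.2.1.2⟩, mem_univ _,
    hp.2.2⟩

lemma CauchyData.isOpen_domH : IsOpen (S.domH ρ V) :=
  ((S.t₁.isOpen_openDom ρ).sdiff isClosed_singleton).prod
    (((S.t₂.isOpen_openDom ρ).sdiff isClosed_singleton).prod H.isOpen)

lemma CauchyData.smul_mem_dom {q : ℙ} (hq : q ∈ S.dom ρ V)
    (h1 : c1 ∈ Ioc 0 1) (h2 : c2 ∈ Ioc 0 1) (m : ℝ) :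
    (q.1 * (c1 : ℂ), q.2.1 * (c2 : ℂ), m, q.2.2.2) ∈ S.dom ρ V :=
  ⟨⟨S.t₁.smul_mem_closedDom hq.1.1 h1.1 h1.2,
      mul_ne_zero hq.1.2 (ofReal_ne_zero.2 h1.1.ne')⟩,
    ⟨S.t₂.smul_mem_closedDom hq.2.1.1 h2.1 h2.2,
      mul_ne_zero hq.2.1.2 (ofReal_ne_zero.2 h2.1.ne')⟩, mem_univ _, hq.2.2.2⟩

lemma CauchyData.smul_mem_domH {q : ℂ × ℂ × ℂ} (hq : q ∈ S.domH ρ V)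
    (h1 : c1 ∈ Ioc 0 1) (h2 : c2 ∈ Ioc 0 1) :
    (q.1 * (c1 : ℂ), q.2.1 * (c2 : ℂ), q.2.2) ∈ S.domH ρ V :=
  ⟨⟨S.t₁.smul_mem_openDom hq.1.1 h1.1 h1.2,
      mul_ne_zero hq.1.2 (ofReal_ne_zero.2 h1.1.ne')⟩,
    ⟨S.t₂.smul_mem_openDom hq.2.1.1 h2.1 h2.2,
      mul_ne_zero hq.2.1.2 (ofReal_ne_zero.2 h2.1.ne')⟩, hq.2.2⟩

lemma Reg.swap (h : Reg S ρ V G) : Reg S.swap ρ V fun q => G (q.2.1, q.1, q.2.2) :=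
  ⟨h.cont.comp (f := fun q : ℙ => (q.2.1, q.1, q.2.2)) fp!
      fun q hq => ⟨hq.2.1, hq.1, hq.2.2⟩,
    fun m => (h.holo m).comp (f := fun q : ℂ × ℂ × ℂ => (q.2.1, q.1, q.2.2)) fp!
      fun q hq => ⟨hq.2.1, hq.1, hq.2.2⟩⟩

namespace Reg

lemma const (c : ℂ) : Reg S ρ V fun _ => c :=
  ⟨continuousOn_const, fun _ => differentiableOn_const c⟩

lemma add (h : Reg S ρ V G) (h' : Reg S ρ V G') : Reg S ρ V fun q => G q + G' q :=
  ⟨h.cont.add h'.cont, fun m => (h.holo m).add (h'.holo m)⟩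

lemma mul (h : Reg S ρ V G) (h' : Reg S ρ V G') : Reg S ρ V fun q => G q * G' q :=
  ⟨h.cont.mul h'.cont, fun m => (h.holo m).mul (h'.holo m)⟩

lemma sub (h : Reg S ρ V G) (h' : Reg S ρ V G') : Reg S ρ V fun q => G q - G' q :=
  ⟨h.cont.sub h'.cont, fun m => (h.holo m).sub (h'.holo m)⟩

lemma pow (h : Reg S ρ V G) (n : ℕ) : Reg S ρ V fun q => G q ^ n :=
  ⟨h.cont.pow n, fun m => (h.holo m).pow n⟩

lemma inv (h : Reg S ρ V G) (h0 : ∀ q ∈ S.dom ρ V, G q ≠ 0) : Reg S ρ V fun q => (G q)⁻¹ :=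
  ⟨h.cont.inv₀ h0, fun m => (h.holo m).inv fun _ hp => h0 _ (CauchyData.mem_dom_of_mem_domH hp m)⟩

lemma sum {ι : Type*} (s : Finset ι) {G : ι → ℙ → ℂ} (h : ∀ i ∈ s, Reg S ρ V (G i)) :
    Reg S ρ V fun q => ∑ i ∈ s, G i q :=
  ⟨continuousOn_finsetSum s fun i hi => (h i hi).cont, fun m =>
    DifferentiableOn.fun_sum fun i hi => (h i hi).holo m⟩

lemma congr (h : Reg S ρ V G) (h' : ∀ q ∈ S.dom ρ V, G' q = G q) : Reg S ρ V G' :=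
  ⟨h.cont.congr h', fun m => (h.holo m).congr fun _ hp =>
    h' _ (CauchyData.mem_dom_of_mem_domH hp m)⟩

lemma coord1 : Reg S ρ V fun q => q.1 :=
  ⟨continuousOn_fst, fun _ => differentiableOn_fst⟩

lemma coord2 : Reg S ρ V fun q => q.2.1 :=
  ⟨by fun_prop, fun _ => by fun_prop⟩

lemma eval (p : ℂ[X]) (a b : ℝ) : Reg S ρ V fun q => p.eval (I * ((a * q.2.2.1 + b : ℝ) : ℂ)) :=
  ⟨(p.continuous.comp fp!).continuousOn, fun m =>
    differentiableOn_const (p.eval (I * ((a * m + b : ℝ) : ℂ)))⟩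

lemma eval' (p : ℂ[X]) : Reg S ρ V fun q => p.eval (I * (q.2.2.1 : ℂ)) :=
  ⟨(p.continuous.comp fp!).continuousOn, fun m =>
    differentiableOn_const (p.eval (I * (m : ℂ)))⟩

lemma eps {g : ℂ → ℂ} (hg : DifferentiableOn ℂ g V) : Reg S ρ V fun q => g q.2.2.2 :=
  ⟨hg.continuousOn.comp fp! fun q hq => hq.2.2.2, fun _ =>
    hg.comp fp! fun q hq => hq.2.2⟩

lemma scale (h : Reg S ρ V G) (h1 : c1 ∈ Ioc 0 1) (h2 : c2 ∈ Ioc 0 1)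
    (a b : ℝ) : Reg S ρ V fun q =>
      G (q.1 * (c1 : ℂ), q.2.1 * (c2 : ℂ), a * q.2.2.1 + b, q.2.2.2) :=
  ⟨h.cont.comp (f := fun q : ℙ => (q.1 * (c1 : ℂ), q.2.1 * (c2 : ℂ), a * q.2.2.1 + b, q.2.2.2))
      fp! fun q hq => CauchyData.smul_mem_dom hq h1 h2 _,
    fun m => (h.holo (a * m + b)).comp
      (f := fun q : ℂ × ℂ × ℂ => (q.1 * (c1 : ℂ), q.2.1 * (c2 : ℂ), q.2.2))
      fp! fun q hq => CauchyData.smul_mem_domH hq h1 h2⟩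

/-- Integrals over a parameter, with locally uniform majorants. -/
lemma integral {α : Type*} [MeasurableSpace α] {ν : Measure α} {s : Set α}
    (hs : MeasurableSet s) {G : α → ℙ → ℂ} (h : ∀ a ∈ s, Reg S ρ V (G a))
    (hm : ∀ q ∈ S.dom ρ V, AEStronglyMeasurable (fun a => G a q) (ν.restrict s))
    (hb : ∀ q0 ∈ S.dom ρ V, ∃ bound : α → ℝ, IntegrableOn bound s ν ∧
      ∀ᶠ q in 𝓝[S.dom ρ V] q0, ∀ a ∈ s, ‖G a q‖ ≤ bound a) :
    Reg S ρ V fun q => ∫ a in s, G a q ∂ν := by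
  refine ⟨continuousOn_setIntegral hs (F := fun q a => G a q) (fun a ha => (h a ha).cont) hm hb,
    fun m => differentiableOn_setIntegral hs (F := fun (p : ℂ × ℂ × ℂ) a => G a (p.1, p.2.1, m, p.2.2))
      isOpen_domH (fun a ha => (h a ha).holo m)
      (fun p hp => hm _ (CauchyData.mem_dom_of_mem_domH hp m)) fun p hp => ?_⟩
  obtain ⟨bound, hbi, hbe⟩ := hb _ (CauchyData.mem_dom_of_mem_domH hp m)
  have ht : Tendsto (fun p : ℂ × ℂ × ℂ => (p.1, p.2.1, m, p.2.2)) (𝓝[S.domH ρ V] p)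
      (𝓝[S.dom ρ V] (p.1, p.2.1, m, p.2.2)) :=
    ContinuousWithinAt.tendsto_nhdsWithin fp!
      fun p hp => CauchyData.mem_dom_of_mem_domH hp m
  exact ⟨bound, hbi, ht.eventually hbe⟩

/-- Integrals over a parameter, with a majorant which is a product. -/
lemma integral_of_le {α : Type*} [MeasurableSpace α] {ν : Measure α} {s : Set α}
    (hs : MeasurableSet s) {G : α → ℙ → ℂ} (h : ∀ a ∈ s, Reg S ρ V (G a))
    (hm : ∀ q ∈ S.dom ρ V, AEStronglyMeasurable (fun a => G a q) (ν.restrict s))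
    {κ : ℙ → ℝ} (hκ : ContinuousOn κ (S.dom ρ V)) {bd : α → ℝ} (hbd : IntegrableOn bd s ν)
    (hb : ∀ q ∈ S.dom ρ V, ∀ a ∈ s, ‖G a q‖ ≤ κ q * bd a) :
    Reg S ρ V fun q => ∫ a in s, G a q ∂ν := by
  refine integral hs h hm fun q0 hq0 => ⟨fun a => (|κ q0| + 1) * |bd a|, hbd.abs.const_mul _, ?_⟩
  have h1 : ∀ᶠ q in 𝓝[S.dom ρ V] q0, |κ q| < |κ q0| + 1 :=
    (hκ q0 hq0).abs.eventually_lt_const (by linarith)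
  filter_upwards [h1, self_mem_nhdsWithin] with q hq hq' a ha
  refine (hb q hq' a ha).trans ((le_abs_self _).trans ?_)
  rw [abs_mul]
  exact mul_le_r hq.le (abs_nonneg _)

end Reg

/-- `c` if `b` is true, else `1`. -/
def pw (b : Bool) (c : ℝ) : ℝ :=
  match b with
  | true => c
  | false => 1

/-- The product `cvB` as a functional of the two scaling factors. -/
def cvI (b : Bool) (k : ℕ) (Ψ : ℝ → ℝ → ℂ) : ℂ :=
  match b with
  | true => ∫ x in Ioo (0 : ℝ) 1, Ψ ((1 - x) ^ ((1 : ℝ) / k)) (x ^ ((1 : ℝ) / k)) /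
      (((1 - x) * x : ℝ) : ℂ)
  | false => Ψ 1 1

lemma cvB_eq_cvI (b : Bool) (k : ℕ) (B : ℂ → ℂ → ℂ) (τ : ℂ) :
    cvB b k B τ = cvI b k fun c c' => B (τ * (c : ℂ)) (τ * (c' : ℂ)) := by
  cases b
  · simp [cvB, cvI]
  · exact convB_eq_setIntegral k B τ

/-- The integrable majorant for `cvI`. -/
def cvMaj (k : ℕ) (x : ℝ) : ℝ := (1 - x) ^ ((1 : ℝ) / k - 1) * x ^ ((1 : ℝ) / k - 1)

lemma integrableOn_cvMaj (hk : 1 ≤ k) : IntegrableOn (cvMaj k) (Ioo 0 1) := by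
  have : (0 : ℝ) < k := mod_cast hk
  exact integrableOn_one_sub_rpow_mul_rpow pos! pos!

lemma root_mem_Ioc (hx : x ∈ Ioo (0 : ℝ) 1) : x ^ ((1 : ℝ) / k) ∈ Ioc 0 1 :=
  rpow_one_div_mem hx

lemma norm_cvI_integrand_le {Ψ : ℝ → ℝ → ℂ}
    (h : ∀ c ∈ Ioc (0 : ℝ) 1, ∀ c' ∈ Ioc (0 : ℝ) 1, ‖Ψ c c'‖ ≤ K * (c * c'))
    (hx : x ∈ Ioo (0 : ℝ) 1) :
    ‖Ψ ((1 - x) ^ ((1 : ℝ) / k)) (x ^ ((1 : ℝ) / k)) / (((1 - x) * x : ℝ) : ℂ)‖ ≤ K * cvMaj k x := by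
  have hx0 := hx.1
  have hx1 : 0 < 1 - x := by linarith [hx.2]
  have h1 := h _ (root_mem_Ioc (k := k) (one_sub_mem_Ioo hx)) _ (root_mem_Ioc (k := k) hx)
  rw [norm_div, norm_real, norm_of_nonneg pos!, div_le_iff₀ pos!,
    cvMaj, rpow_sub_one hx1.ne', rpow_sub_one hx0.ne']
  refine h1.trans_eq ?_
  field_simp

/-- The norm of `cvI`. -/
def cvIConst (b : Bool) (k : ℕ) : ℝ :=
  match b with
  | true => ∫ x in Ioo (0 : ℝ) 1, cvMaj k x
  | false => 1

lemma norm_cvI_le (hk : 1 ≤ k) (b : Bool) {Ψ : ℝ → ℝ → ℂ}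
    (h : ∀ c ∈ Ioc (0 : ℝ) 1, ∀ c' ∈ Ioc (0 : ℝ) 1, ‖Ψ c c'‖ ≤ K * (pw b c * c')) :
    ‖cvI b k Ψ‖ ≤ K * cvIConst b k := by
  cases b
  · have := h 1 (by simp) 1 (by simp)
    simpa [cvI, cvIConst, pw] using this
  · simp only [cvI, cvIConst]
    rw [← integral_const_mul]
    exact norm_integral_le_of_norm_le ((integrableOn_cvMaj hk).const_mul K)
      ((ae_restrict_iff' measurableSet_Ioo).2 (.of_forall fun x hx =>
        norm_cvI_integrand_le h hx))

lemma Reg.cvI (hk : 1 ≤ k) (b : Bool) {Ψ : ℝ → ℝ → ℙ → ℂ}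
    (h : ∀ c ∈ Ioc (0 : ℝ) 1, ∀ c' ∈ Ioc (0 : ℝ) 1, Reg S ρ V (Ψ c c'))
    (hm : ∀ q ∈ S.dom ρ V, Measurable fun p : ℝ × ℝ => Ψ p.1 p.2 q)
    {κ : ℙ → ℝ} (hκ : ContinuousOn κ (S.dom ρ V))
    (hb : ∀ q ∈ S.dom ρ V, ∀ c ∈ Ioc (0 : ℝ) 1, ∀ c' ∈ Ioc (0 : ℝ) 1,
      ‖Ψ c c' q‖ ≤ κ q * (pw b c * c')) :
    Reg S ρ V fun q => cvI b k fun c c' => Ψ c c' q := by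
  cases b
  · exact h 1 (by simp) 1 (by simp)
  · refine Reg.integral_of_le (κ := κ) measurableSet_Ioo (fun x hx => ?_) (fun q hq => ?_) hκ
      (integrableOn_cvMaj hk) fun q hq x hx => norm_cvI_integrand_le (hb q hq) hx
    · simp only [div_eq_mul_inv]
      exact (h _ (root_mem_Ioc (one_sub_mem_Ioo hx)) _ (root_mem_Ioc hx)).mul (Reg.const _)
    · have : Measurable fun x : ℝ => Ψ ((1 - x) ^ ((1 : ℝ) / k)) (x ^ ((1 : ℝ) / k)) q :=
        (hm q hq).comp (f := fun x : ℝ => ((1 - x) ^ ((1 : ℝ) / k), x ^ ((1 : ℝ) / k))) fp!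
      exact (this.div fp!).aestronglyMeasurable

/-- Regular functions which are small for small `τ1` and small `τ2`, so that the operators `mulB`
can be applied to them. -/
structure RegB (S : CauchyData) (ρ : ℝ) (V : Set ℂ) (f : ℂ → 𝔽) : Prop where
  reg : Reg S ρ V fun q => f q.2.2.2 q.1 q.2.1 q.2.2.1
  meas : ∀ ε ∈ V, Meas3 (f ε)
  bound : ∃ κ : ℙ → ℝ, ContinuousOn κ (S.dom ρ V) ∧ ∀ q ∈ S.dom ρ V,
    ∀ c1 ∈ Ioc (0 : ℝ) 1, ∀ c2 ∈ Ioc (0 : ℝ) 1,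
      ‖f q.2.2.2 (q.1 * (c1 : ℂ)) (q.2.1 * (c2 : ℂ)) q.2.2.1‖ ≤ κ q * (c1 * c2)

lemma Ioc_mul_mem (h : c ∈ Ioc 0 1) (h' : c' ∈ Ioc 0 1) :
    c * c' ∈ Ioc 0 1 :=
  ⟨mul_pos h.1 h'.1, mul_le_one₀ h.2 h'.1.le h'.2⟩

lemma norm_mul_ofReal_pow_le (z : ℂ) (hc : c ∈ Ioc 0 1) (hn : 1 ≤ n) :
    ‖(z * (c : ℂ)) ^ n‖ ≤ ‖z‖ ^ n * c := by
  rw [norm_pow, norm_mul, norm_real, norm_of_nonneg hc.1.le, mul_pow]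
  exact mul_le_l (pow_le_of_le_one hc.1.le hc.2 (by omega))

namespace RegB

variable {f g : ℂ → 𝔽}

lemma sum {ι : Type*} (s : Finset ι) {f : ι → ℂ → 𝔽} (h : ∀ i ∈ s, RegB S ρ V (f i)) :
    RegB S ρ V fun ε τ1 τ2 m => ∑ i ∈ s, f i ε τ1 τ2 m := by
  refine ⟨Reg.sum s fun i hi => (h i hi).reg, fun ε hε =>
    Finset.measurable_fun_sum s fun i hi => (h i hi).meas ε hε, ?_⟩
  choose! κ hκ hb using fun i (hi : i ∈ s) => (h i hi).bound
  refine ⟨fun q => ∑ i ∈ s, κ i q, continuousOn_finsetSum s hκ, fun q hq c1 h1 c2 h2 => ?_⟩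
  rw [sum_mul]
  exact norm_sum_le_of_le s fun i hi => hb i hi q hq c1 h1 c2 h2

lemma add (hf : RegB S ρ V f) (hg : RegB S ρ V g) :
    RegB S ρ V fun ε τ1 τ2 m => f ε τ1 τ2 m + g ε τ1 τ2 m := by
  obtain ⟨κ, hκ, hb⟩ := hf.bound
  obtain ⟨κ', hκ', hb'⟩ := hg.bound
  refine ⟨hf.reg.add hg.reg, fun ε hε => (hf.meas ε hε).add (hg.meas ε hε),
    fun q => κ q + κ' q, hκ.add hκ', fun q hq c1 h1 c2 h2 => ?_⟩
  rw [add_mul]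
  exact (norm_add_le _ _).trans (add_le_add (hb q hq c1 h1 c2 h2) (hb' q hq c1 h1 c2 h2))

lemma swap (hf : RegB S ρ V f) : RegB S.swap ρ V fun ε τ1 τ2 m => f ε τ2 τ1 m := by
  obtain ⟨κ, hκ, hb⟩ := hf.bound
  exact ⟨hf.reg.swap, fun ε hε => (hf.meas ε hε).comp,
    fun q => κ (q.2.1, q.1, q.2.2), hκ.comp (f := fun q : ℙ => (q.2.1, q.1, q.2.2)) fp!
      fun q hq => ⟨hq.2.1, hq.1, hq.2.2⟩, fun q hq c1 h1 c2 h2 => by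
    simpa only [mul_comm c2] using hb (q.2.1, q.1, q.2.2) ⟨hq.2.1, hq.1, hq.2.2⟩ c2 h2 c1 h1⟩

lemma monomial_mul (hf : RegB S ρ V f) (a : ℂ) (n : ℕ) :
    RegB S ρ V fun ε τ1 τ2 m => a * τ1 ^ n * f ε τ1 τ2 m := by
  obtain ⟨κ, hκ, hb⟩ := hf.bound
  refine ⟨((Reg.const a).mul (Reg.coord1.pow n)).mul hf.reg, fun ε hε =>
    Measurable.mul fp! (hf.meas ε hε), fun q => ‖a‖ * ‖q.1‖ ^ n * κ q,
    ContinuousOn.mul fp! hκ, fun q hq c1 h1 c2 h2 => ?_⟩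
  rw [norm_mul, mul_assoc _ (κ q), norm_mul, norm_pow, norm_mul, norm_real, norm_of_nonneg h1.1.le]
  have := mul_le_of_le_one_right (norm_nonneg q.1) h1.2
  have := h1.1
  gcongr
  exact hb q hq c1 h1 c2 h2

lemma const_mul (hf : RegB S ρ V f) (c : ℂ) : RegB S ρ V fun ε τ1 τ2 m => c * f ε τ1 τ2 m := by
  simpa using hf.monomial_mul c 0

lemma kpow (hf : RegB S ρ V f) (k p : ℕ) :
    RegB S ρ V fun ε τ1 τ2 m => ((k : ℂ) * τ1 ^ k) ^ p * f ε τ1 τ2 m := by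
  simpa only [mul_pow, ← pow_mul] using hf.monomial_mul (k ^ p) (k * p)

lemma mulB_eq_cvI (hk : 1 ≤ k) (n : ℕ) (f : ℂ → ℂ) (τ : ℂ) :
    mulB k n f τ = TwoTime.cvI true k fun c c' =>
      (τ * (c : ℂ)) ^ n / (Gamma ((n : ℝ) / k) : ℝ) * f (τ * (c' : ℂ)) := by
  rw [mulB_eq_convB hk]
  exact cvB_eq_cvI true k (fun x y => x ^ n / (Gamma ((n : ℝ) / k) : ℝ) * f y) τ

lemma norm_monomial_mul_le (hn : 1 ≤ n) (G : ℝ) (τ z : ℂ) {a : ℝ}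
    (hc : c ∈ Ioc 0 1) (hz : ‖z‖ ≤ K * a) :
    ‖(τ * (c : ℂ)) ^ n / (G : ℂ) * z‖ ≤ ‖τ‖ ^ n / |G| * K * (c * a) := by
  rw [norm_mul, norm_div, norm_real, Real.norm_eq_abs]
  calc _ ≤ ‖τ‖ ^ n * c / |G| * (K * a) := by
        refine mul_le_mul (div_le_r (norm_mul_ofReal_pow_le τ hc hn) (abs_nonneg _))
          hz (norm_nonneg _) ?_
        have := hc.1
        positivity
    _ = _ := by ring

lemma mulB1 (hf : RegB S ρ V f) {n : ℕ} (hn : 1 ≤ n) :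
    RegB S ρ V fun ε τ1 τ2 m => mulB S.t₁.k n (fun σ => f ε σ τ2 m) τ1 := by
  have hk := H.k1
  set k := S.t₁.k
  obtain ⟨κ, hκ, hb⟩ := hf.bound
  have one : (1 : ℝ) ∈ Ioc 0 1 := by simp
  have hκ' : ContinuousOn (fun q : ℙ => ‖q.1‖ ^ n / |Gamma ((n : ℝ) / k)| * κ q)
      (S.dom ρ V) := ContinuousOn.mul fp! hκ
  refine ⟨?_, fun ε hε => ?_, ?_⟩
  · simp only [mulB_eq_cvI hk]
    refine Reg.cvI hk true (Ψ := fun c c' q => (q.1 * (c : ℂ)) ^ n / (Gamma ((n : ℝ) / k) : ℝ) *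
      f q.2.2.2 (q.1 * (c' : ℂ)) q.2.1 q.2.2.1) (fun c hc c' hc' => ?_) (fun q hq => ?_) hκ'
      fun q hq c hc c' hc' => ?_
    · have u1 := hf.reg.scale hc' one 1 0
      simp only [ofReal_one, mul_one, one_mul, add_zero] at u1
      simp only [div_eq_mul_inv]
      exact (((Reg.coord1.mul (Reg.const _)).pow n).mul (Reg.const _)).mul u1
    · have := (hf.meas _ hq.2.2.2).comp (a := fun p : ℝ × ℝ => q.1 * (p.2 : ℂ)) (b := fun _ => q.2.1)
        (c := fun _ => q.2.2.1) fp! fp! fp!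
      exact Measurable.mul fp! this
    · have u1 := hb q hq c' hc' 1 one
      rw [mul_one, ofReal_one, mul_one] at u1
      exact norm_monomial_mul_le hn _ _ _ hc u1
  · exact measurable_mulB hk n (f := fun p : ℂ × ℂ × ℝ => fun σ => f ε σ p.2.1 p.2.2)
      (τ := fun p => p.1) ((hf.meas ε hε).comp) fp!
  · refine ⟨fun q => ‖q.1‖ ^ n / |Gamma ((n : ℝ) / k)| * κ q * cvIConst true k,
      hκ'.mul continuousOn_const, fun q hq c1 h1 c2 h2 => ?_⟩
    rw [mulB_eq_cvI hk]
    refine (norm_cvI_le hk true (K := ‖q.1‖ ^ n / |Gamma ((n : ℝ) / k)| * κ q * (c1 * c2))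
      fun c hc c' hc' => ?_).trans_eq (by ring)
    have u1 := hb q hq (c1 * c') (Ioc_mul_mem h1 hc') c2 h2
    have e1 : q.1 * ((c1 * c' : ℝ) : ℂ) = q.1 * (c1 : ℂ) * (c' : ℂ) := by push_cast; ring
    rw [e1] at u1
    refine (norm_monomial_mul_le hn _ _ _ hc (K := κ q) (a := c1 * c' * c2) u1).trans ?_
    have u2 : ‖q.1 * (c1 : ℂ)‖ ≤ ‖q.1‖ := by
      rw [norm_mul, norm_real, norm_of_nonneg h1.1.le]
      exact mul_le_of_le_one_right (norm_nonneg _) h1.2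
    have h3 : 0 ≤ κ q := by
      have := (norm_nonneg _).trans (hb q hq 1 one 1 one)
      simpa using this
    have := h1.1; have := h2.1; have := hc.1; have := hc'.1
    calc _ ≤ ‖q.1‖ ^ n / |Gamma ((n : ℝ) / k)| * κ q * (c * (c1 * c' * c2)) := by gcongr
      _ = _ := by rw [pw]; ring

lemma mulB2 (hf : RegB S ρ V f) {n : ℕ} (hn : 1 ≤ n) :
    RegB S ρ V fun ε τ1 τ2 m => mulB S.t₂.k n (fun σ => f ε τ1 σ m) τ2 :=
  (hf.swap.mulB1 hn).swap

lemma lowB1 (hf : RegB S ρ V f) (δ : ℕ) :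
    RegB S ρ V fun ε τ1 τ2 m => lowB S.t₁.k δ (fun σ => f ε σ τ2 m) τ1 := by
  refine RegB.sum _ fun p hp => ?_
  rw [Finset.mem_Icc] at hp
  exact ((hf.kpow _ p).mulB1 (Nat.mul_pos H.k1 (by omega))).const_mul _

lemma lowB2 (hf : RegB S ρ V f) (δ : ℕ) :
    RegB S ρ V fun ε τ1 τ2 m => lowB S.t₂.k δ (fun σ => f ε τ1 σ m) τ2 :=
  (hf.swap.lowB1 δ).swap

lemma derivB1 (hf : RegB S ρ V f) (δ : ℕ) :
    RegB S ρ V fun ε τ1 τ2 m => derivB S.t₁.k δ (fun σ => f ε σ τ2 m) τ1 :=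
  (hf.kpow _ δ).add (hf.lowB1 δ)

lemma derivB2 (hf : RegB S ρ V f) (δ : ℕ) :
    RegB S ρ V fun ε τ1 τ2 m => derivB S.t₂.k δ (fun σ => f ε τ1 σ m) τ2 :=
  (hf.swap.derivB1 δ).swap

end RegB

end

/-- The growth of the weight `wt e` at `z`, without the decay. -/
def TimeData.ze (t : TimeData) (e : ℝ) (z : ℂ) : ℝ := ‖z‖ ^ e * exp (t.ν * ‖z‖ ^ t.k)

/-- The limit of the weight `wtb b` along `c ↦ c z`, as `c → 0`, up to the factor `pw b c`. -/
def TimeData.zb (t : TimeData) (b : Bool) (z : ℂ) : ℝ :=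
  match b with
  | true => t.ze 1 z
  | false => 1

lemma TimeData.continuous_ze (t : TimeData) (he : 0 ≤ e) : Continuous (t.ze e) :=
  (continuous_norm.rpow_const fun _ => Or.inr he).mul fp!

lemma TimeData.continuous_zb (t : TimeData) (b : Bool) : Continuous (t.zb b) := by
  cases b
  · exact continuous_const
  · exact t.continuous_ze zero_le_one

lemma TimeData.wt_smul_le (t : TimeData) (hν : 0 < t.ν) (he : 1 ≤ e) (z : ℂ)
    (hc : c ∈ Ioc 0 1) : t.wt e (z * (c : ℂ)) ≤ c * t.ze e z := by
  have hc0 := hc.1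
  have h2 : c ^ e ≤ c := by simpa using Real.rpow_le_rpow_of_exponent_ge hc.1 hc.2 he
  have h3 : ‖z‖ * c ≤ ‖z‖ := mul_le_of_le_one_right (norm_nonneg z) hc.2
  rw [TimeData.wt, norm_mul, norm_real, norm_of_nonneg hc0.le]
  calc _ ≤ (‖z‖ * c) ^ e * exp (t.ν * (‖z‖ * c) ^ t.k) := by
        gcongr
        exact div_le_self pos! (le_add_of_nonneg_right pos!)
    _ ≤ (‖z‖ ^ e * c) * exp (t.ν * ‖z‖ ^ t.k) := by
        rw [mul_rpow (norm_nonneg _) hc0.le]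
        gcongr
    _ = _ := by rw [ze]; ring

lemma TimeData.wtb_smul_le (t : TimeData) (hν : 0 < t.ν) (b : Bool) (z : ℂ)
    (hc : c ∈ Ioc 0 1) : t.wtb b (z * (c : ℂ)) ≤ pw b c * t.zb b z := by
  cases b
  · exact (mul_one 1).ge
  · exact t.wt_smul_le hν le_rfl z hc

lemma Dom.continuousOn_div (H : Dom S ρ V) {u1 u2 : ℂ → ℝ} (h1 : Continuous u1) (h2 : Continuous u2) {D : Set ℙ}
    (hD : ∀ q ∈ D, q.2.2.2 ∈ V) :
    ContinuousOn (fun q : ℙ => u1 (q.1 / q.2.2.2) * u2 (q.2.1 / q.2.2.2)) D :=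
  have h0 := fun q hq => H.ne_zero _ (hD q hq)
  (h1.comp_continuousOn (ContinuousOn.div fp! fp! h0)).mul
    (h2.comp_continuousOn (ContinuousOn.div fp! fp! h0))

section
variable [H : Dom S ρ V] {f g : ℂ → 𝔽}

/-- A bound by a product weight, at the points of the segments `c ↦ c τ`. -/
lemma CauchyData.Bd.norm_smul_le {w1 w2 : ℂ → ℝ} {f : 𝔽} (hK : 0 ≤ K)
    (hf : S.Bd ρ (fun τ1 τ2 m => w1 (τ1 / ε) * w2 (τ2 / ε) * fw β s m) K f) {q : ℙ}
    (hq : q ∈ S.dom ρ V) (h1 : c1 ∈ Ioc 0 1) (h2 : c2 ∈ Ioc 0 1) (m : ℝ)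
    (h0 : ∀ z, 0 ≤ w1 z) (h0' : ∀ z, 0 ≤ w2 z)
    {v1 v2 : ℝ} (hw1 : w1 (q.1 / ε * (c1 : ℂ)) ≤ v1) (hw2 : w2 (q.2.1 / ε * (c2 : ℂ)) ≤ v2) :
    ‖f (q.1 * (c1 : ℂ)) (q.2.1 * (c2 : ℂ)) m‖ ≤ K * (v1 * v2 * fw β s m) := by
  have hm := S.smul_mem_dom hq h1 h2 m
  refine (hf _ hm.1.1 _ hm.2.1.1 m).trans ?_
  beta_reduce
  rw [mul_div_right_comm, mul_div_right_comm]
  have := (fw_pos β s m).le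
  have := h0' (q.2.1 / ε * (c2 : ℂ))
  have := (h0 _).trans hw1
  gcongr

lemma CauchyData.bound_of_bd (hK : 0 ≤ K) {e1 e2 : ℝ} (he1 : 1 ≤ e1) (he2 : 1 ≤ e2)
    (hb : ∀ ε ∈ V, S.Bd ρ (S.W β ε e1 e2 s) K (f ε)) :
    ∃ κ : ℙ → ℝ, ContinuousOn κ (S.dom ρ V) ∧ ∀ q ∈ S.dom ρ V,
      ∀ c1 ∈ Ioc (0 : ℝ) 1, ∀ c2 ∈ Ioc (0 : ℝ) 1,
        ‖f q.2.2.2 (q.1 * (c1 : ℂ)) (q.2.1 * (c2 : ℂ)) q.2.2.1‖ ≤ κ q * (c1 * c2) := by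
  refine ⟨fun q => K * (S.t₁.ze e1 (q.1 / q.2.2.2) * S.t₂.ze e2 (q.2.1 / q.2.2.2) *
    fw β s q.2.2.1), ?_, fun q hq c1 h1 c2 h2 => ((hb _ hq.2.2.2).norm_smul_le hK hq h1 h2 _
      (S.t₁.wt_nonneg e1) (S.t₂.wt_nonneg e2) (S.t₁.wt_smul_le H.ν1 he1 _ h1)
      (S.t₂.wt_smul_le H.ν2 he2 _ h2)).trans_eq (by ring)⟩
  have := H.continuousOn_div (S.t₁.continuous_ze (zero_le_one.trans he1))
    (S.t₂.continuous_ze (zero_le_one.trans he2)) (D := S.dom ρ V) fun q hq => hq.2.2.2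
  have := continuous_fw β s
  fun_prop

/-- A regular family of functions `f ε` with bounds, uniform in `ε`, by the weight `Wb`. -/
structure RegW (S : CauchyData) (ρ β μ : ℝ) (V : Set ℂ) (b1 b2 : Bool) (K : ℝ)
    (f : ℂ → 𝔽) : Prop where
  reg : Reg S ρ V fun q => f q.2.2.2 q.1 q.2.1 q.2.2.1
  nonneg : 0 ≤ K
  ball : ∀ ε ∈ V, S.Ball ρ (S.Wb β ε b1 b2 (-μ)) K (f ε)

lemma RegW.regB (hf : RegW S ρ β μ V true true K f) : RegB S ρ V f :=
  ⟨hf.reg, fun ε hε => (hf.ball ε hε).meas,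
    bound_of_bd hf.nonneg le_rfl le_rfl fun ε hε => (hf.ball ε hε).bd⟩

/-- A symbol `A(im, ε)` which is regular and bounded by `a`. -/
structure RegSymbol (S : CauchyData) (ρ : ℝ) (V : Set ℂ) (A : ℂ → ℂ[X]) (a : ℝ → ℝ) : Prop where
  reg : ∀ x y : ℝ, Reg S ρ V fun q => (A q.2.2.2).eval (I * ((x * q.2.2.1 + y : ℝ) : ℂ))
  le : ∀ ε ∈ V, ∀ m : ℝ, ‖(A ε).eval (I * m)‖ ≤ a m

variable {C : ℝ} {A B : ℂ → ℂ[X]}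

lemma RegW.norm_smul_le (hf : RegW S ρ β μ V b1 b2 K f) {q : ℙ} (hq : q ∈ S.dom ρ V)
    (h1 : c1 ∈ Ioc 0 1) (h2 : c2 ∈ Ioc 0 1) (m : ℝ) :
    ‖f q.2.2.2 (q.1 * (c1 : ℂ)) (q.2.1 * (c2 : ℂ)) m‖ ≤
      K * (S.t₁.zb b1 (q.1 / q.2.2.2) * S.t₂.zb b2 (q.2.1 / q.2.2.2)) * (pw b1 c1 * pw b2 c2) *
        fw β (-μ) m :=
  ((hf.ball _ hq.2.2.2).bd.norm_smul_le hf.nonneg hq h1 h2 m (S.t₁.wtb_nonneg b1) (S.t₂.wtb_nonneg b2)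
    (S.t₁.wtb_smul_le H.ν1 b1 _ h1) (S.t₂.wtb_smul_le H.ν2 b2 _ h2)).trans_eq (by ring)

lemma continuousOn_zb (b1 b2 : Bool) :
    ContinuousOn (fun q : ℙ => S.t₁.zb b1 (q.1 / q.2.2.2) * S.t₂.zb b2 (q.2.1 / q.2.2.2))
      (S.dom ρ V) :=
  H.continuousOn_div (S.t₁.continuous_zb b1) (S.t₂.continuous_zb b2) fun _ hq => hq.2.2.2

lemma ConvMaj.reg_fourierConv (h : ConvMaj β μ M C s a b) (hA : RegSymbol S ρ V A a) (hB : RegSymbol S ρ V B b)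
    (hf : RegW S ρ β μ V b1 b2 K f) (hg : RegW S ρ β μ V true true K' g) {c1' c2' : ℝ}
    (h1 : c1 ∈ Ioc 0 1) (h1' : c1' ∈ Ioc 0 1) (h2 : c2 ∈ Ioc 0 1)
    (h2' : c2' ∈ Ioc 0 1) :
    Reg S ρ V fun q => fourierConv (A q.2.2.2) (B q.2.2.2)
      (f q.2.2.2 (q.1 * (c1 : ℂ)) (q.2.1 * (c2 : ℂ)))
      (g q.2.2.2 (q.1 * (c1' : ℂ)) (q.2.1 * (c2' : ℂ))) q.2.2.1 := by
  unfold fourierConv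
  simp only [← setIntegral_univ (μ := volume)]
  refine (Reg.const _).mul (Reg.integral_of_le MeasurableSet.univ (fun m1 _ => ?_) (fun q hq => ?_)
    (κ := fun q => K * (S.t₁.zb b1 (q.1 / q.2.2.2) * S.t₂.zb b2 (q.2.1 / q.2.2.2)) *
      (pw b1 c1 * pw b2 c2) * (K' * (S.t₁.zb true (q.1 / q.2.2.2) * S.t₂.zb true (q.2.1 / q.2.2.2)) *
      (pw true c1' * pw true c2'))) ?_ (bd := fun m1 => C * (b m1 * fw β (-μ) m1))
    (h.int_b.const_mul C).integrableOn fun q hq m1 _ => ?_)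
  · have e1 := hA.reg 1 (-m1)
    have e2 := hf.reg.scale h1 h2 1 (-m1)
    have e3 := hB.reg 0 m1
    have e4 := hg.reg.scale h1' h2' 0 m1
    simp only [one_mul, zero_mul, zero_add, ← sub_eq_add_neg] at e1 e2 e3 e4
    exact (e1.mul e2).mul (e3.mul e4)
  · have hA' : Measurable fun x : ℂ => (A q.2.2.2).eval x := (A q.2.2.2).continuous.measurable
    have hB' : Measurable fun x : ℂ => (B q.2.2.2).eval x := (B q.2.2.2).continuous.measurable
    have hf' : Measurable (f q.2.2.2 (q.1 * (c1 : ℂ)) (q.2.1 * (c2 : ℂ))) := (hf.ball _ hq.2.2.2).meas.comp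
    have hg' : Measurable (g q.2.2.2 (q.1 * (c1' : ℂ)) (q.2.1 * (c2' : ℂ))) :=
      (hg.ball _ hq.2.2.2).meas.comp
    exact (by fun_prop : Measurable _).aestronglyMeasurable
  · have z1 := continuousOn_zb (S := S) (ρ := ρ) (V := V) b1 b2
    have z2 := continuousOn_zb (S := S) (ρ := ρ) (V := V) true true
    fun_prop
  · exact h.norm_integrand_le (hA.le _ hq.2.2.2) (hB.le _ hq.2.2.2)
      (fun m => hf.norm_smul_le hq h1 h2 m) (fun m => hg.norm_smul_le hq h1' h2' m)
      q.2.2.1 m1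

lemma ConvMaj.reg_bil (h : ConvMaj β μ M C s a b)
    (hA : RegSymbol S ρ V A a) (hB : RegSymbol S ρ V B b)
    (hf : RegW S ρ β μ V b1 b2 K f) (hg : RegW S ρ β μ V true true K' g) :
    Reg S ρ V fun q => bil S b1 b2 (A q.2.2.2) (B q.2.2.2) (f q.2.2.2) (g q.2.2.2) q.1 q.2.1 q.2.2.1 := by
  set κ : ℙ → ℝ := fun q => convMajConst C s *
    (K * (S.t₁.zb b1 (q.1 / q.2.2.2) * S.t₂.zb b2 (q.2.1 / q.2.2.2)) *
      (K' * (S.t₁.zb true (q.1 / q.2.2.2) * S.t₂.zb true (q.2.1 / q.2.2.2)))) * fw β (M - μ) q.2.2.1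
    with hκdef
  have hκ : ContinuousOn κ (S.dom ρ V) := by
    have z1 := continuousOn_zb (S := S) (ρ := ρ) (V := V) b1 b2
    have z2 := continuousOn_zb (S := S) (ρ := ρ) (V := V) true true
    have z3 := continuous_fw β (M - μ)
    fun_prop
  have hb : ∀ q ∈ S.dom ρ V, ∀ c ∈ Ioc (0 : ℝ) 1, ∀ c' ∈ Ioc (0 : ℝ) 1, ∀ d ∈ Ioc (0 : ℝ) 1,
      ∀ d' ∈ Ioc (0 : ℝ) 1, ‖fourierConv (A q.2.2.2) (B q.2.2.2)
      (f q.2.2.2 (q.1 * (c : ℂ)) (q.2.1 * (d : ℂ)))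
      (g q.2.2.2 (q.1 * (c' : ℂ)) (q.2.1 * (d' : ℂ))) q.2.2.1‖ ≤
        κ q * (pw b1 c * c') * (pw b2 d * d') := by
    intro q hq c hc c' hc' d hd d' hd'
    refine (h.norm_fourierConv_le (hA.le _ hq.2.2.2) (hB.le _ hq.2.2.2)
      (fun m => hf.norm_smul_le hq hc hd m) (fun m => hg.norm_smul_le hq hc' hd' m)
      q.2.2.1).trans_eq ?_
    rw [hκdef]
    simp only [pw]
    ring
  have hmeas : ∀ q ∈ S.dom ρ V, ∀ {α : Type} [MeasurableSpace α] {x1 y1 x2 y2 : α → ℂ},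
      Measurable x1 → Measurable y1 → Measurable x2 → Measurable y2 →
      Measurable fun p => fourierConv (A q.2.2.2) (B q.2.2.2) (f q.2.2.2 (x1 p) (x2 p))
        (g q.2.2.2 (y1 p) (y2 p)) q.2.2.1 := fun q hq α _ x1 y1 x2 y2 m1 m2 m3 m4 =>
    meas_fourierConv_four _ _ (hf.ball _ hq.2.2.2).meas (hg.ball _ hq.2.2.2).meas m1 m2 m3 m4 measurable_const
  unfold bil cv2
  simp only [cvB_eq_cvI b1]
  refine Reg.cvI H.k1 b1 (Ψ := fun c c' q => cvB b2 S.t₂.k (fun x2 y2 =>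
    fourierConv (A q.2.2.2) (B q.2.2.2) (f q.2.2.2 (q.1 * (c : ℂ)) x2)
      (g q.2.2.2 (q.1 * (c' : ℂ)) y2) q.2.2.1) q.2.1) (κ := fun q => κ q * cvIConst b2 S.t₂.k)
    (fun c hc c' hc' => ?_) (fun q hq => ?_) (hκ.mul continuousOn_const) fun q hq c hc c' hc' => ?_
  · simp only [cvB_eq_cvI b2]
    refine Reg.cvI H.k2 b2 (Ψ := fun d d' q => fourierConv (A q.2.2.2) (B q.2.2.2)
      (f q.2.2.2 (q.1 * (c : ℂ)) (q.2.1 * (d : ℂ)))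
      (g q.2.2.2 (q.1 * (c' : ℂ)) (q.2.1 * (d' : ℂ))) q.2.2.1) (κ := fun q => κ q * (pw b1 c * c'))
      (fun d hd d' hd' => h.reg_fourierConv hA hB hf hg hc hc' hd hd') (fun q hq => ?_)
      (hκ.mul continuousOn_const) fun q hq d hd d' hd' => hb q hq c hc c' hc' d hd d' hd'
    exact hmeas q hq fp! fp! fp! fp!
  · exact measurable_cvB b2 S.t₂.k (α := ℝ × ℝ) (B := fun p x2 y2 => fourierConv (A q.2.2.2) (B q.2.2.2)
      (f q.2.2.2 (q.1 * (p.1 : ℂ)) x2) (g q.2.2.2 (q.1 * (p.2 : ℂ)) y2) q.2.2.1) (τ := fun _ => q.2.1)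
      (hmeas q hq (α := (ℝ × ℝ) × ℂ × ℂ) fp! fp! fp! fp!)
      measurable_const
  · rw [cvB_eq_cvI b2]
    exact (norm_cvI_le H.k2 b2 fun d hd d' hd' => hb q hq c hc c' hc' d hd d' hd').trans_eq (by ring)

lemma ConvMaj.regB_bil (h : ConvMaj β μ M C s a b)
    (hA : RegSymbol S ρ V A a) (hB : RegSymbol S ρ V B b)
    (hf : RegW S ρ β μ V b1 b2 K f) (hg : RegW S ρ β μ V true true K' g) :
    RegB S ρ V fun ε => bil S b1 b2 (A ε) (B ε) (f ε) (g ε) := by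
  refine ⟨h.reg_bil hA hB hf hg,
    fun ε hε => meas3_bil S _ _ _ _ (hf.ball ε hε).meas (hg.ball ε hε).meas,
    CauchyData.bound_of_bd (K := cvConst S.t₁.k b1 * cvConst S.t₂.k b2 * convMajConst C s * (K * K'))
      ?_ (cvExp_mem b1).1 (cvExp_mem b2).1
    fun ε hε => (h.bil_bound (hA.le ε hε) (hB.le ε hε) H.k1 H.k2 (hf.ball ε hε)
      (hg.ball ε hε)).bd⟩
  have := cvConst_nonneg S.t₁.k b1
  have := cvConst_nonneg S.t₂.k b2
  have := h.const_nonneg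
  have := hf.nonneg
  have := hg.nonneg
  positivity

/-! ### Regularity of the fixed point operator -/

lemma CauchyData.reg_inv_den1 : Reg S ρ V fun q => (S.t₁.den q.2.2.1 q.1)⁻¹ := by
  refine Reg.inv ?_ fun q hq => S.t₁.den_ne_zero H.roots1 q.2.2.1 hq.1.1 hq.1.2
  unfold den Pm
  exact (Reg.coord1.pow _).mul (((Reg.eval' _).mul (Reg.const _)).sub
    (((Reg.eval' _).mul (Reg.const _)).mul (Reg.coord1.pow _)))

lemma CauchyData.reg_inv_den2 : Reg S ρ V fun q => (S.t₂.den q.2.2.1 q.2.1)⁻¹ :=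
  (reg_inv_den1 (S := S.swap)).swap

lemma CauchyData.reg_divOp
    (hf : Reg S ρ V fun q => f q.2.2.2 q.1 q.2.1 q.2.2.1) :
    Reg S ρ V fun q => S.divOp (f q.2.2.2) q.1 q.2.1 q.2.2.1 := by
  unfold divOp
  simp only [mul_inv]
  exact ((reg_inv_den1).mul (reg_inv_den2)).mul hf

lemma Reg.zpow (n : ℤ) : Reg S ρ V fun q => q.2.2.2 ^ n :=
  Reg.eps (g := fun ε => ε ^ n) fun ε hε =>
    (differentiableAt_zpow.2 (Or.inl (H.ne_zero ε hε))).differentiableWithinAt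

lemma CauchyData.reg_nrm (hf : RegB S ρ V f) :
    Reg S ρ V fun q => S.nrm q.2.2.2 (f q.2.2.2) q.1 q.2.1 q.2.2.1 :=
  reg_divOp (f := fun ε τ1 τ2 m => ε ^ (-2 : ℤ) *
    prodOp (fun _ => mulB S.t₁.k (S.t₁.k + 1)) (fun _ => mulB S.t₂.k (S.t₂.k + 1)) (f ε) τ1 τ2 m)
    ((Reg.zpow _).mul ((hf.mulB2 (by omega)).mulB1 (by omega)).reg)

lemma CauchyData.reg_leftOp (hf : RegB S ρ V f) :
    Reg S ρ V fun q => S.leftOp (f q.2.2.2) q.1 q.2.1 q.2.2.1 := by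
  have i1 := reg_inv_den1 (S := S) (ρ := ρ) (V := V)
  have i2 := reg_inv_den2 (S := S) (ρ := ρ) (V := V)
  have r1 : Reg S ρ V fun q => S.t₁.RD.eval (I * (q.2.2.1 : ℂ)) := Reg.eval' _
  have r2 : Reg S ρ V fun q => S.t₂.RD.eval (I * (q.2.2.1 : ℂ)) := Reg.eval' _
  have l2 := hf.lowB2 (S.t₂.δ S.t₂.D)
  refine Reg.add ?_ (Reg.add ?_ ((Reg.const (-1)).mul ?_))
  · exact ((r1.mul i1).mul (hf.lowB1 (S.t₁.δ S.t₁.D)).reg).congr fun q _ => by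
      simp only [prodOp, TimeData.kop, TimeData.den, div_eq_mul_inv]
  · exact ((r2.mul i2).mul l2.reg).congr fun q _ => by
      simp only [prodOp, TimeData.kop, TimeData.den, div_eq_mul_inv]
  · refine (((r2.mul i2).mul (r1.mul i1)).mul (l2.lowB1 (S.t₁.δ S.t₁.D)).reg).congr
      fun q _ => ?_
    unfold prodOp
    have e1 : (fun σ1 => S.t₂.kop q.2.2.1 (fun σ2 => f q.2.2.2 σ1 σ2 q.2.2.1) q.2.1) = fun σ1 =>
        S.t₂.RD.eval (I * q.2.2.1) * (S.t₂.den q.2.2.1 q.2.1)⁻¹ *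
        lowB S.t₂.k (S.t₂.δ S.t₂.D) (fun σ2 => f q.2.2.2 σ1 σ2 q.2.2.1) q.2.1 := by
      funext σ1
      simp only [TimeData.kop, TimeData.den, div_eq_mul_inv]
    rw [e1, S.t₁.kop_const_mul H.k1]
    simp only [TimeData.kop, TimeData.den, div_eq_mul_inv]
    ring

lemma CauchyData.reg_rightOp (hS : S.Setup ρ β μ r) (hf : RegB S ρ V f) :
    Reg S ρ V fun q => S.rightOp q.2.2.2 (f q.2.2.2) q.1 q.2.1 q.2.2.1 := by
  refine Reg.sum _ fun l1 hl1 => Reg.sum _ fun l2 hl2 => ?_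
  rw [Finset.mem_Icc] at hl1 hl2
  have d1 := (hS.time₁.dk_add hl1.1 hl1.2).2
  have d2 := (hS.time₂.dk_add hl2.1 hl2.2).2
  exact reg_divOp (f := fun ε τ1 τ2 m =>
    (S.R l1 l2).eval (I * m) * ε ^ S.epsExp l1 l2 *
      prodOp (fun _ f => mulB S.t₁.k (S.t₁.dk l1) (derivB S.t₁.k (S.t₁.δ l1) f))
        (fun _ f => mulB S.t₂.k (S.t₂.dk l2) (derivB S.t₂.k (S.t₂.δ l2) f)) (f ε) τ1 τ2 m)
    (((Reg.eval' _).mul (Reg.zpow _)).mul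
      ((((hf.derivB2 _).mulB2 d2).derivB1 _).mulB1 d1).reg)

lemma PolyAdmissible.regSymbol {P : ℂ → ℂ[X]} {N : ℕ} (hP : PolyAdmissible P r μ N)
    (hVr : V ⊆ closedBall 0 r)
    (ha : ∀ ε ∈ V, ∀ m : ℝ, ‖(P ε).eval (I * m)‖ ≤ a m) : RegSymbol S ρ V P a := by
  refine ⟨fun x y => ?_, ha⟩
  have h1 : Reg S ρ V fun q => ∑ i ∈ Finset.range (N + 1), (P q.2.2.2).coeff i *
      (Polynomial.X ^ i : ℂ[X]).eval (I * ((x * q.2.2.1 + y : ℝ) : ℂ)) :=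
    Reg.sum _ fun i _ => Reg.mul (Reg.eps (g := fun ε => (P ε).coeff i)
      ((hP.analytic i).differentiableOn.mono hVr)) (Reg.eval _ x y)
  refine h1.congr fun q hq => ?_
  rw [Polynomial.eval_eq_sum_range' (Nat.lt_succ_of_le (hP.deg_le _ (hVr hq.2.2.2)))]
  simp

lemma regSymbol_const (p : ℂ[X]) (ha : ∀ m : ℝ, ‖p.eval (I * m)‖ ≤ a m) :
    RegSymbol S ρ V (fun _ => p) a :=
  ⟨fun x y => Reg.eval p x y, fun _ _ => ha⟩

/-- Regularity of the coefficient functions. -/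
structure RegCoefs (S : CauchyData) (ρ : ℝ) (V : Set ℂ) (c : ℂ → Coefs) : Prop where
  φ : Reg S ρ V fun q => (c q.2.2.2).φ q.1 q.2.1 q.2.2.1
  φ1 : Reg S ρ V fun q => (c q.2.2.2).φ1 q.1 q.2.2.1
  φ2 : Reg S ρ V fun q => (c q.2.2.2).φ2 q.2.1 q.2.2.1
  c0 : Reg S ρ V fun q => (c q.2.2.2).c q.2.2.1
  ψ : Reg S ρ V fun q => (c q.2.2.2).ψ q.1 q.2.1 q.2.2.1

/-- The fixed point operator preserves regularity. -/
lemma CauchyData.reg_fixOp (hS : S.Setup ρ β μ r)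
    (hVr : V ⊆ closedBall 0 r) {c : ℂ → Coefs} (hζ : 0 ≤ ζ)
    (hc : ∀ ε ∈ V, (c ε).Small S ρ β μ ε ζ) (hcr : RegCoefs S ρ V c)
    (hf : RegW S ρ β μ V true true K f) :
    Reg S ρ V fun q => S.fixOp q.2.2.2 (c q.2.2.2) (f q.2.2.2) q.1 q.2.1 q.2.2.1 := by
  have hfB := hf.regB
  have wφ : RegW S ρ β μ V true true ζ fun ε => (c ε).φ :=
    ⟨hcr.φ, hζ, fun ε hε => (hc ε hε).φ⟩
  have wφ1 : RegW S ρ β μ V true false ζ fun ε x _ m => (c ε).φ1 x m :=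
    ⟨hcr.φ1, hζ, fun ε hε => (hc ε hε).φ1⟩
  have wφ2 : RegW S ρ β μ V false true ζ fun ε _ y m => (c ε).φ2 y m :=
    ⟨hcr.φ2, hζ, fun ε hε => (hc ε hε).φ2⟩
  have wc : RegW S ρ β μ V false false ζ fun ε _ _ m => (c ε).c m :=
    ⟨hcr.c0, hζ, fun ε hε => (hc ε hε).c⟩
  have wψ : RegW S ρ β μ V true true ζ fun ε => (c ε).ψ := ⟨hcr.ψ, hζ, fun ε hε => (hc ε hε).ψ⟩
  obtain ⟨CR, hCR, hR⟩ := exists_norm_eval_le hS.deg_R₀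
  obtain ⟨Cm, hm⟩ := convMaj_of_one hS.hβ (hS.one_lt_μ hS.hr) S.N hCR
  have sA : RegSymbol S ρ V (fun _ => 1) fun _ => 1 := regSymbol_const 1 norm_eval_one_le
  have sB : RegSymbol S ρ V (fun _ => S.R₀) fun m => CR * (1 + |m|) ^ S.N := regSymbol_const S.R₀ hR
  have regN : ∀ {g}, RegB S ρ V g →
      Reg S ρ V fun q => S.nrm q.2.2.2 (g q.2.2.2) q.1 q.2.1 q.2.2.1 :=
    fun hg => reg_nrm hg
  have regB : ∀ {b1 b2} {φ : ℂ → 𝔽}, RegW S ρ β μ V b1 b2 ζ φ →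
      RegB S ρ V fun ε => bil S b1 b2 1 S.R₀ (φ ε) (f ε) := fun hφ =>
    hm.regB_bil sA sB hφ hf
  obtain ⟨n, Cm', C1, C2, hm', hP⟩ := hS.exists_convMaj
  have s1 := hS.poly₁.regSymbol (S := S) (ρ := ρ) hVr fun ε hε m => (hP ε (hVr hε) m).1
  have s2 := hS.poly₂.regSymbol (S := S) (ρ := ρ) hVr fun ε hε m => (hP ε (hVr hε) m).2
  have h1 : Reg S ρ V fun q => S.leftOp (f q.2.2.2) q.1 q.2.1 q.2.2.1 := reg_leftOp hfB
  have h2 : Reg S ρ V fun q => S.rightOp q.2.2.2 (f q.2.2.2) q.1 q.2.1 q.2.2.1 := reg_rightOp hS hfB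
  have h3 := regN (regB wφ)
  have h4 := regN (regB wφ1)
  have h5 := regN (regB wφ2)
  have h6 := regN (regB wc)
  have h7 := regN (hm'.regB_bil s1 s2 hf hf)
  have h8 := regN wψ.regB
  exact (h1.add (h2.add (h3.add (h4.add (h5.add h6))))).add (h7.add h8)

end

/-! ### The solution of the convolution equation -/

section

/-- The increments of the iteration `w ↦ Φ w` started at `0`, cut off outside the closed domains. -/
def CauchyData.incr (S : CauchyData) (ρ : ℝ)
    (Φ : 𝔽 → 𝔽) (n : ℕ) (τ1 τ2 : ℂ) (m : ℝ) : ℂ :=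
  (S.t₁.closedDom ρ ×ˢ S.t₂.closedDom ρ).indicator
    (fun p => Φ^[n + 1] (fun _ _ _ => 0) p.1 p.2 m - Φ^[n] (fun _ _ _ => 0) p.1 p.2 m) (τ1, τ2)

/-- The limit of the iteration. -/
def CauchyData.picard (S : CauchyData) (ρ : ℝ)
    (Φ : 𝔽 → 𝔽) (τ1 τ2 : ℂ) (m : ℝ) : ℂ :=
  ∑' n, S.incr ρ Φ n τ1 τ2 m

namespace CauchyData.Contracts
variable {Φ : 𝔽 → 𝔽}

lemma ball_iterate (h : S.Contracts ρ β μ ϖ ε Φ) (hϖ : 0 ≤ ϖ) (n : ℕ) :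
    S.Ball ρ (S.W β ε 1 1 (-μ)) ϖ (Φ^[n] fun _ _ _ => 0) := by
  induction n with
  | zero =>
    exact ⟨hϖ, measurable_const, fun τ1 _ τ2 _ m => by
      simpa using mul_nonneg hϖ (S.W_nonneg β ε 1 1 (-μ) τ1 τ2 m)⟩
  | succ n ih => rw [iterate_succ_apply']; exact h.maps ih

lemma bd_sub_iterate (h : S.Contracts ρ β μ ϖ ε Φ) (hϖ : 0 ≤ ϖ) (n : ℕ) :
    S.Bd ρ (S.W β ε 1 1 (-μ)) (ϖ * (1 / 2) ^ n) fun τ1 τ2 m =>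
      Φ^[n + 1] (fun _ _ _ => 0) τ1 τ2 m - Φ^[n] (fun _ _ _ => 0) τ1 τ2 m := by
  induction n with
  | zero => simpa using (h.ball_iterate hϖ 1).bd
  | succ n ih =>
    have := h.half (h.ball_iterate hϖ (n + 1)) (h.ball_iterate hϖ n) pos! ih
    rw [← iterate_succ_apply' Φ (n + 1), ← iterate_succ_apply' Φ n] at this
    convert! this using 1
    ring

lemma incr_of_mem (h1 : τ1 ∈ S.t₁.closedDom ρ) (h2 : τ2 ∈ S.t₂.closedDom ρ) (n : ℕ)
    (m : ℝ) : S.incr ρ Φ n τ1 τ2 m =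
      Φ^[n + 1] (fun _ _ _ => 0) τ1 τ2 m - Φ^[n] (fun _ _ _ => 0) τ1 τ2 m :=
  indicator_of_mem (show (τ1, τ2) ∈ S.t₁.closedDom ρ ×ˢ S.t₂.closedDom ρ from ⟨h1, h2⟩) _

lemma norm_incr_le (h : S.Contracts ρ β μ ϖ ε Φ) (hϖ : 0 ≤ ϖ) (n : ℕ) (τ1 τ2 : ℂ) (m : ℝ) :
    ‖S.incr ρ Φ n τ1 τ2 m‖ ≤ ϖ * S.W β ε 1 1 (-μ) τ1 τ2 m * (1 / 2) ^ n := by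
  by_cases hp : (τ1, τ2) ∈ S.t₁.closedDom ρ ×ˢ S.t₂.closedDom ρ
  · rw [incr_of_mem hp.1 hp.2]
    refine (h.bd_sub_iterate hϖ n τ1 hp.1 τ2 hp.2 m).trans_eq (by ring)
  · rw [CauchyData.incr, indicator_of_notMem hp, norm_zero]
    have := S.W_nonneg β ε 1 1 (-μ) τ1 τ2 m
    positivity

lemma summable_incr (h : S.Contracts ρ β μ ϖ ε Φ) (hϖ : 0 ≤ ϖ) (τ1 τ2 : ℂ) (m : ℝ) :
    Summable fun n => S.incr ρ Φ n τ1 τ2 m :=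
  Summable.of_norm_bounded (summable_geometric_two.mul_left _) fun n =>
    h.norm_incr_le hϖ n τ1 τ2 m

lemma meas_incr (h : S.Contracts ρ β μ ϖ ε Φ) (hϖ : 0 ≤ ϖ) (n : ℕ) : Meas3 (S.incr ρ Φ n) := by
  have hs : MeasurableSet {p : ℂ × ℂ × ℝ | (p.1, p.2.1) ∈ S.t₁.closedDom ρ ×ˢ S.t₂.closedDom ρ} :=
    ((S.t₁.measurableSet_closedDom ρ).prod (S.t₂.measurableSet_closedDom ρ)).preimage
      (f := fun p : ℂ × ℂ × ℝ => (p.1, p.2.1)) fp!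
  have h1 : Measurable fun p : ℂ × ℂ × ℝ =>
      Φ^[n + 1] (fun _ _ _ => 0) p.1 p.2.1 p.2.2 - Φ^[n] (fun _ _ _ => 0) p.1 p.2.1 p.2.2 :=
    Measurable.sub (h.ball_iterate hϖ (n + 1)).meas (h.ball_iterate hϖ n).meas
  exact h1.indicator hs

lemma meas_picard (h : S.Contracts ρ β μ ϖ ε Φ) (hϖ : 0 ≤ ϖ) : Meas3 (S.picard ρ Φ) := by
  refine measurable_of_tendsto_metrizable (f := fun n (p : ℂ × ℂ × ℝ) =>
    ∑ i ∈ Finset.range n, S.incr ρ Φ i p.1 p.2.1 p.2.2)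
    (fun n => Finset.measurable_fun_sum _ fun i _ => h.meas_incr hϖ i) ?_
  rw [tendsto_pi_nhds]
  exact fun p => (h.summable_incr hϖ _ _ _).hasSum.tendsto_sum_nat

lemma tendsto_iterate (h : S.Contracts ρ β μ ϖ ε Φ) (hϖ : 0 ≤ ϖ)
    (h1 : τ1 ∈ S.t₁.closedDom ρ) (h2 : τ2 ∈ S.t₂.closedDom ρ) (m : ℝ) :
    Tendsto (fun n => Φ^[n] (fun _ _ _ => 0) τ1 τ2 m) atTop (𝓝 (S.picard ρ Φ τ1 τ2 m)) := by
  refine (h.summable_incr hϖ τ1 τ2 m).hasSum.tendsto_sum_nat.congr fun n => ?_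
  simp only [incr_of_mem h1 h2]
  rw [Finset.sum_range_sub (fun n => Φ^[n] (fun _ _ _ => (0 : ℂ)) τ1 τ2 m)]
  simp

lemma ball_picard (h : S.Contracts ρ β μ ϖ ε Φ) (hϖ : 0 ≤ ϖ) :
    S.Ball ρ (S.W β ε 1 1 (-μ)) ϖ (S.picard ρ Φ) :=
  ⟨hϖ, h.meas_picard hϖ, fun τ1 h1 τ2 h2 m => le_of_tendsto (h.tendsto_iterate hϖ h1 h2 m).norm
    (.of_forall fun n => (h.ball_iterate hϖ n).bd τ1 h1 τ2 h2 m)⟩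

lemma _root_.TwoTime.tendsto_of_norm_sub_le {u : ℕ → ℂ} {a : ℂ}
    (h : ∀ n, ‖u n - a‖ ≤ c * (1 / 2) ^ n) : Tendsto u atTop (𝓝 a) :=
  tendsto_iff_norm_sub_tendsto_zero.2 (squeeze_zero (fun _ => norm_nonneg _) h (by
    simpa using (tendsto_pow_atTop_nhds_zero_of_lt_one one_half_pos.le one_half_lt_one).const_mul c))

lemma eq_of_fixed (h : S.Contracts ρ β μ ϖ ε Φ) (hf : S.Ball ρ (S.W β ε 1 1 (-μ)) ϖ f)
    (hg : S.Ball ρ (S.W β ε 1 1 (-μ)) ϖ g)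
    (hf' : ∀ τ1 ∈ S.t₁.closedDom ρ, ∀ τ2 ∈ S.t₂.closedDom ρ, ∀ m : ℝ, Φ f τ1 τ2 m = f τ1 τ2 m)
    (hg' : ∀ τ1 ∈ S.t₁.closedDom ρ, ∀ τ2 ∈ S.t₂.closedDom ρ, ∀ m : ℝ, Φ g τ1 τ2 m = g τ1 τ2 m)
    (h1 : τ1 ∈ S.t₁.closedDom ρ) (h2 : τ2 ∈ S.t₂.closedDom ρ) (m : ℝ) : f τ1 τ2 m = g τ1 τ2 m := by
  have hϖ := hf.nonneg
  have hn (n : ℕ) : S.Bd ρ (S.W β ε 1 1 (-μ)) (2 * ϖ * (1 / 2) ^ n)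
      fun τ1 τ2 m => f τ1 τ2 m - g τ1 τ2 m := by
    induction n with
    | zero =>
      intro τ1 h1 τ2 h2 m
      exact (norm_sub_le_of_le (hf.bd τ1 h1 τ2 h2 m) (hg.bd τ1 h1 τ2 h2 m)).trans_eq (by ring)
    | succ n ih =>
      intro τ1 h1 τ2 h2 m
      have := h.half hf hg pos! ih τ1 h1 τ2 h2 m
      beta_reduce at this ⊢
      rw [hf' τ1 h1 τ2 h2, hg' τ1 h1 τ2 h2] at this
      exact this.trans_eq (by ring)
  exact tendsto_nhds_unique tendsto_const_nhds (tendsto_of_norm_sub_le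
    (c := 2 * ϖ * S.W β ε 1 1 (-μ) τ1 τ2 m) fun n => (hn n τ1 h1 τ2 h2 m).trans_eq (by ring))

lemma bd_picard_sub_iterate (h : S.Contracts ρ β μ ϖ ε Φ) (hϖ : 0 ≤ ϖ) (n : ℕ) :
    S.Bd ρ (S.W β ε 1 1 (-μ)) (ϖ * (1 / 2) ^ n * 2) fun τ1 τ2 m =>
      S.picard ρ Φ τ1 τ2 m - Φ^[n] (fun _ _ _ => 0) τ1 τ2 m := by
  intro τ1 h1 τ2 h2 m
  have hW := S.W_nonneg β ε 1 1 (-μ) τ1 τ2 m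
  have hd : ∀ n, dist (Φ^[n] (fun _ _ _ => (0 : ℂ)) τ1 τ2 m) (Φ^[n + 1] (fun _ _ _ => 0) τ1 τ2 m) ≤
      2 * ϖ * S.W β ε 1 1 (-μ) τ1 τ2 m / 2 / 2 ^ n := fun n => by
    rw [dist_comm, dist_eq_norm]
    refine (h.bd_sub_iterate hϖ n τ1 h1 τ2 h2 m).trans_eq ?_
    rw [one_div, inv_pow]; ring
  have := dist_le_of_le_geometric_two_of_tendsto hd (h.tendsto_iterate hϖ h1 h2 m) n
  rw [dist_comm, dist_eq_norm] at this
  refine this.trans_eq ?_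
  rw [one_div, inv_pow]; ring

lemma picard_fixed (h : S.Contracts ρ β μ ϖ ε Φ) (hϖ : 0 ≤ ϖ)
    (h1 : τ1 ∈ S.t₁.closedDom ρ) (h2 : τ2 ∈ S.t₂.closedDom ρ) (m : ℝ) :
    Φ (S.picard ρ Φ) τ1 τ2 m = S.picard ρ Φ τ1 τ2 m := by
  refine tendsto_nhds_unique (tendsto_of_norm_sub_le (c := ϖ * S.W β ε 1 1 (-μ) τ1 τ2 m) fun n => ?_)
    ((h.tendsto_iterate hϖ h1 h2 m).comp (tendsto_add_atTop_nat 1))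
  rw [norm_sub_rev, comp_apply, iterate_succ_apply' Φ n]
  exact (h.half (h.ball_picard hϖ) (h.ball_iterate hϖ n) pos!
    (h.bd_picard_sub_iterate hϖ n) τ1 h1 τ2 h2 m).trans_eq (by ring)

end CauchyData.Contracts

/-- Series of continuous functions with locally uniform summable majorants. -/
lemma continuousOn_tsum_of_locally {X ι : Type*} [TopologicalSpace X] {F : ι → X → ℂ} {U : Set X}
    (h : ∀ i, ContinuousOn (F i) U)
    (hb : ∀ q0 ∈ U, ∃ u : ι → ℝ, Summable u ∧ ∀ᶠ q in 𝓝[U] q0, ∀ i, ‖F i q‖ ≤ u i) :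
    ContinuousOn (fun q => ∑' i, F i q) U := by
  intro q0 hq0
  obtain ⟨u, hu, hb⟩ := hb q0 hq0
  have h1 : ContinuousOn (fun q => ∑' i, F i q) (U ∩ {q | ∀ i, ‖F i q‖ ≤ u i}) :=
    continuousOn_tsum (fun i => (h i).mono inter_subset_left) hu fun i q hq => hq.2 i
  exact (h1 q0 ⟨hq0, hb.self_of_nhdsWithin hq0⟩).mono_of_mem_nhdsWithin
    (inter_mem self_mem_nhdsWithin hb)

/-- Series of holomorphic functions with locally uniform summable majorants. -/
lemma differentiableOn_tsum_of_locally {E ι : Type*} [NormedAddCommGroup E] [NormedSpace ℂ E]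
    [FiniteDimensional ℂ E] [Countable ι] {F : ι → E → ℂ} {U : Set E} (hU : IsOpen U)
    (h : ∀ i, DifferentiableOn ℂ (F i) U)
    (hb : ∀ q0 ∈ U, ∃ u : ι → ℝ, Summable u ∧ ∀ᶠ q in 𝓝[U] q0, ∀ i, ‖F i q‖ ≤ u i) :
    DifferentiableOn ℂ (fun q => ∑' i, F i q) U := by
  let _ : MeasurableSpace ι := ⊤
  have h1 : DifferentiableOn ℂ (fun q => ∫ i in univ, F i q ∂Measure.count) U := by
    refine differentiableOn_setIntegral MeasurableSet.univ hU (F := fun q i => F i q)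
      (fun i _ => h i) (fun q _ => measurable_from_top.aestronglyMeasurable) fun q0 hq0 => ?_
    obtain ⟨u, hu, hb⟩ := hb q0 hq0
    refine ⟨u, ?_, hb.mono fun q hq i _ => hq i⟩
    rw [integrableOn_univ, integrable_count_iff]
    exact hu.norm
  refine h1.congr fun q hq => ?_
  obtain ⟨u, hu, hb⟩ := hb q hq
  have hs : Summable fun i => ‖F i q‖ :=
    Summable.of_nonneg_of_le (fun _ => norm_nonneg _) (hb.self_of_nhdsWithin hq) hu
  rw [Measure.restrict_univ, integral_countable (integrable_count_iff.2 hs)]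
  simp

/-- Series of regular functions with locally uniform summable majorants. -/
lemma Reg.tsum [Dom S ρ V] {ι : Type*} [Countable ι] {G : ι → ℙ → ℂ}
    (h : ∀ i, Reg S ρ V (G i))
    (hb : ∀ q0 ∈ S.dom ρ V, ∃ u : ι → ℝ, Summable u ∧ ∀ᶠ q in 𝓝[S.dom ρ V] q0, ∀ i, ‖G i q‖ ≤ u i) :
    Reg S ρ V fun q => ∑' i, G i q := by
  refine ⟨continuousOn_tsum_of_locally (fun i => (h i).cont) hb, fun m =>
    differentiableOn_tsum_of_locally CauchyData.isOpen_domH (fun i => (h i).holo m) fun p hp => ?_⟩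
  obtain ⟨u, hu, hb⟩ := hb _ (CauchyData.mem_dom_of_mem_domH hp m)
  have ht : Tendsto (fun p : ℂ × ℂ × ℂ => (p.1, p.2.1, m, p.2.2)) (𝓝[S.domH ρ V] p)
      (𝓝[S.dom ρ V] (p.1, p.2.1, m, p.2.2)) :=
    ContinuousWithinAt.tendsto_nhdsWithin fp!
      fun p hp => CauchyData.mem_dom_of_mem_domH hp m
  exact ⟨u, hu, ht.eventually hb⟩

end

section
variable {D : Set ℂ}

lemma mulB_congr (hD : ∀ τ ∈ D, ∀ c ∈ Ioc (0 : ℝ) 1, τ * (c : ℂ) ∈ D) (hk : 1 ≤ k) (n : ℕ)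
    {f g : ℂ → ℂ} (h : ∀ τ ∈ D, f τ = g τ) : ∀ τ ∈ D, mulB k n f τ = mulB k n g τ := by
  intro τ hτ
  rw [mulB_eq_convB hk, mulB_eq_convB hk]
  exact convB_congr fun x hx => by rw [h _ (hD τ hτ _ (root_mem_Ioc hx))]

lemma derivB_congr (hD : ∀ τ ∈ D, ∀ c ∈ Ioc (0 : ℝ) 1, τ * (c : ℂ) ∈ D) (hk : 1 ≤ k) (δ : ℕ)
    {f g : ℂ → ℂ} (h : ∀ τ ∈ D, f τ = g τ) : ∀ τ ∈ D, derivB k δ f τ = derivB k δ g τ := by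
  intro τ hτ
  rw [derivB, derivB, h τ hτ]
  congr 1
  refine sum_congr rfl fun p _ => ?_
  rw [mulB_congr hD hk _ (fun σ hσ => by rw [h σ hσ]) τ hτ]

lemma TimeData.opB_congr (t : TimeData) (hD : ∀ τ ∈ D, ∀ c ∈ Ioc (0 : ℝ) 1, τ * (c : ℂ) ∈ D)
    (hk : 1 ≤ t.k) (m : ℝ) {f g : ℂ → ℂ} (h : ∀ τ ∈ D, f τ = g τ) :
    ∀ τ ∈ D, t.opB m f τ = t.opB m g τ := by
  intro τ hτ
  rw [TimeData.opB, TimeData.opB, derivB_congr hD hk _ h τ hτ, h τ hτ]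

lemma convB_congr_of_mem (hD : ∀ τ ∈ D, ∀ c ∈ Ioc (0 : ℝ) 1, τ * (c : ℂ) ∈ D)
    {B B' : ℂ → ℂ → ℂ} (h : ∀ x ∈ D, ∀ y ∈ D, B x y = B' x y) :
    ∀ τ ∈ D, convB k B τ = convB k B' τ := fun τ hτ =>
  convB_congr fun _ hx =>
    h _ (hD τ hτ _ (root_mem_Ioc (one_sub_mem_Ioo hx))) _ (hD τ hτ _ (root_mem_Ioc hx))

end

lemma TimeData.closedDom_star (t : TimeData) (ρ : ℝ) :
    ∀ τ ∈ t.closedDom ρ, ∀ c ∈ Ioc (0 : ℝ) 1, τ * (c : ℂ) ∈ t.closedDom ρ :=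
  fun _ hτ _ hc => t.smul_mem_closedDom hτ hc.1 hc.2

lemma CauchyData.shiftB_congr (hk1 : 1 ≤ S.t₁.k) (hk2 : 1 ≤ S.t₂.k) {G G' : ℂ → ℂ → ℂ}
    (h : ∀ τ1 ∈ S.t₁.closedDom ρ, ∀ τ2 ∈ S.t₂.closedDom ρ, G τ1 τ2 = G' τ1 τ2)
    (h1 : τ1 ∈ S.t₁.closedDom ρ) (h2 : τ2 ∈ S.t₂.closedDom ρ) :
    S.shiftB G τ1 τ2 = S.shiftB G' τ1 τ2 :=
  mulB_congr (S.t₁.closedDom_star ρ) hk1 _ (fun σ1 hσ1 =>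
    mulB_congr (S.t₂.closedDom_star ρ) hk2 _ (fun σ2 hσ2 => h σ1 hσ1 σ2 hσ2) τ2 h2) τ1 h1

/-- The convolution equation only involves the values of `w` on the closed domains. -/
lemma CauchyData.BorelEqAt.congr (hk1 : 1 ≤ S.t₁.k) (hk2 : 1 ≤ S.t₂.k)
    {w' : 𝔽}
    (h : ∀ τ1 ∈ S.t₁.closedDom ρ, ∀ τ2 ∈ S.t₂.closedDom ρ, ∀ m : ℝ, w τ1 τ2 m = w' τ1 τ2 m) (h1 : τ1 ∈ S.t₁.closedDom ρ) (h2 : τ2 ∈ S.t₂.closedDom ρ) {m : ℝ}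
    (hw : S.BorelEqAt C F ε w τ1 τ2 m) : S.BorelEqAt C F ε w' τ1 τ2 m := by
  have s1 := S.t₁.closedDom_star ρ
  have s2 := S.t₂.closedDom_star ρ
  have hf : ∀ x ∈ S.t₁.closedDom ρ, ∀ y ∈ S.t₂.closedDom ρ, w' x y = w x y := fun x hx y hy =>
    funext fun m => (h x hx y hy m).symm
  have hc {A B : ℂ[X]} {u u' : 𝔽} (hu : ∀ x ∈ S.t₁.closedDom ρ, ∀ y ∈ S.t₂.closedDom ρ,
      u' x y = u x y) := CauchyData.shiftB_congr hk1 hk2 (fun x hx y hy => convB_congr_of_mem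
    (k := S.t₁.k) s1 (fun x1 a1 y1 b1 => convB_congr_of_mem (k := S.t₂.k) s2 (fun x2 a2 y2 b2 =>
      congrArg₂ (fourierConv A B · · m) (hu x1 a1 x2 a2) (hf y1 b1 y2 b2)) y hy) x hx) h1 h2
  have ht {δ l : ℕ} : ∀ x ∈ S.t₁.closedDom ρ, mulB S.t₂.k l (derivB S.t₂.k δ (w' x · m)) τ2 =
    mulB S.t₂.k l (derivB S.t₂.k δ (w x · m)) τ2 := fun x hx => mulB_congr s2 hk2 _
      (derivB_congr s2 hk2 _ fun y hy => by rw [hf x hx y hy]) τ2 h2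
  refine (S.t₁.opB_congr s1 hk1 m (fun x hx => S.t₂.opB_congr s2 hk2 m
    (fun y hy => by rw [hf x hx y hy]) τ2 h2) τ1 h1).trans (hw.trans ?_)
  refine (congrArg₂ _ (congrArg₂ _ (congrArg₂ _ (congrArg₂ _ (congrArg₂ _ (congrArg₂ _
    (congrArg _ (hc hf)) (sum_congr rfl fun l1 _ => sum_congr rfl fun l2 _ => congrArg _
      (mulB_congr s1 hk1 _ (derivB_congr s1 hk1 _ ht) τ1 h1)))
    (congrArg _ (hc fun _ _ _ _ => rfl)))
    (congrArg _ (CauchyData.shiftB_congr hk1 hk2 (fun x hx y hy => convB_congr_of_mem s1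
      (fun x1 _ y1 b1 => by rw [hf y1 b1 y hy]) x hx) h1 h2)))
    (congrArg _ (CauchyData.shiftB_congr hk1 hk2 (fun x hx y hy => convB_congr_of_mem s2
      (fun x1 _ y1 b1 => by rw [hf x hx y1 b1]) y hy) h1 h2)))
    (congrArg _ (CauchyData.shiftB_congr hk1 hk2 (fun x hx y hy => by rw [hf x hx y hy]) h1 h2)))
    rfl).symm

lemma CauchyData.Bd.eq_zero
    (hb : S.Bd ρ (S.W β ε 1 1 (-μ)) K w) (h1 : τ1 ∈ S.t₁.closedDom ρ)
    (h2 : τ2 ∈ S.t₂.closedDom ρ) (h : τ1 = 0 ∨ τ2 = 0) (m : ℝ) : w τ1 τ2 m = 0 := by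
  have u1 := hb τ1 h1 τ2 h2 m
  have u2 : S.W β ε 1 1 (-μ) τ1 τ2 m = 0 := by
    rcases h with rfl | rfl <;> simp [CauchyData.W, TimeData.wt]
  rw [u2, mul_zero] at u1
  exact norm_le_zero_iff.1 u1

/-- In the ball, the solutions of the convolution equation are the fixed points. -/
lemma CauchyData.borelEqAt_iff_fixed (hS : S.Setup ρ β μ r) (hε : ε ≠ 0)
    (hc : S.Contracts ρ β μ ϖ ε (S.fixOp ε (S.coefs C F ε))) (hw : S.Ball ρ (S.W β ε 1 1 (-μ)) ϖ w) (h1 : τ1 ∈ S.t₁.closedDom ρ)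
    (h2 : τ2 ∈ S.t₂.closedDom ρ) (m : ℝ) :
    S.BorelEqAt C F ε w τ1 τ2 m ↔ S.fixOp ε (S.coefs C F ε) w τ1 τ2 m = w τ1 τ2 m := by
  by_cases h : τ1 = 0 ∨ τ2 = 0
  · refine ⟨fun _ => ?_, fun _ => S.borelEqAt_of_zero hS ε C F w h m⟩
    rw [hw.bd.eq_zero h1 h2 h, (hc.maps hw).bd.eq_zero h1 h2 h]
  · push Not at h
    exact S.borelEqAt_iff hS hε C F hw h1 h2 h.1 h.2 m

lemma Dom.continuousOn_weight (H : Dom S ρ V) {D : Set ℙ} (hD : ∀ q ∈ D, q.2.2.2 ∈ V) :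
    ContinuousOn (fun q : ℙ => K * S.W β q.2.2.2 1 1 (-μ) q.1 q.2.1 q.2.2.1) D := by
  have := H.continuousOn_div (S.t₁.continuous_wt zero_le_one) (S.t₂.continuous_wt zero_le_one) hD
  have := continuous_fw β (-μ)
  unfold W
  fun_prop

section
variable [H : Dom S ρ V]

/-- A regular function bounded by the weight extends continuously by zero to `τ1 τ2 = 0`. -/
lemma Reg.continuousOn_full {f : ℂ → 𝔽}
    (hf : Reg S ρ V fun q => f q.2.2.2 q.1 q.2.1 q.2.2.1)
    (hb : ∀ ε ∈ V, S.Bd ρ (S.W β ε 1 1 (-μ)) K (f ε)) :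
    ContinuousOn (fun q : ℙ => f q.2.2.2 q.1 q.2.1 q.2.2.1)
      (S.t₁.closedDom ρ ×ˢ S.t₂.closedDom ρ ×ˢ univ ×ˢ V) := by
  rintro ⟨τ1, τ2, m, ε⟩ ⟨h1, h2, -, hε⟩
  by_cases h : τ1 = 0 ∨ τ2 = 0
  · have h0 := (hb ε hε).eq_zero h1 h2 h m
    have hW := H.continuousOn_weight (β := β) (μ := μ) (K := K) (D := S.t₁.closedDom ρ ×ˢ
      S.t₂.closedDom ρ ×ˢ univ ×ˢ V) fun q hq => hq.2.2.2
    have hW0 : K * S.W β ε 1 1 (-μ) τ1 τ2 m = 0 := by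
      rcases h with rfl | rfl <;> simp [CauchyData.W, TimeData.wt]
    have ht := hW (τ1, τ2, m, ε) ⟨h1, h2, mem_univ _, hε⟩
    rw [ContinuousWithinAt] at ht ⊢
    simp only [h0]
    simp only [hW0] at ht
    exact squeeze_zero_norm' (eventually_mem_nhdsWithin.mono fun q hq =>
      hb _ hq.2.2.2 _ hq.1 _ hq.2.1 _) ht
  · push Not at h
    refine (hf.cont (τ1, τ2, m, ε) ⟨⟨h1, h.1⟩, ⟨h2, h.2⟩, mem_univ _, hε⟩).mono_of_mem_nhdsWithin ?_
    have ho : IsOpen {q : ℙ | q.1 ≠ 0 ∧ q.2.1 ≠ 0} :=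
      (isOpen_ne_fun continuous_fst continuous_const).inter
        (isOpen_ne_fun fp! continuous_const)
    refine mem_of_superset (inter_mem_nhdsWithin _ (ho.mem_nhds h)) fun q hq => ?_
    exact ⟨⟨hq.1.1, hq.2.1⟩, ⟨hq.1.2.1, hq.2.2⟩, hq.1.2.2⟩

lemma Reg.differentiableOn_full {f : ℂ → 𝔽} (hf : Reg S ρ V fun q => f q.2.2.2 q.1 q.2.1 q.2.2.1)
    (hb : ∀ ε ∈ V, S.Bd ρ (S.W β ε 1 1 (-μ)) K (f ε)) (m : ℝ) :
    DifferentiableOn ℂ (fun p : ℂ × ℂ × ℂ => f p.2.2 p.1 p.2.1 m)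
      (S.t₁.openDom ρ ×ˢ S.t₂.openDom ρ ×ˢ V) := by
  have hc : ContinuousOn (fun p : ℂ × ℂ × ℂ => f p.2.2 p.1 p.2.1 m)
      (S.t₁.openDom ρ ×ˢ S.t₂.openDom ρ ×ˢ V) :=
    (hf.continuousOn_full hb).comp (f := fun p : ℂ × ℂ × ℂ => (p.1, p.2.1, m, p.2.2))
      fp! fun p hp =>
        ⟨S.t₁.openDom_subset ρ hp.1, S.t₂.openDom_subset ρ hp.2.1, mem_univ _, hp.2.2⟩
  have o1 := S.t₁.isOpen_openDom ρ
  have o2 := S.t₂.isOpen_openDom ρ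
  have d1 : DifferentiableOn ℂ (fun p : ℂ × ℂ × ℂ => f p.2.2 p.1 p.2.1 m)
      (S.t₁.openDom ρ ×ˢ (S.t₂.openDom ρ \ {0}) ×ˢ V) :=
    differentiableOn_of_continuousOn_of_off_zero o1 ((o2.sdiff isClosed_singleton).prod H.isOpen)
      (hc.mono fun p hp => ⟨hp.1, hp.2.1.1, hp.2.2⟩) (hf.holo m)
  have d2 : DifferentiableOn ℂ (fun p : ℂ × ℂ × ℂ => f p.2.2 p.2.1 p.1 m)
      (S.t₂.openDom ρ ×ˢ S.t₁.openDom ρ ×ˢ V) :=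
    differentiableOn_of_continuousOn_of_off_zero o2 (o1.prod H.isOpen)
      (hc.comp (f := fun p : ℂ × ℂ × ℂ => (p.2.1, p.1, p.2.2)) fp!
        fun p hp => ⟨hp.2.1, hp.1, hp.2.2⟩)
      (d1.comp (f := fun p : ℂ × ℂ × ℂ => (p.2.1, p.1, p.2.2)) fp!
        fun p hp => ⟨hp.2.1, hp.1, hp.2.2⟩)
  exact d2.comp (f := fun p : ℂ × ℂ × ℂ => (p.2.1, p.1, p.2.2)) fp!
    fun p hp => ⟨hp.2.1, hp.1, hp.2.2⟩

/-- The limit of the iteration is regular if the operators preserve regularity. -/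
lemma CauchyData.reg_picard {Φ : ℂ → 𝔽 → 𝔽} (hϖ : 0 ≤ ϖ)
    (hΦ : ∀ f, RegW S ρ β μ V true true ϖ f →
      Reg S ρ V fun q => Φ q.2.2.2 (f q.2.2.2) q.1 q.2.1 q.2.2.1)
    (hc : ∀ ε ∈ V, S.Contracts ρ β μ ϖ ε (Φ ε)) :
    Reg S ρ V fun q => S.picard ρ (Φ q.2.2.2) q.1 q.2.1 q.2.2.1 := by
  have hi : ∀ n, RegW S ρ β μ V true true ϖ fun ε => (Φ ε)^[n] fun _ _ _ => 0 := by
    refine fun n => ⟨?_, hϖ, fun ε hε => (hc ε hε).ball_iterate hϖ n⟩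
    induction n with
    | zero => exact Reg.const 0
    | succ n ih =>
      simp only [iterate_succ_apply']
      exact hΦ _ ⟨ih, hϖ, fun ε hε => (hc ε hε).ball_iterate hϖ n⟩
  have hc1 := H.continuousOn_weight (β := β) (μ := μ) (K := ϖ) (D := S.dom ρ V)
    fun q hq => hq.2.2.2
  refine Reg.tsum (G := fun n q => S.incr ρ (Φ q.2.2.2) n q.1 q.2.1 q.2.2.1) (fun n => ((hi (n + 1)).reg.sub (hi n).reg).congr fun q hq => ?_) fun q0 hq0 => ?_
  · exact CauchyData.Contracts.incr_of_mem hq.1.1 hq.2.1.1 n _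
  · refine ⟨fun n => (ϖ * S.W β q0.2.2.2 1 1 (-μ) q0.1 q0.2.1 q0.2.2.1 + 1) * (1 / 2) ^ n,
      summable_geometric_two.mul_left _, ?_⟩
    filter_upwards [(hc1 q0 hq0).eventually_lt_const (lt_add_one _), self_mem_nhdsWithin]
      with q hq hq' n
    exact ((hc _ hq'.2.2.2).norm_incr_le hϖ n _ _ _).trans
      (mul_le_r hq.le)

/-- Existence, uniqueness and regularity of the solution of the convolution equation. -/
lemma CauchyData.exists_borelSol (hS : S.Setup ρ β μ r) (hVr : V ⊆ closedBall 0 r) (hζ : 0 ≤ ζ) (hϖ : 0 ≤ ϖ)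
    (hsm : ∀ ε ∈ V, (S.coefs C F ε).Small S ρ β μ ε ζ) (hcr : RegCoefs S ρ V (S.coefs C F))
    (hc : ∀ ε ∈ V, S.Contracts ρ β μ ϖ ε (S.fixOp ε (S.coefs C F ε))) :
    ∃ ω : ℂ → ℂ → ℝ → ℂ → ℂ,
      (∀ ε ∈ V, S.BorelSol ρ β μ ϖ C F ε (fun τ1 τ2 m => ω τ1 τ2 m ε) ∧
        ∀ w : 𝔽, S.BorelSol ρ β μ ϖ C F ε w →
          ∀ τ1 ∈ S.t₁.closedDom ρ, ∀ τ2 ∈ S.t₂.closedDom ρ, ∀ m : ℝ,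
            w τ1 τ2 m = ω τ1 τ2 m ε) ∧
      ContinuousOn (fun p : ℙ => ω p.1 p.2.1 p.2.2.1 p.2.2.2)
        (S.t₁.closedDom ρ ×ˢ S.t₂.closedDom ρ ×ˢ Set.univ ×ˢ V) ∧
      (∀ m : ℝ, DifferentiableOn ℂ (fun p : ℂ × ℂ × ℂ => ω p.1 p.2.1 m p.2.2)
        (S.t₁.openDom ρ ×ˢ S.t₂.openDom ρ ×ˢ V)) ∧
      ∀ ε ∈ V, S.Ball ρ (S.W β ε 1 1 (-μ)) ϖ fun τ1 τ2 m => ω τ1 τ2 m ε := by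
  have hk1 := hS.time₁.one_le_k
  have hk2 := hS.time₂.one_le_k
  have hreg := CauchyData.reg_picard (Φ := fun ε => S.fixOp ε (S.coefs C F ε)) hϖ
    (fun f hf => CauchyData.reg_fixOp hS hVr hζ hsm hcr hf) hc
  have hp := fun ε hε => (hc ε hε).ball_picard hϖ
  have hb := fun ε hε => (hp ε hε).bd
  have hfix {ε} (hε : ε ∈ V) {w : 𝔽} (hw : S.Ball ρ (S.W β ε 1 1 (-μ)) ϖ w) {x y : ℂ}
      (hx : x ∈ S.t₁.closedDom ρ) (hy : y ∈ S.t₂.closedDom ρ) (m : ℝ) :=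
    CauchyData.borelEqAt_iff_fixed hS (H.ne_zero ε hε) (hc ε hε) hw hx hy m
  have hct := Reg.continuousOn_full (f := fun ε => S.picard ρ (S.fixOp ε (S.coefs C F ε))) hreg hb
  have hd := Reg.differentiableOn_full (f := fun ε => S.picard ρ (S.fixOp ε (S.coefs C F ε)))
    hreg hb
  refine ⟨fun τ1 τ2 m ε => S.picard ρ (S.fixOp ε (S.coefs C F ε)) τ1 τ2 m,
    fun ε hε => ⟨?_, fun w hw τ1 h1 τ2 h2 m => ?_⟩, hct, hd, hp⟩
  · obtain ⟨hm, hn⟩ := S.memF_of_bd hS.hρ (H.ne_zero ε hε) hϖ (hb ε hε)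
      (hct.comp (f := fun p : ℂ × ℂ × ℝ => (p.1, p.2.1, p.2.2, ε)) fp!
        fun p hp => ⟨hp.1, hp.2.1, mem_univ _, hε⟩)
      fun m => (hd m).comp (f := fun p : ℂ × ℂ => (p.1, p.2, ε)) fp!
        fun p hp => ⟨hp.1, hp.2, hε⟩
    exact ⟨hm, hn, fun τ1 h1 τ2 h2 m =>
      (hfix hε (hp ε hε) h1 h2 m).2 ((hc ε hε).picard_fixed hϖ h1 h2 m)⟩
  · -- cut off the competitor outside the closed domains to make it measurable
    classical
    have hsm : MeasurableSet (S.t₁.closedDom ρ ×ˢ S.t₂.closedDom ρ ×ˢ (univ : Set ℝ)) :=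
      (S.t₁.measurableSet_closedDom ρ).prod
        ((S.t₂.measurableSet_closedDom ρ).prod MeasurableSet.univ)
    set w' : 𝔽 := fun x y m => (S.t₁.closedDom ρ ×ˢ S.t₂.closedDom ρ ×ˢ
      (univ : Set ℝ)).piecewise (fun p : ℂ × ℂ × ℝ => w p.1 p.2.1 p.2.2) (fun _ => 0) (x, y, m)
      with hw'
    have he : ∀ x ∈ S.t₁.closedDom ρ, ∀ y ∈ S.t₂.closedDom ρ, ∀ m : ℝ, w x y m = w' x y m :=
      fun x hx y hy m => (piecewise_eq_of_mem _ (fun p : ℂ × ℂ × ℝ => w p.1 p.2.1 p.2.2) (fun _ => 0) (show (x, y, m) ∈ S.t₁.closedDom ρ ×ˢ S.t₂.closedDom ρ ×ˢ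
      (univ : Set ℝ) from ⟨hx, hy, mem_univ _⟩)).symm
    have hb' : S.Ball ρ (S.W β ε 1 1 (-μ)) ϖ w' :=
      ⟨hϖ, hw.1.1.measurable_piecewise continuousOn_const hsm, fun x hx y hy m => by
        rw [← he x hx y hy m]
        exact S.bd_of_memF hS.hρ (H.ne_zero ε hε) hw.1 hw.2.1 x hx y hy m⟩
    rw [he τ1 h1 τ2 h2 m]
    refine (hc ε hε).eq_of_fixed hb' (hp ε hε) (fun x hx y hy m => ?_)
      (fun x hx y hy m => (hc ε hε).picard_fixed hϖ hx hy m) h1 h2 m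
    rw [← hfix hε hb' hx hy m]
    exact (hw.2.2 x hx y hy m).congr hk1 hk2 he hx hy

end

/-! ### Borel transforms of power series -/

lemma rpow_le_Gamma_mul_exp (hs : 0 ≤ s) (hx : 0 ≤ x) : x ^ s ≤ Gamma (s + 1) * exp (x + 1) := by
  have hi := Real.GammaIntegral_convergent (by linarith : 0 < s + 1)
  have hsub : Ioc x (x + 1) ⊆ Ioi 0 := fun t ht => hx.trans_lt ht.1
  have h1 : exp (-(x + 1)) * x ^ s ≤ Gamma (s + 1) := by
    calc exp (-(x + 1)) * x ^ s = ∫ _ in Ioc x (x + 1), exp (-(x + 1)) * x ^ s := by simp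
      _ ≤ ∫ t in Ioc x (x + 1), exp (-t) * t ^ (s + 1 - 1) := by
          refine setIntegral_mono_on ?_ (hi.mono_set hsub) measurableSet_Ioc fun t ht => ?_
          · exact integrableOn_const (by simp)
          · rw [add_sub_cancel_right]
            refine mul_le_mul (exp_le_exp.2 (by linarith [ht.2]))
              (rpow_le_rpow hx ht.1.le hs) (Real.rpow_nonneg hx _) (exp_pos _).le
      _ ≤ ∫ t in Ioi 0, exp (-t) * t ^ (s + 1 - 1) := by
          refine setIntegral_mono_set hi ?_ hsub.eventuallyLE
          exact (ae_restrict_mem measurableSet_Ioi).mono fun t ht =>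
            mul_nonneg (exp_pos _).le (Real.rpow_nonneg (le_of_lt ht) _)
      _ = Gamma (s + 1) := (Real.Gamma_eq_integral (by linarith)).symm
  calc x ^ s = exp (-(x + 1)) * x ^ s * exp (x + 1) := by
        rw [mul_right_comm, ← exp_add, neg_add_cancel, Real.exp_zero, one_mul]
    _ ≤ _ := mul_le_r h1 (exp_pos _).le

/-- The monomials `z ^ n / Γ(n/k)` in terms of the weight. -/
lemma TimeData.exists_pow_div_Gamma_le (t : TimeData) (hk : 1 ≤ t.k) (hν : 0 < t.ν) :
    ∃ A B : ℝ, 0 < A ∧ 0 < B ∧ ∀ (n : ℕ) (z : ℂ),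
      ‖z‖ ^ (n + 1) / Gamma (((n + 1 : ℕ) : ℝ) / t.k) ≤ A * B ^ (n + 1) * t.wt 1 z := by
  have hk1 : (1 : ℝ) ≤ t.k := mod_cast hk
  set M := max 1 (1 / t.ν) with hM
  have hM1 : 1 ≤ M := le_max_left _ _
  refine ⟨27 * (1 + 2 * exp 1 * M ^ 3), 8 * M, by positivity, by positivity, fun n z => ?_⟩
  set y := ‖z‖ with hy
  have hy0 : 0 ≤ y := norm_nonneg z
  set u : ℝ := (n + 1 : ℕ) / t.k with hu
  have hu0 : 0 < u := by positivity
  have hun : u ≤ n + 1 := by rw [hu]; push_cast; exact div_le_self pos! hk1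
  set s : ℝ := n / t.k + 2 with hs
  have hs2 : 2 ≤ s := by
    have : (0 : ℝ) ≤ n / t.k := by positivity
    linarith
  have hsn : s ≤ n + 3 := by
    have : (n : ℝ) / t.k ≤ n := div_le_self pos! hk1
    linarith
  have hΓ : Gamma (u + 3) = (u + 2) * ((u + 1) * (u * Gamma u)) := by
    rw [show u + 3 = u + 2 + 1 by ring, Real.Gamma_add_one pos!,
      show u + 2 = u + 1 + 1 by ring, Real.Gamma_add_one pos!,
      Real.Gamma_add_one hu0.ne']
  have hΓu := Gamma_pos_of_pos hu0
  have hmono := Real.Gamma_strictMonoOn_Ici.monotoneOn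
  have hsu : s + 1 ≤ u + 3 := by
    have : n / t.k ≤ u := by rw [hu]; gcongr; linarith
    linarith
  have g1 := hmono (by simp only [mem_Ici]; linarith) (by simp only [mem_Ici]; linarith) hsu
  have g2 : 1 ≤ Gamma (u + 3) := by
    have := hmono (a := 2) (b := u + 3) (by simp) (by simp only [mem_Ici]; linarith) (by linarith)
    rwa [Real.Gamma_two] at this
  -- the ratio of the two values of the Gamma function
  have g3 : Gamma (u + 3) ≤ 27 * 8 ^ (n + 1) * Gamma u := by
    have hn : (n : ℝ) + 1 ≤ 2 ^ (n + 1) := by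
      have := (Nat.lt_two_pow_self (n := n + 1)).le
      exact_mod_cast this
    have hc : ((3 : ℝ) * 2 ^ (n + 1)) ^ 3 = 27 * 8 ^ (n + 1) := by
      rw [mul_pow, ← pow_mul, mul_comm (n + 1) 3, pow_mul]; norm_num
    have h2 : (1 : ℝ) ≤ 2 ^ (n + 1) := one_le_pow₀ (by norm_num)
    have : (u + 2) * ((u + 1) * u) ≤ (3 * 2 ^ (n + 1)) ^ 3 := by
      calc (u + 2) * ((u + 1) * u)
          ≤ (3 * 2 ^ (n + 1)) * ((3 * 2 ^ (n + 1)) * (3 * 2 ^ (n + 1))) := by gcongr <;> linarith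
        _ = _ := by ring
    calc Gamma (u + 3) = (u + 2) * ((u + 1) * u) * Gamma u := by rw [hΓ]; ring
      _ ≤ _ := by rw [← hc]; exact mul_le_r this hΓu.le
  set E := exp (t.ν * y ^ t.k) with hE
  have hE1 : 1 ≤ E := one_le_exp pos!
  have hx : (y ^ t.k) ^ s ≤ exp 1 * M ^ (n + 3) * Gamma (u + 3) * E := by
    have h1 := rpow_le_Gamma_mul_exp (s := s) (x := t.ν * y ^ t.k) (by linarith) pos!
    have h2 : (y ^ t.k) ^ s = (1 / t.ν) ^ s * (t.ν * y ^ t.k) ^ s := by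
      rw [← mul_rpow pos! pos!]
      congr 1; field_simp
    have h3 : (1 / t.ν) ^ s ≤ M ^ (n + 3) := by
      calc (1 / t.ν) ^ s ≤ M ^ s := rpow_le_rpow pos! (le_max_right _ _) (by linarith)
        _ ≤ M ^ ((n + 3 : ℕ) : ℝ) := rpow_le_rpow_of_exponent_le hM1 (by push_cast; exact hsn)
        _ = _ := rpow_natCast _ _
    calc (y ^ t.k) ^ s ≤ M ^ (n + 3) * (Gamma (u + 3) * exp (t.ν * y ^ t.k + 1)) := by
          rw [h2]
          exact mul_le_m h3 (h1.trans (mul_le_r g1 (exp_pos _).le))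
      _ = _ := by rw [exp_add]; ring
  have hys : (y ^ t.k) ^ s = y ^ (n + 2 * t.k) := by
    rw [← rpow_natCast y t.k, ← rpow_mul hy0, ← rpow_natCast y (n + 2 * t.k)]
    rw [hs]; push_cast; field_simp
  rw [hys] at hx
  have hyn : y ^ n * (1 + y ^ (2 * t.k)) ≤ 1 + 2 * y ^ (n + 2 * t.k) := by
    have : y ^ n ≤ 1 + y ^ (n + 2 * t.k) := by
      rcases le_total y 1 with h | h
      · have := pow_le_one₀ (n := n) hy0 h
        have h' : 0 ≤ y ^ (n + 2 * t.k) := by positivity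
        linarith
      · have := pow_le_pow_right₀ h (Nat.le_add_right n (2 * t.k))
        linarith
    calc y ^ n * (1 + y ^ (2 * t.k)) = y ^ n + y ^ (n + 2 * t.k) := by rw [pow_add]; ring
      _ ≤ _ := by linarith
  have hfin : y ^ n * (1 + y ^ (2 * t.k)) ≤
      27 * (1 + 2 * exp 1 * M ^ 3) * (8 * M) ^ (n + 1) * E * Gamma u := by
    have hMn : M ^ (n + 3) ≤ M ^ 3 * M ^ (n + 1) := by
      rw [← pow_add]; exact pow_le_pow_right₀ hM1 (by omega)
    have hM0 : 1 ≤ M ^ (n + 1) := one_le_pow₀ hM1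
    calc _ ≤ 1 + 2 * y ^ (n + 2 * t.k) := hyn
      _ ≤ M ^ (n + 1) * Gamma (u + 3) * E + 2 * (exp 1 * (M ^ 3 * M ^ (n + 1)) *
            Gamma (u + 3) * E) := by
          refine add_le_add ?_ (mul_le_l (hx.trans ?_) (by norm_num))
          · have := one_le_mul_of_one_le_of_one_le (one_le_mul_of_one_le_of_one_le hM0 g2) hE1
            exact this
          · gcongr
      _ = (1 + 2 * exp 1 * M ^ 3) * M ^ (n + 1) * E * Gamma (u + 3) := by ring
      _ ≤ (1 + 2 * exp 1 * M ^ 3) * M ^ (n + 1) * E * (27 * 8 ^ (n + 1) * Gamma u) := by gcongr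
      _ = _ := by rw [mul_pow]; ring
  rw [wt, rpow_one, div_le_iff₀ hΓu, ← hy]
  have hd : 0 < 1 + y ^ (2 * t.k) := by positivity
  have h1 := mul_le_l hfin hy0
  rw [← hE, ← mul_le_mul_iff_left₀ hd]
  refine le_trans (le_of_eq (by rw [pow_succ]; ring)) (h1.trans_eq ?_)
  field_simp

/-- The series `∑ R ^ n / Γ(n/k)` converges for all `R`. -/
lemma summable_pow_div_Gamma (hk : 1 ≤ k) (hR : 0 ≤ R) :
    Summable fun n : ℕ => R ^ (n + 1) / Gamma (((n + 1 : ℕ) : ℝ) / k) := by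
  obtain ⟨A, B, hA, hB, h⟩ := exists_pow_div_Gamma_le ⟨k, 0, 0, 0, 0, 0, 1, 0, 0⟩ hk one_pos
  set z : ℂ := ((2 * B * R : ℝ) : ℂ)
  have hz : ‖z‖ = 2 * B * R := by rw [norm_real, norm_of_nonneg pos!]
  refine .of_nonneg_of_le (fun n => ?_) (fun n => ?_)
    (summable_geometric_two.mul_left (A * wt ⟨k, 0, 0, 0, 0, 0, 1, 0, 0⟩ 1 z))
  · have : 0 ≤ Gamma ((n + 1) / k) := (Gamma_nonneg_of_nonneg pos!)
    positivity
  · have h1 := h n z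
    have w0 := wt_nonneg ⟨k, 0, 0, 0, 0, 0, 1, 0, 0⟩ 1 z
    rw [hz, mul_pow, mul_pow, mul_div_assoc] at h1
    have h2 : R ^ (n + 1) / Gamma ((n + 1 : ℕ) / k) ≤
        A * wt ⟨k, 0, 0, 0, 0, 0, 1, 0, 0⟩ 1 z * (1 / 2) ^ (n + 1) := by
      have hp : 0 < 2 ^ (n + 1) * B ^ (n + 1) := by positivity
      rw [← mul_le_mul_iff_right₀ hp]
      refine h1.trans_eq ?_
      rw [one_div, inv_pow]
      field_simp
    refine h2.trans (mul_le_l ?_)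
    exact pow_le_pow_of_le_one (by norm_num) (by norm_num) (Nat.le_succ n)

/-- A bounded family, with the sign conditions on the parameters. -/
structure PosFamily (β μ K0 T0 ε0 : ℝ) (n0 : ℕ) (C : Family) : Prop
    extends FamilyBound β μ K0 T0 ε0 n0 C where
  hβ : 0 ≤ β
  hμ : 0 ≤ μ
  hK : 0 ≤ K0
  hT : 0 < T0

lemma PosFamily.norm_le_fw (hC : PosFamily β μ K0 T0 ε0 n0 C) (h1 : n0 ≤ n1)
    (h2 : n0 ≤ n2) (hε : ε ∈ ball (0 : ℂ) ε0) (m : ℝ) :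
    ‖C n1 n2 m ε‖ ≤ K0 * (1 / T0) ^ (n1 + n2) * fw β (-μ) m :=
  norm_le_of_memE (h := fun m => C n1 n2 m ε) (hC.mem n1 n2 h1 h2 ε hε) (hC.norm_le n1 n2 h1 h2 ε hε) m

lemma PosFamily.swap (hC : PosFamily β μ K0 T0 ε0 n0 C) :
    PosFamily β μ K0 T0 ε0 n0 fun a b => C b a :=
  ⟨⟨fun n1 n2 h1 h2 => hC.mem n2 n1 h2 h1, fun n1 n2 h1 h2 => hC.holo n2 n1 h2 h1,
    fun n1 n2 h1 h2 => by rw [Nat.add_comm n1 n2]; exact hC.norm_le n2 n1 h2 h1⟩,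
    hC.hβ, hC.hμ, hC.hK, hC.hT⟩

/-- Joint continuity of the coefficients in `(m, ε)`: by the Cauchy estimates they are Lipschitz
in `ε`, locally uniformly with respect to `m`. -/
lemma PosFamily.continuousOn (hC : PosFamily β μ K0 T0 ε0 n0 C) (h1 : n0 ≤ n1) (h2 : n0 ≤ n2) :
    ContinuousOn (fun p : ℝ × ℂ => C n1 n2 p.1 p.2) (univ ×ˢ ball 0 ε0) := by
  rintro ⟨m0, e⟩ ⟨-, he⟩
  set K := K0 * (1 / T0) ^ (n1 + n2) with hKd
  have hK0 : 0 ≤ K := by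
    have := hC.hK
    have := hC.hT
    positivity
  have hb : ∀ m, ∀ ε ∈ ball (0 : ℂ) ε0, ‖C n1 n2 m ε‖ ≤ K := fun m ε hε =>
    (hC.norm_le_fw h1 h2 hε m).trans (mul_le_of_le_one_right hK0 (fw_le_one hC.hβ (neg_nonpos.2 hC.hμ) m))
  obtain ⟨R, hR, hball⟩ := Metric.isOpen_iff.1 isOpen_ball e he
  have hlip : ∀ m, ∀ ε ∈ ball e R,
      dist (C n1 n2 m ε) (C n1 n2 m e) ≤ (2 * K + 1) / R * dist ε e := fun m ε hε =>
    Complex.dist_le_div_mul_dist_of_mapsTo_ball ((hC.holo n1 n2 h1 h2 m).mono hball)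
      (fun z hz => by
        have u1 := hb m z (hball hz)
        have u2 := hb m e he
        rw [Metric.mem_closedBall, dist_eq_norm]
        linarith [norm_sub_le (C n1 n2 m z) (C n1 n2 m e)]) hε
  have hc : Continuous fun m => C n1 n2 m e := (hC.mem n1 n2 h1 h2 e he).1
  rw [ContinuousWithinAt, tendsto_iff_dist_tendsto_zero]
  have hlim : Tendsto (fun p : ℝ × ℂ => (2 * K + 1) / R * dist p.2 e +
      dist (C n1 n2 p.1 e) (C n1 n2 m0 e)) (𝓝 (m0, e)) (𝓝 0) := by
    have : Continuous fun p : ℝ × ℂ => (2 * K + 1) / R * dist p.2 e +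
        dist (C n1 n2 p.1 e) (C n1 n2 m0 e) := by fun_prop
    simpa using this.tendsto (m0, e)
  have hnear : ∀ᶠ p : ℝ × ℂ in 𝓝 (m0, e), p.2 ∈ ball e R :=
    continuous_snd.continuousAt.eventually_mem (Metric.ball_mem_nhds e hR)
  refine squeeze_zero' (.of_forall fun _ => dist_nonneg) ?_
    (hlim.mono_left nhdsWithin_le_nhds)
  exact (hnear.mono fun p hp => (dist_triangle _ _ _).trans
    (add_le_add_left (hlip p.1 p.2 hp) _)).filter_mono nhdsWithin_le_nhds

lemma norm_pow_div_Gamma (k n : ℕ) (τ : ℂ) :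
    ‖τ ^ n / (Gamma ((n : ℝ) / k) : ℝ)‖ = ‖τ‖ ^ n / Gamma ((n : ℝ) / k) := by
  rw [norm_div, norm_pow, norm_real,
    norm_of_nonneg (Gamma_nonneg_of_nonneg pos!)]

lemma PosFamily.norm_borel1_term_le (hC : PosFamily β μ K0 T0 ε0 0 C)
    (hε : ε ∈ ball (0 : ℂ) ε0) (k n : ℕ) (τ : ℂ) (m : ℝ) :
    ‖C (n + 1) 0 m ε * (τ ^ (n + 1) / (Gamma (((n + 1 : ℕ) : ℝ) / k) : ℝ))‖ ≤
      K0 * fw β (-μ) m * ((1 / T0) ^ (n + 1) * (‖τ‖ ^ (n + 1) / Gamma (((n + 1 : ℕ) : ℝ) / k))) := by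
  rw [norm_mul, norm_pow_div_Gamma]
  have hΓ : 0 ≤ Gamma (((n + 1 : ℕ) : ℝ) / k) := Gamma_nonneg_of_nonneg pos!
  refine (mul_le_r (hC.norm_le_fw (Nat.zero_le _) (Nat.zero_le 0) hε m)).trans_eq ?_
  rw [Nat.add_zero]; ring

lemma PosFamily.norm_borel12_term_le (hn : n0 ≤ 1) (hC : PosFamily β μ K0 T0 ε0 n0 C)
    (hε : ε ∈ ball (0 : ℂ) ε0) (k1 k2 : ℕ) (n : ℕ × ℕ) (τ1 τ2 : ℂ) (m : ℝ) :
    ‖C (n.1 + 1) (n.2 + 1) m ε * (τ1 ^ (n.1 + 1) / (Gamma (((n.1 + 1 : ℕ) : ℝ) / k1) : ℝ))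
      * (τ2 ^ (n.2 + 1) / (Gamma (((n.2 + 1 : ℕ) : ℝ) / k2) : ℝ))‖ ≤
      K0 * fw β (-μ) m *
        (((1 / T0) ^ (n.1 + 1) * (‖τ1‖ ^ (n.1 + 1) / Gamma (((n.1 + 1 : ℕ) : ℝ) / k1))) *
        ((1 / T0) ^ (n.2 + 1) * (‖τ2‖ ^ (n.2 + 1) / Gamma (((n.2 + 1 : ℕ) : ℝ) / k2)))) := by
  rw [norm_mul, norm_mul, norm_pow_div_Gamma, norm_pow_div_Gamma]
  have hΓ1 : 0 ≤ Gamma (((n.1 + 1 : ℕ) : ℝ) / k1) := Gamma_nonneg_of_nonneg pos!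
  have hΓ2 : 0 ≤ Gamma (((n.2 + 1 : ℕ) : ℝ) / k2) := Gamma_nonneg_of_nonneg pos!
  rw [mul_assoc ‖_‖]
  refine (mul_le_r (hC.norm_le_fw (by omega) (by omega) hε m)).trans_eq ?_
  rw [pow_add _ (n.1 + 1)]; ring

lemma summable_borel_majorant (hk : 1 ≤ k) (hT : 0 < T0) (hR : 0 ≤ R) :
    Summable fun n : ℕ => (1 / T0) ^ (n + 1) * (R ^ (n + 1) / Gamma (((n + 1 : ℕ) : ℝ) / k)) := by
  refine (summable_pow_div_Gamma hk (R := 1 / T0 * R) pos!).congr fun n => ?_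
  rw [mul_pow, mul_div_assoc]

lemma borel_majorant_nonneg (k n : ℕ) (hT : 0 < T0) (hR : 0 ≤ R) :
    0 ≤ (1 / T0) ^ (n + 1) * (R ^ (n + 1) / Gamma (((n + 1 : ℕ) : ℝ) / k)) := by
  have hΓ : 0 ≤ Gamma (((n + 1 : ℕ) : ℝ) / k) := Gamma_nonneg_of_nonneg pos!
  positivity

lemma borel_majorant_mono (k n : ℕ) (hT : 0 < T0) {R' : ℝ} (hR : 0 ≤ R) (h : R ≤ R') :
    (1 / T0) ^ (n + 1) * (R ^ (n + 1) / Gamma (((n + 1 : ℕ) : ℝ) / k)) ≤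
      (1 / T0) ^ (n + 1) * (R' ^ (n + 1) / Gamma (((n + 1 : ℕ) : ℝ) / k)) :=
  mul_le_l (div_le_r (pow_le_pow_left₀ hR h _)
    (Gamma_nonneg_of_nonneg pos!))

lemma eventually_norm_le {X : Type*} [TopologicalSpace X] {g : X → ℂ} (hg : Continuous g) (s : Set X)
    (q0 : X) : ∀ᶠ q in 𝓝[s] q0, ‖g q‖ ≤ ‖g q0‖ + 1 :=
  ((hg.norm.continuousAt.eventually_le_const (lt_add_one ‖g q0‖))).filter_mono nhdsWithin_le_nhds

lemma PosFamily.borel1_locally_summable (hk : 1 ≤ k) (hC : PosFamily β μ K0 T0 ε0 0 C) {X : Type*} [TopologicalSpace X]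
    {τ e : X → ℂ} {m : X → ℝ} (hτ : Continuous τ) {U : Set X} (hU : ∀ q ∈ U, e q ∈ ball 0 ε0)
    (q0 : X) : ∃ u : ℕ → ℝ, Summable u ∧ ∀ᶠ q in 𝓝[U] q0, ∀ n, ‖C (n + 1) 0 (m q) (e q) *
      (τ q ^ (n + 1) / (Gamma (((n + 1 : ℕ) : ℝ) / k) : ℝ))‖ ≤ u n := by
  refine ⟨_, (summable_borel_majorant hk hC.hT (R := ‖τ q0‖ + 1) pos!).mul_left K0, ?_⟩
  filter_upwards [eventually_norm_le hτ U q0, self_mem_nhdsWithin] with q hq hq' n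
  refine (hC.norm_borel1_term_le (hU q hq') k n (τ q) (m q)).trans ?_
  have h0 := borel_majorant_nonneg k n hC.hT (norm_nonneg (τ q))
  exact mul_le_mul (mul_le_of_le_one_right hC.hK (fw_le_one hC.hβ (neg_nonpos.2 hC.hμ) _))
    (borel_majorant_mono k n hC.hT (norm_nonneg _) hq) h0 hC.hK

lemma PosFamily.borel12_locally_summable (hk1 : 1 ≤ k1) (hk2 : 1 ≤ k2) (hn : n0 ≤ 1) (hC : PosFamily β μ K0 T0 ε0 n0 C)
    {X : Type*} [TopologicalSpace X] {τ1 τ2 e : X → ℂ} {m : X → ℝ} (hτ1 : Continuous τ1)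
    (hτ2 : Continuous τ2) {U : Set X} (hU : ∀ q ∈ U, e q ∈ ball 0 ε0)
    (q0 : X) : ∃ u : ℕ × ℕ → ℝ, Summable u ∧ ∀ᶠ q in 𝓝[U] q0, ∀ n : ℕ × ℕ,
      ‖C (n.1 + 1) (n.2 + 1) (m q) (e q) *
        (τ1 q ^ (n.1 + 1) / (Gamma (((n.1 + 1 : ℕ) : ℝ) / k1) : ℝ)) *
        (τ2 q ^ (n.2 + 1) / (Gamma (((n.2 + 1 : ℕ) : ℝ) / k2) : ℝ))‖ ≤ u n := by
  have hs := (summable_borel_majorant hk1 hC.hT (R := ‖τ1 q0‖ + 1) pos!).mul_of_nonneg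
    (summable_borel_majorant hk2 hC.hT (R := ‖τ2 q0‖ + 1) pos!)
    (fun n => borel_majorant_nonneg k1 n hC.hT pos!)
    (fun n => borel_majorant_nonneg k2 n hC.hT pos!)
  refine ⟨_, hs.mul_left K0, ?_⟩
  filter_upwards [eventually_norm_le hτ1 U q0, eventually_norm_le hτ2 U q0, self_mem_nhdsWithin]
    with q hq1 hq2 hq' n
  refine (hC.norm_borel12_term_le hn (hU q hq') k1 k2 n (τ1 q) (τ2 q) (m q)).trans ?_
  have h1 := borel_majorant_nonneg k1 n.1 hC.hT (norm_nonneg (τ1 q))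
  have h2 := borel_majorant_nonneg k2 n.2 hC.hT (norm_nonneg (τ2 q))
  have h3 := borel_majorant_nonneg k1 n.1 hC.hT (by positivity : 0 ≤ ‖τ1 q0‖ + 1)
  exact mul_le_mul (mul_le_of_le_one_right hC.hK (fw_le_one hC.hβ (neg_nonpos.2 hC.hμ) _))
    (mul_le_mul (borel_majorant_mono k1 n.1 hC.hT (norm_nonneg _) hq1)
      (borel_majorant_mono k2 n.2 hC.hT (norm_nonneg _) hq2) h2 h3) (mul_nonneg h1 h2) hC.hK

lemma PosFamily.continuousOn_borel1 (hk : 1 ≤ k) (hC : PosFamily β μ K0 T0 ε0 0 C) :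
    ContinuousOn (fun q : ℂ × ℝ × ℂ => borel₁ k C q.2.2 q.1 q.2.1)
      (univ ×ˢ univ ×ˢ ball 0 ε0) := by
  refine continuousOn_tsum_of_locally (fun n => ?_) fun q0 _ =>
    hC.borel1_locally_summable hk (X := ℂ × ℝ × ℂ) (τ := fun q => q.1)
      (e := fun q => q.2.2) (m := fun q => q.2.1) continuous_fst (fun q hq => hq.2.2) q0
  refine ContinuousOn.mul ?_ fp!
  exact (hC.continuousOn (Nat.zero_le _) (Nat.zero_le _)).comp
    (f := fun q : ℂ × ℝ × ℂ => q.2) fp! fun q hq => hq.2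

lemma PosFamily.differentiableOn_borel1 (hk : 1 ≤ k) (hC : PosFamily β μ K0 T0 ε0 0 C) (m : ℝ) :
    DifferentiableOn ℂ (fun p : ℂ × ℂ => borel₁ k C p.2 p.1 m) (univ ×ˢ ball 0 ε0) := by
  refine differentiableOn_tsum_of_locally (isOpen_univ.prod isOpen_ball) (fun n => ?_) fun q0 _ =>
    hC.borel1_locally_summable hk (X := ℂ × ℂ) (τ := fun q => q.1)
      (e := fun q => q.2) (m := fun q => m) continuous_fst (fun q hq => hq.2) q0
  refine DifferentiableOn.mul ?_ fp!
  exact (hC.holo _ _ (Nat.zero_le _) (Nat.zero_le _) m).comp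
    (f := fun q : ℂ × ℂ => q.2) fp! fun q hq => hq.2

lemma PosFamily.continuousOn_borel12 (hk1 : 1 ≤ k1) (hk2 : 1 ≤ k2) (hn : n0 ≤ 1) (hC : PosFamily β μ K0 T0 ε0 n0 C) :
    ContinuousOn (fun q : ℙ => borel₁₂ k1 k2 C q.2.2.2 q.1 q.2.1 q.2.2.1)
      (univ ×ˢ univ ×ˢ univ ×ˢ ball 0 ε0) := by
  refine continuousOn_tsum_of_locally (fun n => ?_) fun q0 _ =>
    hC.borel12_locally_summable hk1 hk2 hn (X := ℙ) (τ1 := fun q => q.1)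
      (τ2 := fun q => q.2.1) (e := fun q => q.2.2.2) (m := fun q => q.2.2.1) continuous_fst
      fp! (fun q hq => hq.2.2.2) q0
  refine ContinuousOn.mul (ContinuousOn.mul ?_ fp!) fp!
  exact (hC.continuousOn (by omega) (by omega)).comp
    (f := fun q : ℙ => q.2.2) fp! fun q hq => hq.2.2

lemma PosFamily.continuous_borel1 (hC : PosFamily β μ K0 T0 ε0 0 C) (hk : 1 ≤ k)
    (hε : ε ∈ ball 0 ε0) : Continuous fun q : ℂ × ℝ => borel₁ k C ε q.1 q.2 :=
  (hC.continuousOn_borel1 hk).comp_continuous (f := fun q : ℂ × ℝ => (q.1, q.2, ε)) fp!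
    fun q => ⟨mem_univ _, mem_univ _, hε⟩

lemma PosFamily.continuous_borel12 (hC : PosFamily β μ K0 T0 ε0 n0 C) (hk1 : 1 ≤ k1) (hk2 : 1 ≤ k2)
    (hn : n0 ≤ 1) (hε : ε ∈ ball 0 ε0) :
    Continuous fun q : ℂ × ℂ × ℝ => borel₁₂ k1 k2 C ε q.1 q.2.1 q.2.2 :=
  (hC.continuousOn_borel12 hk1 hk2 hn).comp_continuous (f := fun q : ℂ × ℂ × ℝ => (q.1, q.2.1, q.2.2, ε)) fp!
    fun q => ⟨mem_univ _, mem_univ _, mem_univ _, hε⟩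

lemma PosFamily.differentiableOn_borel12 (hk1 : 1 ≤ k1) (hk2 : 1 ≤ k2) (hn : n0 ≤ 1) (hC : PosFamily β μ K0 T0 ε0 n0 C) (m : ℝ) :
    DifferentiableOn ℂ (fun p : ℂ × ℂ × ℂ => borel₁₂ k1 k2 C p.2.2 p.1 p.2.1 m)
      (univ ×ˢ univ ×ˢ ball 0 ε0) := by
  refine differentiableOn_tsum_of_locally (isOpen_univ.prod (isOpen_univ.prod isOpen_ball))
    (fun n => ?_) fun q0 _ =>
    hC.borel12_locally_summable hk1 hk2 hn (X := ℂ × ℂ × ℂ) (τ1 := fun q => q.1)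
      (τ2 := fun q => q.2.1) (e := fun q => q.2.2) (m := fun q => m) continuous_fst
      fp! (fun q hq => hq.2.2) q0
  refine DifferentiableOn.mul (DifferentiableOn.mul ?_ fp!) fp!
  exact (hC.holo _ _ (by omega) (by omega) m).comp
    (f := fun q : ℂ × ℂ × ℂ => q.2.2) fp! fun q hq => hq.2.2

section

/-- The coefficient functions of the convolution equation are regular. -/
lemma regCoefs_coefs (hS : S.Setup ρ β μ r) (hC : PosFamily β μ K0 T0 ε0 0 C) (hF : PosFamily β μ K0 T0 ε0 1 F) :
    RegCoefs S ρ (puncturedDisc ε0) (S.coefs C F) := by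
  have hk1 := hS.time₁.one_le_k
  have hk2 := hS.time₂.one_le_k
  have hV : puncturedDisc ε0 ⊆ ball 0 ε0 := sdiff_subset
  refine ⟨⟨?_, fun m => ?_⟩, ⟨?_, fun m => ?_⟩, ⟨?_, fun m => ?_⟩, ⟨?_, fun m => ?_⟩, ⟨?_, fun m => ?_⟩⟩
  · exact (hC.continuousOn_borel12 hk1 hk2 zero_le_one).mono
      fun q hq => ⟨mem_univ _, mem_univ _, mem_univ _, hV hq.2.2.2⟩
  · exact (hC.differentiableOn_borel12 hk1 hk2 zero_le_one m).mono
      fun q hq => ⟨mem_univ _, mem_univ _, hV hq.2.2⟩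
  · exact (hC.continuousOn_borel1 hk1).comp
      (f := fun q : ℙ => (q.1, q.2.2.1, q.2.2.2)) fp!
      fun q hq => ⟨mem_univ _, mem_univ _, hV hq.2.2.2⟩
  · exact (hC.differentiableOn_borel1 hk1 m).comp
      (f := fun q : ℂ × ℂ × ℂ => (q.1, q.2.2)) fp! fun q hq => ⟨mem_univ _, hV hq.2.2⟩
  · exact (hC.swap.continuousOn_borel1 hk2).comp
      (f := fun q : ℙ => (q.2.1, q.2.2.1, q.2.2.2)) fp!
      fun q hq => ⟨mem_univ _, mem_univ _, hV hq.2.2.2⟩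
  · exact (hC.swap.differentiableOn_borel1 hk2 m).comp
      (f := fun q : ℂ × ℂ × ℂ => (q.2.1, q.2.2)) fp! fun q hq => ⟨mem_univ _, hV hq.2.2⟩
  · exact (hC.continuousOn (le_refl 0) (le_refl 0)).comp
      (f := fun q : ℙ => q.2.2) fp! fun q hq => ⟨mem_univ _, hV hq.2.2.2⟩
  · exact (hC.holo 0 0 le_rfl le_rfl m).comp
      (f := fun q : ℂ × ℂ × ℂ => q.2.2) fp! fun q hq => hV hq.2.2
  · exact (hF.continuousOn_borel12 hk1 hk2 le_rfl).mono
      fun q hq => ⟨mem_univ _, mem_univ _, mem_univ _, hV hq.2.2.2⟩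
  · exact (hF.differentiableOn_borel12 hk1 hk2 le_rfl m).mono
      fun q hq => ⟨mem_univ _, mem_univ _, hV hq.2.2⟩

lemma coefs_small (hS : S.Setup ρ β μ r) (hC : PosFamily β μ K0 T0 ε0 0 C) (hF : PosFamily β μ K0 T0 ε0 1 F)
    (hsm : S.SmallBorel ρ β μ ε0 ζ ζ ζ ζ C F) (hε : ε ∈ puncturedDisc ε0)
    (h0 : normE β μ (fun m => C 0 0 m ε) ≤ ζ) : (S.coefs C F ε).Small S ρ β μ ε ζ := by
  have hk1 := hS.time₁.one_le_k
  have hk2 := hS.time₂.one_le_k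
  have hε0 : ε ≠ 0 := hε.2
  obtain ⟨⟨m1, b1⟩, ⟨m2, b2⟩, ⟨m3, b3⟩, ⟨m4, b4⟩⟩ := hsm ε hε
  have hζ := (norm_nonneg _).trans (norm_le_of_memE (hC.mem 0 0 le_rfl le_rfl ε hε.1) h0 0)
  rw [fw, abs_zero, add_zero, Real.one_rpow, one_mul, mul_zero, neg_zero, Real.exp_zero, mul_one] at hζ
  refine ⟨⟨hζ, ?_, S.bd_of_memF hS.hρ hε0 m1 b1⟩, ⟨hζ, ?_, fun τ1 h1 τ2 _ m => ?_⟩,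
    ⟨hζ, ?_, fun τ1 _ τ2 h2 m => ?_⟩, ⟨hζ, ?_, S.bd_of_memF hS.hρ hε0 m2 b2⟩,
    ⟨hζ, ?_, fun τ1 _ τ2 _ m => ?_⟩⟩
  · exact (hC.continuous_borel12 hk1 hk2 zero_le_one hε.1).measurable
  · exact ((hC.continuous_borel1 hk1 hε.1).comp (f := fun q : ℂ × ℂ × ℝ => (q.1, q.2.2)) fp!).measurable
  · refine (S.t₁.bd_of_memF1 hS.hρ hε0 m3 b3 h1 m).trans_eq ?_
    simp [CauchyData.Wb, TimeData.wtb]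
  · exact ((hC.swap.continuous_borel1 hk2 hε.1).comp (f := fun q : ℂ × ℂ × ℝ => (q.2.1, q.2.2)) fp!).measurable
  · refine (S.t₂.bd_of_memF1 hS.hρ hε0 m4 b4 h2 m).trans_eq ?_
    simp [CauchyData.Wb, TimeData.wtb]
  · exact (hF.continuous_borel12 hk1 hk2 le_rfl hε.1).measurable
  · exact (hC.mem 0 0 le_rfl le_rfl ε hε.1).1.measurable.comp
      (f := fun q : ℂ × ℂ × ℝ => q.2.2) fp!
  · refine (norm_le_of_memE (h := fun m => C 0 0 m ε) (hC.mem 0 0 le_rfl le_rfl ε hε.1) h0 m).trans_eq ?_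
    simp [CauchyData.Wb, TimeData.wtb]

/-- A monomial of the Borel transform, for small `|ε| / T0`. -/
lemma TimeData.monomial_le {A B : ℝ} (hA : 0 < A) (hB : 0 < B)
    (h : ∀ (n : ℕ) (z : ℂ),
      ‖z‖ ^ (n + 1) / Gamma (((n + 1 : ℕ) : ℝ) / t.k) ≤ A * B ^ (n + 1) * t.wt 1 z)
    (hT : 0 < T0) (hε : ε ≠ 0) (hu : ‖ε‖ / T0 * B ≤ u) (hu2 : u ≤ 1 / 2) (n : ℕ) (τ : ℂ) :
    (1 / T0) ^ (n + 1) * (‖τ‖ ^ (n + 1) / Gamma (((n + 1 : ℕ) : ℝ) / t.k)) ≤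
      A * u * t.wt 1 (τ / ε) * (1 / 2) ^ n := by
  have hε' : 0 < ‖ε‖ := norm_pos_iff.2 hε
  have h1 : ‖τ‖ = ‖ε‖ * ‖τ / ε‖ := by rw [norm_div]; field_simp
  have hq0 : 0 ≤ ‖ε‖ / T0 * B := by positivity
  have w0 := t.wt_nonneg 1 (τ / ε)
  calc _ = (‖ε‖ / T0) ^ (n + 1) * (‖τ / ε‖ ^ (n + 1) / Gamma (((n + 1 : ℕ) : ℝ) / t.k)) := by
        rw [h1, mul_pow, div_pow, div_pow]; ring
    _ ≤ (‖ε‖ / T0) ^ (n + 1) * (A * B ^ (n + 1) * t.wt 1 (τ / ε)) :=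
        mul_le_l (h n _)
    _ = A * t.wt 1 (τ / ε) * ((‖ε‖ / T0 * B) * (‖ε‖ / T0 * B) ^ n) := by
        rw [← pow_succ', mul_pow]; ring
    _ ≤ A * t.wt 1 (τ / ε) * (u * (1 / 2) ^ n) :=
        mul_le_l (mul_le_mul hu (pow_le_pow_left₀ hq0 (hu.trans hu2) n)
          pos! (hq0.trans hu))
    _ = _ := by ring

lemma PosFamily.norm_borel1_le {A B : ℝ} (hA : 0 < A) (hB : 0 < B)
    (h : ∀ (n : ℕ) (z : ℂ),
      ‖z‖ ^ (n + 1) / Gamma (((n + 1 : ℕ) : ℝ) / t.k) ≤ A * B ^ (n + 1) * t.wt 1 z)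
    (hC : PosFamily β μ K0 T0 ε0 0 C)
    (hε : ε ∈ puncturedDisc ε0) (hu : ‖ε‖ / T0 * B ≤ u) (hu2 : u ≤ 1 / 2) (τ : ℂ) (m : ℝ) :
    ‖borel₁ t.k C ε τ m‖ ≤ K0 * (A * u) * 2 * (t.wt 1 (τ / ε) * fw β (-μ) m) := by
  have hf := (fw_pos β (-μ) m).le
  refine (tsum_of_norm_bounded (hasSum_geometric_two.mul_left
    (K0 * fw β (-μ) m * (A * u * t.wt 1 (τ / ε)))) fun n => ?_).trans_eq (by ring)
  refine (hC.norm_borel1_term_le hε.1 t.k n τ m).trans ?_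
  rw [mul_assoc (K0 * _)]
  exact mul_le_l (TimeData.monomial_le hA hB h hC.hT hε.2 hu hu2 n τ)
    (mul_nonneg hC.hK hf)

lemma PosFamily.norm_borel12_le (hn : n0 ≤ 1) {t₁ t₂ : TimeData} {A1 B1 A2 B2 : ℝ}
    (hA1 : 0 < A1) (hB1 : 0 < B1) (h1 : ∀ (n : ℕ) (z : ℂ),
      ‖z‖ ^ (n + 1) / Gamma (((n + 1 : ℕ) : ℝ) / t₁.k) ≤ A1 * B1 ^ (n + 1) * t₁.wt 1 z)
    (hA2 : 0 < A2) (hB2 : 0 < B2) (h2 : ∀ (n : ℕ) (z : ℂ),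
      ‖z‖ ^ (n + 1) / Gamma (((n + 1 : ℕ) : ℝ) / t₂.k) ≤ A2 * B2 ^ (n + 1) * t₂.wt 1 z)
    (hC : PosFamily β μ K0 T0 ε0 n0 C)
    (hε : ε ∈ puncturedDisc ε0) (hu1 : ‖ε‖ / T0 * B1 ≤ u) (hu2 : ‖ε‖ / T0 * B2 ≤ u)
    (hu : u ≤ 1 / 2) (τ1 τ2 : ℂ) (m : ℝ) :
    ‖borel₁₂ t₁.k t₂.k C ε τ1 τ2 m‖ ≤
      K0 * (A1 * u) * (A2 * u) * 4 * (t₁.wt 1 (τ1 / ε) * t₂.wt 1 (τ2 / ε) * fw β (-μ) m) := by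
  have hf := (fw_pos β (-μ) m).le
  have hs : Summable fun x : ℕ × ℕ => (1 / 2 : ℝ) ^ x.1 * (1 / 2) ^ x.2 :=
    summable_geometric_two.mul_of_nonneg summable_geometric_two (fun _ => by positivity)
      (fun _ => by positivity)
  refine (tsum_of_norm_bounded ((hasSum_geometric_two.mul hasSum_geometric_two hs).mul_left
    (K0 * fw β (-μ) m * (A1 * u * t₁.wt 1 (τ1 / ε) * (A2 * u * t₂.wt 1 (τ2 / ε))))) fun n => ?_).trans_eq
    (by ring)
  refine (hC.norm_borel12_term_le hn hε.1 t₁.k t₂.k n τ1 τ2 m).trans ?_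
  rw [mul_assoc (K0 * _)]
  refine mul_le_l ?_ (mul_nonneg hC.hK hf)
  have e1 := TimeData.monomial_le hA1 hB1 h1 hC.hT hε.2 hu1 hu n.1 τ1
  have e2 := TimeData.monomial_le hA2 hB2 h2 hC.hT hε.2 hu2 hu n.2 τ2
  have p1 := borel_majorant_nonneg t₁.k n.1 hC.hT (norm_nonneg τ1)
  have p2 := borel_majorant_nonneg t₂.k n.2 hC.hT (norm_nonneg τ2)
  exact (mul_le_mul e1 e2 p2 (p1.trans e1)).trans_eq (by ring)

/-- The Borel transforms of the coefficient series are small if `|ε|` is small. -/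
lemma exists_smallBorel (hS : S.Setup ρ β μ r)
    (hK : 0 < K0) (hT : 0 < T0) (hζ : 0 < ζ) : ∃ ε1 : ℝ, 0 < ε1 ∧ ∀ (ε0 : ℝ) (C F : Family),
      0 < ε0 → ε0 ≤ ε1 → PosFamily β μ K0 T0 ε0 0 C → PosFamily β μ K0 T0 ε0 1 F →
        S.SmallBorel ρ β μ ε0 ζ ζ ζ ζ C F := by
  have hk1 := hS.time₁.one_le_k
  have hk2 := hS.time₂.one_le_k
  obtain ⟨A1, B1, hA1, hB1, h1⟩ := S.t₁.exists_pow_div_Gamma_le hk1 hS.time₁.ν_pos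
  obtain ⟨A2, B2, hA2, hB2, h2⟩ := S.t₂.exists_pow_div_Gamma_le hk2 hS.time₂.ν_pos
  set L := 4 * K0 * ((1 + A1) * (1 + A2)) with hL
  have hL0 : 0 < L := by positivity
  set u := min (1 / 2) (ζ / L) with hu
  have hu0 : 0 < u := lt_min (by norm_num) pos!
  have hu2 : u ≤ 1 / 2 := min_le_left _ _
  have huL : L * u ≤ ζ := by
    have := mul_le_l (min_le_right (1 / 2) (ζ / L)) hL0.le
    rwa [mul_div_cancel₀ _ hL0.ne'] at this
  refine ⟨u * T0 / (B1 + B2), by positivity, fun ε0 C F hε0 hle hC hF ε hε => ?_⟩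
  have u0 : ε ≠ 0 := hε.2
  have hεn : ‖ε‖ ≤ u * T0 / (B1 + B2) := by
    have := hε.1
    rw [mem_ball_zero_iff] at this
    exact this.le.trans hle
  have hq : ‖ε‖ / T0 * (B1 + B2) ≤ u := by
    rw [le_div_iff₀ pos!] at hεn
    rw [div_mul_eq_mul_div, div_le_iff₀ hT]
    exact hεn
  have hn0 : 0 ≤ ‖ε‖ / T0 := by positivity
  have hq1 : ‖ε‖ / T0 * B1 ≤ u := (mul_le_l (by linarith) hn0).trans hq
  have hq2 : ‖ε‖ / T0 * B2 ≤ u := (mul_le_l (by linarith) hn0).trans hq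
  have c1 {A : ℝ} (hA : 0 < A) (h : A ≤ (1 + A1) * (1 + A2)) : K0 * (A * u) * 2 ≤ ζ := by
    refine le_trans ?_ huL
    calc K0 * (A * u) * 2 = 2 * K0 * A * u := by ring
      _ ≤ 4 * K0 * ((1 + A1) * (1 + A2)) * u := by gcongr; norm_num
  have c12 : K0 * (A1 * u) * (A2 * u) * 4 ≤ ζ := by
    refine le_trans ?_ huL
    have h3 : A1 * A2 ≤ (1 + A1) * (1 + A2) := by nlinarith
    have h4 : u * u ≤ u := mul_le_of_le_one_left hu0.le (by linarith)
    calc K0 * (A1 * u) * (A2 * u) * 4 = 4 * K0 * (A1 * A2) * (u * u) := by ring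
      _ ≤ 4 * K0 * ((1 + A1) * (1 + A2)) * u :=
        mul_le_m (mul_le_l h3) h4
  have mem12 : ∀ {n0 : ℕ} {C : Family}, n0 ≤ 1 → PosFamily β μ K0 T0 ε0 n0 C →
      MemF S.t₁ S.t₂ ρ β μ ε (borel₁₂ S.t₁.k S.t₂.k C ε) ∧
        normF S.t₁ S.t₂ ρ β μ ε (borel₁₂ S.t₁.k S.t₂.k C ε) ≤ ζ := by
    intro n0 C hn hC
    refine S.memF_of_bd hS.hρ u0 hζ.le (fun τ1 _ τ2 _ m => ?_) ?_ fun m => ?_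
    · exact (hC.norm_borel12_le hn hA1 hB1 h1 hA2 hB2 h2 hε hq1 hq2 hu2 τ1 τ2 m).trans
        (mul_le_r c12 (S.W_nonneg β ε 1 1 (-μ) τ1 τ2 m))
    · exact (hC.continuous_borel12 hk1 hk2 hn hε.1).continuousOn
    · exact (hC.differentiableOn_borel12 hk1 hk2 hn m).comp
        (f := fun q : ℂ × ℂ => (q.1, q.2, ε)) fp! fun q _ => ⟨mem_univ _, mem_univ _, hε.1⟩
  have mem1 : ∀ {t : TimeData} {A B : ℝ} {C : Family}, 1 ≤ t.k → 0 < A → 0 < B →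
      (∀ (n : ℕ) (z : ℂ),
        ‖z‖ ^ (n + 1) / Gamma (((n + 1 : ℕ) : ℝ) / t.k) ≤ A * B ^ (n + 1) * t.wt 1 z) →
      ‖ε‖ / T0 * B ≤ u → K0 * (A * u) * 2 ≤ ζ → PosFamily β μ K0 T0 ε0 0 C →
      MemF₁ t ρ β μ ε (borel₁ t.k C ε) ∧ normF₁ t ρ β μ ε (borel₁ t.k C ε) ≤ ζ := by
    intro t A B C hk hA hB h hq hc hC
    refine t.memF1_of_bd hS.hρ u0 hζ.le (fun τ _ m => ?_) ?_ fun m => ?_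
    · exact (hC.norm_borel1_le hA hB h hε hq hu2 τ m).trans
        (mul_le_r hc (mul_nonneg (t.wt_nonneg _ _) (fw_pos _ _ _).le))
    · exact (hC.continuous_borel1 hk hε.1).continuousOn
    · exact (hC.differentiableOn_borel1 hk m).comp
        (f := fun q : ℂ => (q, ε)) fp! fun q _ => ⟨mem_univ _, hε.1⟩
  exact ⟨mem12 zero_le_one hC, mem12 le_rfl hF, mem1 hk1 hA1 hB1 h1 hq1 (c1 hA1 (by nlinarith)) hC,
    mem1 hk2 hA2 hB2 h2 hq2 (c1 hA2 (by nlinarith)) hC.swap⟩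

end

/-! ### The measures of the Laplace transform and of the convolution -/

/-- The measure `k dr / r` on `(0, ∞)`. -/
def lam (k : ℕ) : Measure ℝ :=
  (volume.restrict (Ioi 0)).withDensity fun r => (((k : ℝ) * r⁻¹).toNNReal : ℝ≥0∞)

/-- The measure `dx / ((1 - x) x)` on `(0, 1)`. -/
def betaMeas : Measure ℝ :=
  (volume.restrict (Ioo 0 1)).withDensity fun x => ((((1 - x) * x)⁻¹).toNNReal : ℝ≥0∞)

instance (k : ℕ) : SFinite (lam k) := by unfold lam; infer_instance

instance : SFinite betaMeas := by unfold betaMeas; infer_instance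

lemma lintegral_lam (k : ℕ) {g : ℝ → ℝ≥0∞} (hg : Measurable g) :
    ∫⁻ r, g r ∂lam k = ∫⁻ r in Ioi (0 : ℝ), ENNReal.ofReal (k * r⁻¹) * g r := by
  rw [lam, lintegral_withDensity_eq_lintegral_mul _ fp! hg]
  rfl

lemma lintegral_betaMeas {g : ℝ → ℝ≥0∞} (hg : Measurable g) :
    ∫⁻ x, g x ∂betaMeas = ∫⁻ x in Ioo (0 : ℝ) 1, ENNReal.ofReal (((1 - x) * x)⁻¹) * g x := by
  rw [betaMeas, lintegral_withDensity_eq_lintegral_mul _ fp! hg]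
  rfl

lemma integral_lam (k : ℕ) (g : ℝ → ℂ) : ∫ r, g r ∂lam k = k * ∫ r in Ioi (0 : ℝ), g r / r := by
  rw [lam, integral_withDensity_eq_integral_smul fp!, ← integral_const_mul]
  refine setIntegral_congr_fun measurableSet_Ioi fun r hr => ?_
  have hr : 0 < r := hr
  have h : 0 ≤ k * r⁻¹ := by positivity
  simp only [NNReal.smul_def, Real.coe_toNNReal _ h, real_smul]
  push_cast
  ring

lemma integral_betaMeas (g : ℝ → ℂ) :
    ∫ x, g x ∂betaMeas = ∫ x in Ioo (0 : ℝ) 1, g x / (((1 - x) * x : ℝ) : ℂ) := by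
  rw [betaMeas, integral_withDensity_eq_integral_smul fp!]
  refine setIntegral_congr_fun measurableSet_Ioo fun x hx => ?_
  have h : 0 ≤ ((1 - x) * x)⁻¹ := inv_nonneg.2 (mul_nonneg (by linarith [hx.2]) hx.1.le)
  simp only [NNReal.smul_def, Real.coe_toNNReal _ h, real_smul]
  push_cast
  ring

lemma ae_lam (k : ℕ) : ∀ᵐ r ∂lam k, r ∈ Ioi (0 : ℝ) :=
  (withDensity_absolutelyContinuous _ _) (ae_restrict_mem measurableSet_Ioi)

/-- The substitution `s = r ^ k`. -/
lemma lintegral_lam_pow (hk : 1 ≤ k) {g : ℝ → ℝ≥0∞} (hg : Measurable g) :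
    ∫⁻ r, g (r ^ k) ∂lam k = ∫⁻ s, g s ∂lam 1 := by
  rw [lintegral_lam k fp!, lintegral_lam 1 hg]
  have him : (fun r : ℝ => r ^ k) '' Ioi 0 = Ioi 0 := by
    ext s
    constructor
    · rintro ⟨r, hr, rfl⟩
      exact pow_pos (mem_Ioi.1 hr) k
    · intro hs
      exact ⟨s ^ ((k : ℝ)⁻¹), Real.rpow_pos_of_pos hs _,
        Real.rpow_inv_natCast_pow (le_of_lt hs) (by omega)⟩
  have h := lintegral_image_eq_lintegral_abs_deriv_mul measurableSet_Ioi (fun r _ => (hasDerivAt_pow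
    k r).hasDerivWithinAt) (fun a ha b hb hab => (pow_left_inj₀ (le_of_lt ha) (le_of_lt hb) (by
    omega)).1 hab) fun s => .ofReal ((1 : ℕ) * s⁻¹) * g s
  rw [him] at h
  rw [h]
  refine setLIntegral_congr_fun measurableSet_Ioi fun r hr => ?_
  have hr : 0 < r := hr
  rw [← mul_assoc, ← ENNReal.ofReal_mul (abs_nonneg _)]
  rw [abs_of_nonneg pos!, Nat.cast_one, one_mul]
  obtain ⟨j, rfl⟩ : ∃ j, k = j + 1 := ⟨k - 1, by omega⟩
  rw [Nat.add_sub_cancel, pow_succ]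
  field_simp

lemma lintegral_shear_one {G : ℝ × ℝ → ℝ≥0∞} (hG : Measurable G) :
    ∫⁻ s, ∫⁻ x, G (s * (1 - x), s * x) ∂betaMeas ∂lam 1 = ∫⁻ a, ∫⁻ b, G (a, b) ∂lam 1 ∂lam 1 := by
  set H : ℝ × ℝ → ℝ≥0∞ := (Ioi 0 ×ˢ Ioi 0).indicator fun p =>
    .ofReal p.1⁻¹ * .ofReal p.2⁻¹ * G p with hH
  have hHm : Measurable H :=
    .indicator fp! (measurableSet_Ioi.prod measurableSet_Ioi)
  have m1 : Measurable fun s : ℝ => ∫⁻ x, G _ ∂betaMeas := .lintegral_prod_right' (f := fun p : ℝ ×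
    ℝ => G (p.1 * (1 - p.2), p.1 * p.2)) (hG.comp fp!)
  have m2 : Measurable fun a : ℝ => ∫⁻ b, G (a, b) ∂lam 1 := .lintegral_prod_right' hG
  have hl : ∫⁻ s, ∫⁻ x, G (s * (1 - x), s * x) ∂betaMeas ∂lam 1 = ∫⁻ s, ∫⁻ y, H (s - y, y) := by
    rw [lintegral_lam 1 m1, ← lintegral_indicator measurableSet_Ioi]
    refine lintegral_congr fun s => ?_
    by_cases hs : s ∈ Ioi 0
    swap
    · rw [indicator_of_notMem hs, eq_comm]
      refine lintegral_eq_zero_of_ae_eq_zero (.of_forall fun y => ?_)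
      refine indicator_of_notMem (fun h => hs ?_) _
      have h1 : 0 < s - y := h.1
      have h2 : 0 < y := h.2
      exact show 0 < s by linarith
    have hs0 : 0 < s := hs
    rw [indicator_of_mem hs, lintegral_betaMeas fp!,
      ← lintegral_const_mul _ fp!]
    have hy : ∫⁻ y, H (s - y, y) = ∫⁻ y in Ioo 0 s,
        .ofReal (s - y)⁻¹ * .ofReal y⁻¹ * G (s - y, y) := by
      rw [← lintegral_indicator measurableSet_Ioo]
      refine lintegral_congr fun y => ?_
      by_cases hy : y ∈ Ioo 0 s
      · rw [indicator_of_mem hy, hH, indicator_of_mem]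
        exact ⟨show 0 < s - y by linarith [hy.2], hy.1⟩
      · rw [indicator_of_notMem hy, hH, indicator_of_notMem]
        exact fun h => hy ⟨h.2, by have h1 : 0 < s - y := h.1
                                   linarith⟩
    have him : (fun x : ℝ => s * x) '' Ioo 0 1 = Ioo 0 s := by
      rw [image_mul_left_Ioo hs0, mul_zero, mul_one]
    have h := lintegral_image_eq_lintegral_abs_deriv_mul (s := Ioo 0 1) measurableSet_Ioo (fun x _
      => by simpa using ((hasDerivAt_id x).const_mul s).hasDerivWithinAt) (fun a _ b _ hab =>
      mul_left_cancel₀ hs0.ne' hab) fun y => .ofReal (s - y)⁻¹ * .ofReal y⁻¹ * G (s - y, y)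
    rw [him] at h
    rw [hy, h]
    refine setLIntegral_congr_fun measurableSet_Ioo fun x hx => ?_
    have hx0 := hx.1
    have hx1 : 0 < 1 - x := by linarith [hx.2]
    rw [show s - s * x = s * (1 - x) by ring, ← mul_assoc, ← mul_assoc, ← mul_assoc,
      ← ENNReal.ofReal_mul pos!, ← ENNReal.ofReal_mul pos!,
      ← ENNReal.ofReal_mul pos!]
    congr 2
    rw [abs_of_pos hs0]
    push_cast
    field_simp
  have hr : ∫⁻ a, ∫⁻ b, G (a, b) ∂lam 1 ∂lam 1 = ∫⁻ a, ∫⁻ b, H (a, b) := by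
    rw [lintegral_lam 1 m2, ← lintegral_indicator measurableSet_Ioi]
    refine lintegral_congr fun a => ?_
    by_cases ha : a ∈ Ioi 0
    · rw [indicator_of_mem ha, lintegral_lam 1 fp!,
        ← lintegral_const_mul _ fp!, ← lintegral_indicator measurableSet_Ioi]
      refine lintegral_congr fun b => ?_
      by_cases hb : b ∈ Ioi 0
      · rw [indicator_of_mem hb, hH, indicator_of_mem (show (a, b) ∈ Ioi 0 ×ˢ Ioi 0 from ⟨ha, hb⟩)]
        simp only [Nat.cast_one, one_mul, mul_assoc]
      · rw [indicator_of_notMem hb, hH, indicator_of_notMem fun h => hb h.2]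
    · rw [indicator_of_notMem ha, eq_comm]
      exact lintegral_eq_zero_of_ae_eq_zero (.of_forall fun b =>
        indicator_of_notMem (fun h => ha h.1) _)
  have hH1 : Measurable fun p : ℝ × ℝ => H (p.1 - p.2, p.2) := hHm.comp fp!
  rw [hl, hr, lintegral_lintegral_swap hH1.aemeasurable,
    lintegral_lintegral_swap (f := fun a b => H (a, b)) hHm.aemeasurable]
  refine lintegral_congr fun y => ?_
  exact lintegral_sub_right_eq_self (fun a => H (a, y)) y

/-- The map `(r, x) ↦ (r (1 - x) ^ (1/k), r x ^ (1/k))`, which turns convolutions of order `k`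
into products. -/
def shear (k : ℕ) (p : ℝ × ℝ) : ℝ × ℝ :=
  (p.1 * (1 - p.2) ^ ((1 : ℝ) / k), p.1 * p.2 ^ ((1 : ℝ) / k))

lemma measurable_shear (k : ℕ) : Measurable (shear k) := by unfold shear; fun_prop

lemma measurePreserving_shear (hk : 1 ≤ k) :
    MeasurePreserving (shear k) ((lam k).prod betaMeas) ((lam k).prod (lam k)) := by
  refine ⟨measurable_shear k, Measure.ext_of_lintegral _ fun G hG => ?_⟩
  rw [lintegral_map hG (measurable_shear k), lintegral_prod (fun p => G (shear k p)) (hG.comp (measurable_shear k)).aemeasurable,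
    lintegral_prod _ hG.aemeasurable]
  set G' : ℝ × ℝ → ℝ≥0∞ := fun p => G (p.1 ^ ((1 : ℝ) / k), p.2 ^ ((1 : ℝ) / k)) with hG'
  have hG'm : Measurable G' := hG.comp fp!
  have root : ∀ r : ℝ, 0 < r → (r ^ k) ^ ((1 : ℝ) / k) = r := fun r hr => by
    rw [one_div]; exact Real.pow_rpow_inv_natCast hr.le (by omega)
  have m1 : Measurable fun s : ℝ => ∫⁻ x, G' _ ∂betaMeas := .lintegral_prod_right' (f := fun p : ℝ ×
    ℝ => G' (p.1 * (1 - p.2), p.1 * p.2)) (hG'm.comp fp!)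
  have m2 : Measurable fun a : ℝ => ∫⁻ b, G' (a, b) ∂lam 1 := .lintegral_prod_right' hG'm
  have hbm : ∀ᵐ x ∂betaMeas, x ∈ Ioo 0 1 :=
    (withDensity_absolutelyContinuous _ _) (ae_restrict_mem measurableSet_Ioo)
  calc ∫⁻ r, ∫⁻ x, G _ ∂betaMeas ∂lam k
      = ∫⁻ r, (fun s => ∫⁻ x, G' (s * (1 - x), s * x) ∂betaMeas) (r ^ k) ∂lam k := by
        refine lintegral_congr_ae ((ae_lam k).mono fun r hr => lintegral_congr_ae (hbm.mono fun x hx => ?_))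
        have hr0 : 0 < r := hr
        simp only [hG', shear]
        rw [mul_rpow pos! (by linarith [hx.2]),
          mul_rpow pos! hx.1.le, root r hr0]
    _ = ∫⁻ a, ∫⁻ b, G' (a, b) ∂lam 1 ∂lam 1 := by
        rw [lintegral_lam_pow hk m1, lintegral_shear_one hG'm]
    _ = ∫⁻ r, (fun a => ∫⁻ b, G' (a, b) ∂lam 1) (r ^ k) ∂lam k := (lintegral_lam_pow hk m2).symm
    _ = ∫⁻ r, ∫⁻ r', G (r, r') ∂lam k ∂lam k := by
        refine lintegral_congr_ae ((ae_lam k).mono fun r hr => ?_)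
        simp only
        rw [← lintegral_lam_pow hk fp!]
        refine lintegral_congr_ae ((ae_lam k).mono fun r' hr' => ?_)
        simp only [hG']
        rw [root r hr, root r' hr']

/-! ### The Laplace kernel and the rotation of the path of integration -/

lemma integrable_lam_iff (hk : 1 ≤ k) {E : Type*} [NormedAddCommGroup E] [NormedSpace ℝ E]
    {g : ℝ → E} : Integrable g (lam k) ↔ IntegrableOn (fun r => r⁻¹ • g r) (Ioi 0) := by
  have hk0 : (0 : ℝ) < k := mod_cast hk
  rw [lam, integrable_withDensity_iff_integrable_smul fp!, IntegrableOn,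
    ← integrable_smul_iff hk0.ne' (fun r : ℝ => r⁻¹ • g r)]
  refine integrable_congr ((ae_restrict_mem measurableSet_Ioi).mono fun r hr => ?_)
  have hr : 0 < r := hr
  have h : 0 ≤ k * r⁻¹ := by positivity
  simp only [NNReal.smul_def, Real.coe_toNNReal _ h, Pi.smul_apply, smul_smul]

lemma integrable_pow_mul_exp (hk : 1 ≤ k) (hn : 1 ≤ n) (hκ : 0 < κ) :
    Integrable (fun r : ℝ => r ^ n * exp (-(κ * r ^ k))) (lam k) := by
  rw [integrable_lam_iff hk]
  have hk0 : (0 : ℝ) < k := mod_cast hk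
  have hn0 : (1 : ℝ) ≤ n := mod_cast hn
  refine (integrableOn_rpow_mul_exp_neg_mul_rpow (s := n - 1) (by linarith) hk0 hκ).congr_fun
    (fun r hr => ?_) measurableSet_Ioi
  have hr := hr
  simp only
  rw [rpow_sub_one hr.ne', rpow_natCast, rpow_natCast, neg_mul]
  ring

lemma ray_ne_zero (γ : ℝ) (hr : r ≠ 0) : ray γ r ≠ 0 :=
  mul_ne_zero (ofReal_ne_zero.2 hr) (exp_ne_zero _)

lemma norm_ray (γ : ℝ) (hr : 0 ≤ r) : ‖ray γ r‖ = r := by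
  rw [ray, norm_mul, Complex.norm_exp_ofReal_mul_I, mul_one, norm_real, norm_of_nonneg hr]

lemma ray_mul (γ r c : ℝ) : ray γ (r * c) = ray γ r * (c : ℂ) := by simp only [ray]; push_cast; ring

lemma continuous_ray (γ : ℝ) : Continuous (ray γ) := by unfold ray; fun_prop

lemma exp_add_mul_I (x γ : ℝ) : Complex.exp (x + γ * I) = ray γ (exp x) := by
  rw [Complex.exp_add, ray, Complex.ofReal_exp]

/-- The kernel `e^{-(u/T)^k}` on the half-line `L_γ`. -/
def ker (k : ℕ) (γ : ℝ) (T : ℂ) (r : ℝ) : ℂ := Complex.exp (-(ray γ r / T) ^ k)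

/-- The rate of decay of the kernel on the half-line `L_γ`. -/
def rate (k : ℕ) (γ : ℝ) (T : ℂ) : ℝ := ((Complex.exp (γ * I) / T) ^ k).re

lemma norm_ker (k : ℕ) (γ : ℝ) (T : ℂ) (r : ℝ) : ‖ker k γ T r‖ = exp (-(rate k γ T * r ^ k)) := by
  rw [ker, Complex.norm_exp, rate, ray, mul_div_assoc, mul_pow, ← ofReal_pow,
    Complex.neg_re, Complex.re_ofReal_mul, mul_comm]

lemma rate_eq (k : ℕ) (γ φ : ℝ) (hρ : 0 < ρ) : rate k γ (ray φ ρ) = cos (k * (γ - φ)) / ρ ^ k := by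
  have h : .exp (γ * I) / ray φ ρ = (ρ⁻¹) * .exp ((γ - φ : ℝ) * I) := by
    rw [ray, Complex.ofReal_sub, sub_mul, Complex.exp_sub]
    push_cast
    field_simp
  rw [rate, h, mul_pow, ← ofReal_pow, Complex.re_ofReal_mul, ← Complex.exp_nat_mul,
    show k * ((γ - φ : ℝ) * I) = (k * (γ - φ) : ℝ) * I by
      push_cast; ring, Complex.exp_ofReal_mul_I_re, inv_pow]
  field_simp

lemma measurable_ker (k : ℕ) (γ : ℝ) (T : ℂ) : Measurable (ker k γ T) := by
  have := continuous_ray γ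
  exact (by fun_prop : Continuous fun r => Complex.exp _).measurable

/-- In logarithmic coordinates, `lam` is Lebesgue measure. -/
lemma integrable_lam_iff_exp (hk : 1 ≤ k) {E : Type*} [NormedAddCommGroup E]
    [NormedSpace ℝ E] {g : ℝ → E} : Integrable g (lam k) ↔ Integrable fun x : ℝ => g (exp x) := by
  rw [integrable_lam_iff hk, ← Real.range_exp, ← image_univ,
    integrableOn_image_iff_integrableOn_abs_deriv_smul .univ (fun x _ => (Real.hasDerivAt_exp
    x).hasDerivWithinAt) Real.exp_injective.injOn, integrableOn_univ]
  refine integrable_congr (.of_forall fun x => ?_)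
  simp only
  rw [abs_of_pos (exp_pos x), smul_smul, mul_inv_cancel₀ (exp_pos x).ne', one_smul]

lemma integral_lam_eq_exp (k : ℕ) (g : ℝ → ℂ) : ∫ r, g r ∂lam k = k * ∫ x : ℝ, g (exp x) := by
  rw [integral_lam, ← Real.range_exp, ← image_univ, integral_image_eq_integral_abs_deriv_smul .univ
      (fun x _ => (Real.hasDerivAt_exp x).hasDerivWithinAt) Real.exp_injective.injOn, setIntegral_univ]
  congr 2
  funext x
  rw [abs_of_pos (exp_pos x), real_smul, mul_div_cancel₀]
  exact ofReal_ne_zero.2 (exp_pos x).ne'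

/-- Horizontal lines in a strip give the same integral of a holomorphic function which decays at
infinity. -/
lemma integral_horizontal_eq {g : ℂ → ℂ} {a b : ℝ} {G : ℝ → ℝ} (hg : DifferentiableOn ℂ g {z | z.im
    ∈ [[a, b]]}) (hb : ∀ x : ℝ, ∀ y ∈ [[a, b]], ‖g (x + y * I)‖ ≤ G x) (hG : Integrable G) (h1 :
    Tendsto G atTop (𝓝 0)) (h2 : Tendsto G atBot (𝓝 0)) : ∫ x : ℝ, g (x + a * I) = ∫ x : ℝ, g (x + b
    * I) := by
  have hint := fun y hy => by
    refine hG.mono' (Continuous.aestronglyMeasurable ?_) (.of_forall fun x => hb x y hy)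
    exact continuousOn_univ.1 (hg.continuousOn.comp fp! fun x _ => by simpa using hy)
  have hrect : ∀ R : ℝ, (∫ x : ℝ in -R..R, g (x + a * I)) - (∫ x : ℝ in -R..R, g (x + b * I)) = I *
      (∫ y : ℝ in a..b, g ((-R : ℝ) + y * I)) - I * ∫ y : ℝ in a..b, g (R + y * I) := fun R => by
    have := Complex.integral_boundary_rect_eq_zero_of_differentiableOn g
      ((-R : ℝ) + a * I) (R + b * I) (hg.mono fun z hz => by
        have := hz.2
        simpa using this)
    simp only [Complex.add_re, Complex.mul_re, Complex.I_re, mul_zero, Complex.ofReal_im,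
      Complex.I_im, mul_one, sub_self, add_zero, Complex.add_im, Complex.mul_im, zero_add] at this
    linear_combination this
  have hside := fun R =>
    intervalIntegral.norm_integral_le_of_norm_le_const fun y hy => hb R y (uIoc_subset_uIcc hy)
  have hz : ∀ (l : Filter ℝ) (s : ℝ → ℝ), Tendsto (fun R => G (s R)) l (𝓝 0) →
      Tendsto (fun R : ℝ => I * ∫ y : ℝ in a..b, g ((s R) + y * I)) l (𝓝 0) := by
    intro l s hs
    have h0 : Tendsto (fun R => G (s R) * |b - a|) l (𝓝 0) := by simpa using hs.mul_const |b - a|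
    refine squeeze_zero_norm (fun R => ?_) h0
    rw [norm_mul, Complex.norm_I, one_mul]
    exact hside (s R)
  have ht : ∀ y ∈ [[a, b]], Tendsto (fun R : ℝ => ∫ x : ℝ in -R..R, g (x + y * I)) atTop (𝓝 _) :=
    fun y hy => intervalIntegral_tendsto_integral (hint y hy) tendsto_neg_atTop_atBot tendsto_id
  have hd := (ht a left_mem_uIcc).sub (ht b right_mem_uIcc)
  simp only [hrect] at hd
  have h0 := (hz atTop (fun R => -R) (h2.comp tendsto_neg_atTop_atBot)).sub (hz atTop (fun R => R) h1)
  rw [sub_zero] at h0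
  exact sub_eq_zero.1 (tendsto_nhds_unique hd h0)

/-- Rotation of the path of integration of a Laplace transform. -/
lemma integral_ker_rotate (hk : 1 ≤ k) (hn : 1 ≤ n) {f : ℂ → ℂ} {γ0 C N δ : ℝ} (hC : 0 ≤ C) (hN : N < δ) (hδ : ∀ γ ∈ [[γ0, γ1]], δ ≤ rate k γ T)
    (hf : DifferentiableOn ℂ (fun z => f (Complex.exp z)) {z | z.im ∈ [[γ0, γ1]]})
    (hb : ∀ γ ∈ [[γ0, γ1]], ∀ r : ℝ, 0 < r → ‖f (ray γ r)‖ ≤ C * r ^ n * exp (N * r ^ k)) :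
    ∫ r, f (ray γ0 r) * ker k γ0 T r ∂lam k = ∫ r, f (ray γ1 r) * ker k γ1 T r ∂lam k := by
  set κ := δ - N with hκ
  have hκ0 := sub_pos.2 hN
  set G : ℝ → ℝ := fun x => C * (exp x ^ n * exp (-(κ * exp x ^ k))) with hG
  set g : ℂ → ℂ := fun z => f (.exp z) * .exp (-(.exp z / T) ^ k) with hgd
  have hgr : ∀ x γ : ℝ, g (x + γ * I) = f (ray γ (exp x)) * ker k γ T (exp x) :=
    fun x γ => by rw [hgd]; simp only [exp_add_mul_I, ker]
  rw [integral_lam_eq_exp, integral_lam_eq_exp]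
  simp only [← hgr]
  congr 1
  refine integral_horizontal_eq (G := G) (hf.mul fp!) (fun x y hy => ?_) ?_ ?_ ?_
  · have hx := exp_pos x
    rw [hgr, norm_mul, norm_ker]
    calc _ ≤ (C * exp x ^ n * exp _) * exp (-(δ * exp x ^ k)) := by
          refine mul_le_mul (hb y hy _ hx) (exp_le_exp.2 (neg_le_neg ?_)) (exp_pos _).le
            pos!
          exact mul_le_r (hδ y hy)
      _ = C * (exp x ^ n * (exp (N * exp x ^ k) * exp (-(δ * exp x ^ k)))) := by ring
      _ = G x := by rw [← exp_add, hG, hκ]; ring_nf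
  · exact ((integrable_lam_iff_exp hk).1 (integrable_pow_mul_exp hk hn hκ0)).const_mul C
  · have h1 : Tendsto (fun r : ℝ => C * (r ^ n * exp (-κ * r))) atTop (𝓝 0) := by
      simpa using (tendsto_rpow_mul_exp_neg_mul_atTop_nhds_zero n κ hκ0).const_mul C
    refine squeeze_zero' (.of_forall fun x => by positivity) ?_ (h1.comp Real.tendsto_exp_atTop)
    filter_upwards [eventually_ge_atTop 0] with x hx
    have h1 := one_le_exp hx
    have : κ * exp x ≤ κ * exp x ^ k :=
      mul_le_l (le_self_pow₀ h1 (by omega)) hκ0.le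
    refine mul_le_l (mul_le_l (exp_le_exp.2 ?_)) hC
    linarith
  · have h1 : Tendsto (fun r : ℝ => C * (r ^ n * exp (-(κ * r ^ k)))) (𝓝 0) (𝓝 0) := by
      have : Continuous fun r : ℝ => C * (r ^ n * exp (-(κ * r ^ k))) := by fun_prop
      have := this.tendsto 0
      simpa [show n ≠ 0 by omega] using this
    exact h1.comp (Real.tendsto_exp_atBot)

/-! ### Convolutions under the Laplace transform -/

lemma integral_comp_measurePreserving {α β : Type*} [MeasurableSpace α] [MeasurableSpace β]
    {μ : Measure α} {ν : Measure β} {T : α → β} (hT : MeasurePreserving T μ ν) {f : β → ℂ}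
    (hf : AEStronglyMeasurable f ν) : ∫ a, f (T a) ∂μ = ∫ b, f b ∂ν := by
  rw [← hT.map_eq] at hf ⊢
  exact (integral_map hT.measurable.aemeasurable hf).symm

section
variable {α : Type*} [MeasurableSpace α] {ν : Measure α} [SFinite ν]

lemma integral_shear (hk : 1 ≤ k) {Φ : (ℝ × ℝ) × α → ℂ} (hΦ : Integrable Φ (((lam k).prod (lam
    k)).prod ν)) : Integrable (fun q : ℝ × α => ∫ x, Φ (shear k (q.1, x), q.2) ∂betaMeas) ((lam
    k).prod ν) ∧ ∫ q, (∫ x, Φ (shear k (q.1, x), q.2) ∂betaMeas) ∂((lam k).prod ν) = ∫ p, Φ p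
    ∂(((lam k).prod (lam k)).prod ν) := by
  have h1 := (measurePreserving_shear hk).prod (.id ν)
  -- the rearrangement `((r, a), x) ↦ ((r, x), a)`
  have h2 : MeasurePreserving (fun p : (ℝ × α) × ℝ => ((p.1.1, p.2), p.1.2))
      (((lam k).prod ν).prod betaMeas) (((lam k).prod betaMeas).prod ν) := by
    have e1 := measurePreserving_prodAssoc (lam k) ν betaMeas
    have e2 := (MeasurePreserving.id (lam k)).prod (Measure.measurePreserving_swap (μ := ν) (ν := betaMeas))
    have e3 := (measurePreserving_prodAssoc (lam k) betaMeas ν).symm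
    exact (e3.comp (e2.comp e1))
  have h3 := h1.comp h2
  have h4 := h3.integrable_comp_of_integrable hΦ
  refine ⟨h4.integral_prod_left, ?_⟩
  rw [← integral_comp_measurePreserving h3 hΦ.aestronglyMeasurable]
  exact (integral_prod _ h4).symm

/-- The multiplicative character `r ↦ e^{- z r ^ k}` of the convolution of order `k`. -/
def expk (k : ℕ) (z : ℂ) (r : ℝ) : ℂ := Complex.exp (-(z * (r : ℂ) ^ k))

lemma ker_eq_expk (k : ℕ) (γ : ℝ) (T : ℂ) (r : ℝ) :
    ker k γ T r = expk k ((Complex.exp (γ * I) / T) ^ k) r := by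
  rw [ker, expk, ray, mul_div_assoc, mul_pow, mul_comm]

lemma continuous_expk (k : ℕ) (z : ℂ) : Continuous (expk k z) := by unfold expk; fun_prop

lemma norm_expk (k : ℕ) (z : ℂ) (r : ℝ) : ‖expk k z r‖ = exp (-(z.re * r ^ k)) := by
  rw [expk, Complex.norm_exp, ← ofReal_pow, Complex.neg_re, Complex.re_mul_ofReal]

lemma expk_shear (hk : 1 ≤ k) (z : ℂ) (r : ℝ) (hx : x ∈ Ioo (0 : ℝ) 1) :
    expk k z (shear k (r, x)).1 * expk k z (shear k (r, x)).2 = expk k z r := by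
  have h1 : ∀ y : ℝ, 0 < y → (y ^ ((1 : ℝ) / k)) ^ k = y := fun y hy => by
    rw [one_div]; exact Real.rpow_inv_natCast_pow hy.le (by omega)
  have e1 := h1 x hx.1
  have e2 := h1 (1 - x) (by linarith [hx.2])
  simp only [expk, shear, ← ofReal_pow, mul_pow, e1, e2]
  rw [← Complex.exp_add]
  push_cast
  ring

/-- The measure integrating the first factor of `cvB`. -/
def lamB (b : Bool) (k : ℕ) : Measure ℝ := cond b (lam k) (Measure.dirac 1)

/-- The character integrated against the first factor of `cvB`. -/
def expB (b : Bool) (k : ℕ) (z : ℂ) (r : ℝ) : ℂ := cond b (expk k z r) 1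

instance (b : Bool) (k : ℕ) : SFinite (lamB b k) := by
  cases b
  · exact inferInstanceAs (SFinite (Measure.dirac (1 : ℝ)))
  · exact inferInstanceAs (SFinite (lam k))

lemma ae_betaMeas : ∀ᵐ x ∂betaMeas, x ∈ Ioo (0 : ℝ) 1 :=
  (withDensity_absolutelyContinuous _ _) (ae_restrict_mem measurableSet_Ioo)

/-- The Laplace transform turns the product `cvB` into an ordinary product. -/
lemma integral_cvB (hk : 1 ≤ k) (b : Bool) (γ : ℝ) (z : ℂ) {Ψ : ℂ → ℂ → α → ℂ} (hb : b = false → ∀ x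
    x' y a, Ψ x y a = Ψ x' y a) (hΨ : Integrable (fun p : (ℝ × ℝ) × α => Ψ (ray γ p.1.1) (ray γ
    p.1.2) p.2 * (expB b k z p.1.1 * expk k z p.1.2)) (((lamB b k).prod (lam k)).prod ν)) :
    Integrable (fun q : ℝ × α => cvB b k (fun x y => Ψ x y q.2) (ray γ q.1) * expk k z q.1) ((lam
    k).prod ν) ∧ ∫ q, cvB b k (fun x y => Ψ x y q.2) (ray γ q.1) * expk k z q.1 ∂((lam k).prod ν) =
    ∫ p, Ψ (ray γ p.1.1) (ray γ p.1.2) p.2 * (expB b k z p.1.1 * expk k z p.1.2) ∂(((lamB b k).prod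
    (lam k)).prod ν) := by
  cases b
  · have h1 : MeasurePreserving (.mk 1) (lam k) ((lamB false k).prod (lam k)) :=
      ⟨measurable_prodMk_left, (Measure.dirac_prod 1).symm⟩
    have h2 := h1.prod (.id ν)
    have h3 : ∀ q : ℝ × α, cvB false k (fun x y => Ψ x y q.2) (ray γ q.1) * expk k z q.1 =
        Ψ (ray γ 1) (ray γ q.1) q.2 * (expB false k z 1 * expk k z q.1) := fun q => by
      simp only [cvB, expB, cond_false, one_mul]
      rw [hb rfl (ray γ q.1) (ray γ 1)]
    simp only [h3]
    exact ⟨h2.integrable_comp_of_integrable hΨ, integral_comp_measurePreserving h2 hΨ.aestronglyMeasurable⟩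
  · have h := integral_shear hk hΨ
    have h3 : ∀ q : ℝ × α, (∫ x, Ψ _ _ q.2 *
        (expB true k z (shear k (q.1, x)).1 * expk k z (shear k (q.1, x)).2) ∂betaMeas) =
        cvB true k (fun x y => Ψ x y q.2) (ray γ q.1) * expk k z q.1 := fun q => by
      have e : ∫ x, Ψ (ray γ (shear k (q.1, x)).1) (ray γ (shear k (q.1, x)).2) q.2 *
          (expB true k z (shear k (q.1, x)).1 * expk k z (shear k (q.1, x)).2) ∂betaMeas =
          ∫ x, Ψ (ray γ (shear k (q.1, x)).1) (ray γ (shear k (q.1, x)).2) q.2 * expk k z q.1 ∂betaMeas := by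
        refine integral_congr_ae (ae_betaMeas.mono fun x hx => ?_)
        simp only [expB, cond_true]
        rw [expk_shear hk z q.1 hx]
      rw [e, integral_mul_const, integral_betaMeas]
      simp only [cvB]
      rw [convB_eq_setIntegral]
      simp only [shear, ray_mul]
    simp only [h3] at h
    exact h

end

/-! ### The Laplace transform in one variable -/

section
variable {α : Type*} [MeasurableSpace α] {ν : Measure α} [SFinite ν]
  {f : ℂ → α → ℂ}

/-- Integrability of `f e^{-κ r^k}` along the half-line `L_γ`, jointly with the parameter. -/
def LapInt (k : ℕ) (γ : ℝ) (ν : Measure α) (κ : ℝ) (f : ℂ → α → ℂ) : Prop :=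
  Integrable (fun q : ℝ × α => f (ray γ q.1) q.2 * expk k κ q.1) ((lam k).prod ν)

/-- The Laplace transform along `L_γ`, integrated over the parameter. -/
def lap (k : ℕ) (γ : ℝ) (ν : Measure α) (f : ℂ → α → ℂ) (T : ℂ) : ℂ :=
  ∫ q, f (ray γ q.1) q.2 * ker k γ T q.1 ∂((lam k).prod ν)

lemma ae_lam_prod (k : ℕ) (ν : Measure α) [SFinite ν] : ∀ᵐ q ∂((lam k).prod ν), (0 : ℝ) < q.1 :=
  quasiMeasurePreserving_fst.ae (ae_lam k)

lemma measurable_ray_comp (hf : Measurable fun p : ℂ × α => f p.1 p.2) (γ : ℝ) :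
    Measurable fun q : ℝ × α => f (ray γ q.1) q.2 :=
  hf.comp (((continuous_ray γ).measurable.comp measurable_fst).prodMk measurable_snd)

/-- Replacing the exponential factor by a function of faster decay. -/
lemma LapInt.of_le (h : LapInt k γ ν κ f) (hf : Measurable fun p : ℂ × α => f p.1 p.2) {g : ℝ → ℂ}
    (hg : Measurable g) {C : ℝ} (hC : ∀ r, 0 < r → ‖g r‖ ≤ C * exp (-(κ * r ^ k))) :
    Integrable (fun q : ℝ × α => f (ray γ q.1) q.2 * g q.1) ((lam k).prod ν) := by
  refine (Integrable.const_mul (.norm h) C).mono'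
    ((measurable_ray_comp hf γ).mul (hg.comp measurable_fst)).aestronglyMeasurable ?_
  filter_upwards [ae_lam_prod k ν] with q hq
  rw [norm_mul, norm_mul, norm_expk, ofReal_re, mul_left_comm]
  exact mul_le_l (hC _ hq) (norm_nonneg _)

lemma LapInt.ker (h : LapInt k γ ν κ f) (hf : Measurable fun p : ℂ × α => f p.1 p.2) (hT : κ ≤ rate
    k γ T) : Integrable (fun q : ℝ × α => f (ray γ q.1) q.2 * ker k γ T q.1) ((lam k).prod ν) := by
  refine h.of_le hf (measurable_ker k γ T) (C := 1) fun r hr => ?_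
  rw [norm_ker, one_mul]
  exact exp_le_exp.2 (neg_le_neg (mul_le_r hT))

lemma LapInt.mono (h : LapInt k γ ν κ f) (hf : Measurable fun p : ℂ × α => f p.1 p.2) (hκ : κ ≤ κ') :
    LapInt k γ ν κ' f := by
  refine h.of_le hf (continuous_expk k κ').measurable (C := 1) fun r hr => ?_
  rw [norm_expk, one_mul, ofReal_re]
  exact exp_le_exp.2 (neg_le_neg (mul_le_r hκ))

lemma exists_pow_mul_exp_le (p : ℕ) (h : κ < κ') : ∃ C : ℝ, 0 ≤ C ∧
    ∀ s : ℝ, 0 ≤ s → s ^ p * exp (-(κ' * s)) ≤ C * exp (-(κ * s)) := by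
  refine ⟨p.factorial / (κ' - κ) ^ p, by positivity, fun s hs => ?_⟩
  have h1 := Real.pow_div_factorial_le_exp ((κ' - κ) * s) pos! p
  have h2 : s ^ p ≤ p.factorial / (κ' - κ) ^ p * exp ((κ' - κ) * s) := by
    rw [mul_pow, div_le_iff₀ pos!] at h1
    rw [div_mul_eq_mul_div, le_div_iff₀ pos!]
    linarith
  calc s ^ p * exp (-(κ' * s)) ≤ (p.factorial / (κ' - κ) ^ p * exp _) * exp (-(κ' * s)) :=
        mul_le_r h2 (exp_pos _).le
    _ = p.factorial / (κ' - κ) ^ p * exp (-(κ * s)) := by rw [mul_assoc, ← exp_add]; ring_nf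

lemma LapInt.mul_pow (h : LapInt k γ ν κ f) (hf : Measurable fun p : ℂ × α => f p.1 p.2) (hκ : κ < κ')
    (p : ℕ) : LapInt k γ ν κ' fun σ a => (k * σ ^ k) ^ p * f σ a := by
  obtain ⟨C, hC, hb⟩ := exists_pow_mul_exp_le p hκ
  have := h.of_le hf (by
    have := continuous_ray γ
    have := continuous_expk k κ'
    exact (by fun_prop : Continuous fun r => (k * ray γ r ^ k) ^ p * expk k κ' r).measurable)
    fun r hr => by
      rw [norm_mul, norm_pow, norm_mul, norm_pow, norm_ray γ hr.le, norm_expk, ofReal_re,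
        norm_natCast, _root_.mul_pow, mul_assoc, mul_assoc]
      exact mul_le_l (hb _ pos!)
  refine this.congr (.of_forall fun q => ?_)
  ring

lemma integrable_monomial (hk : 1 ≤ k) (hn : 1 ≤ n) (γ : ℝ) (hz : 0 < z.re) (c : ℂ) :
    Integrable (fun r => ray γ r ^ n / c * expk k z r) (lam k) := by
  have := continuous_ray γ
  have h2 := continuous_expk k z
  refine ((integrable_pow_mul_exp hk hn hz).const_mul ‖c‖⁻¹).mono'
    (by fun_prop : Continuous _).aestronglyMeasurable ?_
  filter_upwards [ae_lam k] with r hr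
  rw [norm_mul, norm_div, norm_pow, norm_ray γ (le_of_lt hr), norm_expk]
  apply le_of_eq
  ring

lemma integral_mulB (hk : 1 ≤ k) (hn : 1 ≤ n) (hz : 0 < z.re) (h : Integrable (fun q : ℝ × α => f
    (ray γ q.1) q.2 * expk k z q.1) ((lam k).prod ν)) : Integrable (fun q : ℝ × α => mulB k n (fun σ
    => f σ q.2) (ray γ q.1) * expk k z q.1) ((lam k).prod ν) ∧ ∫ q, mulB k n (fun σ => f σ q.2) (ray
    γ q.1) * expk k z q.1 ∂((lam k).prod ν) = (∫ r, ray γ r ^ n / (Gamma ((n : ℝ) / k) : ℝ) * expk k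
    z r ∂lam k) * ∫ q, f (ray γ q.1) q.2 * expk k z q.1 ∂((lam k).prod ν) := by
  have h1 := (integrable_monomial hk hn γ hz (Gamma (n / k))).mul_prod h
  have h2 := measurePreserving_prodAssoc (lam k) (lam k) ν
  have h3 := h2.integrable_comp_of_integrable h1
  have e : ∀ p : (ℝ × ℝ) × α, ray γ p.1.1 ^ n / (Gamma (n / k)) * f (ray γ p.1.2) p.2 * (expB true k
      z p.1.1 * expk k z p.1.2) = ray γ p.1.1 ^ n / (Gamma (n / k)) * expk k z p.1.1 * (f (ray γ
      p.1.2) p.2 * expk k z p.1.2) := fun p => by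
    change _ * (expk k z p.1.1 * _) = _
    ring
  have h4 := integral_cvB hk true γ z (Ψ := fun x y a => x ^ n / (Gamma (n / k)) * f y a) (by simp)
    (h3.congr (.of_forall fun p => (e p).symm))
  have e2 : ∀ q : ℝ × α, mulB k n (fun σ => f σ q.2) (ray γ q.1) = cvB true k (fun x y => x ^ n /
    (Gamma (n / k)) * f y q.2) (ray γ q.1) := fun q => mulB_eq_convB hk n _ _
  simp only [e2]
  refine ⟨h4.1, h4.2.trans ((integral_congr_ae (.of_forall e)).trans ?_)⟩
  rw [← integral_prod_mul, ← integral_comp_measurePreserving h2 h1.aestronglyMeasurable]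
  rfl

lemma integral_real_monomial (hk : 1 ≤ k) (hn : 1 ≤ n) (hc : 0 < c) : ∫ r : ℝ, ((r ^ n * exp (-(c *
    r ^ k)) : ℝ) : ℂ) ∂lam k = ((c ^ (-(n : ℝ) / k) * Gamma ((n : ℝ) / k) : ℝ) : ℂ) := by
  have hk0 : (0 : ℝ) < k := mod_cast hk
  have hn0 : (1 : ℝ) ≤ n := mod_cast hn
  have h := integral_rpow_mul_exp_neg_mul_rpow (q := n - 1) hk0 (by linarith) hc
  rw [integral_lam]
  have e : ∫ r : ℝ in Ioi 0, (r ^ n * exp (-(c * r ^ k)) : ℝ) / (r : ℂ) =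
      ∫ r : ℝ in Ioi 0, ((r ^ ((n : ℝ) - 1) * exp (-c * r ^ (k : ℝ)) : ℝ) : ℂ) := by
    refine setIntegral_congr_fun measurableSet_Ioi fun r hr => ?_
    have hr := hr
    rw [← Complex.ofReal_div, rpow_sub_one hr.ne', rpow_natCast, rpow_natCast, neg_mul]
    ring
  rw [e, integral_complex_ofReal, h, ← Complex.ofReal_natCast, ← Complex.ofReal_mul]
  rw [sub_add_cancel]
  field_simp

lemma mem_sector_half (hk : 1 ≤ k) {φ : ℝ} (h : |φ - γ| < π / (2 * k)) : 0 < cos (k * (γ - φ)) := by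
  have hk0 : (0 : ℝ) < k := mod_cast hk
  rw [lt_div_iff₀ pos!] at h
  apply Real.cos_pos_of_mem_Ioo
  have h1 := abs_lt.1 (show |k * (γ - φ)| < π / 2 by
    rw [abs_mul, abs_of_pos hk0, abs_sub_comm]; linarith)
  exact ⟨by linarith, h1.2⟩

/-- The Laplace transform of `τ ^ n / Γ(n/k)` is `T ^ n`. -/
lemma integral_ker_monomial (hk : 1 ≤ k) (hn : 1 ≤ n) (hT : T ∈ sector γ (π / (2 * k))) :
    ∫ r, ray γ r ^ n / (Gamma ((n : ℝ) / k) : ℝ) * ker k γ T r ∂lam k = T ^ n := by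
  obtain ⟨ρ, φ, hρ, hφ, rfl⟩ := hT
  have hk0 : (0 : ℝ) < k := mod_cast hk
  change ∫ r, ray γ r ^ n / (Gamma (n / k)) * ker k γ (ray φ ρ) r ∂lam k = ray φ ρ ^ n
  have hφ' := mem_sector_half hk hφ
  have hΓ : 0 < Gamma (n / k) := Gamma_pos_of_pos pos!
  have hcos : ∀ γ' ∈ [[γ, φ]], cos (k * (γ - φ)) / ρ ^ k ≤ rate k γ' (ray φ ρ) := fun γ' hγ' => by
    rw [rate_eq k γ' φ hρ]
    refine div_le_r ?_
    rw [← Real.cos_abs (k * (γ - φ)), ← Real.cos_abs (k * (γ' - φ))]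
    rw [lt_div_iff₀ pos!] at hφ
    have h1 : |γ' - φ| ≤ |γ - φ| := by
      rw [abs_sub_comm γ', abs_sub_comm γ]
      exact abs_sub_right_of_mem_uIcc hγ'
    refine Real.cos_le_cos_of_nonneg_of_le_pi (abs_nonneg _) ?_ ?_
    · rw [abs_mul, abs_of_pos hk0, abs_sub_comm]
      linarith [pi_pos]
    · rw [abs_mul, abs_mul, abs_of_pos hk0]
      exact mul_le_l h1 hk0.le
  rw [integral_ker_rotate hk hn (f := fun u => u ^ n / (Gamma (n / k))) (C := (Gamma (n / k))⁻¹) (by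
    positivity) (div_pos hφ' (pow_pos hρ k)) hcos fp! fun γ' _ r hr => by
      rw [norm_div, norm_pow, norm_ray γ' hr.le, norm_real, norm_of_nonneg hΓ.le]
      simp [div_eq_inv_mul] ]
  have e : ∀ r, ray φ r ^ n / (Gamma (n / k)) * ker k φ (ray φ ρ) r =
      (.exp (φ * I) ^ n / (Gamma (n / k))) * (r ^ n * exp (-((ρ ^ k)⁻¹ * r ^ k)) : ℝ) := fun r => by
    have h1 : ray φ r / ray φ ρ = (r / ρ) := by
      have h1 := exp_ne_zero (φ * I)
      simp only [ray]
      rw [mul_div_mul_right _ _ h1]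
    rw [ker, h1, ray]
    push_cast
    ring_nf
  simp only [e]
  rw [integral_const_mul, integral_real_monomial hk hn pos!, ray, Complex.ofReal_mul]
  have h2 : ((ρ ^ k)⁻¹) ^ (-(n : ℝ) / k) = ρ ^ n := by
    rw [Real.inv_rpow pos!, ← rpow_natCast ρ k, ← rpow_mul hρ.le,
      ← rpow_neg hρ.le, show -(k * (-(n : ℝ) / k)) = n by field_simp, rpow_natCast]
  rw [h2]
  have : ((Gamma (n / k)) : ℂ) ≠ 0 := ofReal_ne_zero.2 hΓ.ne'
  push_cast
  field_simp
  ring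

lemma lap_mulB (hk : 1 ≤ k) (hn : 1 ≤ n) (hT : T ∈ sector γ (π / (2 * k))) (hκ0 : 0 < κ) (hκ : κ ≤
    rate k γ T) (hf : Measurable fun p : ℂ × α => f p.1 p.2) (h : LapInt k γ ν κ f) : lap k γ ν (fun
    σ a => mulB k n (fun σ' => f σ' a) σ) T = T ^ n * lap k γ ν f T := by
  have h1 := h.ker hf hκ
  have h2 := integral_ker_monomial hk hn hT
  simp only [lap, ker_eq_expk] at h1 h2 ⊢
  rw [(integral_mulB hk hn (hκ0.trans_le hκ) h1).2, h2]

lemma LapInt.mulB (hk : 1 ≤ k) (hn : 1 ≤ n) (hκ0 : 0 < κ) (h : LapInt k γ ν κ f) :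
    LapInt k γ ν κ fun σ a => TwoTime.mulB k n (fun σ' => f σ' a) σ :=
  (integral_mulB hk hn (by simpa using hκ0) h).1

lemma hasDerivAt_ker (k : ℕ) (γ : ℝ) (hT : T ≠ 0) (r : ℝ) : HasDerivAt (fun T => TwoTime.ker k γ T
    r) ((T ^ (k + 1))⁻¹ * (k * ray γ r ^ k * TwoTime.ker k γ T r)) T := by
  have h1 := (((hasDerivAt_id T).fun_inv hT).const_mul (ray γ r)).fun_pow k
  have h2 := h1.fun_neg.cexp
  have e : (fun T => TwoTime.ker k γ T r) = fun x => .exp (-(ray γ r * (id x)⁻¹) ^ k) := by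
    funext x; simp only [TwoTime.ker, div_eq_mul_inv, id]
  rw [e]
  refine h2.congr_deriv ?_
  simp only [id, TwoTime.ker, div_eq_mul_inv]
  rcases k with _ | k
  · simp
  · rw [Nat.add_sub_cancel, mul_pow, inv_pow, mul_pow, inv_pow, pow_succ (ray γ r) k]
    ring

lemma continuousAt_rate (k : ℕ) (γ : ℝ) (hT : T ≠ 0) : ContinuousAt (rate k γ) T := by
  have : ContinuousAt (fun T : ℂ => (.exp (γ * I) / T) ^ k) T :=
    (continuousAt_const.div continuousAt_id hT).pow k
  exact Complex.continuous_re.continuousAt.comp this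

lemma hasDerivAt_lap (hT : T ≠ 0) (hκ : κ < rate k γ T) (hf : Measurable fun p : ℂ × α => f p.1 p.2)
    (h : LapInt k γ ν κ f) :
    HasDerivAt (lap k γ ν f) ((T ^ (k + 1))⁻¹ * lap k γ ν (fun σ a => k * σ ^ k * f σ a) T) T := by
  obtain ⟨κ1, hκ1, hκ2⟩ := exists_between hκ
  have hU : ∀ᶠ z in 𝓝 T, κ1 < rate k γ z ∧ ‖T‖ / 2 < ‖z‖ := by
    refine ((continuousAt_rate k γ hT).eventually_const_lt hκ2).and
      (continuous_norm.continuousAt.eventually_const_lt ?_)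
    have := norm_pos_iff.2 hT
    linarith
  have h1 := h.mul_pow hf hκ1 1
  have hT0 := norm_pos_iff.2 hT
  have hm := fun z => (measurable_ray_comp hf γ).mul ((measurable_ker k γ z).comp measurable_fst)
  have hm' : Measurable fun p : ℂ × α => k * p.1 ^ k * f p.1 p.2 := by fun_prop
  have key := hasDerivAt_integral_of_dominated_loc_of_deriv_le (μ := (lam k).prod ν)
   
    (F' := fun z q => f (ray γ q.1) q.2 * ((z ^ (k + 1))⁻¹ * (k * ray γ q.1 ^ k * TwoTime.ker k γ z q.1)))
    (bound := fun q => ((‖T‖ / 2) ^ (k + 1))⁻¹ *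
      ‖(k * ray γ q.1 ^ k) ^ 1 * f (ray γ q.1) q.2 * expk k κ1 q.1‖) hU
    (.of_forall fun z => (hm z).aestronglyMeasurable) (h.ker hf hκ.le) ?_ ?_ ?_ ?_
  · refine key.2.congr_deriv ?_
    rw [lap, ← integral_const_mul]
    congr 1
    funext q
    ring
  · have := (measurable_ray_comp (f := fun σ a => k * σ ^ k * f σ a) hm' γ).mul ((measurable_ker k γ T).comp measurable_fst)
    refine (this.const_mul (T ^ (k + 1))⁻¹).aestronglyMeasurable.congr (.of_forall fun q => ?_)
    simp only [Pi.mul_apply, comp_apply]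
    ring
  · filter_upwards [ae_lam_prod k ν] with q hq z hz
    have hz0 : 0 < ‖z‖ := by linarith
    have e1 : ((‖z‖) ^ (k + 1))⁻¹ ≤ ((‖T‖ / 2) ^ (k + 1))⁻¹ :=
      inv_anti₀ pos! (pow_le_pow_left₀ pos! hz.2.le _)
    have e2 : exp (-(rate k γ z * q.1 ^ k)) ≤ exp (-(κ1 * q.1 ^ k)) :=
      exp_le_exp.2 (neg_le_neg (mul_le_r hz.1.le))
    simp only [norm_mul, norm_inv, norm_pow, norm_ker, norm_expk, pow_one]
    calc _ = (‖z‖ ^ (k + 1))⁻¹ * (‖(k : ℂ)‖ * ‖ray γ q.1‖ ^ k * ‖f (ray γ q.1) q.2‖ *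
          exp (-(rate k γ z * q.1 ^ k))) := by ring
      _ ≤ ((‖T‖ / 2) ^ (k + 1))⁻¹ * (‖(k : ℂ)‖ * ‖ray γ q.1‖ ^ k * ‖f (ray γ q.1) q.2‖ * exp (-(κ1 *
        q.1 ^ k))) := mul_le_m e1 (mul_le_l e2)
  · exact h1.norm.const_mul _
  · refine .of_forall fun q z hz => ?_
    have hz0 : z ≠ 0 := norm_pos_iff.1 (by linarith [hz.2])
    exact (hasDerivAt_ker k γ hz0 q.1).const_mul _

end

/-! ### Differential operators under the Laplace transform -/

lemma coefA_of_lt (k : ℕ) {p : ℕ} (h : δ < p) : coefA k δ p = 0 := by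
  induction δ generalizing p with
  | zero => obtain ⟨q, rfl⟩ : ∃ q, p = q + 1 := ⟨p - 1, by omega⟩
            rfl
  | succ δ ih =>
    obtain ⟨q, rfl⟩ : ∃ q, p = q + 1 := ⟨p - 1, by omega⟩
    rw [coefA, ih (by omega), ih (by omega), mul_zero, sub_zero]

lemma coefA_self (k δ : ℕ) : coefA k δ δ = 1 := by
  induction δ with
  | zero => rfl
  | succ δ ih => rw [coefA, ih, coefA_of_lt k (Nat.lt_succ_self δ), mul_zero, sub_zero]

lemma coefA_zero_right (k : ℕ) (h : 1 ≤ δ) : coefA k δ 0 = 0 := by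
  induction δ with
  | zero => omega
  | succ δ ih =>
    rw [coefA]
    rcases eq_zero_or_pos δ with rfl | h1
    · simp
    · rw [ih h1, mul_zero]

/-- The iterated derivatives in terms of the iterates of `T ^ (k + 1) ∂_T`. -/
lemma iteratedDeriv_eq_sum_coefA {U : Set ℂ} (hU : IsOpen U) (h0 : ∀ T ∈ U, T ≠ 0) {g : ℕ → ℂ → ℂ}
    (hg : ∀ p, ∀ T ∈ U, HasDerivAt (g p) ((T ^ (k + 1))⁻¹ * g (p + 1) T) T) (δ : ℕ) : ∀ T ∈ U,
    iteratedDeriv δ (g 0) T = ∑ p ∈ Finset.range (δ + 1), (coefA k δ p : ℂ) * ((T ^ (k * p + δ))⁻¹ *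
    g p T) := by
  induction δ with
  | zero =>
    intro T hT
    simp [coefA]
  | succ δ ih =>
    intro T hT
    have hT0 := h0 T hT
    have he : iteratedDeriv δ (g 0) =ᶠ[𝓝 T] fun T => ∑ p ∈ .range (δ + 1), (coefA k δ p) * ((T ^ (k
      * p + δ))⁻¹ * g p T) := (hU.eventually_mem hT).mono ih
    set h : ℕ → ℂ := fun p => (T ^ (k * p + (δ + 1)))⁻¹ * g p T with hh
    have hd : ∀ p, HasDerivAt (fun T => (coefA k δ p) * ((T ^ (k * p + δ))⁻¹ * g p T))
        ((coefA k δ p) * (-(k * p + δ : ℕ) * h p + h (p + 1))) T := fun p => by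
      have h1 := ((hasDerivAt_pow (k * p + δ) T).fun_inv (pow_ne_zero _ hT0)).fun_mul (hg p T hT)
      refine (h1.const_mul _).congr_deriv ?_
      have e1 : (k * p + δ : ℕ) * T ^ (k * p + δ - 1) / (T ^ (k * p + δ)) ^ 2 =
          (k * p + δ : ℕ) * (T ^ (k * p + (δ + 1)))⁻¹ := by
        rcases eq_zero_or_pos (k * p + δ) with h2 | h2
        · simp [h2]
        · obtain ⟨j, hj⟩ : ∃ j, k * p + δ = j + 1 := ⟨k * p + δ - 1, by omega⟩
          rw [← add_assoc, hj, Nat.add_sub_cancel]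
          field_simp
          ring
      have e2 : (T ^ (k * p + δ))⁻¹ * (T ^ (k + 1))⁻¹ = (T ^ (k * (p + 1) + (δ + 1)))⁻¹ := by ring
      rw [neg_div, e1, ← mul_assoc, e2]
      ring
    rw [iteratedDeriv_succ, he.deriv_eq, (HasDerivAt.fun_sum fun p _ => hd p).deriv]
    rw [Finset.sum_range_succ' (fun p => (coefA k (δ + 1) p) * h p)]
    simp only [mul_add, Finset.sum_add_distrib]
    rw [Finset.sum_range_succ' _]
    have e3 : ∑ p ∈ .range δ, (coefA k δ (p + 1)) * (-(k * (p + 1) + δ : ℕ) * h (p + 1)) =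
        ∑ p ∈ .range (δ + 1), (coefA k δ (p + 1)) * (-(k * (p + 1) + δ) * h (p + 1)) := by
      rw [Finset.sum_range_succ, coefA_of_lt k (Nat.lt_succ_self δ)]
      simp
    rw [e3, add_right_comm, ← Finset.sum_add_distrib]
    congr 1
    · refine sum_congr rfl fun p _ => ?_
      rw [coefA]
      push_cast
      ring
    · rw [coefA]
      push_cast
      ring

section
variable {α : Type*} [MeasurableSpace α] {ν : Measure α} {f g : ℂ → α → ℂ}

lemma LapInt.add (hf : LapInt k γ ν κ f) (hg : LapInt k γ ν κ g) :
    LapInt k γ ν κ fun σ a => f σ a + g σ a :=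
  (Integrable.add hf hg).congr (.of_forall fun q => by simp only [Pi.add_apply]; ring)

lemma LapInt.const_mul (c : ℂ) (hf : LapInt k γ ν κ f) : LapInt k γ ν κ fun σ a => c * f σ a :=
  (Integrable.const_mul hf c).congr (.of_forall fun q => by ring)

lemma LapInt.sum {ι : Type*} (s : Finset ι) {f : ι → ℂ → α → ℂ} (hf : ∀ i ∈ s, LapInt k γ ν κ (f i)) :
    LapInt k γ ν κ fun σ a => ∑ i ∈ s, f i σ a :=
  (integrable_finsetSum s hf).congr (.of_forall fun q => by simp only [sum_mul])

lemma lap_const_mul (c : ℂ) : lap k γ ν (fun σ a => c * f σ a) T = c * lap k γ ν f T := by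
  simp only [lap, mul_assoc, integral_const_mul]

end

section
variable {α : Type*} [MeasurableSpace α] {ν : Measure α} [SFinite ν]
  {f : ℂ → α → ℂ}

lemma isOpen_rate (k : ℕ) (γ κ : ℝ) : IsOpen {T : ℂ | T ≠ 0 ∧ κ < rate k γ T} :=
  isOpen_iff_eventually.2 fun _ hT => (isOpen_ne.eventually_mem hT.1).and ((continuousAt_rate k γ
  hT.1).eventually_const_lt hT.2)

lemma iteratedDeriv_lap (hT : T ≠ 0) (hκ : κ < rate k γ T) (hf : Measurable fun p : ℂ × α => f p.1
    p.2) (h : LapInt k γ ν κ f) (δ : ℕ) : iteratedDeriv δ (lap k γ ν f) T = ∑ p ∈ Finset.range (δ +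
    1), (coefA k δ p : ℂ) * ((T ^ (k * p + δ))⁻¹ * lap k γ ν (fun σ a => (k * σ ^ k) ^ p * f σ a) T)
    := by
  have hg : ∀ p, ∀ z ∈ {T : ℂ | T ≠ 0 ∧ κ < rate k γ T}, HasDerivAt _
        ((z ^ (k + 1))⁻¹ * lap k γ ν _ z) z := fun p z hz => by
    obtain ⟨κ1, h1, h2⟩ := exists_between hz.2
    have := hasDerivAt_lap hz.1 h2 fp! (h.mul_pow hf h1 p)
    simpa only [← mul_assoc, ← pow_succ'] using this
  have := iteratedDeriv_eq_sum_coefA (isOpen_rate k γ κ) (fun T hT => hT.1) hg δ T ⟨hT, hκ⟩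
  simpa only [pow_zero, one_mul] using this

lemma measurable_derivB (hk : 1 ≤ k) (δ : ℕ) (hf : Measurable fun p : ℂ × α => f p.1 p.2) :
    Measurable fun p : ℂ × α => derivB k δ (fun σ => f σ p.2) p.1 := by
  refine .add fp! (Finset.measurable_fun_sum _ fun p _ => ?_)
  refine .const_mul (measurable_mulB hk _ ?_ measurable_fst) _
  have := hf.comp (f := fun q : (ℂ × α) × ℂ => (q.2, q.1.2)) fp!
  exact .mul fp! this

lemma LapInt.derivB (hk : 1 ≤ k) (δ : ℕ) (hκ0 : 0 < κ) (hκ : κ < κ')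
    (hf : Measurable fun p : ℂ × α => f p.1 p.2) (h : LapInt k γ ν κ f) :
    LapInt k γ ν κ' fun σ a => TwoTime.derivB k δ (fun σ' => f σ' a) σ := by
  refine (h.mul_pow hf hκ δ).add (.sum _ fun p hp => .const_mul _ ?_)
  have hp := Finset.mem_Icc.1 hp
  refine .mulB hk ?_ (hκ0.trans hκ) (h.mul_pow hf hκ p)
  exact Nat.mul_pos hk (by omega)

lemma lap_derivB (hk : 1 ≤ k) (hδ : 1 ≤ δ) (hT0 : T ≠ 0) (hT : T ∈ sector γ (π / (2 * k))) (hκ0 : 0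
    < κ) (hκ : κ < rate k γ T) (hf : Measurable fun p : ℂ × α => f p.1 p.2) (h : LapInt k γ ν κ f) :
    T ^ (δ * (k + 1)) * iteratedDeriv δ (lap k γ ν f) T = lap k γ ν (fun σ a => derivB k δ (fun σ'
    => f σ' a) σ) T := by
  obtain ⟨κ1, h1, h2⟩ := exists_between hκ
  have hm := fun p => h.mul_pow hf h1 p
  have hmm : ∀ p ∈ Finset.Icc 1 (δ - 1), LapInt k γ ν κ1 fun σ a => (coefA k δ p) *
      mulB k (k * (δ - p)) (fun σ' => (k * σ' ^ k) ^ p * f σ' a) σ := fun p hp => by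
    have hp := Finset.mem_Icc.1 hp
    exact ((hm p).mulB hk (Nat.mul_pos hk (by omega)) (hκ0.trans h1)).const_mul _
  have meas : ∀ p, Measurable fun q : ℂ × α => (coefA k δ p) *
      mulB k (k * (δ - p)) (fun σ' => (k * σ' ^ k) ^ p * f σ' q.2) q.1 := fun p => by
    refine .const_mul (measurable_mulB hk _ ?_ measurable_fst) _
    have := hf.comp (f := fun q : (ℂ × α) × ℂ => (q.2, q.1.2)) fp!
    exact .mul fp! this
  have e : lap k γ ν (fun σ a => derivB k δ (fun σ' => f σ' a) σ) T = lap k γ ν (fun σ a => (k * σ ^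
      k) ^ δ * f σ a) T + ∑ p ∈ Finset.Icc 1 (δ - 1), (coefA k δ p) * (T ^ (k * (δ - p)) * lap k γ ν
      (fun σ a => (k * σ ^ k) ^ p * f σ a) T) := by
    have e1 : ∀ p ∈ Finset.Icc 1 (δ - 1), (coefA k δ p) * (T ^ (k * (δ - p)) * lap k γ ν (fun σ a =>
      (k * σ ^ k) ^ p * f σ a) T) = lap k γ ν (fun σ a => (coefA k δ p) * mulB k (k * (δ - p)) (fun
      σ' => (k * σ' ^ k) ^ p * f σ' a) σ) T := fun p hp => by
      have hp := Finset.mem_Icc.1 hp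
      rw [lap_const_mul, lap_mulB hk (Nat.mul_pos hk (by omega)) hT (hκ0.trans h1) h2.le fp! (hm p)]
    rw [sum_congr rfl e1]
    simp only [lap]
    rw [← integral_finsetSum _ fun p hp => (hmm p hp).ker (meas p) h2.le, ← integral_add ((hm δ).ker
      fp! h2.le) (integrable_finsetSum _ fun p hp => (hmm p hp).ker (meas p) h2.le)]
    congr 1
    funext q
    rw [← sum_mul, ← add_mul]
    rfl
  have key : ∀ p, p ≤ δ → T ^ (δ * (k + 1)) * (T ^ (k * p + δ))⁻¹ = T ^ (k * (δ - p)) := fun p hp => by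
    have : δ * (k + 1) = k * (δ - p) + (k * p + δ) := by
      obtain ⟨j, rfl⟩ := Nat.exists_eq_add_of_le hp
      rw [Nat.add_sub_cancel_left]
      ring
    rw [this, pow_add, mul_assoc, mul_inv_cancel₀ (pow_ne_zero _ hT0), mul_one]
  rw [iteratedDeriv_lap hT0 hκ hf h, e, mul_sum, Finset.sum_range_succ]
  obtain ⟨j, rfl⟩ : ∃ j, δ = j + 1 := ⟨δ - 1, by omega⟩
  rw [Finset.sum_range_succ', coefA_zero_right k hδ, coefA_self, Nat.add_sub_cancel, add_comm]
  congr 1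
  · rw [Int.cast_one, one_mul, ← mul_assoc, key _ le_rfl]
    simp
  · rw [Int.cast_zero, zero_mul, mul_zero, add_zero, Finset.range_eq_Ico, Finset.sum_Ico_add' (fun p
      => T ^ ((j + 1) * (k + 1)) * ((coefA k (j + 1) p) * ((T ^ (k * p + (j + 1)))⁻¹ * lap k γ ν
      (fun σ a => (k * σ ^ k) ^ p * f σ a) T))) 0 j 1, zero_add]
    refine sum_congr (by ext p; simp [mem_Icc]) fun p hp => ?_
    have hp := Finset.mem_Ico.1 hp
    rw [← key p (by omega)]
    ring

end

/-! ### Pairs of operators which correspond under the Laplace transform -/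

/-- The operator `O` in the Borel plane corresponds to the operator `D` on functions of `T` under
the Laplace transform of order `k` along `L_γ`. -/
structure LaplacePair (k : ℕ) (γ : ℝ) (O D : (ℂ → ℂ) → ℂ → ℂ) : Prop where
  const_mul : ∀ (c : ℂ) (f : ℂ → ℂ) (τ : ℂ), O (fun σ => c * f σ) τ = c * O f τ
  meas : ∀ {α : Type} [MeasurableSpace α] {f : ℂ → α → ℂ}, (Measurable fun p : ℂ × α => f p.1 p.2) →
    Measurable fun p : ℂ × α => O (fun σ => f σ p.2) p.1
  germ : ∀ {f g : ℂ → ℂ} {T : ℂ}, f =ᶠ[𝓝 T] g → D f T = D g T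
  const_mul' : ∀ (c : ℂ) (f : ℂ → ℂ) (T : ℂ), D (fun z => c * f z) T = c * D f T
  lapInt : ∀ {α : Type} [MeasurableSpace α] {ν : Measure α} [SFinite ν] {f : ℂ → α → ℂ} {κ κ' : ℝ},
    (Measurable fun p : ℂ × α => f p.1 p.2) → 0 < κ → κ < κ' → LapInt k γ ν κ f →
    LapInt k γ ν κ' fun σ a => O (fun σ' => f σ' a) σ
  lap_eq : ∀ {α : Type} [MeasurableSpace α] {ν : Measure α} [SFinite ν] {f : ℂ → α → ℂ} {κ : ℝ} {T : ℂ},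
    (Measurable fun p : ℂ × α => f p.1 p.2) → 0 < κ → LapInt k γ ν κ f →
    T ∈ sector γ (π / (2 * k)) → κ < rate k γ T →
    D (lap k γ ν f) T = lap k γ ν (fun σ a => O (fun σ' => f σ' a) σ) T

lemma ne_zero_of_mem_sector {a : ℝ} (h : T ∈ sector d a) : T ≠ 0 := by
  obtain ⟨r, φ, hr, -, rfl⟩ := h
  exact ray_ne_zero φ hr.ne'

namespace LaplacePair

variable {O D : (ℂ → ℂ) → ℂ → ℂ}

lemma mulB_comp (h : LaplacePair k γ O D) (hk : 1 ≤ k) (hn : 1 ≤ n) :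
    LaplacePair k γ (fun f => mulB k n (O f)) fun f T => T ^ n * D f T where
  const_mul c f τ := by
    simp only [funext (h.const_mul c f), mulB_const_mul hk]
  meas {α _ f} hf := measurable_mulB hk n (f := fun q : ℂ × α => O fun σ => f σ q.2) (τ := fun q => q.1)
    ((h.meas hf).comp (f := fun q : (ℂ × α) × ℂ => (q.2, q.1.2)) fp!) measurable_fst
  germ hf := by rw [h.germ hf]
  const_mul' c f T := by rw [h.const_mul']; ring
  lapInt {α _ ν _ f κ κ'} hf h0 hκ hi :=
    LapInt.mulB (f := fun σ a => O (fun σ' => f σ' a) σ) hk hn (h0.trans hκ) (h.lapInt hf h0 hκ hi)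
  lap_eq {α _ ν _ f κ T} hf h0 hi hT hκ := by
    obtain ⟨κ1, h1, h2⟩ := exists_between hκ
    rw [h.lap_eq hf h0 hi hT hκ]
    exact (lap_mulB (f := fun σ a => O (fun σ' => f σ' a) σ) hk hn hT (h0.trans h1) h2.le
      (h.meas hf) (h.lapInt hf h0 h1 hi)).symm

lemma id (k : ℕ) (γ : ℝ) : LaplacePair k γ (fun f => f) fun f => f where
  const_mul _ _ _ := rfl
  meas hf := hf
  germ hf := hf.eq_of_nhds
  const_mul' _ _ _ := rfl
  lapInt hf _ hκ hi := hi.mono hf hκ.le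
  lap_eq _ _ _ _ _ := rfl

lemma mulB (hk : 1 ≤ k) (γ : ℝ) (hn : 1 ≤ n) :
    LaplacePair k γ (TwoTime.mulB k n) fun f T => T ^ n * f T :=
  (LaplacePair.id k γ).mulB_comp hk hn

lemma derivB (hk : 1 ≤ k) (γ : ℝ) (hδ : 1 ≤ δ) :
    LaplacePair k γ (TwoTime.derivB k δ) fun f T => T ^ (δ * (k + 1)) * iteratedDeriv δ f T where
  const_mul c f τ := by
    rw [derivB_eq, derivB_eq, lowB_const_mul hk]
    ring
  meas hf := measurable_derivB hk δ hf
  germ hf := by rw [hf.iteratedDeriv_eq]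
  const_mul' c f T := by
    rw [show (fun z => c * f z) = c • f from rfl, iteratedDeriv_const_smul_field]
    simp only [smul_eq_mul]
    ring
  lapInt hf h0 hκ hi := hi.derivB hk δ h0 hκ hf
  lap_eq hf h0 hi hT hκ := lap_derivB hk hδ (ne_zero_of_mem_sector hT) hT h0 hκ hf hi

lemma opB (t : TimeData) (ht : t.Admissible) (γ m : ℝ) :
    LaplacePair t.k γ (t.opB m) fun f T => T ^ (t.k + 1) * t.opT m f T where
  const_mul c f τ := by
    have h := (LaplacePair.derivB ht.one_le_k γ ht.one_lt_δ.le).const_mul c f τ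
    rw [TimeData.opB, h, TimeData.opB]
    ring
  meas {α _ f} hf := by
    have h := (LaplacePair.derivB ht.one_le_k γ ht.one_lt_δ.le).meas hf
    unfold TimeData.opB
    fun_prop
  germ hf := by
    rw [TimeData.opT, TimeData.opT, hf.iteratedDeriv_eq, hf.deriv_eq]
  const_mul' c f T := by
    have h := (LaplacePair.derivB ht.one_le_k γ ht.one_lt_δ.le).const_mul' c f T
    rw [TimeData.opT, deriv_const_mul_field, show (fun z => c * f z) = c • f from rfl,
      iteratedDeriv_const_smul_field, TimeData.opT]
    simp only [smul_eq_mul]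
    ring
  lapInt {α _ ν _ f κ κ'} hf h0 hκ hi := by
    have h := (LaplacePair.derivB ht.one_le_k γ ht.one_lt_δ.le).lapInt hf h0 hκ hi
    have h1 := hi.mul_pow hf hκ 1
    refine ((h1.const_mul (t.Q.eval (I * m))).add
      (h.const_mul (-t.RD.eval (I * m)))).congr (.of_forall fun q => ?_)
    simp only [TimeData.opB, pow_one]
    ring
  lap_eq {α _ ν _ f κ T} hf h0 hi hT hκ := by
    obtain ⟨κ1, h1, h2⟩ := exists_between hκ
    have hp := LaplacePair.derivB ht.one_le_k γ ht.one_lt_δ.le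
    have h := hp.lapInt hf h0 h1 hi
    have h' := hi.mul_pow hf h1 1
    have hT0 := ne_zero_of_mem_sector hT
    have e1 := hp.lap_eq hf h0 hi hT hκ
    have e2 := (hasDerivAt_lap hT0 hκ hf hi).deriv
    have e3 : T ^ (t.δ t.D * (t.k + 1)) = T ^ (t.k + 1) * T ^ ((t.δ t.D - 1) * (t.k + 1)) := by
      rw [← pow_add]
      congr 1
      obtain ⟨j, hj⟩ : ∃ j, t.δ t.D = j + 1 := ⟨t.δ t.D - 1, by have := ht.one_lt_δ; omega⟩
      rw [hj, Nat.add_sub_cancel]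
      ring
    have e4 : lap t.k γ ν (fun σ a => t.opB m (fun σ' => f σ' a) σ) T =
        t.Q.eval (I * m) * lap t.k γ ν (fun σ a => t.k * σ ^ t.k * f σ a) T -
          lap t.k γ ν (fun σ a => TwoTime.derivB t.k (t.δ t.D) (fun σ' => f σ' a) σ) T *
            t.RD.eval (I * m) := by
      simp only [pow_one] at h'
      have hm : Measurable fun p : ℂ × α => t.k * p.1 ^ t.k * f p.1 p.2 := by fun_prop
      have i1 := h'.ker (f := fun σ a => t.k * σ ^ t.k * f σ a) hm h2.le
      have i2 := h.ker (hp.meas hf) h2.le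
      rw [lap, lap, lap, ← integral_const_mul, ← integral_mul_const,
        ← integral_sub (i1.const_mul _) (i2.mul_const _)]
      congr 1
      funext q
      simp only [TimeData.opB]
      ring
    rw [e4, ← e1, TimeData.opT, e2, e3]
    have : T ^ (t.k + 1) ≠ 0 := pow_ne_zero _ hT0
    field_simp

end LaplacePair

/-! ### The Laplace transform in two variables -/

section
variable {κ1' κ2' : ℝ} {f : ℂ → ℂ → ℂ}

/-- The Laplace transform in two variables. -/
def lap2 (k1 k2 : ℕ) (γ1 γ2 : ℝ) (f : ℂ → ℂ → ℂ) (T1 T2 : ℂ) : ℂ :=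
  ∫ p, f (ray γ1 p.1) (ray γ2 p.2) * (ker k1 γ1 T1 p.1 * ker k2 γ2 T2 p.2) ∂((lam k1).prod (lam k2))

/-- Integrability of `f e^{-κ1 r1^k1 - κ2 r2^k2}` on the product of two half-lines. -/
def LapInt2 (k1 k2 : ℕ) (γ1 γ2 κ1 κ2 : ℝ) (f : ℂ → ℂ → ℂ) : Prop :=
  Integrable (fun p : ℝ × ℝ => f (ray γ1 p.1) (ray γ2 p.2) * (expk k1 κ1 p.1 * expk k2 κ2 p.2))
    ((lam k1).prod (lam k2))

lemma LapInt2.fst (h : LapInt2 k1 k2 γ1 γ2 κ1 κ2 f) :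
    LapInt k1 γ1 (lam k2) κ1 fun σ r => expk k2 κ2 r * f σ (ray γ2 r) :=
  h.congr (.of_forall fun q => by simp only; ring)

lemma LapInt2.of_fst (h : LapInt k1 γ1 (lam k2) κ1 fun σ r => expk k2 κ2 r * f σ (ray γ2 r)) :
    LapInt2 k1 k2 γ1 γ2 κ1 κ2 f :=
  h.congr (.of_forall fun q => by simp only; ring)

lemma LapInt2.swap (h : LapInt2 k1 k2 γ1 γ2 κ1 κ2 f) :
    LapInt2 k2 k1 γ2 γ1 κ2 κ1 fun x y => f y x :=
  (Integrable.swap h).congr (.of_forall fun q => by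
    simp only [comp_apply, Prod.swap]; ring)

lemma lap2_swap (k1 k2 : ℕ) (γ1 γ2 : ℝ) (f : ℂ → ℂ → ℂ) (T1 T2 : ℂ) :
    lap2 k1 k2 γ1 γ2 f T1 T2 = lap2 k2 k1 γ2 γ1 (fun x y => f y x) T2 T1 := by
  rw [lap2, ← integral_prod_swap, lap2]
  congr 1
  funext q
  simp only [Prod.swap]
  ring

lemma lap2_eq_lap (k1 k2 : ℕ) (γ1 γ2 : ℝ) (f : ℂ → ℂ → ℂ) (T1 T2 : ℂ) :
    lap2 k1 k2 γ1 γ2 f T1 T2 =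
      lap k1 γ1 (lam k2) (fun σ r => ker k2 γ2 T2 r * f σ (ray γ2 r)) T1 := by
  rw [lap2, lap]
  congr 1
  funext q
  ring

lemma LapInt2.integrable (h : LapInt2 k1 k2 γ1 γ2 κ1 κ2 f)
    (hf : Measurable fun p : ℂ × ℂ => f p.1 p.2) {g1 g2 : ℝ → ℂ} (h1 : Measurable g1)
    (h2 : Measurable g2) (hb1 : ∀ r, 0 < r → ‖g1 r‖ ≤ exp (-(κ1 * r ^ k1)))
    (hb2 : ∀ r, 0 < r → ‖g2 r‖ ≤ exp (-(κ2 * r ^ k2))) :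
    Integrable (fun p : ℝ × ℝ => f (ray γ1 p.1) (ray γ2 p.2) * (g1 p.1 * g2 p.2))
      ((lam k1).prod (lam k2)) := by
  have c1 := (continuous_ray γ1).measurable
  have c2 := (continuous_ray γ2).measurable
  refine (Integrable.norm h).mono' (Measurable.aestronglyMeasurable ?_) ?_
  · have := hf.comp (f := fun p : ℝ × ℝ => (ray γ1 p.1, ray γ2 p.2)) fp!
    exact Measurable.mul this fp!
  · filter_upwards [quasiMeasurePreserving_fst.ae (ae_lam k1),
      quasiMeasurePreserving_snd.ae (ae_lam k2)] with p u1 u2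
    rw [norm_mul, norm_mul, norm_mul, norm_mul, norm_expk, norm_expk, ofReal_re,
      ofReal_re]
    exact mul_le_l (mul_le_mul (hb1 _ u1) (hb2 _ u2) (norm_nonneg _)
      (exp_pos _).le) (norm_nonneg _)

lemma norm_ker_le (h : κ ≤ rate k γ T) (hr : 0 < r) :
    ‖ker k γ T r‖ ≤ exp (-(κ * r ^ k)) := by
  rw [norm_ker]
  exact exp_le_exp.2 (neg_le_neg (mul_le_r h))

lemma norm_expk_le (h : κ ≤ κ') (hr : 0 < r) :
    ‖expk k κ' r‖ ≤ exp (-(κ * r ^ k)) := by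
  rw [norm_expk, ofReal_re]
  exact exp_le_exp.2 (neg_le_neg (mul_le_r h))

lemma LapInt2.ker (h : LapInt2 k1 k2 γ1 γ2 κ1 κ2 f) (hf : Measurable fun p : ℂ × ℂ => f p.1 p.2)
    (h1 : κ1 ≤ rate k1 γ1 T1) (h2 : κ2 ≤ rate k2 γ2 T2) :
    Integrable (fun p : ℝ × ℝ => f (ray γ1 p.1) (ray γ2 p.2) *
      (TwoTime.ker k1 γ1 T1 p.1 * TwoTime.ker k2 γ2 T2 p.2)) ((lam k1).prod (lam k2)) :=
  h.integrable hf (measurable_ker _ _ _) (measurable_ker _ _ _) (fun _ hr => norm_ker_le h1 hr)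
    fun _ hr => norm_ker_le h2 hr

lemma measurable_fst_param {g : ℝ → ℂ} (hg : Measurable g) (hf : Measurable fun p : ℂ × ℂ => f p.1 p.2)
    (γ : ℝ) : Measurable fun p : ℂ × ℝ => g p.2 * f p.1 (ray γ p.2) := by
  have c1 := (continuous_ray γ).measurable
  exact Measurable.mul fp! (hf.comp (f := fun p : ℂ × ℝ => (p.1, ray γ p.2)) fp!)

variable {O1 D1 O2 D2 : (ℂ → ℂ) → ℂ → ℂ}

/-- An operator in the first variable. -/
lemma LaplacePair.fst (h : LaplacePair k1 γ1 O1 D1) (hf : Measurable fun p : ℂ × ℂ => f p.1 p.2)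
    (h0 : 0 < κ1) (hi : LapInt2 k1 k2 γ1 γ2 κ1 κ2 f) (hT1 : T1 ∈ sector γ1 (π / (2 * k1)))
    (h1 : κ1 < rate k1 γ1 T1) (h2 : κ2 ≤ rate k2 γ2 T2) :
    D1 (fun z1 => lap2 k1 k2 γ1 γ2 f z1 T2) T1 =
      lap2 k1 k2 γ1 γ2 (fun σ1 σ2 => O1 (fun σ => f σ σ2) σ1) T1 T2 := by
  simp only [lap2_eq_lap]
  have hi' : LapInt k1 γ1 (lam k2) κ1 fun σ r => TwoTime.ker k2 γ2 T2 r * f σ (ray γ2 r) :=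
    (hi.integrable hf (continuous_expk k1 κ1).measurable (measurable_ker k2 γ2 T2)
      (fun _ hr => norm_expk_le le_rfl hr) fun _ hr => norm_ker_le h2 hr).congr
      (.of_forall fun q => by simp only; ring)
  have := h.lap_eq (measurable_fst_param (measurable_ker k2 γ2 T2) hf γ2) h0 hi' hT1 h1
  refine this.trans ?_
  simp only [h.const_mul]

lemma LaplacePair.lapInt_fst (h : LaplacePair k1 γ1 O1 D1)
    (hf : Measurable fun p : ℂ × ℂ => f p.1 p.2) (h0 : 0 < κ1) (hκ : κ1 < κ1')
    (hi : LapInt2 k1 k2 γ1 γ2 κ1 κ2 f) :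
    LapInt2 k1 k2 γ1 γ2 κ1' κ2 fun σ1 σ2 => O1 (fun σ => f σ σ2) σ1 := by
  have := h.lapInt (measurable_fst_param (continuous_expk k2 κ2).measurable hf γ2) h0 hκ hi.fst
  simp only [h.const_mul] at this
  exact LapInt2.of_fst (f := fun σ1 σ2 => O1 (fun σ => f σ σ2) σ1) this

/-- Operators in both variables. -/
lemma LaplacePair.lap2 (h1 : LaplacePair k1 γ1 O1 D1) (h2 : LaplacePair k2 γ2 O2 D2)
    (hf : Measurable fun p : ℂ × ℂ => f p.1 p.2) (h01 : 0 < κ1) (h02 : 0 < κ2)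
    (hi : LapInt2 k1 k2 γ1 γ2 κ1 κ2 f) (hT1 : T1 ∈ sector γ1 (π / (2 * k1)))
    (hT2 : T2 ∈ sector γ2 (π / (2 * k2))) (hκ1 : κ1 < rate k1 γ1 T1) (hκ2 : κ2 < rate k2 γ2 T2) :
    D1 (fun z1 => D2 (fun z2 => TwoTime.lap2 k1 k2 γ1 γ2 f z1 z2) T2) T1 =
      TwoTime.lap2 k1 k2 γ1 γ2 (fun σ1 σ2 => O1 (fun x1 => O2 (fun x2 => f x1 x2) σ2) σ1) T1 T2 := by
  obtain ⟨κ, hκ, hκ'⟩ := exists_between hκ2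
  have hfs : Measurable fun p : ℂ × ℂ => (fun x y => f y x) p.1 p.2 := hf.comp measurable_swap
  have hm : Measurable fun p : ℂ × ℂ => O2 (fun x2 => f p.1 x2) p.2 :=
    (h2.meas (f := fun x y => f y x) hfs).comp measurable_swap
  have hi2 : LapInt2 k1 k2 γ1 γ2 κ1 κ fun σ1 σ2 => O2 (fun x2 => f σ1 x2) σ2 :=
    (h2.lapInt_fst hfs h02 hκ hi.swap).swap
  rw [← h1.fst hm h01 hi2 hT1 hκ1 hκ'.le]
  refine h1.germ ?_
  filter_upwards [(isOpen_rate k1 γ1 κ1).eventually_mem ⟨ne_zero_of_mem_sector hT1, hκ1⟩] with z hz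
  simp only [lap2_swap k1 k2 γ1 γ2]
  exact h2.fst hfs h02 hi.swap hT2 hκ2 hz.2.le

lemma LaplacePair.lapInt2 (h1 : LaplacePair k1 γ1 O1 D1) (h2 : LaplacePair k2 γ2 O2 D2)
    (hf : Measurable fun p : ℂ × ℂ => f p.1 p.2) (h01 : 0 < κ1) (h02 : 0 < κ2)
    (hi : LapInt2 k1 k2 γ1 γ2 κ1 κ2 f) (hκ1 : κ1 < κ1') (hκ2 : κ2 < κ2') :
    LapInt2 k1 k2 γ1 γ2 κ1' κ2' fun σ1 σ2 => O1 (fun x1 => O2 (fun x2 => f x1 x2) σ2) σ1 := by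
  have hfs : Measurable fun p : ℂ × ℂ => (fun x y => f y x) p.1 p.2 := hf.comp measurable_swap
  have hm : Measurable fun p : ℂ × ℂ => O2 (fun x2 => f p.1 x2) p.2 :=
    (h2.meas (f := fun x y => f y x) hfs).comp measurable_swap
  exact h1.lapInt_fst hm h01 hκ1 (h2.lapInt_fst hfs h02 hκ2 hi.swap).swap

lemma LaplacePair.meas2 (h1 : LaplacePair k1 γ1 O1 D1) (h2 : LaplacePair k2 γ2 O2 D2)
    (hf : Measurable fun p : ℂ × ℂ => f p.1 p.2) :
    Measurable fun p : ℂ × ℂ => O1 (fun x1 => O2 (fun x2 => f x1 x2) p.2) p.1 := by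
  have hfs : Measurable fun p : ℂ × ℂ => (fun x y => f y x) p.1 p.2 := hf.comp measurable_swap
  have hm : Measurable fun p : ℂ × ℂ => O2 (fun x2 => f p.1 x2) p.2 :=
    (h2.meas (f := fun x y => f y x) hfs).comp measurable_swap
  exact h1.meas hm

end

/-! ### The Laplace transform of a product in the Borel plane -/

lemma cvB_mul_const (b : Bool) (k : ℕ) (c : ℂ) (B : ℂ → ℂ → ℂ) (τ : ℂ) :
    cvB b k (fun x y => B x y * c) τ = cvB b k B τ * c := by
  cases b
  · rfl
  · simp only [cvB, mul_comm _ c]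
    exact convB_const_mul k c B τ

lemma ae_lamB (b : Bool) (k : ℕ) : ∀ᵐ r ∂lamB b k, (0 : ℝ) < r := by
  cases b
  · exact (ae_dirac_iff measurableSet_Ioi).2 one_pos
  · exact ae_lam k

lemma measurable_expB (b : Bool) (k : ℕ) (z : ℂ) : Measurable (expB b k z) := by
  cases b
  · exact measurable_const
  · exact (continuous_expk k z).measurable

lemma TimeData.wt_le (t : TimeData) (z : ℂ) : t.wt 1 z ≤ ‖z‖ * exp (t.ν * ‖z‖ ^ t.k) := by
  unfold wt
  rw [rpow_one]
  refine mul_le_r (div_le_self (norm_nonneg _) ?_) (exp_pos _).le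
  have : 0 ≤ ‖z‖ ^ (2 * t.k) := by positivity
  linarith

lemma TimeData.wt_ray_mul_exp_le (t : TimeData) (γ : ℝ) (hε : ε ≠ 0) (hr : 0 < r)
    (κ : ℝ) : t.wt 1 (ray γ r / ε) * exp (-(κ * r ^ t.k)) ≤
      ‖ε‖⁻¹ * (r ^ 1 * exp (-((κ - t.ν / ‖ε‖ ^ t.k) * r ^ t.k))) := by
  have h0 := norm_pos_iff.2 hε
  refine (mul_le_r (t.wt_le _) (exp_pos _).le).trans_eq ?_
  rw [norm_div, norm_ray γ hr.le, mul_assoc, ← exp_add, div_pow, pow_one]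
  have : t.ν * (r ^ t.k / ‖ε‖ ^ t.k) + -(κ * r ^ t.k) = -((κ - t.ν / ‖ε‖ ^ t.k) * r ^ t.k) := by ring
  rw [this]
  ring

lemma TimeData.integrable_wt_ray (t : TimeData) (hk : 1 ≤ t.k) (γ : ℝ) (hε : ε ≠ 0)
    (hz : t.ν / ‖ε‖ ^ t.k < z.re) :
    Integrable (fun r => t.wt 1 (ray γ r / ε) * ‖expk t.k z r‖) (lam t.k) := by
  have hc := t.continuous_wt (e := 1) zero_le_one
  have c1 := continuous_ray γ
  have c2 := continuous_expk t.k z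
  refine ((integrable_pow_mul_exp hk le_rfl (sub_pos.2 hz)).const_mul ‖ε‖⁻¹).mono'
    (by fun_prop : Continuous _).aestronglyMeasurable ?_
  filter_upwards [ae_lam t.k] with r hr
  rw [norm_of_nonneg (mul_nonneg (t.wt_nonneg _ _) (norm_nonneg _)), norm_expk]
  exact t.wt_ray_mul_exp_le γ hε hr z.re

lemma TimeData.integrable_wtb_ray (t : TimeData) (hk : 1 ≤ t.k) (b : Bool) (γ : ℝ) (hε : ε ≠ 0) (hz : t.ν / ‖ε‖ ^ t.k < z.re) :
    Integrable (fun r => t.wtb b (ray γ r / ε) * ‖expB b t.k z r‖) (lamB b t.k) := by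
  cases b
  · simp only [TimeData.wtb, expB, cond_false]
    exact show Integrable _ (Measure.dirac (1 : ℝ)) from integrable_const _
  · exact t.integrable_wt_ray hk γ hε hz

section
variable {C : ℝ} {z1 z2 : ℂ}

/-- The Laplace integral of a function which may be independent of `τ1` or of `τ2`. -/
def lapB (S : CauchyData) (b1 b2 : Bool) (γ1 γ2 : ℝ) (z1 z2 : ℂ) (f : 𝔽)
    (m : ℝ) : ℂ :=
  ∫ r1, ∫ r2, f (ray γ1 r1) (ray γ2 r2) m * (expB b1 S.t₁.k z1 r1 * expB b2 S.t₂.k z2 r2)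
    ∂lamB b2 S.t₂.k ∂lamB b1 S.t₁.k

lemma integrable_lapB (hk1 : 1 ≤ S.t₁.k) (hk2 : 1 ≤ S.t₂.k) (hε : ε ≠ 0)
    (hγ1 : ∀ r, 0 < r → ray γ1 r ∈ S.t₁.closedDom ρ) (hγ2 : ∀ r, 0 < r → ray γ2 r ∈ S.t₂.closedDom ρ)
    (hz1 : S.t₁.ν / ‖ε‖ ^ S.t₁.k < z1.re) (hz2 : S.t₂.ν / ‖ε‖ ^ S.t₂.k < z2.re)
    (hf : S.Ball ρ (S.Wb β ε b1 b2 (-μ)) Kf f) (m : ℝ) :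
    Integrable (fun p : ℝ × ℝ => f (ray γ1 p.1) (ray γ2 p.2) m *
      (expB b1 S.t₁.k z1 p.1 * expB b2 S.t₂.k z2 p.2)) ((lamB b1 S.t₁.k).prod (lamB b2 S.t₂.k)) := by
  have c1 := (continuous_ray γ1).measurable
  have c2 := (continuous_ray γ2).measurable
  have e1 := measurable_expB b1 S.t₁.k z1
  have e2 := measurable_expB b2 S.t₂.k z2
  refine (((S.t₁.integrable_wtb_ray hk1 b1 γ1 hε hz1).mul_prod
    (S.t₂.integrable_wtb_ray hk2 b2 γ2 hε hz2)).const_mul (Kf * fw β (-μ) m)).mono'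
    (Measurable.aestronglyMeasurable ?_) ?_
  · exact Measurable.mul hf.meas.comp fp!
  · filter_upwards [quasiMeasurePreserving_fst.ae (ae_lamB b1 S.t₁.k),
      quasiMeasurePreserving_snd.ae (ae_lamB b2 S.t₂.k)] with p h1 h2
    rw [norm_mul, norm_mul]
    refine (mul_le_r (hf.bd _ (hγ1 _ h1) _ (hγ2 _ h2) m)).trans_eq ?_
    unfold Wb
    ring

/-- The Laplace transform turns `bil` into the Fourier convolution. -/
lemma ConvMaj.integral_bil (h : ConvMaj β μ M C s a b)
    (hA : EvalLe A a) (hB : EvalLe B b)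
    (hk1 : 1 ≤ S.t₁.k) (hk2 : 1 ≤ S.t₂.k) (hε : ε ≠ 0)
    (hγ1 : ∀ r, 0 < r → ray γ1 r ∈ S.t₁.closedDom ρ) (hγ2 : ∀ r, 0 < r → ray γ2 r ∈ S.t₂.closedDom ρ)
    (hz1 : S.t₁.ν / ‖ε‖ ^ S.t₁.k < z1.re) (hz2 : S.t₂.ν / ‖ε‖ ^ S.t₂.k < z2.re)
    (hb1 : b1 = false → ∀ x x' y m, f x y m = f x' y m)
    (hb2 : b2 = false → ∀ x y y' m, f x y m = f x y' m)
    (hf : S.Ball ρ (S.Wb β ε b1 b2 (-μ)) Kf f) (hg : S.Ball ρ (S.W β ε 1 1 (-μ)) Kg g) (m : ℝ) :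
    Integrable (fun p : ℝ × ℝ => bil S b1 b2 A B f g (ray γ1 p.1) (ray γ2 p.2) m *
        (expk S.t₁.k z1 p.1 * expk S.t₂.k z2 p.2)) ((lam S.t₁.k).prod (lam S.t₂.k)) ∧
      (Integrable fun m1 : ℝ => A.eval (I * ((m - m1 : ℝ) : ℂ)) *
        lapB S b1 b2 γ1 γ2 z1 z2 f (m - m1) *
          (B.eval (I * (m1 : ℂ)) * lapB S true true γ1 γ2 z1 z2 g m1)) ∧
      ∫ p, bil S b1 b2 A B f g (ray γ1 p.1) (ray γ2 p.2) m *
        (expk S.t₁.k z1 p.1 * expk S.t₂.k z2 p.2) ∂((lam S.t₁.k).prod (lam S.t₂.k)) =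
      fourierConv A B (lapB S b1 b2 γ1 γ2 z1 z2 f) (lapB S true true γ1 γ2 z1 z2 g) m := by
  set c0 : ℂ := (((Real.sqrt (2 * π))⁻¹ : ℝ) : ℂ) with hc0
  set P₁ := (lamB b1 S.t₁.k).prod (lam S.t₁.k) with hP1
  set P₂ := (lamB b2 S.t₂.k).prod (lam S.t₂.k) with hP2
  -- the integrand, in the variables `((x1, y1), (x2, y2))` and `m1`
  set Θ : ((ℝ × ℝ) × ℝ × ℝ) × ℝ → ℂ := fun q =>
    A.eval (I * ((m - q.2 : ℝ) : ℂ)) * f (ray γ1 q.1.1.1) (ray γ2 q.1.2.1) (m - q.2) *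
      (B.eval (I * (q.2 : ℂ)) * g (ray γ1 q.1.1.2) (ray γ2 q.1.2.2) q.2) *
      ((expB b1 S.t₁.k z1 q.1.1.1 * expk S.t₁.k z1 q.1.1.2) *
        (expB b2 S.t₂.k z2 q.1.2.1 * expk S.t₂.k z2 q.1.2.2)) with hΘ
  have c1 := (continuous_ray γ1).measurable
  have c2 := (continuous_ray γ2).measurable
  have e1 := measurable_expB b1 S.t₁.k z1
  have e2 := measurable_expB b2 S.t₂.k z2
  have e3 := (continuous_expk S.t₁.k z1).measurable
  have e4 := (continuous_expk S.t₂.k z2).measurable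
  have hAm : Measurable fun x : ℂ => A.eval x := A.continuous.measurable
  have hBm : Measurable fun x : ℂ => B.eval x := B.continuous.measurable
  have hΘi : Integrable Θ ((P₁.prod P₂).prod volume) := by
    have i1 := (S.t₁.integrable_wtb_ray hk1 b1 γ1 hε hz1).mul_prod (S.t₁.integrable_wt_ray hk1 γ1 hε hz1)
    have i2 := (S.t₂.integrable_wtb_ray hk2 b2 γ2 hε hz2).mul_prod (S.t₂.integrable_wt_ray hk2 γ2 hε hz2)
    have i3 := (h.int_b.const_mul C).const_mul (Kf * Kg)
    refine ((i1.mul_prod i2).mul_prod i3).mono' (Measurable.aestronglyMeasurable ?_) ?_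
    · have u1 : Measurable fun q : ((ℝ × ℝ) × ℝ × ℝ) × ℝ => f (ray γ1 q.1.1.1) (ray γ2 q.1.2.1) (m - q.2) :=
        hf.meas.comp
      have u2 : Measurable fun q : ((ℝ × ℝ) × ℝ × ℝ) × ℝ => g (ray γ1 q.1.1.2) (ray γ2 q.1.2.2) q.2 :=
        hg.meas.comp
      exact ((Measurable.mul fp! u1).mul (Measurable.mul fp! u2)).mul fp!
    · have q1 {ν ν' : Measure ℝ} := quasiMeasurePreserving_fst (μ := ν) (ν := ν')
      have q2 {ν ν' : Measure ℝ} := quasiMeasurePreserving_snd (μ := ν) (ν := ν')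
      have r1 := quasiMeasurePreserving_fst (μ := P₁.prod P₂) (ν := (volume : Measure ℝ))
      have a1 := r1.ae (quasiMeasurePreserving_fst.ae (q1.ae (ae_lamB b1 S.t₁.k)))
      have a2 := r1.ae (quasiMeasurePreserving_fst.ae (q2.ae (ae_lam S.t₁.k)))
      have a3 := r1.ae (quasiMeasurePreserving_snd.ae (q1.ae (ae_lamB b2 S.t₂.k)))
      have a4 := r1.ae (quasiMeasurePreserving_snd.ae (q2.ae (ae_lam S.t₂.k)))
      filter_upwards [a1, a2, a3, a4] with q h1 h2 h3 h4
      have hb := h.norm_integrand_le hA hB (f := f (ray γ1 q.1.1.1) (ray γ2 q.1.2.1))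
        (g := g (ray γ1 q.1.1.2) (ray γ2 q.1.2.2))
        (Kf := Kf * (S.t₁.wtb b1 (ray γ1 q.1.1.1 / ε) * S.t₂.wtb b2 (ray γ2 q.1.2.1 / ε)))
        (Kg := Kg * (S.t₁.wt 1 (ray γ1 q.1.1.2 / ε) * S.t₂.wt 1 (ray γ2 q.1.2.2 / ε)))
        (fun m => (hf.bd _ (hγ1 _ h1) _ (hγ2 _ h3) m).trans_eq (by unfold Wb; ring))
        (fun m => (hg.bd _ (hγ1 _ h2) _ (hγ2 _ h4) m).trans_eq (by unfold W; ring)) m q.2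
      rw [hΘ]
      beta_reduce
      have en : ‖(expB b1 S.t₁.k z1 q.1.1.1 * expk S.t₁.k z1 q.1.1.2) *
          (expB b2 S.t₂.k z2 q.1.2.1 * expk S.t₂.k z2 q.1.2.2)‖ =
          (‖expB b1 S.t₁.k z1 q.1.1.1‖ * ‖expk S.t₁.k z1 q.1.1.2‖) *
            (‖expB b2 S.t₂.k z2 q.1.2.1‖ * ‖expk S.t₂.k z2 q.1.2.2‖) := by simp only [norm_mul]
      rw [norm_mul, en]
      refine (mul_le_r hb).trans_eq ?_
      ring
  -- integration over `m1`
  set I1 : (ℝ × ℝ) × ℝ × ℝ → ℂ := fun p =>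
    fourierConv A B (f (ray γ1 p.1.1) (ray γ2 p.2.1)) (g (ray γ1 p.1.2) (ray γ2 p.2.2)) m *
      ((expB b1 S.t₁.k z1 p.1.1 * expk S.t₁.k z1 p.1.2) *
        (expB b2 S.t₂.k z2 p.2.1 * expk S.t₂.k z2 p.2.2)) with hI1
  have eI1 : ∀ p, I1 p = c0 * ∫ m1, Θ (p, m1) := fun p => by
    simp only [hI1, hΘ, integral_mul_const, fourierConv, hc0]
    ring
  have iI1 : Integrable I1 (P₁.prod P₂) := by
    rw [funext eI1]
    exact hΘi.integral_prod_left.const_mul c0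
  -- the convolution in the second variable
  have s2 := integral_cvB hk2 b2 γ2 z2 (ν := P₁)
    (Ψ := fun x2 y2 p => fourierConv A B (f (ray γ1 p.1) x2) (g (ray γ1 p.2) y2) m *
      (expB b1 S.t₁.k z1 p.1 * expk S.t₁.k z1 p.2))
    (fun hb x x' y p => by
      rw [show f (ray γ1 p.1) x = f (ray γ1 p.1) x' from funext fun m => hb2 hb _ _ _ m])
    (iI1.swap.congr (.of_forall fun q => by
      simp only [hI1, comp_apply, Prod.swap]; ring))
  -- the convolution in the first variable
  have s1 := integral_cvB hk1 b1 γ1 z1 (ν := lam S.t₂.k)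
    (Ψ := fun x1 y1 r2 => cvB b2 S.t₂.k (fun x2 y2 => fourierConv A B (f x1 x2) (g y1 y2) m)
      (ray γ2 r2) * expk S.t₂.k z2 r2)
    (fun hb x x' y r => by
      rw [show f x = f x' from funext fun y => funext fun m => hb1 hb _ _ _ m])
    (s2.1.swap.congr (.of_forall fun q => by
      simp only [comp_apply, Prod.swap, cvB_mul_const]; ring))
  simp only [cvB_mul_const] at s1 s2
  have eb : ∀ p : ℝ × ℝ, bil S b1 b2 A B f g (ray γ1 p.1) (ray γ2 p.2) m *
        (expk S.t₁.k z1 p.1 * expk S.t₂.k z2 p.2) =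
      cvB b1 S.t₁.k (fun x1 y1 => cvB b2 S.t₂.k (fun x2 y2 =>
        fourierConv A B (f x1 x2) (g y1 y2) m) (ray γ2 p.2)) (ray γ1 p.1) * expk S.t₂.k z2 p.2 *
        expk S.t₁.k z1 p.1 := fun p => by
    rw [bil, cv2]; ring
  -- the integral over the four time variables is a product
  have em : ∀ᵐ m1 : ℝ, ∫ p, Θ (p, m1) ∂(P₁.prod P₂) = A.eval (I * ((m - m1 : ℝ) : ℂ)) *
        lapB S b1 b2 γ1 γ2 z1 z2 f (m - m1) *
          (B.eval (I * (m1 : ℂ)) * lapB S true true γ1 γ2 z1 z2 g m1) := by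
    filter_upwards [hΘi.prod_left_ae] with m1 hm1
    rw [integral_prod _ hm1]
    have e : ∀ p : ℝ × ℝ, ∫ q, Θ ((p, q), m1) ∂P₂ =
        (A.eval (I * ((m - m1 : ℝ) : ℂ)) * ∫ r2, f (ray γ1 p.1) (ray γ2 r2) (m - m1) *
          (expB b1 S.t₁.k z1 p.1 * expB b2 S.t₂.k z2 r2) ∂lamB b2 S.t₂.k) *
        (B.eval (I * (m1 : ℂ)) * ∫ r2, g (ray γ1 p.2) (ray γ2 r2) m1 *
          (expk S.t₁.k z1 p.2 * expk S.t₂.k z2 r2) ∂lam S.t₂.k) := fun p => by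
      rw [← integral_const_mul, ← integral_const_mul, ← integral_prod_mul]
      congr 1
      funext q
      rw [hΘ]
      ring
    simp only [e]
    refine (integral_prod_mul (μ := lamB b1 S.t₁.k) (ν := lam S.t₁.k)
      (fun r1 => A.eval (I * ((m - m1 : ℝ) : ℂ)) * ∫ r2, f (ray γ1 r1) (ray γ2 r2) (m - m1) *
        (expB b1 S.t₁.k z1 r1 * expB b2 S.t₂.k z2 r2) ∂lamB b2 S.t₂.k)
      (fun r1 => B.eval (I * (m1 : ℂ)) * ∫ r2, g (ray γ1 r1) (ray γ2 r2) m1 *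
        (expk S.t₁.k z1 r1 * expk S.t₂.k z2 r2) ∂lam S.t₂.k)).trans ?_
    rw [integral_const_mul, integral_const_mul]
    rfl
  have hF : fourierConv A B (lapB S b1 b2 γ1 γ2 z1 z2 f) (lapB S true true γ1 γ2 z1 z2 g) m =
      ∫ p, I1 p ∂(P₁.prod P₂) := by
    rw [fourierConv, ← integral_congr_ae em, ← integral_prod_symm Θ hΘi, integral_prod Θ hΘi,
      ← integral_const_mul]
    exact integral_congr_ae (.of_forall fun p => (eI1 p).symm)
  refine ⟨s1.1.congr (.of_forall fun p => (eb p).symm), hΘi.integral_prod_right.congr em, ?_⟩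
  rw [hF, integral_congr_ae (.of_forall eb), s1.2, ← integral_prod_swap,
    ← integral_prod_swap I1]
  refine Eq.trans ?_ (s2.2.trans ?_)
  · congr 1
    funext q
    simp only [Prod.swap]
    ring
  · congr 1
    funext q
    simp only [hI1, Prod.swap]
    ring

end

/-! ### The Laplace transform of the coefficient series -/

section

lemma integral_norm_monomial (hk : 1 ≤ k) (hn : 1 ≤ n) (hr : 0 < rate k γ T) :
    ∫ r, ‖ray γ r ^ n / (Gamma ((n : ℝ) / k) : ℝ) * ker k γ T r‖ ∂lam k =
      (rate k γ T ^ (-(1 : ℝ) / k)) ^ n := by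
  have hΓ : 0 < Gamma ((n : ℝ) / k) := Gamma_pos_of_pos (by
    have : (1 : ℝ) ≤ n := mod_cast hn
    have : (1 : ℝ) ≤ k := mod_cast hk
    positivity)
  have e : ∀ᵐ r ∂lam k, ‖ray γ r ^ n / (Gamma ((n : ℝ) / k) : ℝ) * ker k γ T r‖ =
      (Gamma ((n : ℝ) / k))⁻¹ * (r ^ n * exp (-(rate k γ T * r ^ k))) := by
    filter_upwards [ae_lam k] with r hr
    rw [norm_mul, norm_div, norm_pow, norm_ray γ (le_of_lt hr), norm_ker, norm_real,
      norm_of_nonneg hΓ.le]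
    ring
  rw [integral_congr_ae e, integral_const_mul]
  have h := integral_real_monomial hk hn hr
  rw [integral_complex_ofReal, Complex.ofReal_inj] at h
  rw [h, ← Real.rpow_mul_natCast hr.le, mul_comm (_ ^ _), ← mul_assoc, inv_mul_cancel₀ hΓ.ne', one_mul]
  congr 1
  ring

lemma rate_rpow_lt (hk : 1 ≤ k) (hT0 : 0 < T0) (hr : (1 / T0) ^ k < rate k γ T) :
    rate k γ T ^ (-(1 : ℝ) / k) < T0 := by
  have hk0 : (0 : ℝ) < k := mod_cast hk
  have h1 : T0 = ((1 / T0) ^ k) ^ (-(1 : ℝ) / k) := by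
    rw [← rpow_natCast, ← rpow_mul pos!, mul_div_cancel₀ _ hk0.ne', one_div,
      Real.rpow_neg_one, inv_inv]
  conv_rhs => rw [h1]
  exact Real.rpow_lt_rpow_of_neg pos! hr (div_neg_of_neg_of_pos (by norm_num) hk0)

lemma integrable_ker_monomial (hk : 1 ≤ k) (hn : 1 ≤ n) (hr : 0 < rate k γ T) :
    Integrable (fun r => ray γ r ^ n / (Gamma ((n : ℝ) / k) : ℝ) * ker k γ T r) (lam k) := by
  simp only [ker_eq_expk]
  exact integrable_monomial hk hn γ hr _

lemma integral_series (hk : 1 ≤ k) (hT0 : 0 < T0) (hT : T ∈ sector γ (π / (2 * k)))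
    (hr : (1 / T0) ^ k < rate k γ T) {c : ℕ → ℂ} (hc : ∀ n, ‖c n‖ ≤ K * (1 / T0) ^ (n + 1)) :
    ∫ r, (∑' n : ℕ, c n * (ray γ r ^ (n + 1) / (Gamma (((n + 1 : ℕ) : ℝ) / k) : ℝ))) *
      ker k γ T r ∂lam k = ∑' n, c n * T ^ (n + 1) := by
  have hr0 : 0 < rate k γ T := lt_of_le_of_lt pos! hr
  set q := rate k γ T ^ (-(1 : ℝ) / k) with hq
  have hq0 : 0 ≤ q := by positivity
  have hqT : q < T0 := rate_rpow_lt hk hT0 hr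
  have hs : Summable fun n => ∫ r, ‖c n * (ray γ r ^ (n + 1) /
      (Gamma (((n + 1 : ℕ) : ℝ) / k) : ℝ) * ker k γ T r)‖ ∂lam k := by
    have hg : Summable fun n : ℕ => K * (q / T0) ^ (n + 1) :=
      ((summable_nat_add_iff 1).2 (summable_geometric_of_lt_one pos!
        ((div_lt_one hT0).2 hqT))).mul_left K
    refine hg.of_nonneg_of_le (fun n => integral_nonneg fun r => norm_nonneg _) fun n => ?_
    simp only [norm_mul (c n)]
    rw [integral_const_mul, integral_norm_monomial hk (by omega) hr0]
    refine (mul_le_r (hc n)).trans_eq ?_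
    rw [one_div, inv_pow, div_pow]
    ring
  have h := hasSum_integral_of_summable_integral_norm
    (fun n => (integrable_ker_monomial hk (n := n + 1) (by omega) hr0).const_mul (c n)) hs
  have e : ∀ n, ∫ r, c n * (ray γ r ^ (n + 1) / (Gamma (((n + 1 : ℕ) : ℝ) / k) : ℝ) *
      ker k γ T r) ∂lam k = c n * T ^ (n + 1) := fun n => by
    rw [integral_const_mul, integral_ker_monomial hk (by omega) hT]
  simp only [e] at h
  rw [h.tsum_eq]
  congr 1
  funext r
  rw [← tsum_mul_right]
  simp only [mul_assoc]

lemma integral_series2 (hk : 1 ≤ k) (hk2 : 1 ≤ k2) (hT0 : 0 < T0)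
    (hT : T ∈ sector γ (π / (2 * k))) (hT2 : T2 ∈ sector γ2 (π / (2 * k2)))
    (hr : (1 / T0) ^ k < rate k γ T) (hr2 : (1 / T0) ^ k2 < rate k2 γ2 T2) {c : ℕ × ℕ → ℂ}
    (hc : ∀ n, ‖c n‖ ≤ K * (1 / T0) ^ ((n.1 + 1) + (n.2 + 1))) :
    ∫ p, (∑' n : ℕ × ℕ, c n * (ray γ p.1 ^ (n.1 + 1) / (Gamma (((n.1 + 1 : ℕ) : ℝ) / k) : ℝ)) *
      (ray γ2 p.2 ^ (n.2 + 1) / (Gamma (((n.2 + 1 : ℕ) : ℝ) / k2) : ℝ))) *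
      (ker k γ T p.1 * ker k2 γ2 T2 p.2) ∂((lam k).prod (lam k2)) =
      ∑' n : ℕ × ℕ, c n * T ^ (n.1 + 1) * T2 ^ (n.2 + 1) := by
  have hr0 : 0 < rate k γ T := lt_of_le_of_lt pos! hr
  have hr02 : 0 < rate k2 γ2 T2 := lt_of_le_of_lt pos! hr2
  set q := rate k γ T ^ (-(1 : ℝ) / k) with hq
  set q2 := rate k2 γ2 T2 ^ (-(1 : ℝ) / k2) with hq2
  have hq0 : 0 ≤ q := by positivity
  have hq02 : 0 ≤ q2 := by positivity
  have hqT : q < T0 := rate_rpow_lt hk hT0 hr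
  have hqT2 : q2 < T0 := rate_rpow_lt hk2 hT0 hr2
  set F : ℕ × ℕ → ℝ × ℝ → ℂ := fun n p =>
    (ray γ p.1 ^ (n.1 + 1) / (Gamma (((n.1 + 1 : ℕ) : ℝ) / k) : ℝ) * ker k γ T p.1) *
      (ray γ2 p.2 ^ (n.2 + 1) / (Gamma (((n.2 + 1 : ℕ) : ℝ) / k2) : ℝ) * ker k2 γ2 T2 p.2) with hF
  have hFi : ∀ n, Integrable (F n) ((lam k).prod (lam k2)) := fun n =>
    (integrable_ker_monomial hk (n := n.1 + 1) (by omega) hr0).mul_prod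
      (integrable_ker_monomial hk2 (n := n.2 + 1) (by omega) hr02)
  have hs : Summable fun n => ∫ p, ‖c n * F n p‖ ∂((lam k).prod (lam k2)) := by
    have hg : Summable fun n : ℕ × ℕ => K * ((q / T0) ^ (n.1 + 1) * (q2 / T0) ^ (n.2 + 1)) :=
      (Summable.mul_of_nonneg
        ((summable_nat_add_iff 1).2 (summable_geometric_of_lt_one pos!
          ((div_lt_one hT0).2 hqT)))
        ((summable_nat_add_iff 1).2 (summable_geometric_of_lt_one pos!
          ((div_lt_one hT0).2 hqT2))) (fun n => by positivity) (fun n => by positivity)).mul_left K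
    refine hg.of_nonneg_of_le (fun n => integral_nonneg fun r => norm_nonneg _) fun n => ?_
    have e : ∫ p, ‖F n p‖ ∂((lam k).prod (lam k2)) = q ^ (n.1 + 1) * q2 ^ (n.2 + 1) := by
      simp only [hF, norm_mul (_ * _) (_ * _)]
      rw [integral_prod_mul (fun r => ‖ray γ r ^ (n.1 + 1) / (Gamma (((n.1 + 1 : ℕ) : ℝ) / k) : ℝ) *
        ker k γ T r‖) (fun r => ‖ray γ2 r ^ (n.2 + 1) / (Gamma (((n.2 + 1 : ℕ) : ℝ) / k2) : ℝ) *
        ker k2 γ2 T2 r‖), integral_norm_monomial hk (by omega) hr0,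
        integral_norm_monomial hk2 (by omega) hr02]
    simp only [norm_mul (c n)]
    rw [integral_const_mul, e]
    refine (mul_le_r (hc n)).trans_eq ?_
    rw [one_div, inv_pow, div_pow, div_pow, pow_add T0]
    field_simp
  have h := hasSum_integral_of_summable_integral_norm (fun n => (hFi n).const_mul (c n)) hs
  have e : ∀ n, ∫ p, c n * F n p ∂((lam k).prod (lam k2)) =
      c n * T ^ (n.1 + 1) * T2 ^ (n.2 + 1) := fun n => by
    rw [integral_const_mul]
    simp only [hF]
    rw [integral_prod_mul (fun r => ray γ r ^ (n.1 + 1) / (Gamma (((n.1 + 1 : ℕ) : ℝ) / k) : ℝ) *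
        ker k γ T r) (fun r => ray γ2 r ^ (n.2 + 1) / (Gamma (((n.2 + 1 : ℕ) : ℝ) / k2) : ℝ) *
        ker k2 γ2 T2 r), integral_ker_monomial hk (by omega) hT,
        integral_ker_monomial hk2 (by omega) hT2, mul_assoc]
  simp only [e] at h
  rw [h.tsum_eq]
  congr 1
  funext p
  rw [← tsum_mul_right]
  congr 1
  funext n
  simp only [hF]
  ring

end

section

/-- The exponent of the Laplace kernel, as a multiple of `r ^ k`. -/
def kexp (k : ℕ) (γ : ℝ) (T : ℂ) : ℂ := (Complex.exp (γ * I) / T) ^ k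

lemma expk_kexp (k : ℕ) (γ : ℝ) (T : ℂ) (r : ℝ) : expk k (kexp k γ T) r = ker k γ T r :=
  (ker_eq_expk k γ T r).symm

lemma lapB_eq_integral_prod (hk1 : 1 ≤ S.t₁.k) (hk2 : 1 ≤ S.t₂.k) (hε : ε ≠ 0)
    (hγ1 : ∀ r, 0 < r → ray γ1 r ∈ S.t₁.closedDom ρ) (hγ2 : ∀ r, 0 < r → ray γ2 r ∈ S.t₂.closedDom ρ)
    (hr1 : S.t₁.ν / ‖ε‖ ^ S.t₁.k < rate S.t₁.k γ1 T1) (hr2 : S.t₂.ν / ‖ε‖ ^ S.t₂.k < rate S.t₂.k γ2 T2)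
    (hf : S.Ball ρ (S.Wb β ε true true (-μ)) Kf f) (m : ℝ) :
    lapB S true true γ1 γ2 (kexp S.t₁.k γ1 T1) (kexp S.t₂.k γ2 T2) f m =
      lap2 S.t₁.k S.t₂.k γ1 γ2 (fun x y => f x y m) T1 T2 := by
  have h := integrable_lapB (z1 := kexp S.t₁.k γ1 T1) (z2 := kexp S.t₂.k γ2 T2) hk1 hk2 hε hγ1 hγ2
    hr1 hr2 hf m
  rw [lapB, ← integral_prod (fun p : ℝ × ℝ => f (ray γ1 p.1) (ray γ2 p.2) m *
    (expB true S.t₁.k (kexp S.t₁.k γ1 T1) p.1 * expB true S.t₂.k (kexp S.t₂.k γ2 T2) p.2)) h]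
  simp only [expB, cond_true, expk_kexp]
  rfl

lemma PosFamily.lapB_borel12 (hn : n0 ≤ 1) (hC : PosFamily β μ K0 T0 ε0 n0 C) (hε0 : ε ∈ ball (0 : ℂ) ε0) (hk1 : 1 ≤ S.t₁.k) (hk2 : 1 ≤ S.t₂.k)
    (hT1 : T1 ∈ sector γ1 (π / (2 * S.t₁.k))) (hT2 : T2 ∈ sector γ2 (π / (2 * S.t₂.k)))
    (hr1' : (1 / T0) ^ S.t₁.k < rate S.t₁.k γ1 T1)
    (hr2' : (1 / T0) ^ S.t₂.k < rate S.t₂.k γ2 T2) (m : ℝ) :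
    lap2 S.t₁.k S.t₂.k γ1 γ2 (fun x y => borel₁₂ S.t₁.k S.t₂.k C ε x y m) T1 T2 = sumF C T1 T2 m ε :=
  integral_series2 (K := K0 * fw β (-μ) m) hk1 hk2 hC.hT hT1 hT2 hr1' hr2'
    (c := fun n => C (n.1 + 1) (n.2 + 1) m ε) fun n =>
      (hC.norm_le_fw (by omega) (by omega) hε0 m).trans_eq (by ring)

lemma PosFamily.lapB_borel1 (hC : PosFamily β μ K0 T0 ε0 0 C) (hε0 : ε ∈ ball (0 : ℂ) ε0) (hk1 : 1 ≤ S.t₁.k)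
    (hT1 : T1 ∈ sector γ1 (π / (2 * S.t₁.k)))
    (hr1' : (1 / T0) ^ S.t₁.k < rate S.t₁.k γ1 T1) (z2 : ℂ) (m : ℝ) :
    lapB S true false γ1 γ2 (kexp S.t₁.k γ1 T1) z2 (fun x _ m => borel₁ S.t₁.k C ε x m) m =
      ∑' n, C (n + 1) 0 m ε * T1 ^ (n + 1) := by
  rw [← integral_series (γ := γ1) (K := K0 * fw β (-μ) m) hk1 hC.hT hT1 hr1'
    (c := fun n => C (n + 1) 0 m ε) fun n =>
      (hC.norm_le_fw (by omega) (by omega) hε0 m).trans_eq (by ring_nf)]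
  simp only [lapB, lamB, expB, cond_true, cond_false, integral_dirac, mul_one, expk_kexp]
  rfl

lemma PosFamily.lapB_borel2 (hC : PosFamily β μ K0 T0 ε0 0 C) (hε0 : ε ∈ ball (0 : ℂ) ε0) (hk2 : 1 ≤ S.t₂.k)
    (hT2 : T2 ∈ sector γ2 (π / (2 * S.t₂.k)))
    (hr2' : (1 / T0) ^ S.t₂.k < rate S.t₂.k γ2 T2) (z1 : ℂ) (m : ℝ) :
    lapB S false true γ1 γ2 z1 (kexp S.t₂.k γ2 T2) (fun _ y m => borel₂ S.t₂.k C ε y m) m =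
      ∑' n, C 0 (n + 1) m ε * T2 ^ (n + 1) := by
  rw [← integral_series (γ := γ2) (K := K0 * fw β (-μ) m) hk2 hC.hT hT2 hr2'
    (c := fun n => C 0 (n + 1) m ε) fun n =>
      (hC.norm_le_fw (by omega) (by omega) hε0 m).trans_eq (by ring_nf)]
  simp only [lapB, lamB, expB, cond_true, cond_false, integral_dirac, one_mul, expk_kexp]
  rfl

lemma norm_lt_of_rate_lt (hT : T ≠ 0)
    (hT0 : 0 < T0) (hr : (1 / T0) ^ k < rate k γ T) : ‖T‖ < T0 := by
  have hT' := norm_pos_iff.2 hT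
  have h1 : rate k γ T ≤ (1 / ‖T‖) ^ k := by
    refine (Complex.re_le_norm _).trans_eq ?_
    rw [norm_pow, norm_div, Complex.norm_exp_ofReal_mul_I]
  have h2 := lt_of_pow_lt_pow_left₀ k pos! (hr.trans_le h1)
  exact (one_div_lt_one_div hT0 hT').1 h2

/-- The coefficient series, split according to the dependence on `T1` and `T2`. -/
lemma PosFamily.sumC_eq (hC : PosFamily β μ K0 T0 ε0 0 C) (hε0 : ε ∈ ball (0 : ℂ) ε0) (h1 : ‖T1‖ < T0) (h2 : ‖T2‖ < T0) (m : ℝ) :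
    sumC C T1 T2 m ε = sumF C T1 T2 m ε + ∑' n, C (n + 1) 0 m ε * T1 ^ (n + 1) +
      ∑' n, C 0 (n + 1) m ε * T2 ^ (n + 1) + C 0 0 m ε := by
  have hT := hC.hT
  have hs : Summable fun n : ℕ × ℕ => C n.1 n.2 m ε * T1 ^ n.1 * T2 ^ n.2 := by
    have hg : Summable fun n : ℕ × ℕ => (K0 * fw β (-μ) m) * ((‖T1‖ / T0) ^ n.1 * (‖T2‖ / T0) ^ n.2) :=
      (Summable.mul_of_nonneg (summable_geometric_of_lt_one pos! ((div_lt_one hC.hT).2 h1))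
        (summable_geometric_of_lt_one pos! ((div_lt_one hC.hT).2 h2))
        (fun n => by positivity) (fun n => by positivity)).mul_left _
    refine hg.of_norm_bounded fun n => ?_
    rw [norm_mul, norm_mul, norm_pow, norm_pow]
    refine (mul_le_r (mul_le_r
      (hC.norm_le_fw (Nat.zero_le _) (Nat.zero_le _) hε0 m))).trans_eq ?_
    rw [one_div, inv_pow, div_pow, div_pow, pow_add T0]
    field_simp
  have hs' : Summable fun n : ℕ × ℕ => C (n.1 + 1) n.2 m ε * T1 ^ (n.1 + 1) * T2 ^ n.2 :=
    hs.comp_injective (i := fun n : ℕ × ℕ => (n.1 + 1, n.2)) fun a b h => by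
      simp only [Prod.mk.injEq, Nat.add_right_cancel_iff] at h
      exact Prod.ext h.1 h.2
  have hs0 := hs.prod_factor 0
  have hs1 : Summable fun n => C (n + 1) 0 m ε * T1 ^ (n + 1) :=
    (hs'.comp_injective (i := fun n : ℕ => (n, 0)) fun a b h => by simpa using h).congr fun n => by simp
  have hs2 : Summable fun n : ℕ × ℕ => C (n.1 + 1) (n.2 + 1) m ε * T1 ^ (n.1 + 1) * T2 ^ (n.2 + 1) :=
    hs'.comp_injective (i := fun n : ℕ × ℕ => (n.1, n.2 + 1)) fun a b h => by
      simp only [Prod.mk.injEq, Nat.add_right_cancel_iff] at h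
      exact Prod.ext h.1 h.2
  rw [sumC, hs.tsum_prod, hs.prod.tsum_eq_zero_add, hs0.tsum_eq_zero_add]
  have e : ∀ n, ∑' c, C (n + 1) c m ε * T1 ^ (n + 1) * T2 ^ c =
      C (n + 1) 0 m ε * T1 ^ (n + 1) + ∑' c, C (n + 1) (c + 1) m ε * T1 ^ (n + 1) * T2 ^ (c + 1) :=
    fun n => by rw [(hs'.prod_factor n).tsum_eq_zero_add, pow_zero, mul_one]
  simp only [e]
  rw [hs1.tsum_add hs2.prod, sumF, hs2.tsum_prod]
  simp only [pow_zero, mul_one]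
  ring

end

/-! ### From the Borel plane to the singular equation -/

/-- The Laplace integral of `f` at `(T1, T2)` converges absolutely and has the value `I`. -/
def HasLap2 (k1 k2 : ℕ) (γ1 γ2 : ℝ) (T1 T2 : ℂ) (f : ℂ → ℂ → ℂ) (I : ℂ) : Prop :=
  Integrable (fun p : ℝ × ℝ => f (ray γ1 p.1) (ray γ2 p.2) * (ker k1 γ1 T1 p.1 * ker k2 γ2 T2 p.2))
    ((lam k1).prod (lam k2)) ∧ lap2 k1 k2 γ1 γ2 f T1 T2 = I

namespace HasLap2

variable {I J : ℂ} {f g : ℂ → ℂ → ℂ}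

lemma add (hf : HasLap2 k1 k2 γ1 γ2 T1 T2 f I) (hg : HasLap2 k1 k2 γ1 γ2 T1 T2 g J) :
    HasLap2 k1 k2 γ1 γ2 T1 T2 (fun x y => f x y + g x y) (I + J) := by
  refine ⟨(hf.1.add hg.1).congr (.of_forall fun p => (add_mul _ _ _).symm), ?_⟩
  rw [← hf.2, ← hg.2, lap2, lap2, lap2, ← integral_add hf.1 hg.1]
  simp only [add_mul]

lemma const_mul (c : ℂ) (hf : HasLap2 k1 k2 γ1 γ2 T1 T2 f I) :
    HasLap2 k1 k2 γ1 γ2 T1 T2 (fun x y => c * f x y) (c * I) := by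
  refine ⟨(hf.1.const_mul c).congr (.of_forall fun p => (mul_assoc _ _ _).symm), ?_⟩
  rw [← hf.2, lap2, lap2, ← integral_const_mul]
  simp only [mul_assoc]

lemma sum {ι : Type*} (s : Finset ι) {f : ι → ℂ → ℂ → ℂ} {I : ι → ℂ}
    (h : ∀ i ∈ s, HasLap2 k1 k2 γ1 γ2 T1 T2 (f i) (I i)) :
    HasLap2 k1 k2 γ1 γ2 T1 T2 (fun x y => ∑ i ∈ s, f i x y) (∑ i ∈ s, I i) := by
  refine ⟨(integrable_finsetSum s fun i hi => (h i hi).1).congr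
    (.of_forall fun p => (sum_mul _ _ _).symm), ?_⟩
  rw [← sum_congr rfl fun i hi => (h i hi).2]
  simp only [lap2]
  rw [← integral_finsetSum s fun i hi => (h i hi).1]
  simp only [sum_mul]

lemma eq_of_eq (hf : HasLap2 k1 k2 γ1 γ2 T1 T2 f I) (hg : HasLap2 k1 k2 γ1 γ2 T1 T2 g J)
    (h : ∀ r1 r2 : ℝ, 0 < r1 → 0 < r2 → f (ray γ1 r1) (ray γ2 r2) = g (ray γ1 r1) (ray γ2 r2)) :
    I = J := by
  rw [← hf.2, ← hg.2]
  refine integral_congr_ae ?_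
  filter_upwards [quasiMeasurePreserving_fst.ae (ae_lam k1),
    quasiMeasurePreserving_snd.ae (ae_lam k2)] with p h1 h2
  rw [h _ _ h1 h2]

lemma of_pair {O1 D1 O2 D2 : (ℂ → ℂ) → ℂ → ℂ} (h1 : LaplacePair k1 γ1 O1 D1)
    (h2 : LaplacePair k2 γ2 O2 D2) (hf : Measurable fun p : ℂ × ℂ => f p.1 p.2) (h01 : 0 < κ1)
    (h02 : 0 < κ2) (hi : LapInt2 k1 k2 γ1 γ2 κ1 κ2 f) (hT1 : T1 ∈ sector γ1 (π / (2 * k1)))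
    (hT2 : T2 ∈ sector γ2 (π / (2 * k2))) (hκ1 : κ1 < rate k1 γ1 T1) (hκ2 : κ2 < rate k2 γ2 T2) :
    HasLap2 k1 k2 γ1 γ2 T1 T2 (fun σ1 σ2 => O1 (fun x1 => O2 (fun x2 => f x1 x2) σ2) σ1)
      (D1 (fun z1 => D2 (fun z2 => lap2 k1 k2 γ1 γ2 f z1 z2) T2) T1) :=
  ⟨(h1.lapInt2 h2 hf h01 h02 hi hκ1 hκ2).ker (h1.meas2 h2 hf) le_rfl le_rfl,
    (h1.lap2 h2 hf h01 h02 hi hT1 hT2 hκ1 hκ2).symm⟩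

end HasLap2

/-- The half-line `L_γ` lies in the domain and is admissible for the Laplace integrals at `T` of the
functions of growth `ν / |ε| ^ k` and of the Borel transforms of power series which converge on
`D(0, T0)`. -/
structure TimeData.Ray (t : TimeData) (ρ T0 : ℝ) (ε : ℂ) (γ : ℝ) (T : ℂ) : Prop where
  mem : ∀ r, 0 < r → ray γ r ∈ t.closedDom ρ
  sec : T ∈ sector γ (π / (2 * t.k))
  rate : t.ν / ‖ε‖ ^ t.k < rate t.k γ T
  rate' : (1 / T0) ^ t.k < TwoTime.rate t.k γ T

section
variable {Cm : ℝ}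

lemma lapInt2_of_bd (hk1 : 1 ≤ S.t₁.k) (hk2 : 1 ≤ S.t₂.k) (hε : ε ≠ 0)
    (hγ1 : ∀ r, 0 < r → ray γ1 r ∈ S.t₁.closedDom ρ) (hγ2 : ∀ r, 0 < r → ray γ2 r ∈ S.t₂.closedDom ρ)
    (hf : S.Ball ρ (S.W β ε 1 1 (-μ)) Kf f)
    (h1 : S.t₁.ν / ‖ε‖ ^ S.t₁.k < κ1) (h2 : S.t₂.ν / ‖ε‖ ^ S.t₂.k < κ2) (m : ℝ) :
    LapInt2 S.t₁.k S.t₂.k γ1 γ2 κ1 κ2 fun x y => f x y m :=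
  integrable_lapB (b1 := true) (b2 := true) (z1 := κ1) (z2 := κ2) hk1 hk2 hε hγ1 hγ2 h1 h2 hf m

lemma CauchyData.hasLap2_shiftB (hS : S.Setup ρ β μ r) (hε : ε ≠ 0)
    (h1 : S.t₁.Ray ρ T0 ε γ1 T1) (h2 : S.t₂.Ray ρ T0 ε γ2 T2) {f : ℂ → ℂ → ℂ}
    (hfm : Measurable fun p : ℂ × ℂ => f p.1 p.2)
    (hf : ∀ κ1 κ2 : ℝ, S.t₁.ν / ‖ε‖ ^ S.t₁.k < κ1 → S.t₂.ν / ‖ε‖ ^ S.t₂.k < κ2 →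
      LapInt2 S.t₁.k S.t₂.k γ1 γ2 κ1 κ2 f) :
    HasLap2 S.t₁.k S.t₂.k γ1 γ2 T1 T2 (S.shiftB f) (T1 ^ (S.t₁.k + 1) * (T2 ^ (S.t₂.k + 1) *
      lap2 S.t₁.k S.t₂.k γ1 γ2 f T1 T2)) := by
  obtain ⟨κ1, hν1, hκ1⟩ := exists_between h1.rate
  obtain ⟨κ2, hν2, hκ2⟩ := exists_between h2.rate
  have hν10 := hS.time₁.ν_pos
  have hν20 := hS.time₂.ν_pos
  have h0 := norm_pos_iff.2 hε
  exact HasLap2.of_pair (LaplacePair.mulB hS.time₁.one_le_k γ1 (Nat.le_add_left 1 _))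
    (LaplacePair.mulB hS.time₂.one_le_k γ2 (Nat.le_add_left 1 _)) hfm
    (lt_trans pos! hν1) (lt_trans pos! hν2) (hf κ1 κ2 hν1 hν2) h1.sec h2.sec hκ1 hκ2

lemma ConvMaj.hasLap2_shiftB_bil (h : ConvMaj β μ M Cm s a b)
    (hA : EvalLe A a) (hB : EvalLe B b)
    (hS : S.Setup ρ β μ r) (hε : ε ≠ 0) (h1 : S.t₁.Ray ρ T0 ε γ1 T1) (h2 : S.t₂.Ray ρ T0 ε γ2 T2)
    (hb1 : b1 = false → ∀ x x' y m, f x y m = f x' y m)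
    (hb2 : b2 = false → ∀ x y y' m, f x y m = f x y' m)
    (hf : S.Ball ρ (S.Wb β ε b1 b2 (-μ)) Kf f) (hw : S.Ball ρ (S.W β ε 1 1 (-μ)) K w) (m : ℝ) :
    HasLap2 S.t₁.k S.t₂.k γ1 γ2 T1 T2 (S.shiftB fun σ1 σ2 => bil S b1 b2 A B f w σ1 σ2 m)
      (T1 ^ (S.t₁.k + 1) * (T2 ^ (S.t₂.k + 1) * fourierConv A B
        (lapB S b1 b2 γ1 γ2 (kexp S.t₁.k γ1 T1) (kexp S.t₂.k γ2 T2) f)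
        (fun m' => lap2 S.t₁.k S.t₂.k γ1 γ2 (fun x y => w x y m') T1 T2) m)) ∧
    Integrable fun m1 : ℝ => A.eval (I * ((m - m1 : ℝ) : ℂ)) *
      lapB S b1 b2 γ1 γ2 (kexp S.t₁.k γ1 T1) (kexp S.t₂.k γ2 T2) f (m - m1) *
        (B.eval (I * (m1 : ℂ)) *
          lap2 S.t₁.k S.t₂.k γ1 γ2 (fun x y => w x y m1) T1 T2) := by
  have hk1 := hS.time₁.one_le_k
  have hk2 := hS.time₂.one_le_k
  have e : lapB S true true γ1 γ2 (kexp S.t₁.k γ1 T1) (kexp S.t₂.k γ2 T2) w =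
      fun m' => lap2 S.t₁.k S.t₂.k γ1 γ2 (fun x y => w x y m') T1 T2 := funext fun m' =>
    lapB_eq_integral_prod hk1 hk2 hε h1.mem h2.mem h1.rate h2.rate hw m'
  have hL := h.integral_bil (z1 := kexp S.t₁.k γ1 T1) (z2 := kexp S.t₂.k γ2 T2) hA hB hk1 hk2 hε h1.mem
    h2.mem h1.rate h2.rate hb1 hb2 hf hw m
  rw [e] at hL
  refine ⟨?_, hL.2.1⟩
  have hm := meas3_bil S b1 b2 A B hf.meas hw.meas
  have := S.hasLap2_shiftB hS hε h1 h2 (f := fun σ1 σ2 => bil S b1 b2 A B f w σ1 σ2 m)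
    hm.comp
    fun κ1 κ2 hκ1 hκ2 => (h.integral_bil (z1 := κ1) (z2 := κ2) hA hB hk1 hk2 hε h1.mem
      h2.mem hκ1 hκ2 hb1 hb2 hf hw m).1
  simp only [expk_kexp] at hL
  rwa [lap2, hL.2.2] at this

lemma fourierConv_add4 {f1 f2 f3 f4 g : ℝ → ℂ} {m : ℝ}
    (h1 : Integrable fun m1 : ℝ => A.eval (I * ((m - m1 : ℝ) : ℂ)) * f1 (m - m1)
      * (B.eval (I * (m1 : ℂ)) * g m1))
    (h2 : Integrable fun m1 : ℝ => A.eval (I * ((m - m1 : ℝ) : ℂ)) * f2 (m - m1)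
      * (B.eval (I * (m1 : ℂ)) * g m1))
    (h3 : Integrable fun m1 : ℝ => A.eval (I * ((m - m1 : ℝ) : ℂ)) * f3 (m - m1)
      * (B.eval (I * (m1 : ℂ)) * g m1))
    (h4 : Integrable fun m1 : ℝ => A.eval (I * ((m - m1 : ℝ) : ℂ)) * f4 (m - m1)
      * (B.eval (I * (m1 : ℂ)) * g m1)) :
    fourierConv A B (fun m => f1 m + f2 m + f3 m + f4 m) g m =
      fourierConv A B f1 g m + fourierConv A B f2 g m + fourierConv A B f3 g m + fourierConv A B f4 g m := by
  simp only [fourierConv, ← mul_add]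
  rw [← integral_add' h1 h2, ← integral_add' (h1.add h2) h3, ← integral_add' ((h1.add h2).add h3) h4]
  congr 2
  funext m1
  simp only [Pi.add_apply]
  ring

lemma CauchyData.SolvesAt.congr {U V : 𝔽} {m : ℝ} (h : S.SolvesAt C F ε V T1 T2 m)
    (hUV : ∀ m', U T1 T2 m' = V T1 T2 m')
    (h' : ∀ᶠ z1 in 𝓝 T1, ∀ᶠ z2 in 𝓝 T2, U z1 z2 m = V z1 z2 m) : S.SolvesAt C F ε U T1 T2 m := by
  have hT (t : TimeData) {f g : ℂ → ℂ} {T : ℂ} (hf : f =ᶠ[𝓝 T] g) : t.opT m f T = t.opT m g T := by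
    rw [TimeData.opT, TimeData.opT, hf.iteratedDeriv_eq, hf.deriv_eq]
  have e1 : S.t₁.opT m (fun z1 => S.t₂.opT m (fun z2 => U z1 z2 m) T2) T1 =
      S.t₁.opT m (fun z1 => S.t₂.opT m (fun z2 => V z1 z2 m) T2) T1 :=
    hT _ (h'.mono fun z1 hz => hT _ hz)
  have e2 (i j : ℕ) : iteratedDeriv i (fun z1 => iteratedDeriv j (fun z2 => U z1 z2 m) T2) T1 =
      iteratedDeriv i (fun z1 => iteratedDeriv j (fun z2 => V z1 z2 m) T2) T1 :=
    Filter.EventuallyEq.iteratedDeriv_eq _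
      (h'.mono fun z1 hz => Filter.EventuallyEq.iteratedDeriv_eq _ hz)
  rw [SolvesAt] at h ⊢
  rw [show U T1 T2 = V T1 T2 from funext hUV, e1, h]
  simp only [e2]

/-- The Laplace transforms of the four terms with the coefficient series. -/
lemma CauchyData.exists_hasLap2_coef (hS : S.Setup ρ β μ r)
    (hC : PosFamily β μ K0 T0 ε0 0 C) (hε : ε ∈ puncturedDisc ε0)
    (hsm : (S.coefs C F ε).Small S ρ β μ ε ζ) (hw : S.Ball ρ (S.W β ε 1 1 (-μ)) K w)
    (h1 : S.t₁.Ray ρ T0 ε γ1 T1) (h2 : S.t₂.Ray ρ T0 ε γ2 T2) (m : ℝ) :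
    ∃ I1 I2 I3 I4 : ℂ,
      HasLap2 S.t₁.k S.t₂.k γ1 γ2 T1 T2 (S.shiftB fun σ1 σ2 =>
        bil S true true 1 S.R₀ (S.coefs C F ε).φ w σ1 σ2 m) I1 ∧
      HasLap2 S.t₁.k S.t₂.k γ1 γ2 T1 T2 (S.shiftB fun σ1 σ2 =>
        bil S true false 1 S.R₀ (fun x _ m => (S.coefs C F ε).φ1 x m) w σ1 σ2 m) I2 ∧
      HasLap2 S.t₁.k S.t₂.k γ1 γ2 T1 T2 (S.shiftB fun σ1 σ2 =>
        bil S false true 1 S.R₀ (fun _ y m => (S.coefs C F ε).φ2 y m) w σ1 σ2 m) I3 ∧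
      HasLap2 S.t₁.k S.t₂.k γ1 γ2 T1 T2 (S.shiftB fun σ1 σ2 =>
        bil S false false 1 S.R₀ (fun _ _ m => (S.coefs C F ε).c m) w σ1 σ2 m) I4 ∧
      I1 + I2 + I3 + I4 = T1 ^ (S.t₁.k + 1) * (T2 ^ (S.t₂.k + 1) * fourierConv 1 S.R₀
        (fun m' => sumC C T1 T2 m' ε)
        (fun m' => lap2 S.t₁.k S.t₂.k γ1 γ2 (fun x y => w x y m') T1 T2) m) := by
  have hε0 : ε ≠ 0 := hε.2
  have hk1 := hS.time₁.one_le_k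
  have hk2 := hS.time₂.one_le_k
  obtain ⟨CR, hCR, hRb⟩ := exists_norm_eval_le hS.deg_R₀
  obtain ⟨Cm, hcm⟩ := convMaj_of_one hS.hβ (hS.one_lt_μ hS.hr) S.N hCR
  have hc := fun (b1 b2 : Bool) (f : 𝔽) hb1 hb2 hf =>
    hcm.hasLap2_shiftB_bil (b1 := b1) (b2 := b2) (f := f) (Kf := ζ) (A := 1)
      (fun m => norm_eval_one_le m) hRb hS hε0 h1 h2 hb1 hb2 hf hw m
  obtain ⟨hφ, iφ⟩ := hc true true (S.coefs C F ε).φ (by simp) (by simp) hsm.φ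
  obtain ⟨hφ1, iφ1⟩ := hc true false (fun x _ m => (S.coefs C F ε).φ1 x m) (by simp) (fun _ _ _ _ _ => rfl) hsm.φ1
  obtain ⟨hφ2, iφ2⟩ := hc false true (fun _ y m => (S.coefs C F ε).φ2 y m) (fun _ _ _ _ _ => rfl) (by simp) hsm.φ2
  obtain ⟨h00, i00⟩ := hc false false (fun _ _ m => (S.coefs C F ε).c m) (fun _ _ _ _ _ => rfl) (fun _ _ _ _ _ => rfl) hsm.c
  refine ⟨_, _, _, _, hφ, hφ1, hφ2, h00, ?_⟩
  have f := fourierConv_add4 iφ iφ1 iφ2 i00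
  have h1T := norm_lt_of_rate_lt (ne_zero_of_mem_sector h1.sec) hC.hT h1.rate'
  have h2T := norm_lt_of_rate_lt (ne_zero_of_mem_sector h2.sec) hC.hT h2.rate'
  rw [← mul_add, ← mul_add, ← mul_add, ← mul_add, ← mul_add, ← mul_add, ← f]
  congr 3
  funext m'
  rw [hC.sumC_eq hε.1 h1T h2T m',
    ← hC.lapB_borel12 zero_le_one hε.1 hk1 hk2 h1.sec h2.sec h1.rate' h2.rate' m',
    ← hC.lapB_borel1 (S := S) (γ2 := γ2) hε.1 hk1 h1.sec h1.rate' (kexp S.t₂.k γ2 T2) m',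
    ← hC.lapB_borel2 (S := S) (γ1 := γ1) hε.1 hk2 h2.sec h2.rate' (kexp S.t₁.k γ1 T1) m',
    lapB_eq_integral_prod hk1 hk2 hε0 h1.mem h2.mem h1.rate h2.rate hsm.φ m']
  congr 1
  simp only [lapB, lamB, expB, cond_false, integral_dirac, mul_one]
  rfl

/-- The Laplace transform of a solution of the convolution equation solves the singular equation. -/
lemma CauchyData.solvesAt_lap2 (hS : S.Setup ρ β μ r)
    (hC : PosFamily β μ K0 T0 ε0 0 C) (hF : PosFamily β μ K0 T0 ε0 1 F) (hε : ε ∈ puncturedDisc ε0) (hεr : ε ∈ closedBall (0 : ℂ) r)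
    (hsm : (S.coefs C F ε).Small S ρ β μ ε ζ) (hw : S.Ball ρ (S.W β ε 1 1 (-μ)) K w)
    (heq : ∀ τ1 ∈ S.t₁.closedDom ρ, ∀ τ2 ∈ S.t₂.closedDom ρ, ∀ m : ℝ, S.BorelEqAt C F ε w τ1 τ2 m)
    (h1 : S.t₁.Ray ρ T0 ε γ1 T1) (h2 : S.t₂.Ray ρ T0 ε γ2 T2) (m : ℝ) :
    S.SolvesAt C F ε (fun z1 z2 m => lap2 S.t₁.k S.t₂.k γ1 γ2 (fun x y => w x y m) z1 z2) T1 T2 m := by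
  have hε0 : ε ≠ 0 := hε.2
  have hk1 := hS.time₁.one_le_k
  have hk2 := hS.time₂.one_le_k
  have hT1 := ne_zero_of_mem_sector h1.sec
  have hT2 := ne_zero_of_mem_sector h2.sec
  obtain ⟨κ1, hν1, hκ1⟩ := exists_between h1.rate
  obtain ⟨κ2, hν2, hκ2⟩ := exists_between h2.rate
  have h01 : 0 < κ1 := by
    have := hS.time₁.ν_pos
    have := norm_pos_iff.2 hε0
    exact lt_trans pos! hν1
  have h02 : 0 < κ2 := by
    have := hS.time₂.ν_pos
    have := norm_pos_iff.2 hε0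
    exact lt_trans pos! hν2
  have hwl := lapInt2_of_bd hk1 hk2 hε0 h1.mem h2.mem hw hν1 hν2 m
  have hm2 {f : 𝔽} (hf : Meas3 f) : Measurable fun p : ℂ × ℂ => f p.1 p.2 m :=
    hf.comp
  -- the left hand side
  have hL := HasLap2.of_pair (LaplacePair.opB S.t₁ hS.time₁ γ1 m) (LaplacePair.opB S.t₂ hS.time₂ γ2 m)
    (hm2 hw.meas) h01 h02 hwl h1.sec h2.sec hκ1 hκ2
  -- the linear terms without convolution in `m`
  have hR := HasLap2.sum (Finset.Icc 1 (S.t₁.D - 1)) fun l1 hl1 => HasLap2.sum (Finset.Icc 1 (S.t₂.D - 1))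
    fun l2 hl2 => HasLap2.const_mul ((S.R l1 l2).eval (I * m) * ε ^ S.epsExp l1 l2)
      (HasLap2.of_pair
        ((LaplacePair.derivB hk1 γ1 (hS.time₁.one_le_δ (Finset.mem_Icc.1 hl1).1
          (Finset.mem_Icc.1 hl1).2)).mulB_comp hk1 (hS.time₁.dk_add (Finset.mem_Icc.1 hl1).1
          (Finset.mem_Icc.1 hl1).2).2)
        ((LaplacePair.derivB hk2 γ2 (hS.time₂.one_le_δ (Finset.mem_Icc.1 hl2).1
          (Finset.mem_Icc.1 hl2).2)).mulB_comp hk2 (hS.time₂.dk_add (Finset.mem_Icc.1 hl2).1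
          (Finset.mem_Icc.1 hl2).2).2)
        (hm2 hw.meas) h01 h02 hwl h1.sec h2.sec hκ1 hκ2)
  -- the quadratic term
  obtain ⟨n, Cq, C1, C2, hq, hP⟩ := hS.exists_convMaj
  have hQ := (hq.hasLap2_shiftB_bil (b1 := true) (b2 := true) (fun m => (hP ε hεr m).1)
    (fun m => (hP ε hεr m).2) hS hε0 h1 h2 (by simp) (by simp) hw hw m).1
  obtain ⟨I1, I2, I3, I4, hφ, hφ1, hφ2, h00, eI⟩ :=
    S.exists_hasLap2_coef hS hC hε hsm hw h1 h2 m
  -- the inhomogeneous term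
  have hψ := S.hasLap2_shiftB hS hε0 h1 h2 (f := fun σ1 σ2 => (S.coefs C F ε).ψ σ1 σ2 m) (hm2 hsm.ψ.meas)
    fun κ1 κ2 hκ1 hκ2 => lapInt2_of_bd hk1 hk2 hε0 h1.mem h2.mem hsm.ψ hκ1 hκ2 m
  have eψ : lap2 S.t₁.k S.t₂.k γ1 γ2 (fun σ1 σ2 => (S.coefs C F ε).ψ σ1 σ2 m) T1 T2 = sumF F T1 T2 m ε :=
    hF.lapB_borel12 le_rfl hε.1 hk1 hk2 h1.sec h2.sec h1.rate' h2.rate' m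
  have eL := (LaplacePair.opB S.t₁ hS.time₁ γ1 m).const_mul' (T2 ^ (S.t₂.k + 1))
    (fun z1 => S.t₂.opT m (fun z2 => lap2 S.t₁.k S.t₂.k γ1 γ2 (fun x y => w x y m) z1 z2) T2) T1
  have ew : lapB S true true γ1 γ2 (kexp S.t₁.k γ1 T1) (kexp S.t₂.k γ2 T2) w = _ := funext fun m' =>
    lapB_eq_integral_prod hk1 hk2 hε0 h1.mem h2.mem h1.rate h2.rate hw m'
  have hall := hL.eq_of_eq (((((((hQ.const_mul (ε ^ (-2 : ℤ))).add hR).add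
    (hφ.const_mul (ε ^ (-2 : ℤ)))).add (hφ1.const_mul (ε ^ (-2 : ℤ)))).add
    (hφ2.const_mul (ε ^ (-2 : ℤ)))).add (h00.const_mul (ε ^ (-2 : ℤ)))).add
    (hψ.const_mul (ε ^ (-2 : ℤ)))) fun r1 r2 hr1 hr2 => heq _ (h1.mem r1 hr1) _ (h2.mem r2 hr2) m
  clear hL hQ hR hφ hφ1 hφ2 h00 hψ hwl heq hw hsm hC hF
  have eD (i : ℕ) (c : ℂ) (g : ℂ → ℂ) : iteratedDeriv i (fun z => c * g z) T1 = c * iteratedDeriv i g T1 := by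
    rw [show (fun z => c * g z) = c • g from rfl, iteratedDeriv_const_smul_field, smul_eq_mul]
  have eS : ∀ l1 ∈ Finset.Icc 1 (S.t₁.D - 1), ∀ l2 ∈ Finset.Icc 1 (S.t₂.D - 1), ∀ p e x : ℂ,
      p * e * (T1 ^ S.t₁.dk l1 * (T1 ^ (S.t₁.δ l1 * (S.t₁.k + 1)) * (T2 ^ S.t₂.dk l2 *
        (T2 ^ (S.t₂.δ l2 * (S.t₂.k + 1)) * x)))) = T1 ^ (S.t₁.k + 1) * T2 ^ (S.t₂.k + 1) *
          (e * T1 ^ S.t₁.d l1 * T2 ^ S.t₂.d l2 * x * p) := by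
    intro l1 hl1 l2 hl2 p e x
    have e1 : T1 ^ S.t₁.dk l1 * T1 ^ (S.t₁.δ l1 * (S.t₁.k + 1)) = T1 ^ (S.t₁.k + 1) * T1 ^ S.t₁.d l1 := by
      rw [← pow_add, ← pow_add, (hS.time₁.dk_add (Finset.mem_Icc.1 hl1).1 (Finset.mem_Icc.1 hl1).2).1]
      congr 1; omega
    have e2 : T2 ^ S.t₂.dk l2 * T2 ^ (S.t₂.δ l2 * (S.t₂.k + 1)) = T2 ^ (S.t₂.k + 1) * T2 ^ S.t₂.d l2 := by
      rw [← pow_add, ← pow_add, (hS.time₂.dk_add (Finset.mem_Icc.1 hl2).1 (Finset.mem_Icc.1 hl2).2).1]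
      congr 1; omega
    linear_combination p * e * x * (T2 ^ S.t₂.dk l2 * T2 ^ (S.t₂.δ l2 * (S.t₂.k + 1))) * e1 +
      p * e * x * (T1 ^ (S.t₁.k + 1) * T1 ^ S.t₁.d l1) * e2
  have hne : T1 ^ (S.t₁.k + 1) * T2 ^ (S.t₂.k + 1) ≠ 0 := mul_ne_zero (pow_ne_zero _ hT1) (pow_ne_zero _ hT2)
  beta_reduce at hall eL
  rw [eL, eψ] at hall
  simp only [eD] at hall
  rw [sum_congr rfl fun l1 hl1 => sum_congr rfl fun l2 hl2 => eS l1 hl1 l2 hl2 _ _ _] at hall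
  simp only [← mul_sum] at hall
  rw [SolvesAt]
  refine mul_left_cancel₀ hne ?_
  rw [ew] at hall
  linear_combination hall + ε ^ (-2 : ℤ) * eI

end

/-! ### The choice of the half-line -/

/-- The roots of `P_m` are equally spaced on a circle, and there are at least two of them; hence the
sector is not larger than a half-plane. -/
lemma TimeData.Admissible.a_le (ht : t.Admissible) (hroots : t.RootsApart ρ) :
    t.a ≤ π / 2 := by
  obtain ⟨M, hM, h⟩ := hroots
  have hk : (0 : ℝ) < t.k := mod_cast ht.one_le_k
  set N := (t.δ t.D - 1) * t.k with hN
  have hδ := ht.one_lt_δ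
  have hN2 : 2 ≤ N := by
    have h1 := ht.δ_gap 1 le_rfl (by have := ht.two_le_D; omega)
    rw [ht.δ_one, Nat.cast_one, ← le_sub_iff_add_le', div_le_iff₀ hk] at h1
    have : ((t.δ t.D - 1 : ℕ) : ℝ) = t.δ t.D - 1 := by push_cast [hδ.le]; ring
    rw [← this] at h1
    exact_mod_cast h1
  have hN0 : (2 : ℝ) ≤ N := mod_cast hN2
  by_contra! ha
  set A := t.Q.eval (I * (0 : ℝ)) * t.k with hA
  set B := t.RD.eval (I * (0 : ℝ)) * (t.k : ℂ) ^ t.δ t.D with hB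
  have hkc : (t.k : ℂ) ≠ 0 := mod_cast hk.ne'
  have hB0 : B ≠ 0 := mul_ne_zero (ht.RD_ne 0) (pow_ne_zero _ hkc)
  have hA0 : A ≠ 0 := mul_ne_zero (ht.Q_ne 0) hkc
  have hPm : ∀ q : ℂ, q ^ N = A / B → t.Pm 0 q = 0 := fun q hq => by
    rw [Pm, ← hN, hq, ← hA, ← hB, mul_div_cancel₀ _ hB0, sub_self]
  obtain ⟨q0, hq0⟩ := IsAlgClosed.exists_pow_nat_eq (A / B) (show 0 < N by omega)
  have u0 : q0 ≠ 0 := fun h0 => by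
    rw [h0, zero_pow (by omega)] at hq0
    exact (div_ne_zero hA0 hB0) hq0.symm
  set j : ℤ := round ((t.dir - q0.arg) * N / (2 * π)) with hj
  set φ : ℝ := q0.arg + 2 * π * j / N with hφ
  have hπ := pi_pos
  have hφd : |φ - t.dir| < t.a := by
    have h1 := abs_sub_round ((t.dir - q0.arg) * N / (2 * π))
    rw [← hj] at h1
    have h2 : φ - t.dir = -((t.dir - q0.arg) * N / (2 * π) - j) * (2 * π / N) := by
      rw [hφ]; field_simp; ring
    rw [h2, abs_mul, abs_neg, abs_of_pos (a := 2 * π / N) pos!]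
    calc _ ≤ 1 / 2 * (2 * π / N) := mul_le_r h1
      _ ≤ π / 2 := by
          rw [show 1 / 2 * (2 * π / N) = π / N by ring]
          exact div_le_div_of_nonneg_left hπ.le (by norm_num) hN0
      _ < t.a := ha
  have hmem : ray φ ‖q0‖ ∈ t.closedDom ρ := Or.inr ⟨‖q0‖, φ, norm_pos_iff.2 u0, hφd, rfl⟩
  have hroot : t.Pm 0 (ray φ ‖q0‖) = 0 := by
    refine hPm _ (hq0 ▸ ?_)
    conv_rhs => rw [← Complex.norm_mul_exp_arg_mul_I q0]
    have hNc : (N : ℂ) ≠ 0 := mod_cast (by omega : N ≠ 0)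
    rw [ray, mul_pow, mul_pow, ← Complex.exp_nat_mul, ← Complex.exp_nat_mul, Complex.exp_eq_exp_iff_exists_int.2
      ⟨j, _⟩]
    rw [hφ]; push_cast; field_simp
  have := h 0 _ hroot _ hmem
  rw [sub_self, norm_zero] at this
  have : 0 < M * (1 + ‖ray φ ‖q0‖‖) := by positivity
  linarith

/-- The argument of `T`, measured from the direction `d`. -/
def argFrom (d : ℝ) (T : ℂ) : ℝ := d + (T * Complex.exp (-d * I)).arg

lemma argFrom_ray {φ : ℝ} (hr : 0 < r) (h : |φ - d| < π) : argFrom d (ray φ r) = φ := by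
  have e : ray φ r * Complex.exp (-d * I) = r * Complex.exp ((φ - d : ℝ) * I) := by
    rw [ray, mul_assoc, ← Complex.exp_add]
    push_cast
    ring_nf
  rw [argFrom, e, Complex.exp_mul_I, Complex.arg_mul_cos_add_sin_mul_I hr
    ⟨(abs_lt.1 h).1, (abs_lt.1 h).2.le⟩]
  ring

lemma continuousAt_argFrom {α : ℝ} (hα : α ≤ π) (hT : T ∈ sector d α) :
    ContinuousAt (argFrom d) T := by
  have h0 := ne_zero_of_mem_sector hT
  obtain ⟨r, φ, hr, hφ, e⟩ := hT
  have h := argFrom_ray hr (hφ.trans_le hα)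
  have e' : T = ray φ r := e
  rw [← e', argFrom] at h
  have := abs_lt.1 (hφ.trans_le hα)
  refine continuousAt_const.add ((Complex.continuousAt_arg ?_).comp (f := fun T : ℂ => T * Complex.exp (-d * I))
    fp!)
  exact Complex.mem_slitPlane_iff_arg.2 ⟨by linarith, mul_ne_zero h0 (exp_ne_zero _)⟩

lemma rate_mul_norm {α : ℝ} (hα : α ≤ π) (hT : T ∈ sector d α) :
    rate k γ T = cos (k * (γ - argFrom d T)) / ‖T‖ ^ k := by
  obtain ⟨r, φ, hr, hφ, rfl⟩ := hT
  change rate k γ (ray φ r) = cos (k * (γ - argFrom d (ray φ r))) / ‖ray φ r‖ ^ k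
  rw [argFrom_ray hr (hφ.trans_le hα), norm_ray φ hr.le, rate_eq k γ φ hr]

lemma sin_le_cos_of_abs_le (hk : 1 ≤ k) {g : ℝ} (hg : 0 ≤ g) (hx : |x| ≤ π / (2 * k) - g) :
    Real.sin (k * g) ≤ cos (k * x) := by
  have hk0 : (0 : ℝ) < k := mod_cast hk
  rw [← Real.cos_pi_div_two_sub, ← Real.cos_abs (k * x), abs_mul, abs_of_pos hk0]
  refine Real.cos_le_cos_of_nonneg_of_le_pi pos! ?_ ?_
  · have := pi_pos
    have : 0 ≤ k * g := by positivity
    linarith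
  · calc k * |x| ≤ k * (π / (2 * k) - g) := mul_le_l hx hk0.le
      _ = _ := by field_simp

/-- For `T` in the sector of opening `θ` there is a direction `γ(T)` in the sector of the Borel plane
for which the kernel decays, uniformly in `T`. The bound on the kernel holds along all directions
between `γ(T)` and `γ(z)`, for `z` near `T`. -/
lemma TimeData.Admissible.exists_direction (ht : t.Admissible)
    (hroots : t.RootsApart ρ) (h1 : π / t.k < θ) (h2 : θ < π / t.k + 2 * t.a) :
    ∃ (γ : ℂ → ℝ) (δ : ℝ), 0 < δ ∧ δ ≤ 1 ∧ ∀ T ∈ sector t.dir (θ / 2),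
      |γ T - t.dir| < t.a ∧ T ∈ sector (γ T) (π / (2 * t.k)) ∧
      δ ≤ cos (t.k * (γ T - T.arg)) ∧
      ∀ᶠ z in 𝓝 T, ∀ γ' ∈ [[γ T, γ z]], |γ' - t.dir| < t.a ∧ δ / ‖z‖ ^ t.k ≤ rate t.k γ' z := by
  have hk := ht.one_le_k
  have hk0 : (0 : ℝ) < t.k := mod_cast hk
  have hk1 : (1 : ℝ) ≤ t.k := mod_cast hk
  have ha := ht.a_le hroots
  have hπ := pi_pos
  set κ := π / (2 * t.k) with hκ
  have hκ0 : 0 < κ := by positivity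
  have hκ2 : π / t.k = 2 * κ := by rw [hκ]; field_simp
  have hκπ : κ ≤ π / 2 := by
    rw [hκ]; exact div_le_div_of_nonneg_left hπ.le (by norm_num) (by linarith)
  rw [hκ2] at h1 h2
  set g := min (κ + t.a - θ / 2) κ with hg
  have hg1 : g ≤ κ + t.a - θ / 2 := min_le_left _ _
  have hg2 : g ≤ κ := min_le_right _ _
  have hg0 : 0 < g := lt_min (by linarith) hκ0
  have hα : θ / 2 ≤ π := by linarith
  set b := t.a - g / 2 with hb
  set φ := argFrom t.dir with hφ
  set γ : ℂ → ℝ := fun T => max (t.dir - b) (min (t.dir + b) (φ T)) with hγ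
  have hb0 : 0 < b := by rw [hb]; linarith
  have hkg : t.k * (g / 4) ≤ π / 2 := by
    have : t.k * g ≤ t.k * κ := mul_le_l hg2 hk0.le
    have e : t.k * κ = π / 2 := by rw [hκ]; field_simp
    nlinarith
  have hγb : ∀ T, |γ T - t.dir| ≤ b := fun T => by
    rw [abs_le, hγ]
    constructor
    · have := le_max_left (t.dir - b) (min (t.dir + b) (φ T)); linarith
    · have : max (t.dir - b) (min (t.dir + b) (φ T)) ≤ t.dir + b :=
        max_le (by linarith) (min_le_left _ _)
      linarith
  have hφT : ∀ T ∈ sector t.dir (θ / 2), |φ T - t.dir| < θ / 2 ∧ T = ray (φ T) ‖T‖ := by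
    rintro T ⟨r, ψ, hr, hψ, rfl⟩
    rw [hφ, show (r : ℂ) * Complex.exp (ψ * I) = ray ψ r from rfl,
      argFrom_ray hr (hψ.trans_le hα), norm_ray ψ hr.le]
    exact ⟨hψ, rfl⟩
  have hγφ : ∀ T ∈ sector t.dir (θ / 2), |γ T - φ T| ≤ κ - g / 2 := fun T hT => by
    have h := abs_lt.1 (hφT T hT).1
    rw [abs_le, hγ]
    beta_reduce
    rcases max_cases (t.dir - b) (min (t.dir + b) (φ T)) with u1 | u1 <;>
    rcases min_cases (t.dir + b) (φ T) with u2 | u2 <;> constructor <;> linarith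
  refine ⟨γ, Real.sin (t.k * (g / 4)), Real.sin_pos_of_pos_of_lt_pi pos! (by linarith),
    Real.sin_le_one _, fun T hT => ⟨(hγb T).trans_lt (by linarith), ?_, ?_, ?_⟩⟩
  · refine ⟨‖T‖, φ T, norm_pos_iff.2 (ne_zero_of_mem_sector hT), ?_, (hφT T hT).2⟩
    rw [abs_sub_comm]
    exact (hγφ T hT).trans_lt (by linarith)
  · have hT0 := norm_pos_iff.2 (ne_zero_of_mem_sector hT)
    have e1 := rate_mul_norm (k := t.k) (γ := γ T) hα hT
    have e2 := rate_eq t.k (γ T) T.arg hT0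
    rw [ray, Complex.norm_mul_exp_arg_mul_I, e1, div_left_inj' (pow_ne_zero _ hT0.ne')] at e2
    rw [← e2]
    exact sin_le_cos_of_abs_le hk pos! ((hγφ T hT).trans (by linarith))
  · have hc := (continuousAt_argFrom hα hT).eventually (Metric.ball_mem_nhds _ (show 0 < g / 4 by positivity))
    filter_upwards [(isOpen_sector _ _).eventually_mem hT, hc] with z hz hzd γ' hγ'
    have hzd : |φ z - φ T| < g / 4 := hzd
    have hz1 := abs_le.1 (hγφ z hz)
    have hT1 := abs_le.1 (hγφ T hT)
    have hd := abs_lt.1 hzd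
    have b1 := abs_le.1 (hγb z)
    have b2 := abs_le.1 (hγb T)
    rw [rate_mul_norm hα hz]
    refine ⟨?_, div_le_r (sin_le_cos_of_abs_le hk pos! ?_)⟩ <;>
    rcases mem_uIcc.1 hγ' with h | h
    · exact abs_lt.2 ⟨by linarith, by linarith⟩
    · exact abs_lt.2 ⟨by linarith, by linarith⟩
    · exact abs_le.2 ⟨by linarith, by linarith⟩
    · exact abs_le.2 ⟨by linarith, by linarith⟩

/-! ### Properties of the Laplace transform of the solution -/

lemma TimeData.ray_mem (h : |γ - t.dir| < t.a) (hr : 0 < r) :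
    ray γ r ∈ t.S := ⟨r, γ, hr, h, rfl⟩

lemma TimeData.ray_mem_closedDom (h : |γ - t.dir| < t.a) (ρ : ℝ)
    (hr : 0 < r) : ray γ r ∈ t.closedDom ρ := Or.inr (t.ray_mem h hr)

lemma TimeData.integral_wt_ker_le (t : TimeData) (hk : 1 ≤ t.k) (hε : ε ≠ 0) (hT : T ≠ 0)
    (hc : 0 < c) (h : c / ‖T‖ ^ t.k ≤ rate t.k γ T - t.ν / ‖ε‖ ^ t.k) :
    ∫ r, t.wt 1 (ray γ r / ε) * ‖ker t.k γ T r‖ ∂lam t.k ≤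
      ‖ε‖⁻¹ * (c ^ (-(1 : ℝ) / t.k) * Gamma (1 / t.k)) * ‖T‖ := by
  have hT' := norm_pos_iff.2 hT
  have hk0 : (0 : ℝ) < t.k := mod_cast hk
  have hc' : 0 < c / ‖T‖ ^ t.k := by positivity
  have h1 := integral_real_monomial hk le_rfl hc'
  rw [integral_complex_ofReal, Complex.ofReal_inj, Nat.cast_one] at h1
  calc _ ≤ ∫ r, ‖ε‖⁻¹ * (r ^ 1 * exp (-(c / ‖T‖ ^ t.k * r ^ t.k))) ∂lam t.k := by
        refine integral_mono_of_nonneg (.of_forall fun r => mul_nonneg (t.wt_nonneg _ _)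
          (norm_nonneg _)) ((integrable_pow_mul_exp hk le_rfl hc').const_mul _) ?_
        filter_upwards [ae_lam t.k] with r hr
        rw [norm_ker]
        refine (t.wt_ray_mul_exp_le γ hε hr _).trans (mul_le_l
          (mul_le_l (exp_le_exp.2 (neg_le_neg ?_)) (pow_nonneg hr.le 1)) (inv_nonneg.2 (norm_nonneg _)))
        exact mul_le_r h (pow_nonneg hr.le _)
    _ = _ := by
        rw [integral_const_mul, h1, Real.div_rpow hc.le pos!, ← rpow_natCast, ← rpow_mul hT'.le,
          mul_div_cancel₀ _ hk0.ne', Real.rpow_neg_one, div_inv_eq_mul]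
        ring

section
variable {γ1' γ2' : ℝ}

lemma norm_lap2_integrand_le (hγ1 : ∀ r, 0 < r → ray γ1 r ∈ S.t₁.closedDom ρ)
    (hγ2 : ∀ r, 0 < r → ray γ2 r ∈ S.t₂.closedDom ρ) (hw : S.Ball ρ (S.W β ε 1 1 (-μ)) K w) (T1 T2 : ℂ) :
    ∀ᵐ p ∂(lam S.t₁.k).prod (lam S.t₂.k), ∀ m, ‖w (ray γ1 p.1) (ray γ2 p.2) m *
      (ker S.t₁.k γ1 T1 p.1 * ker S.t₂.k γ2 T2 p.2)‖ ≤ K * fw β (-μ) m *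
        ((S.t₁.wt 1 (ray γ1 p.1 / ε) * ‖ker S.t₁.k γ1 T1 p.1‖) *
          (S.t₂.wt 1 (ray γ2 p.2 / ε) * ‖ker S.t₂.k γ2 T2 p.2‖)) := by
  filter_upwards [quasiMeasurePreserving_fst.ae (ae_lam S.t₁.k),
    quasiMeasurePreserving_snd.ae (ae_lam S.t₂.k)] with p h1 h2 m
  rw [norm_mul, norm_mul]
  refine (mul_le_r (hw.bd _ (hγ1 _ h1) _ (hγ2 _ h2) m)).trans_eq ?_
  unfold W
  ring

lemma integrable_wt_ker (t : TimeData) (hk : 1 ≤ t.k) (hε : ε ≠ 0)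
    (h : t.ν / ‖ε‖ ^ t.k < rate t.k γ T) :
    Integrable (fun r => t.wt 1 (ray γ r / ε) * ‖ker t.k γ T r‖) (lam t.k) := by
  simp only [ker_eq_expk]
  exact t.integrable_wt_ray hk γ hε h

lemma norm_lap2_le (hk1 : 1 ≤ S.t₁.k) (hk2 : 1 ≤ S.t₂.k) (hε : ε ≠ 0)
    (h1 : S.t₁.Ray ρ T0 ε γ1 T1) (h2 : S.t₂.Ray ρ T0 ε γ2 T2) (hc1 : 0 < c1) (hc2 : 0 < c2)
    (hr1 : c1 / ‖T1‖ ^ S.t₁.k ≤ rate S.t₁.k γ1 T1 - S.t₁.ν / ‖ε‖ ^ S.t₁.k)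
    (hr2 : c2 / ‖T2‖ ^ S.t₂.k ≤ rate S.t₂.k γ2 T2 - S.t₂.ν / ‖ε‖ ^ S.t₂.k)
    (hw : S.Ball ρ (S.W β ε 1 1 (-μ)) K w) (m : ℝ) :
    ‖lap2 S.t₁.k S.t₂.k γ1 γ2 (fun x y => w x y m) T1 T2‖ ≤ K * fw β (-μ) m *
      ((‖ε‖⁻¹ * (c1 ^ (-(1 : ℝ) / S.t₁.k) * Gamma (1 / S.t₁.k)) * ‖T1‖) *
        (‖ε‖⁻¹ * (c2 ^ (-(1 : ℝ) / S.t₂.k) * Gamma (1 / S.t₂.k)) * ‖T2‖)) := by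
  have hfw := (fw_pos β (-μ) m).le
  have hK := hw.nonneg
  have i1 := S.t₁.integral_wt_ker_le hk1 hε (ne_zero_of_mem_sector h1.sec) hc1 hr1
  have i2 := S.t₂.integral_wt_ker_le hk2 hε (ne_zero_of_mem_sector h2.sec) hc2 hr2
  refine (norm_integral_le_of_norm_le (((integrable_wt_ker S.t₁ hk1 hε h1.rate).mul_prod
    (integrable_wt_ker S.t₂ hk2 hε h2.rate)).const_mul (K * fw β (-μ) m))
    ((norm_lap2_integrand_le h1.mem h2.mem hw T1 T2).mono fun p hp => hp m)).trans ?_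
  rw [integral_const_mul, integral_prod_mul (fun r => S.t₁.wt 1 (ray γ1 r / ε) * ‖ker S.t₁.k γ1 T1 r‖)
    (fun r => S.t₂.wt 1 (ray γ2 r / ε) * ‖ker S.t₂.k γ2 T2 r‖)]
  refine mul_le_l (mul_le_mul i1 i2 (integral_nonneg fun r =>
    mul_nonneg (TimeData.wt_nonneg _ _ _) (norm_nonneg _)) ((integral_nonneg fun r =>
    mul_nonneg (TimeData.wt_nonneg _ _ _) (norm_nonneg _)).trans i1))

lemma continuous_lap2 (hk1 : 1 ≤ S.t₁.k) (hk2 : 1 ≤ S.t₂.k) (hε : ε ≠ 0) (hβ : 0 ≤ β) (hμ : 0 ≤ μ)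
    (h1 : S.t₁.Ray ρ T0 ε γ1 T1) (h2 : S.t₂.Ray ρ T0 ε γ2 T2)
    (hw : S.Ball ρ (S.W β ε 1 1 (-μ)) K w)
    (hc : ∀ x ∈ S.t₁.closedDom ρ, ∀ y ∈ S.t₂.closedDom ρ, Continuous (w x y)) :
    Continuous fun m => lap2 S.t₁.k S.t₂.k γ1 γ2 (fun x y => w x y m) T1 T2 := by
  have m1 := (continuous_ray γ1).measurable
  have m2 := (continuous_ray γ2).measurable
  have m3 := measurable_ker S.t₁.k γ1 T1
  have m4 := measurable_ker S.t₂.k γ2 T2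
  refine continuous_of_dominated (fun m => Measurable.aestronglyMeasurable (Measurable.mul
    hw.meas.comp fp!))
    (bound := fun p => K * 1 * ((S.t₁.wt 1 (ray γ1 p.1 / ε) * ‖ker S.t₁.k γ1 T1 p.1‖) *
          (S.t₂.wt 1 (ray γ2 p.2 / ε) * ‖ker S.t₂.k γ2 T2 p.2‖)))
    (fun m => (norm_lap2_integrand_le h1.mem h2.mem hw T1 T2).mono fun p hp => (hp m).trans ?_)
    (((integrable_wt_ker S.t₁ hk1 hε h1.rate).mul_prod
    (integrable_wt_ker S.t₂ hk2 hε h2.rate)).const_mul _) ?_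
  · exact mul_le_r (mul_le_l (fw_le_one hβ (neg_nonpos.2 hμ) m) hw.nonneg)
      (mul_nonneg (mul_nonneg (TimeData.wt_nonneg _ _ _) (norm_nonneg _))
        (mul_nonneg (TimeData.wt_nonneg _ _ _) (norm_nonneg _)))
  · filter_upwards [quasiMeasurePreserving_fst.ae (ae_lam S.t₁.k),
      quasiMeasurePreserving_snd.ae (ae_lam S.t₂.k)] with p p1 p2
    exact (hc _ (h1.mem _ p1) _ (h2.mem _ p2)).mul continuous_const

lemma differentiableAt_ker (k : ℕ) (γ : ℝ) (r : ℝ) (hT : T ≠ 0) :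
    DifferentiableAt ℂ (fun T => ker k γ T r) T := by
  unfold ker
  fun_prop (disch := exact hT)

lemma LapInt2.differentiableAt_lap2 {f : ℂ → ℂ → ℂ}
    (hi : LapInt2 k1 k2 γ1 γ2 κ1 κ2 f) (hm : Measurable fun p : ℂ × ℂ => f p.1 p.2) (h1 : T1 ≠ 0)
    (h2 : T2 ≠ 0) (hκ1 : κ1 < rate k1 γ1 T1) (hκ2 : κ2 < rate k2 γ2 T2) :
    DifferentiableAt ℂ (fun T : ℂ × ℂ => lap2 k1 k2 γ1 γ2 f T.1 T.2) (T1, T2) := by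
  set U : Set (ℂ × ℂ) := {T | T ≠ 0 ∧ κ1 < rate k1 γ1 T} ×ˢ {T | T ≠ 0 ∧ κ2 < rate k2 γ2 T}
  have hU : IsOpen U := (isOpen_rate _ _ _).prod (isOpen_rate _ _ _)
  have hTU : (T1, T2) ∈ U := ⟨⟨h1, hκ1⟩, h2, hκ2⟩
  have hae : ∀ᵐ p ∂(lam k1).prod (lam k2), p ∈ Ioi (0 : ℝ) ×ˢ Ioi (0 : ℝ) := by
    filter_upwards [quasiMeasurePreserving_fst.ae (ae_lam k1),
      quasiMeasurePreserving_snd.ae (ae_lam k2)] with p p1 p2 using ⟨p1, p2⟩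
  have hres := Measure.restrict_eq_self_of_ae_mem hae
  set F : ℂ × ℂ → ℝ × ℝ → ℂ := fun T p => f (ray γ1 p.1) (ray γ2 p.2) * (TwoTime.ker k1 γ1 T.1 p.1 * TwoTime.ker k2 γ2 T.2 p.2)
    with hF
  have hd : ∀ p ∈ Ioi (0 : ℝ) ×ˢ Ioi (0 : ℝ), DifferentiableOn ℂ (F · p) U := fun p _ T hT => by
    have d1 := (differentiableAt_ker k1 γ1 p.1 hT.1.1).comp T differentiableAt_fst
    have d2 := (differentiableAt_ker k2 γ2 p.2 hT.2.1).comp T differentiableAt_snd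
    exact ((d1.mul d2).const_mul (f (ray γ1 p.1) (ray γ2 p.2))).differentiableWithinAt
  have h := differentiableOn_setIntegral (measurableSet_Ioi.prod measurableSet_Ioi) hU hd
    (ν := (lam k1).prod (lam k2)) (fun T hT => by
      rw [hres]
      exact (hi.ker (T1 := T.1) (T2 := T.2) hm hT.1.2.le hT.2.2.le).1)
    fun T hT => ⟨_, (Integrable.norm hi).integrableOn, eventually_mem_nhdsWithin.mono fun T hT p hp => ?_⟩
  · rw [hres] at h
    exact (h _ hTU).differentiableAt (hU.mem_nhds hTU)
  · rw [norm_mul, norm_mul, norm_mul, norm_mul, norm_expk, norm_expk, ofReal_re, ofReal_re]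
    exact mul_le_l (mul_le_mul (norm_ker_le hT.1.2.le hp.1) (norm_ker_le hT.2.2.le hp.2)
      (norm_nonneg _) (exp_pos _).le) (norm_nonneg _)

lemma differentiableAt_lap2 (hk1 : 1 ≤ S.t₁.k) (hk2 : 1 ≤ S.t₂.k) (hε : ε ≠ 0)
    (h1 : S.t₁.Ray ρ T0 ε γ1 T1) (h2 : S.t₂.Ray ρ T0 ε γ2 T2)
    (hw : S.Ball ρ (S.W β ε 1 1 (-μ)) K w) (m : ℝ) :
    DifferentiableAt ℂ (fun T : ℂ × ℂ => lap2 S.t₁.k S.t₂.k γ1 γ2 (fun x y => w x y m) T.1 T.2) (T1, T2) := by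
  obtain ⟨κ1, hν1, hκ1⟩ := exists_between h1.rate
  obtain ⟨κ2, hν2, hκ2⟩ := exists_between h2.rate
  exact (lapInt2_of_bd hk1 hk2 hε h1.mem h2.mem hw hν1 hν2 m).differentiableAt_lap2
    (hw.meas.comp (c := fun _ => m)) (ne_zero_of_mem_sector h1.sec) (ne_zero_of_mem_sector h2.sec) hκ1 hκ2

/-- Rotation of the half-line in the first variable. -/
lemma lap2_rotate {t₁ t₂ : TimeData} {f : ℂ → ℂ → ℂ} {C : ℝ} {e2 : ℂ → ℝ}
    (hk1 : 1 ≤ t₁.k) (hε : ε ≠ 0) (hC : 0 ≤ C) (he2 : ∀ y, 0 ≤ e2 y)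
    (hγ : ∀ γ ∈ [[γ1, γ1']], |γ - t₁.dir| < t₁.a ∧ c1 ≤ rate t₁.k γ T1) (hc1 : t₁.ν / ‖ε‖ ^ t₁.k < c1)
    (hγ2 : |γ2 - t₂.dir| < t₂.a)
    (hf : ∀ y ∈ t₂.S, DifferentiableOn ℂ (fun x => f x y) t₁.S)
    (hb : ∀ x ∈ t₁.S, ∀ y ∈ t₂.S, ‖f x y‖ ≤ C * t₁.wt 1 (x / ε) * e2 y)
    (h : Integrable (fun p : ℝ × ℝ => f (ray γ1 p.1) (ray γ2 p.2) *
      (ker t₁.k γ1 T1 p.1 * ker t₂.k γ2 T2 p.2)) ((lam t₁.k).prod (lam t₂.k)))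
    (h' : Integrable (fun p : ℝ × ℝ => f (ray γ1' p.1) (ray γ2 p.2) *
      (ker t₁.k γ1' T1 p.1 * ker t₂.k γ2 T2 p.2)) ((lam t₁.k).prod (lam t₂.k))) :
    lap2 t₁.k t₂.k γ1 γ2 f T1 T2 = lap2 t₁.k t₂.k γ1' γ2 f T1 T2 := by
  rw [lap2, lap2, integral_prod_symm _ h, integral_prod_symm _ h']
  refine integral_congr_ae ((ae_lam t₂.k).mono fun r2 hr2 => ?_)
  have hy := TimeData.ray_mem hγ2 hr2
  have h0 := norm_pos_iff.2 hε
  have e := integral_ker_rotate (k := t₁.k) hk1 le_rfl (f := fun x => f x (ray γ2 r2)) (γ0 := γ1) (γ1 := γ1')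
    (C := C * ‖ε‖⁻¹ * e2 (ray γ2 r2)) (T := T1) (mul_nonneg pos! (he2 _)) hc1
    (fun γ hγ' => (hγ γ hγ').2)
    ((hf _ hy).comp Complex.differentiable_exp.differentiableOn fun z hz => ?_) fun γ hγ' r hr => ?_
  · beta_reduce
    simp only [← mul_assoc, integral_mul_const]
    rw [e]
  · have := TimeData.ray_mem (hγ _ hz).1 (exp_pos z.re)
    rwa [← exp_add_mul_I, Complex.re_add_im] at this
  · refine (hb _ (TimeData.ray_mem (hγ γ hγ').1 hr) _ hy).trans ?_
    have h1 := t₁.wt_le (ray γ r / ε)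
    rw [norm_div, norm_ray γ hr.le, div_pow, pow_one] at *
    have e3 : t₁.ν * (r ^ t₁.k / ‖ε‖ ^ t₁.k) = t₁.ν / ‖ε‖ ^ t₁.k * r ^ t₁.k := by ring
    rw [e3] at h1
    refine (mul_le_r (mul_le_l h1 hC) (he2 _)).trans_eq ?_
    ring

lemma isLaplace_lap2 (hk1 : 1 ≤ S.t₁.k) (hk2 : 1 ≤ S.t₂.k) (hε : ε ≠ 0)
    (h1 : S.t₁.Ray ρ T0 ε γ1 T1) (h2 : S.t₂.Ray ρ T0 ε γ2 T2)
    (hw : S.Ball ρ (S.W β ε 1 1 (-μ)) K w) (m : ℝ) :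
    IsLaplace S.t₁.k S.t₂.k γ1 γ2 (fun x y => w x y m) T1 T2
      (lap2 S.t₁.k S.t₂.k γ1 γ2 (fun x y => w x y m) T1 T2) := by
  have hi := lapInt2_of_bd hk1 hk2 hε h1.mem h2.mem hw h1.rate h2.rate m
  have hm : Measurable fun p : ℂ × ℂ => w p.1 p.2 m :=
    hw.meas.comp (c := fun _ => m)
  have hI := hi.ker (T1 := T1) (T2 := T2) hm le_rfl le_rfl
  have e : ∀ r1 r2 : ℝ, laplaceIntegrand S.t₁.k S.t₂.k γ1 γ2 (fun x y => w x y m) T1 T2 r1 r2 =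
      w (ray γ1 r1) (ray γ2 r2) m * (ker S.t₁.k γ1 T1 r1 * ker S.t₂.k γ2 T2 r2) / r2 / r1 := fun r1 r2 => by
    rw [laplaceIntegrand, ker, ker, ← Complex.exp_add, sub_eq_add_neg]
  constructor
  · have g1 := (integrable_lam_iff hk1).1 (integrable_wt_ker S.t₁ hk1 hε h1.rate)
    have g2 := (integrable_lam_iff hk2).1 (integrable_wt_ker S.t₂ hk2 hε h2.rate)
    have m1 := (continuous_ray γ1).measurable
    have m2 := (continuous_ray γ2).measurable
    have m3 := measurable_ker S.t₁.k γ1 T1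
    have m4 := measurable_ker S.t₂.k γ2 T2
    have m5 := hm.comp (f := fun p : ℝ × ℝ => (ray γ1 p.1, ray γ2 p.2)) fp!
    rw [IntegrableOn, Measure.volume_eq_prod, ← Measure.prod_restrict]
    refine ((g1.mul_prod g2).const_mul (K * fw β (-μ) m)).mono' (Measurable.aestronglyMeasurable ?_) ?_
    · simp only [e]
      exact (Measurable.mul m5 fp!).div fp! |>.div fp!
    · filter_upwards [quasiMeasurePreserving_fst.ae (ae_restrict_mem measurableSet_Ioi),
        quasiMeasurePreserving_snd.ae (ae_restrict_mem measurableSet_Ioi)] with p p1 p2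
      have p1 : 0 < p.1 := p1
      have p2 : 0 < p.2 := p2
      rw [e, norm_div, norm_div, norm_mul, norm_mul, norm_real, norm_real,
        norm_of_nonneg p1.le, norm_of_nonneg p2.le]
      have := hw.bd _ (h1.mem _ p1) _ (h2.mem _ p2) m
      refine (div_le_r (div_le_r
        (mul_le_r this) p2.le) p1.le).trans_eq ?_
      unfold W
      simp only [smul_eq_mul]
      ring
  · rw [lap2, integral_prod _ hI, integral_lam, mul_assoc]
    congr 1
    rw [← integral_const_mul (S.t₂.k : ℂ)]
    refine integral_congr_ae (.of_forall fun r1 => ?_)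
    beta_reduce
    rw [integral_lam, mul_div_assoc, ← integral_div]
    simp only [e]

end

/-! ### The solution of the singular equation -/

/-- `γ(T)` is, for `T` in the bounded sector, a direction along which the Laplace integrals at `T`
converge; the directions between `γ(T)` and `γ(z)` have this property for all `z` near `T`. -/
structure TimeData.Directions (t : TimeData) (ρ T0 θ h δ : ℝ) (ε : ℂ) (γ : ℂ → ℝ) : Prop where
  pos : 0 < δ
  near : ∀ T ∈ bddSector t.dir θ (h * ‖ε‖), ∀ᶠ z in 𝓝 T, z ∈ bddSector t.dir θ (h * ‖ε‖) ∧
    t.Ray ρ T0 ε (γ T) z ∧ t.Ray ρ T0 ε (γ z) z ∧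
    (∀ γ' ∈ [[γ T, γ z]], |γ' - t.dir| < t.a ∧ δ / ‖z‖ ^ t.k ≤ rate t.k γ' z) ∧
    δ / 2 / ‖z‖ ^ t.k ≤ δ / ‖z‖ ^ t.k - t.ν / ‖ε‖ ^ t.k ∧ t.ν / ‖ε‖ ^ t.k < δ / ‖z‖ ^ t.k

lemma TimeData.Admissible.exists_directions (ht : t.Admissible)
    (hroots : t.RootsApart ρ) (h1 : π / t.k < θ) (h2 : θ < π / t.k + 2 * t.a) (hT0 : 0 < T0) (hε0 : 0 < ε0) :
    ∃ (γ : ℂ → ℝ) (δ h0 : ℝ), 0 < δ ∧ δ ≤ 1 ∧ 0 < h0 ∧ h0 * ε0 ≤ T0 / 2 ∧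
      (∀ T ∈ sector t.dir (θ / 2), |γ T - t.dir| < t.a ∧ δ ≤ cos (t.k * (γ T - T.arg))) ∧
      ∀ h, 0 < h → h ≤ h0 → ∀ ε ∈ puncturedDisc ε0, t.Directions ρ T0 θ h δ ε γ := by
  obtain ⟨γ, δ, hδ, hδ1, hγ⟩ := ht.exists_direction hroots h1 h2
  have hν := ht.ν_pos
  have hk := ht.one_le_k
  refine ⟨γ, δ, min 1 (min (δ / (2 * (t.ν + 1))) (T0 * δ / (2 * ε0))), hδ, hδ1, by positivity, ?_,
    fun T hT => ⟨(hγ T hT).1, (hγ T hT).2.2.1⟩, fun h hh hle ε hε => ⟨hδ, fun T hT => ?_⟩⟩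
  · refine (mul_le_r ((min_le_right _ _).trans (min_le_right _ _)) hε0.le).trans ?_
    rw [show T0 * δ / (2 * ε0) * ε0 = T0 / 2 * δ by field_simp]
    exact mul_le_of_le_one_right pos! hδ1
  have u0 : 0 < ‖ε‖ := norm_pos_iff.2 hε.2
  have hεε : ‖ε‖ < ε0 := mem_ball_zero_iff.1 hε.1
  have l1 : h ≤ 1 := hle.trans (min_le_left _ _)
  have l2 : h * (2 * (t.ν + 1)) ≤ δ :=
    (le_div_iff₀ pos!).1 (hle.trans ((min_le_right _ _).trans (min_le_left _ _)))
  have l3 : h * (2 * ε0) ≤ T0 * δ :=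
    (le_div_iff₀ pos!).1 (hle.trans ((min_le_right _ _).trans (min_le_right _ _)))
  -- the rate dominates the growth of the functions, for `|z| < h |ε|`
  have key : ∀ z : ℂ, z ≠ 0 → ‖z‖ < h * ‖ε‖ → t.ν / ‖ε‖ ^ t.k ≤ δ / 2 / ‖z‖ ^ t.k ∧
      (1 / T0) ^ t.k < δ / ‖z‖ ^ t.k := fun z hz0 hz => by
    have hz0 := norm_pos_iff.2 hz0
    constructor
    · rw [div_le_div_iff₀ pos! pos!]
      calc t.ν * ‖z‖ ^ t.k ≤ t.ν * (h * ‖ε‖) ^ t.k :=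
            mul_le_l (pow_le_pow_left₀ hz0.le hz.le _) hν.le
        _ = t.ν * h ^ t.k * ‖ε‖ ^ t.k := by rw [mul_pow]; ring
        _ ≤ t.ν * h * ‖ε‖ ^ t.k := mul_le_r (mul_le_l
            (pow_le_of_le_one hh.le l1 (by omega)) hν.le)
        _ ≤ δ / 2 * ‖ε‖ ^ t.k := mul_le_r (by linarith)
    · rw [one_div, inv_pow, inv_eq_one_div, div_lt_div_iff₀ pos! pos!, one_mul]
      have : ‖z‖ < T0 * δ := by
        refine hz.trans_le (le_trans ?_ l3)
        exact mul_le_l (by linarith) hh.le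
      calc ‖z‖ ^ t.k < (T0 * δ) ^ t.k := pow_lt_pow_left₀ this hz0.le (by omega)
        _ = δ ^ t.k * T0 ^ t.k := by rw [mul_pow]; ring
        _ ≤ δ * T0 ^ t.k := mul_le_r
            (pow_le_of_le_one hδ.le hδ1 (by omega))
  have ray : ∀ z : ℂ, z ≠ 0 → ‖z‖ < h * ‖ε‖ → ∀ γ' : ℝ, |γ' - t.dir| < t.a → z ∈ sector γ' (π / (2 * t.k)) →
      δ / ‖z‖ ^ t.k ≤ rate t.k γ' z → t.Ray ρ T0 ε γ' z := fun z hz0 hz γ' ha hs hr => by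
    have hz1 := norm_pos_iff.2 hz0
    refine ⟨fun r hr => TimeData.ray_mem_closedDom ha ρ hr, hs, lt_of_lt_of_le ?_ hr, (key z hz0 hz).2.trans_le hr⟩
    exact (key z hz0 hz).1.trans_lt (div_lt_div_of_pos_right (by linarith) pos!)
  filter_upwards [(hγ T hT.1).2.2.2, (isOpen_sector _ _).eventually_mem hT.1,
    isOpen_ball.eventually_mem hT.2, (isOpen_sector _ _).eventually_mem (hγ T hT.1).2.1]
    with z u1 u2 h3 h4
  have hz0 := ne_zero_of_mem_sector u2
  have hz1 := norm_pos_iff.2 hz0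
  have h3' := mem_ball_zero_iff.1 h3
  obtain ⟨k1, k2⟩ := key z hz0 h3'
  have hTz := u1 _ left_mem_uIcc
  have hzz := u1 _ right_mem_uIcc
  refine ⟨⟨u2, h3⟩, ray z hz0 h3' _ hTz.1 h4 hTz.2, ray z hz0 h3' _ hzz.1 (hγ z u2).2.1 hzz.2, u1, ?_,
    k1.trans_lt (div_lt_div_of_pos_right (by linarith) pos!)⟩
  rw [show δ / ‖z‖ ^ t.k = δ / 2 / ‖z‖ ^ t.k + δ / 2 / ‖z‖ ^ t.k by ring]
  linarith

/-- The properties of the solution of the convolution equation, for fixed `ε`, which enter in the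
study of its Laplace transform. -/
structure CauchyData.BorelReg (S : CauchyData) (ρ β μ K : ℝ) (ε : ℂ) (w : 𝔽) : Prop where
  ball : S.Ball ρ (S.W β ε 1 1 (-μ)) K w
  cont : ∀ x ∈ S.t₁.closedDom ρ, ∀ y ∈ S.t₂.closedDom ρ, Continuous (w x y)
  holo : ∀ m, DifferentiableOn ℂ (fun p : ℂ × ℂ => w p.1 p.2 m) (S.t₁.openDom ρ ×ˢ S.t₂.openDom ρ)

/-- The Laplace transform of `w` along the half-lines with directions `γ1(T1)`, `γ2(T2)`, extended by
`0` to the points with `T1 = 0` or `T2 = 0`. -/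
def CauchyData.laplaceSol (S : CauchyData) (γ1 γ2 : ℂ → ℝ) (w : 𝔽)
    (T1 T2 : ℂ) (m : ℝ) : ℂ :=
  if T1 = 0 ∨ T2 = 0 then 0 else lap2 S.t₁.k S.t₂.k (γ1 T1) (γ2 T2) (fun x y => w x y m) T1 T2

section
variable {h δ1 δ2 : ℝ} {γ1 γ2 : ℂ → ℝ}

lemma laplaceSol_eq (h1 : T1 ≠ 0) (h2 : T2 ≠ 0) (m : ℝ) : S.laplaceSol γ1 γ2 w T1 T2 m =
    lap2 S.t₁.k S.t₂.k (γ1 T1) (γ2 T2) (fun x y => w x y m) T1 T2 :=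
  if_neg (not_or.2 ⟨h1, h2⟩)

lemma CauchyData.BorelReg.integrable (hw : S.BorelReg ρ β μ K ε w) (hS : S.Setup ρ β μ r) (hε : ε ≠ 0)
    {γ' : ℝ} (h1 : S.t₁.Ray ρ T0 ε γ T1) (h2 : S.t₂.Ray ρ T0 ε γ' T2) (m : ℝ) :
    Integrable (fun p : ℝ × ℝ => w (ray γ p.1) (ray γ' p.2) m *
      (ker S.t₁.k γ T1 p.1 * ker S.t₂.k γ' T2 p.2)) ((lam S.t₁.k).prod (lam S.t₂.k)) :=
  (lapInt2_of_bd hS.time₁.one_le_k hS.time₂.one_le_k hε h1.mem h2.mem hw.ball h1.rate h2.rate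
    m).ker (hw.ball.meas.comp (c := fun _ => m)) le_rfl le_rfl

/-- Near `(T1, T2)`, the half-lines for `(T1, T2)` can be used for all points. -/
lemma laplaceSol_eventuallyEq (hS : S.Setup ρ β μ r) (hε : ε ≠ 0)
    (hd1 : S.t₁.Directions ρ T0 θ1 h δ1 ε γ1) (hd2 : S.t₂.Directions ρ T0 θ2 h δ2 ε γ2)
    (hw : S.BorelReg ρ β μ K ε w) (hT1 : T1 ∈ bddSector S.t₁.dir θ1 (h * ‖ε‖))
    (hT2 : T2 ∈ bddSector S.t₂.dir θ2 (h * ‖ε‖)) (m : ℝ) :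
    ∀ᶠ z in 𝓝 (T1, T2), S.laplaceSol γ1 γ2 w z.1 z.2 m =
      lap2 S.t₁.k S.t₂.k (γ1 T1) (γ2 T2) (fun x y => w x y m) z.1 z.2 := by
  have hK := hw.ball.nonneg
  have hfw := (fw_pos β (-μ) m).le
  refine ((hd1.near T1 hT1).prod_nhds (hd2.near T2 hT2)).mono ?_
  rintro ⟨z1, z2⟩ ⟨⟨-, a1, b1, c1, -, e1⟩, -, a2, b2, c2, -, e2⟩
  dsimp only at *
  rw [laplaceSol_eq (ne_zero_of_mem_sector a1.sec) (ne_zero_of_mem_sector a2.sec)]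
  have R1 := lap2_rotate (t₁ := S.t₁) (t₂ := S.t₂) (T1 := z1) (T2 := z2) (γ1 := γ1 T1) (γ1' := γ1 z1)
    (γ2 := γ2 z2) (f := fun x y => w x y m) (C := K * fw β (-μ) m) (e2 := fun y => S.t₂.wt 1 (y / ε))
    hS.time₁.one_le_k hε pos! (fun y => S.t₂.wt_nonneg _ _) c1 e1 (c2 _ right_mem_uIcc).1
    (fun y hy => (hw.holo m).comp (f := fun x : ℂ => (x, y)) fp! fun x hx => ⟨Or.inr hx, Or.inr hy⟩)
    (fun x hx y hy => (hw.ball.bd x (Or.inr hx) y (Or.inr hy) m).trans_eq (by unfold W; ring))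
    (hw.integrable hS hε a1 b2 m) (hw.integrable hS hε b1 b2 m)
  have R2 := lap2_rotate (t₁ := S.t₂) (t₂ := S.t₁) (T1 := z2) (T2 := z1) (γ1 := γ2 T2) (γ1' := γ2 z2)
    (γ2 := γ1 T1) (f := fun y x => w x y m) (C := K * fw β (-μ) m) (e2 := fun x => S.t₁.wt 1 (x / ε))
    hS.time₂.one_le_k hε pos! (fun y => S.t₁.wt_nonneg _ _) c2 e2 (c1 _ left_mem_uIcc).1
    (fun x hx => (hw.holo m).comp (f := fun y : ℂ => (x, y)) fp! fun y hy => ⟨Or.inr hx, Or.inr hy⟩)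
    (fun y hy x hx => (hw.ball.bd x (Or.inr hx) y (Or.inr hy) m).trans_eq (by unfold W; ring))
    ((hw.integrable hS hε a1 a2 m).swap.congr (.of_forall fun p => by
      simp only [comp_apply, Prod.swap]; ring))
    ((hw.integrable hS hε a1 b2 m).swap.congr (.of_forall fun p => by
      simp only [comp_apply, Prod.swap]; ring))
  rw [← R1, lap2_swap, lap2_swap S.t₁.k S.t₂.k (γ1 T1) (γ2 T2)]
  exact R2.symm

lemma exists_norm_laplaceSol_le (hS : S.Setup ρ β μ r) (hε : ε ≠ 0)
    (hd1 : S.t₁.Directions ρ T0 θ1 h δ1 ε γ1) (hd2 : S.t₂.Directions ρ T0 θ2 h δ2 ε γ2)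
    (hw : S.BorelReg ρ β μ K ε w) :
    ∃ B : ℝ, 0 ≤ B ∧ ∀ T1 ∈ insert 0 (bddSector S.t₁.dir θ1 (h * ‖ε‖)),
      ∀ T2 ∈ insert 0 (bddSector S.t₂.dir θ2 (h * ‖ε‖)), ∀ m,
        ‖S.laplaceSol γ1 γ2 w T1 T2 m‖ ≤ B * fw β (-μ) m * (‖T1‖ * ‖T2‖) := by
  have hK := hw.ball.nonneg
  have hk1 := hS.time₁.one_le_k
  have hk2 := hS.time₂.one_le_k
  have h1 := hd1.pos
  have h2 := hd2.pos
  have hk10 : (0 : ℝ) < S.t₁.k := mod_cast hk1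
  have hk20 : (0 : ℝ) < S.t₂.k := mod_cast hk2
  have g1 : 0 < Gamma (1 / S.t₁.k) := Gamma_pos_of_pos pos!
  have g2 : 0 < Gamma (1 / S.t₂.k) := Gamma_pos_of_pos pos!
  have hB : 0 ≤ K * ((‖ε‖⁻¹ * ((δ1 / 2) ^ (-(1 : ℝ) / S.t₁.k) * Gamma (1 / S.t₁.k))) *
    (‖ε‖⁻¹ * ((δ2 / 2) ^ (-(1 : ℝ) / S.t₂.k) * Gamma (1 / S.t₂.k)))) := by positivity
  refine ⟨_, hB, fun T1 hT1 T2 hT2 m => ?_⟩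
  have hfw := (fw_pos β (-μ) m).le
  by_cases h0 : T1 = 0 ∨ T2 = 0
  · rw [CauchyData.laplaceSol, if_pos h0, norm_zero]
    positivity
  obtain ⟨h01, h02⟩ := not_or.1 h0
  obtain ⟨-, -, b1, c1, d1, -⟩ := (hd1.near T1 (hT1.resolve_left h01)).self_of_nhds
  obtain ⟨-, -, b2, c2, d2, -⟩ := (hd2.near T2 (hT2.resolve_left h02)).self_of_nhds
  rw [laplaceSol_eq h01 h02]
  refine (norm_lap2_le hk1 hk2 hε b1 b2 (half_pos h1) (half_pos h2)
    (d1.trans (sub_le_sub_right (c1 _ left_mem_uIcc).2 _))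
    (d2.trans (sub_le_sub_right (c2 _ left_mem_uIcc).2 _)) hw.ball m).trans_eq ?_
  ring

lemma differentiableAt_laplaceSol (hS : S.Setup ρ β μ r) (hε : ε ≠ 0)
    (hd1 : S.t₁.Directions ρ T0 θ1 h δ1 ε γ1) (hd2 : S.t₂.Directions ρ T0 θ2 h δ2 ε γ2)
    (hw : S.BorelReg ρ β μ K ε w) (hT1 : T1 ∈ bddSector S.t₁.dir θ1 (h * ‖ε‖))
    (hT2 : T2 ∈ bddSector S.t₂.dir θ2 (h * ‖ε‖)) (m : ℝ) :
    DifferentiableAt ℂ (fun T : ℂ × ℂ => S.laplaceSol γ1 γ2 w T.1 T.2 m) (T1, T2) := by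
  obtain ⟨-, a1, -⟩ := (hd1.near T1 hT1).self_of_nhds
  obtain ⟨-, a2, -⟩ := (hd2.near T2 hT2).self_of_nhds
  refine (differentiableAt_lap2 hS.time₁.one_le_k hS.time₂.one_le_k hε a1 a2 hw.ball
    m).congr_of_eventuallyEq (laplaceSol_eventuallyEq hS hε hd1 hd2 hw hT1 hT2 m)

lemma continuousOn_laplaceSol (hS : S.Setup ρ β μ r) (hε : ε ≠ 0)
    (hd1 : S.t₁.Directions ρ T0 θ1 h δ1 ε γ1) (hd2 : S.t₂.Directions ρ T0 θ2 h δ2 ε γ2)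
    (hw : S.BorelReg ρ β μ K ε w) (m : ℝ) :
    ContinuousOn (fun T : ℂ × ℂ => S.laplaceSol γ1 γ2 w T.1 T.2 m)
      (insert 0 (bddSector S.t₁.dir θ1 (h * ‖ε‖)) ×ˢ insert 0 (bddSector S.t₂.dir θ2 (h * ‖ε‖))) := by
  obtain ⟨B, hB, hb⟩ := exists_norm_laplaceSol_le hS hε hd1 hd2 hw
  rintro ⟨T1, T2⟩ ⟨hT1, hT2⟩
  by_cases h0 : T1 = 0 ∨ T2 = 0
  · rw [ContinuousWithinAt, CauchyData.laplaceSol, if_pos h0]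
    have ht : Tendsto (fun T : ℂ × ℂ => B * fw β (-μ) m * (‖T.1‖ * ‖T.2‖))
        (𝓝[insert 0 (bddSector S.t₁.dir θ1 (h * ‖ε‖)) ×ˢ insert 0 (bddSector S.t₂.dir θ2 (h * ‖ε‖))]
          (T1, T2)) (𝓝 0) := by
      have hc : Continuous fun T : ℂ × ℂ => B * fw β (-μ) m * (‖T.1‖ * ‖T.2‖) := by fun_prop
      have := (hc.tendsto (T1, T2)).mono_left (nhdsWithin_le_nhds (s := insert 0
        (bddSector S.t₁.dir θ1 (h * ‖ε‖)) ×ˢ insert 0 (bddSector S.t₂.dir θ2 (h * ‖ε‖))))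
      rcases h0 with h0 | h0 <;> simpa [h0] using this
    exact squeeze_zero_norm' (eventually_mem_nhdsWithin.mono fun T hT => hb _ hT.1 _ hT.2 m) ht
  · obtain ⟨h01, h02⟩ := not_or.1 h0
    exact (differentiableAt_laplaceSol hS hε hd1 hd2 hw (hT1.resolve_left h01) (hT2.resolve_left h02)
      m).continuousAt.continuousWithinAt

lemma memE_laplaceSol (hS : S.Setup ρ β μ r) (hε : ε ≠ 0) (hβ : 0 ≤ β) (hμ : 0 ≤ μ)
    (hd1 : S.t₁.Directions ρ T0 θ1 h δ1 ε γ1) (hd2 : S.t₂.Directions ρ T0 θ2 h δ2 ε γ2)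
    (hw : S.BorelReg ρ β μ K ε w) (hT1 : T1 ∈ bddSector S.t₁.dir θ1 (h * ‖ε‖))
    (hT2 : T2 ∈ bddSector S.t₂.dir θ2 (h * ‖ε‖)) {β' : ℝ} (hβ' : β' ≤ β) :
    MemE β' μ (S.laplaceSol γ1 γ2 w T1 T2) := by
  obtain ⟨B, hB, hb⟩ := exists_norm_laplaceSol_le hS hε hd1 hd2 hw
  obtain ⟨-, a1, -⟩ := (hd1.near T1 hT1).self_of_nhds
  obtain ⟨-, a2, -⟩ := (hd2.near T2 hT2).self_of_nhds
  constructor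
  · rw [funext fun m => laplaceSol_eq (S := S) (γ1 := γ1) (γ2 := γ2) (w := w)
      (ne_zero_of_mem_sector a1.sec) (ne_zero_of_mem_sector a2.sec) m]
    exact continuous_lap2 hS.time₁.one_le_k hS.time₂.one_le_k hε hβ hμ a1 a2 hw.ball hw.cont
  · refine ⟨B * (‖T1‖ * ‖T2‖), ?_⟩
    rintro _ ⟨m, rfl⟩
    have h1 : exp (β' * |m|) ≤ exp (β * |m|) :=
      exp_le_exp.2 (mul_le_r hβ' (abs_nonneg m))
    have h2 : 0 ≤ (1 + |m|) ^ μ := by positivity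
    calc _ ≤ (1 + |m|) ^ μ * exp (β * |m|) * (B * fw β (-μ) m * (‖T1‖ * ‖T2‖)) :=
          mul_le_mul (mul_le_l h1 h2) (hb _ (Or.inr hT1) _ (Or.inr hT2) m)
            (norm_nonneg _) pos!
      _ = ((1 + |m|) ^ μ * exp (β * |m|) * fw β (-μ) m) * (B * (‖T1‖ * ‖T2‖)) := by ring
      _ = _ := by rw [weight_mul_fw, one_mul]

end

lemma CauchyData.Bd.norm_le
    (hw : S.Bd ρ (S.W β ε 1 1 (-μ)) K w) (h1 : τ1 ∈ S.t₁.closedDom ρ)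
    (h2 : τ2 ∈ S.t₂.closedDom ρ) (m : ℝ) : ‖w τ1 τ2 m‖ ≤ K * (1 + |m|) ^ (-μ) * exp (-β * |m|)
      * (‖τ1 / ε‖ / (1 + ‖τ1 / ε‖ ^ (2 * S.t₁.k))) * (‖τ2 / ε‖ / (1 + ‖τ2 / ε‖ ^ (2 * S.t₂.k)))
      * exp (S.t₁.ν * ‖τ1 / ε‖ ^ S.t₁.k + S.t₂.ν * ‖τ2 / ε‖ ^ S.t₂.k) := by
  refine (hw τ1 h1 τ2 h2 m).trans_eq ?_
  rw [CauchyData.W, TimeData.wt, TimeData.wt, fw, rpow_one, rpow_one, exp_add, neg_mul]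
  ring

end

end TwoTime

theorem proposition12 (S : TwoTime.CauchyData) (ρ β μ r : ℝ)
    (hρ : 0 < ρ) (hβ : 0 < β) (hr : 0 < r) (hS : S.Admissible r μ)
    (hroots₁ : S.t₁.RootsApart ρ) (hroots₂ : S.t₂.RootsApart ρ) :
    ∃ εs ϖ ζ₁ ζ₂ ζ₁₁ ζ₁₂ ζ₀₀ : ℝ,
      0 < εs ∧ εs ≤ r ∧ 0 < ϖ ∧ 0 < ζ₁ ∧ 0 < ζ₂ ∧ 0 < ζ₁₁ ∧ 0 < ζ₁₂ ∧ 0 < ζ₀₀ ∧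
      -- the smallness conditions hold as soon as `ε₀` is small enough
      (∀ K₀ T₀ : ℝ, 0 < K₀ → 0 < T₀ → ∃ ε₁ : ℝ, 0 < ε₁ ∧
        ∀ (ε₀ : ℝ) (C F : TwoTime.Family), 0 < ε₀ → ε₀ ≤ ε₁ →
          TwoTime.FamilyBound β μ K₀ T₀ ε₀ 0 C → TwoTime.FamilyBound β μ K₀ T₀ ε₀ 1 F →
          S.SmallBorel ρ β μ ε₀ ζ₁ ζ₂ ζ₁₁ ζ₁₂ C F) ∧
      -- under the smallness conditions, existence and properties of `ω` and `U`
      (∀ (ε₀ K₀ T₀ : ℝ) (C F : TwoTime.Family), 0 < ε₀ → ε₀ ≤ εs → 0 < K₀ → 0 < T₀ →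
        TwoTime.FamilyBound β μ K₀ T₀ ε₀ 0 C → TwoTime.FamilyBound β μ K₀ T₀ ε₀ 1 F →
        S.SmallBorel ρ β μ ε₀ ζ₁ ζ₂ ζ₁₁ ζ₁₂ C F →
        (∀ ε ∈ TwoTime.puncturedDisc ε₀, TwoTime.normE β μ (fun m => C 0 0 m ε) ≤ ζ₀₀) →
        ∃ ω : ℂ → ℂ → ℝ → ℂ → ℂ,
          -- `ω` is the unique solution of the convolution equation in the ball of radius `ϖ`
          (∀ ε ∈ TwoTime.puncturedDisc ε₀,
            S.BorelSol ρ β μ ϖ C F ε (fun τ₁ τ₂ m => ω τ₁ τ₂ m ε) ∧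
            ∀ w : ℂ → ℂ → ℝ → ℂ, S.BorelSol ρ β μ ϖ C F ε w →
              ∀ τ₁ ∈ S.t₁.closedDom ρ, ∀ τ₂ ∈ S.t₂.closedDom ρ, ∀ m : ℝ,
                w τ₁ τ₂ m = ω τ₁ τ₂ m ε) ∧
          -- regularity of `ω`
          ContinuousOn (fun p : ℂ × ℂ × ℝ × ℂ => ω p.1 p.2.1 p.2.2.1 p.2.2.2)
            (S.t₁.closedDom ρ ×ˢ S.t₂.closedDom ρ ×ˢ Set.univ ×ˢ TwoTime.puncturedDisc ε₀) ∧
          (∀ m : ℝ, DifferentiableOn ℂ (fun p : ℂ × ℂ × ℂ => ω p.1 p.2.1 m p.2.2)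
            (S.t₁.openDom ρ ×ˢ S.t₂.openDom ρ ×ˢ TwoTime.puncturedDisc ε₀)) ∧
          -- growth of `ω`
          (∀ ε ∈ TwoTime.puncturedDisc ε₀, ∀ τ₁ ∈ S.t₁.closedDom ρ, ∀ τ₂ ∈ S.t₂.closedDom ρ,
            ∀ m : ℝ, ‖ω τ₁ τ₂ m ε‖ ≤
              ϖ * (1 + |m|) ^ (-μ) * Real.exp (-β * |m|)
                * (‖τ₁ / ε‖ / (1 + ‖τ₁ / ε‖ ^ (2 * S.t₁.k)))
                * (‖τ₂ / ε‖ / (1 + ‖τ₂ / ε‖ ^ (2 * S.t₂.k)))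
                * Real.exp (S.t₁.ν * ‖τ₁ / ε‖ ^ S.t₁.k + S.t₂.ν * ‖τ₂ / ε‖ ^ S.t₂.k)) ∧
          -- the solution `U` on the bounded sectors
          (∀ θ₁ θ₂ : ℝ,
            Real.pi / S.t₁.k < θ₁ → θ₁ < Real.pi / S.t₁.k + 2 * S.t₁.a →
            Real.pi / S.t₂.k < θ₂ → θ₂ < Real.pi / S.t₂.k + 2 * S.t₂.a →
            ∃ (h δ₁ : ℝ) (U : ℂ → ℂ → ℝ → ℂ → ℂ), 0 < h ∧ h * ε₀ ≤ T₀ / 2 ∧ 0 < δ₁ ∧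
              ∀ ε ∈ TwoTime.puncturedDisc ε₀,
                -- `U` solves the singular equation
                (∀ T₁ ∈ TwoTime.bddSector S.t₁.dir θ₁ (h * ‖ε‖),
                  ∀ T₂ ∈ TwoTime.bddSector S.t₂.dir θ₂ (h * ‖ε‖), ∀ m : ℝ,
                  S.SolvesAt C F ε (fun z₁ z₂ m' => U z₁ z₂ m' ε) T₁ T₂ m) ∧
                -- null initial data
                (∀ m : ℝ,
                  ContinuousOn (fun T : ℂ × ℂ => U T.1 T.2 m ε)
                    (insert 0 (TwoTime.bddSector S.t₁.dir θ₁ (h * ‖ε‖)) ×ˢ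
                      insert 0 (TwoTime.bddSector S.t₂.dir θ₂ (h * ‖ε‖))) ∧
                  (∀ T₁ ∈ insert 0 (TwoTime.bddSector S.t₁.dir θ₁ (h * ‖ε‖)), U T₁ 0 m ε = 0) ∧
                  (∀ T₂ ∈ insert 0 (TwoTime.bddSector S.t₂.dir θ₂ (h * ‖ε‖)), U 0 T₂ m ε = 0)) ∧
                -- `U` is in `E_(β', μ)` in `m`
                (∀ β' : ℝ, 0 < β' → β' < β →
                  ∀ T₁ ∈ TwoTime.bddSector S.t₁.dir θ₁ (h * ‖ε‖),
                  ∀ T₂ ∈ TwoTime.bddSector S.t₂.dir θ₂ (h * ‖ε‖),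
                  TwoTime.MemE β' μ (fun m => U T₁ T₂ m ε)) ∧
                -- `U` is holomorphic and bounded in `(T₁, T₂)`
                (∀ m : ℝ,
                  DifferentiableOn ℂ (fun T : ℂ × ℂ => U T.1 T.2 m ε)
                    (TwoTime.bddSector S.t₁.dir θ₁ (h * ‖ε‖) ×ˢ
                      TwoTime.bddSector S.t₂.dir θ₂ (h * ‖ε‖)) ∧
                  ∃ M : ℝ, ∀ T₁ ∈ TwoTime.bddSector S.t₁.dir θ₁ (h * ‖ε‖),
                    ∀ T₂ ∈ TwoTime.bddSector S.t₂.dir θ₂ (h * ‖ε‖), ‖U T₁ T₂ m ε‖ ≤ M) ∧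
                -- `U` is the iterated Laplace transform of `ω`
                (∀ T₁ ∈ TwoTime.bddSector S.t₁.dir θ₁ (h * ‖ε‖),
                  ∀ T₂ ∈ TwoTime.bddSector S.t₂.dir θ₂ (h * ‖ε‖),
                  ∃ γ₁ γ₂ : ℝ, |γ₁ - S.t₁.dir| < S.t₁.a ∧ |γ₂ - S.t₂.dir| < S.t₂.a ∧
                    δ₁ ≤ Real.cos (S.t₁.k * (γ₁ - T₁.arg)) ∧
                    δ₁ ≤ Real.cos (S.t₂.k * (γ₂ - T₂.arg)) ∧
                    ∀ m : ℝ, TwoTime.IsLaplace S.t₁.k S.t₂.k γ₁ γ₂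
                      (fun u₁ u₂ => ω u₁ u₂ m ε) T₁ T₂ (U T₁ T₂ m ε)))) := by
  open TwoTime CauchyData in
  have hH : S.Setup ρ β μ r := ⟨hS, hρ, hβ, hr, hroots₁, hroots₂⟩
  have hμ : 0 ≤ μ := zero_le_one.trans (hS.one_lt_μ hr).le
  obtain ⟨εs, ϖ, ζ, hεs, hεr, hϖ, hζ, hcon⟩ := S.exists_contraction hH
  refine ⟨εs, ϖ, ζ, ζ, ζ, ζ, ζ, hεs, hεr, hϖ, hζ, hζ, hζ, hζ, hζ, fun K₀ T₀ hK hT => ?_,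
    fun ε₀ K₀ T₀ C F hε₀ hle hK hT hC hF hsb h0 => ?_⟩
  · obtain ⟨ε₁, h1, h⟩ := exists_smallBorel hH hK hT hζ
    exact ⟨ε₁, h1, fun ε₀ C F h0 hle hC hF => h ε₀ C F h0 hle ⟨hC, hβ.le, hμ, hK.le, hT⟩
      ⟨hF, hβ.le, hμ, hK.le, hT⟩⟩
  replace hC : PosFamily β μ K₀ T₀ ε₀ 0 C := ⟨hC, hβ.le, hμ, hK.le, hT⟩
  replace hF : PosFamily β μ K₀ T₀ ε₀ 1 F := ⟨hF, hβ.le, hμ, hK.le, hT⟩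
  have hV : IsOpen (puncturedDisc ε₀) := Metric.isOpen_ball.sdiff isClosed_singleton
  have hlt : ∀ ε ∈ puncturedDisc ε₀, ‖ε‖ ≤ εs := fun ε hε =>
    (mem_ball_zero_iff.1 hε.1).le.trans hle
  have hVr : puncturedDisc ε₀ ⊆ Metric.closedBall 0 r := fun ε hε =>
    mem_closedBall_zero_iff.2 ((hlt ε hε).trans hεr)
  have hsm : ∀ ε ∈ puncturedDisc ε₀, (S.coefs C F ε).Small S ρ β μ ε ζ := fun ε hε =>
    coefs_small hH hC hF hsb hε (h0 ε hε)
  have : Dom S ρ (puncturedDisc ε₀) := ⟨hV, fun ε hε => hε.2, hS.time₁.one_le_k,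
    hS.time₂.one_le_k, hS.time₁.ν_pos, hS.time₂.ν_pos, hroots₁, hroots₂⟩
  obtain ⟨ω, hsol, hct, hd, hb⟩ := exists_borelSol hH hVr hζ.le hϖ.le hsm
    (regCoefs_coefs hH hC hF) fun ε hε => hcon ε hε.2 (hlt ε hε) _ (hsm ε hε)
  refine ⟨ω, hsol, hct, hd, fun ε hε τ₁ h₁ τ₂ h₂ m => (hb ε hε).bd.norm_le h₁ h₂ m,
    fun θ₁ θ₂ h1 h1' h2 h2' => ?_⟩
  obtain ⟨γ1, δ1, η1, hδ1, -, hη1, hηT, hγ1, hd1⟩ :=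
    hS.time₁.exists_directions hroots₁ h1 h1' hT hε₀
  obtain ⟨γ2, δ2, η2, hδ2, -, hη2, -, hγ2, hd2⟩ :=
    hS.time₂.exists_directions hroots₂ h2 h2' hT hε₀
  refine ⟨min η1 η2, min δ1 δ2, fun T₁ T₂ m ε =>
      S.laplaceSol γ1 γ2 (fun τ1 τ2 m => ω τ1 τ2 m ε) T₁ T₂ m, lt_min hη1 hη2,
    (mul_le_mul_of_nonneg_right (min_le_left _ _) hε₀.le).trans hηT, lt_min hδ1 hδ2,
    fun ε hε => ?_⟩
  have u0 : ε ≠ 0 := hε.2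
  have hw : S.BorelReg ρ β μ ϖ ε fun τ1 τ2 m => ω τ1 τ2 m ε :=
    ⟨hb ε hε, fun x hx y hy => hct.comp_continuous (f := fun m : ℝ => (x, y, m, ε)) (by fun_prop)
      fun m => ⟨hx, hy, mem_univ _, hε⟩, fun m => (hd m).comp (f := fun p : ℂ × ℂ => (p.1, p.2, ε))
      (by fun_prop) fun p hp => ⟨hp.1, hp.2, hε⟩⟩
  have d1 := hd1 _ (lt_min hη1 hη2) (min_le_left _ _) ε hε
  have d2 := hd2 _ (lt_min hη1 hη2) (min_le_right _ _) ε hε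
  set h := min η1 η2
  have hne {d θ R : ℝ} {T : ℂ} (hT : T ∈ bddSector d θ R) : T ≠ 0 := ne_zero_of_mem_sector hT.1
  refine ⟨fun T₁ hT1 T₂ hT2 m => ?_, fun m => ⟨continuousOn_laplaceSol hH u0 d1 d2 hw m,
      fun T₁ _ => if_pos (Or.inr rfl), fun T₂ _ => if_pos (Or.inl rfl)⟩,
    fun β' _ hβ' T₁ hT1 T₂ hT2 => memE_laplaceSol hH u0 hβ.le hμ d1 d2 hw hT1 hT2 hβ'.le,
    fun m => ⟨fun T hT => (differentiableAt_laplaceSol hH u0 d1 d2 hw hT.1 hT.2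
      m).differentiableWithinAt, ?_⟩, fun T₁ hT1 T₂ hT2 => ?_⟩
  · obtain ⟨-, a1, -⟩ := (d1.near T₁ hT1).self_of_nhds
    obtain ⟨-, a2, -⟩ := (d2.near T₂ hT2).self_of_nhds
    exact (S.solvesAt_lap2 hH hC hF hε (hVr hε) (hsm ε hε) hw.ball ((hsol ε hε).1.2.2) a1 a2
      m).congr (fun m' => laplaceSol_eq (hne hT1) (hne hT2) m')
      (laplaceSol_eventuallyEq hH u0 d1 d2 hw hT1 hT2 m).curry_nhds
  · obtain ⟨B, hB, hb⟩ := exists_norm_laplaceSol_le hH u0 d1 d2 hw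
    refine ⟨B * fw β (-μ) m * (h * ‖ε‖ * (h * ‖ε‖)), fun T₁ hT1 T₂ hT2 =>
      (hb _ (Or.inr hT1) _ (Or.inr hT2) m).trans (mul_le_l ?_ (mul_nonneg hB (fw_pos _ _ _).le))⟩
    have l1 := mem_ball_zero_iff.1 hT1.2
    exact mul_le_mul l1.le (mem_ball_zero_iff.1 hT2.2).le (norm_nonneg _)
      ((norm_nonneg _).trans l1.le)
  · obtain ⟨-, a1, -⟩ := (d1.near T₁ hT1).self_of_nhds
    obtain ⟨-, a2, -⟩ := (d2.near T₂ hT2).self_of_nhds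
    refine ⟨γ1 T₁, γ2 T₂, (hγ1 T₁ hT1.1).1, (hγ2 T₂ hT2.1).1,
      (min_le_left _ _).trans (hγ1 T₁ hT1.1).2, (min_le_right _ _).trans (hγ2 T₂ hT2.1).2,
      fun m => ?_⟩
    beta_reduce
    rw [laplaceSol_eq (hne hT1) (hne hT2) m]
    exact isLaplace_lap2 hS.time₁.one_le_k hS.time₂.one_le_k u0 a1 a2 hw.ball m
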